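/- **Definitions.** Let $n\ge 5$. For $f=a_0x^n+a_1x^{n-1}+\cdots+a_n\in\mathbb Z[x]$ with $a_0\ne0$, an integer $m\ge1$ and $l\in\mathbb Z$, say that $f$ is *weakly divisible by $m$ at $l$* if $m^2\mid f(l)$ and $m\mid f'(l)$, and *weakly divisible by $m$* if this holds for some $l$. Say that $f$ is *ultra-weakly divisible* (UWD) if for every prime $p$ with $p^2\mid\mathrm{disc}(f)$, $f$ is weakly divisible by $p$. Say that $f$ is *strictly UWD* if moreover, for every prime $p$, the reduction mod $p$ of the degree-$n$ binary form attached to $f$ is nonzero and has neither a triple zero nor two distinct double zeros in $\mathbb P^1(\overline{\mathbb F}_p)$. If $f$ is weakly divisible by $m$ at $l$, write $f(x+l)=b_0x^n+\cdots+b_n$ and let $\theta$ be the class of $x-l$ in $\mathbb Q[x]/(f)$. Put $B_0=1$ and $B_k=b_0\theta^k+b_1\theta^{k-1}+\cdots+b_{k-1}\theta$ for $1\le k\le n-1$. Then $R'_{(f,m,l)}=\mathbb Z\langle B_0,\dots,B_{n-2},B_{n-1}/m\rangle$ is a ring. For real $s,t>0$ let $W(s:t)$ be the set of $f\in\mathbb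 Z[x]$ of degree $n$ with $1\le a_1<s/2<a_0\le s$, $\gcd(a_0,a_1)=1$ and $|a_i|\le st^i$ for $2\le i\le n$. Let $W(s:t:m)$ be the set of pairs $(f,l)$ with $f\in W(s:t)$, $0\le l<m$ and $f$ weakly divisible by $m$ at $l$. Rings are counted up to isomorphism. **Theorem.** Let $n\ge5$. (1) There are constants $c,C>0$ depending only on $n$ such that for all $\varepsilon,K>0$ there is $X_0$ with the following property. Let $m$ be squarefree, $s,t>0$, and let $X=s^{2n-2}t^{n(n-1)}/m^2$ satisfy $X\ge X_0$. Suppose that $$s\ge K(st^n)^{\varepsilon},\qquad X^{1-\varepsilon}\ge K s^{n-1}m^{2n-4}.$$ * If $X^{1-\varepsilon}\ge K s^{2n-2}m^{\,n-4-\frac1{n-2}}$, then the number of pairs $(f,l)\in W(s:t:m)$ with $f$ UWD is at least $$c\,\frac{X^{\frac12+\frac1n}s^{\frac2n}}{m^{1-\frac2n}}.$$ * If $X^{1-\varepsilon}\ge K s^{2n-2}m^{\,n-1+\frac2{n-2}}$, then the number of distinct rings $R'_{(f,m,l)}$ with $(f,l)\in W(s:t:m)$, $f$ UWD, and discriminant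 nonzero and at most $CX$ in absolute value, is at least $$c\,\frac{X^{\frac12+\frac1n}s^{\frac2n}}{m^{1-\frac2n}}.$$ The number of those for which $f$ can be taken strictly UWD is at least $$c\left(\frac{\varphi(m)}m\right)^{n}\frac{X^{\frac12+\frac1n}s^{\frac2n}}{m^{1-\frac2n}}.$$ (2) For squarefree $m$ let $S(X:m)$ be the set of distinct rings $R'_{(f,m,l)}$ with discriminant nonzero and at most $X$ in absolute value, where $f$ is a UWD polynomial of degree $n$ that is weakly divisible by $m$ at $l$. Let $S^*(X:m)\subseteq S(X:m)$ be the rings that arise from a strictly UWD $f$. For every $0<\varepsilon<\frac{n-2}{3n^2-13n+12}$ there are $c>0$ and $X_0$, depending on $n$ and $\varepsilon$, such that for all $X\ge X_0$ $$T(X):=\sum_{\substack{m\le X^{\frac{n-2}{3n^2-13n+12}-\varepsilon}\\ m\text{ squarefree}}}\#S(X:m)\ \ge\ c\,X^{\frac12+\frac1{n-4/3}-\varepsilon},$$ and likewise $$\#\bigcup_m S^*(X:m)\ \ge\ c\,X^{\frac12+\frac1{n-4/3}-\varepsilon},$$ where $m$ runs over the same range. -/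

import Mathlib

noncomputable section

namespace UltraWeak

open Polynomial

/-- `f` (read as the binary form `f(x, y)` of degree `f.natDegree`) is weakly divisible by `m`
at `l`: `m ^ 2` divides `f(l)` and `m` divides `f'(l)`. -/
def WeaklyDivisibleAt (f : ℤ[X]) (m : ℕ) (l : ℤ) : Prop :=
  (m : ℤ) ^ 2 ∣ f.eval l ∧ (m : ℤ) ∣ f.derivative.eval l

/-- `f` is weakly divisible by `m`, i.e. it is so at some integer `l`. -/
def WeaklyDivisible (f : ℤ[X]) (m : ℕ) : Prop :=
  ∃ l : ℤ, WeaklyDivisibleAt f m l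

/-- `f` is ultra-weakly divisible: for each prime `p`, if `p ^ 2` divides the discriminant of `f`,
then `f` is weakly divisible by `p`. -/
def UltraWeaklyDivisible (f : ℤ[X]) : Prop :=
  ∀ p : ℕ, p.Prime → (p : ℤ) ^ 2 ∣ f.discr → WeaklyDivisible f p

/-- The reduction mod `p` of the binary form attached to `f` is nonzero and has at least `n - 1`
distinct zeros on the projective line over an algebraic closure of `𝔽_p`, where `n` is the degree
of `f`. Equivalently, it has neither a triple zero nor two distinct double zeros there.
The point at infinity is a zero exactly when `p` divides the leading coefficient of `f`. -/
def NonsingularMod (f : ℤ[X]) (p : ℕ) [Fact p.Prime] : Prop :=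
  f.natDegree - 1 ≤
      ((f.map (Int.castRingHom (ZMod p))).rootSet (AlgebraicClosure (ZMod p))).ncard
        + (if (f.map (Int.castRingHom (ZMod p))).natDegree < f.natDegree then 1 else 0) ∧
    f.map (Int.castRingHom (ZMod p)) ≠ 0

/-- `f` is ultra-weakly divisible and, modulo each prime, has neither a triple zero nor two
distinct double zeros. -/
def StrictlyUltraWeaklyDivisible (f : ℤ[X]) : Prop :=
  UltraWeaklyDivisible f ∧ ∀ (p : ℕ) [Fact p.Prime], NonsingularMod f p

/-! ### Weakly divisible rings -/

/-- The algebra `ℚ[x] / (f)`. -/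
abbrev QAlg (f : ℤ[X]) : Type := AdjoinRoot (f.map (Int.castRingHom ℚ))

/-- The translate `f_l(x) = f(x + l)`. -/
def translate (f : ℤ[X]) (l : ℤ) : ℤ[X] := f.comp (X + C l)

/-- The root `δ - l` of `f_l` in `ℚ[x] / (f)`, where `δ` is the class of `x`. -/
def transRoot (f : ℤ[X]) (l : ℤ) : QAlg f :=
  AdjoinRoot.root (f.map (Int.castRingHom ℚ)) - (l : QAlg f)

/-- The canonical basis `B_0, …, B_{n-1}` of the binary ring of
`f_l = b_0 x ^ n + b_1 x ^ (n-1) + ⋯ + b_n`, inside `ℚ[x] / (f)`: with `θ = δ - l`, `B_0 = 1` and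
`B_k = b_0 θ ^ k + b_1 θ ^ (k-1) + ⋯ + b_{k-1} θ`. -/
def canonicalElt (f : ℤ[X]) (l : ℤ) (k : ℕ) : QAlg f :=
  if k = 0 then 1
  else ∑ j ∈ Finset.range k,
    (((translate f l).coeff (f.natDegree - j) : ℤ) : QAlg f) * transRoot f l ^ (k - j)

/-- The family `B_0, …, B_{n-2}, B_{n-1} / m`. -/
def wdBasis (f : ℤ[X]) (m : ℕ) (l : ℤ) (k : Fin f.natDegree) : QAlg f :=
  if (k : ℕ) + 1 = f.natDegree then ((m : ℚ)⁻¹) • canonicalElt f l k else canonicalElt f l k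

/-- The weakly divisible ring `R'_{(f,m,l)}`: the subring of `ℚ[x] / (f)` generated by
`B_0, …, B_{n-2}, B_{n-1} / m`. If `f` is weakly divisible by `m` at `l`, it is the `ℤ`-span of
these elements: see `toSubmodule_wdRing`. -/
def wdRing (f : ℤ[X]) (m : ℕ) (l : ℤ) : Subalgebra ℤ (QAlg f) :=
  Algebra.adjoin ℤ (Set.range (wdBasis f m l))

/-! The `ℤ`-span of `B_0, …, B_{n-2}, B_{n-1} / m` is a ring. -/

section Span

variable {A : Type*} [CommRing A]

/-- Horner sums `c_0 θ ^ k + ⋯ + c_k`. -/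
def horner (c : ℕ → ℤ) (θ : A) : ℕ → A
  | 0 => (c 0 : A)
  | k + 1 => θ * horner c θ k + (c (k + 1) : A)

theorem horner_eq_sum (c : ℕ → ℤ) (θ : A) (k : ℕ) :
    horner c θ k = ∑ j ∈ Finset.range (k + 1), (c j : A) * θ ^ (k - j) := by
  induction k with
  | zero => simp [horner]
  | succ k ih =>
    rw [horner, ih, Finset.sum_range_succ _ (k + 1), Finset.mul_sum]
    congr 1
    · refine Finset.sum_congr rfl fun j hj => ?_
      have : k + 1 - j = (k - j) + 1 := by
        have := Finset.mem_range.1 hj; omega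
      rw [this]; ring
    · simp

theorem horner_mul (c : ℕ → ℤ) (θ : A) (j i : ℕ) :
    horner c θ i * horner c θ j =
      ∑ k ∈ Finset.range (i + 1), (c k : A) * horner c θ (i + j - k) -
        ∑ u ∈ Finset.range i, (c (j + u + 1) : A) * horner c θ (i - 1 - u) := by
  induction i with
  | zero => simp [horner]
  | succ i ih =>
    have e1 : horner c θ (i + 1) * horner c θ j =
        θ * (horner c θ i * horner c θ j) + (c (i + 1) : A) * horner c θ j := by
      simp only [horner]; ring
    have e2 : ∀ k, θ * horner c θ k = horner c θ (k + 1) - (c (k + 1) : A) := by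
      intro k; simp only [horner]; ring
    have h1 : θ * ∑ k ∈ Finset.range (i + 1), (c k : A) * horner c θ (i + j - k) =
        ∑ k ∈ Finset.range (i + 1), (c k : A) * horner c θ (i + 1 + j - k) -
          ∑ k ∈ Finset.range (i + 1), (c k : A) * (c (i + 1 + j - k) : A) := by
      rw [Finset.mul_sum, ← Finset.sum_sub_distrib]
      refine Finset.sum_congr rfl fun k hk => ?_
      have hk' : i + j - k + 1 = i + 1 + j - k := by
        have := Finset.mem_range.1 hk; omega
      rw [mul_left_comm, e2, hk']; ring
    have h2 : θ * ∑ u ∈ Finset.range i, (c (j + u + 1) : A) * horner c θ (i - 1 - u) =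
        ∑ u ∈ Finset.range i, (c (j + u + 1) : A) * horner c θ (i - u) -
          ∑ u ∈ Finset.range i, (c (j + u + 1) : A) * (c (i - u) : A) := by
      rw [Finset.mul_sum, ← Finset.sum_sub_distrib]
      refine Finset.sum_congr rfl fun u hu => ?_
      have hu' : i - 1 - u + 1 = i - u := by
        have := Finset.mem_range.1 hu; omega
      rw [mul_left_comm, e2, hu']; ring
    have h3 : ∑ k ∈ Finset.range (i + 1), (c k : A) * (c (i + 1 + j - k) : A) =
        ∑ u ∈ Finset.range i, (c (j + u + 1) : A) * (c (i - u) : A) +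
          (c 0 : A) * (c (i + 1 + j) : A) := by
      rw [Finset.sum_range_succ', ← Finset.sum_range_reflect]
      simp only [Nat.sub_zero]
      congr 1
      refine Finset.sum_congr rfl fun u hu => ?_
      have hu' := Finset.mem_range.1 hu
      have a1 : i - 1 - u + 1 = i - u := by omega
      have a2 : i + 1 + j - (i - u) = j + u + 1 := by omega
      rw [a1, a2]; ring
    have h4 : i + 1 + j - (i + 1) = j := by omega
    have h5 : j + i + 1 = i + 1 + j := by omega
    rw [e1, ih, mul_sub, h1, h2, h3, Finset.sum_range_succ _ (i + 1),
      Finset.sum_range_succ (fun u => (c (j + u + 1) : A) * horner c θ (i + 1 - 1 - u)) i,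
      h4, h5]
    have h6 : i + 1 - 1 - i = 0 := by omega
    have h7 : ∀ u, i + 1 - 1 - u = i - u := fun u => by omega
    have h8 : horner c θ 0 = (c 0 : A) := rfl
    simp only [h6, h7, h8]
    ring

end Span

/-- Descending coefficients `b_0, b_1, …, b_n, 0, 0, …` of `f_l`. -/
def descCoeff (f : ℤ[X]) (l : ℤ) (k : ℕ) : ℤ :=
  if k ≤ f.natDegree then (translate f l).coeff (f.natDegree - k) else 0

theorem translate_natDegree (f : ℤ[X]) (l : ℤ) : (translate f l).natDegree = f.natDegree := by
  rw [translate, natDegree_comp, natDegree_X_add_C, mul_one]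

theorem aeval_transRoot (f : ℤ[X]) (l : ℤ) : aeval (transRoot f l) (translate f l) = 0 := by
  have h : aeval (AdjoinRoot.root (f.map (Int.castRingHom ℚ))) f = 0 := by
    have := AdjoinRoot.eval₂_root (f.map (Int.castRingHom ℚ))
    rw [eval₂_map] at this
    rw [aeval_def]
    convert! this using 2
  rw [translate, aeval_comp]
  simpa [transRoot] using h

theorem horner_vanish (f : ℤ[X]) (l : ℤ) (k : ℕ) (hk : f.natDegree ≤ k) :
    horner (descCoeff f l) (transRoot f l) k = 0 := by
  induction k, hk using Nat.le_induction with
  | base =>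
    have h := aeval_transRoot f l
    rw [aeval_eq_sum_range, translate_natDegree, ← Finset.sum_range_reflect] at h
    rw [horner_eq_sum, ← h]
    refine Finset.sum_congr rfl fun j hj => ?_
    have hj' : j ≤ f.natDegree := by have := Finset.mem_range.1 hj; omega
    simp [descCoeff, hj', zsmul_eq_mul]
  | succ k hk ih =>
    have : ¬ k + 1 ≤ f.natDegree := by omega
    simp [horner, ih, descCoeff, this]

theorem canonicalElt_eq (f : ℤ[X]) (l : ℤ) (k : ℕ) (h0 : k ≠ 0) (hk : k ≤ f.natDegree) :
    canonicalElt f l k = horner (descCoeff f l) (transRoot f l) k - (descCoeff f l k : QAlg f) := by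
  rw [horner_eq_sum, Finset.sum_range_succ, canonicalElt, if_neg h0]
  simp only [Nat.sub_self, pow_zero, mul_one, add_sub_cancel_right]
  refine Finset.sum_congr rfl fun j hj => ?_
  have hj' : j ≤ f.natDegree := by have := Finset.mem_range.1 hj; omega
  simp [descCoeff, hj']

theorem descCoeff_natDegree (f : ℤ[X]) (l : ℤ) : descCoeff f l f.natDegree = f.eval l := by
  simp [descCoeff, translate, coeff_zero_eq_eval_zero, eval_comp]

theorem descCoeff_natDegree_sub_one (f : ℤ[X]) (l : ℤ) (hn : 1 ≤ f.natDegree) :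
    descCoeff f l (f.natDegree - 1) = f.derivative.eval l := by
  have h1 : f.natDegree - (f.natDegree - 1) = 1 := by omega
  have h2 : (translate f l).coeff 1 = (derivative (translate f l)).coeff 0 := by
    simp [coeff_derivative]
  rw [descCoeff, if_pos (by omega), h1, h2, coeff_zero_eq_eval_zero, translate, derivative_comp]
  simp [eval_comp]

/-- If `f` is weakly divisible by `m` at `l`, then the ring `R'_{(f,m,l)}` is the `ℤ`-span of
`B_0, …, B_{n-2}, B_{n-1} / m`. -/
theorem toSubmodule_wdRing (f : ℤ[X]) (m : ℕ) (l : ℤ) (hn : 2 ≤ f.natDegree) (hm : 0 < m)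
    (hf : WeaklyDivisibleAt f m l) :
    Subalgebra.toSubmodule (wdRing f m l) = Submodule.span ℤ (Set.range (wdBasis f m l)) := by
  set n := f.natDegree with hndef
  set M := Submodule.span ℤ (Set.range (wdBasis f m l)) with hM
  set c := descCoeff f l with hc
  set θ := transRoot f l with hθ
  set h := horner c θ with hh
  have hmQ : (m : ℚ) ≠ 0 := by exact_mod_cast hm.ne'
  have hmc : ((m : ℚ)⁻¹) • ((m : ℤ) : QAlg f) = 1 := by
    rw [Int.cast_natCast, ← map_natCast (algebraMap ℚ (QAlg f)) m, Algebra.smul_def, ← map_mul,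
      inv_mul_cancel₀ hmQ, map_one]
  obtain ⟨⟨a, ha⟩, ⟨b, hb⟩⟩ := hf
  have hcn : c n = (m : ℤ) ^ 2 * a := by rw [← ha]; exact descCoeff_natDegree f l
  have hcn1 : c (n - 1) = (m : ℤ) * b := by
    rw [← hb]; exact descCoeff_natDegree_sub_one f l (by omega)
  have hcbig : ∀ k, n < k → c k = 0 := by
    intro k hk
    rw [hc, descCoeff, if_neg (by omega)]
  have hvan : ∀ k, n ≤ k → h k = 0 := fun k hk => horner_vanish f l k hk
  have hint : ∀ (z : ℤ) (x : QAlg f), x ∈ M → (z : QAlg f) * x ∈ M := by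
    intro z x hx
    rw [← zsmul_eq_mul]
    exact M.smul_mem z hx
  have hB : ∀ k : ℕ, k + 1 < n → canonicalElt f l k ∈ M := by
    intro k hk
    have : wdBasis f m l ⟨k, by omega⟩ = canonicalElt f l k := by
      simp only [wdBasis]
      rw [if_neg (by omega)]
    rw [← this]
    exact Submodule.subset_span ⟨_, rfl⟩
  have h1M : (1 : QAlg f) ∈ M := by
    have := hB 0 (by omega)
    simpa [canonicalElt] using this
  have hzM : ∀ z : ℤ, (z : QAlg f) ∈ M := by
    intro z
    have := hint z 1 h1M
    simpa using this
  have hlast : ((m : ℚ)⁻¹) • h (n - 1) ∈ M := by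
    have e : wdBasis f m l ⟨n - 1, by omega⟩ = ((m : ℚ)⁻¹) • canonicalElt f l (n - 1) := by
      simp only [wdBasis]
      rw [if_pos (by omega)]
    have e2 := canonicalElt_eq f l (n - 1) (by omega) (by omega)
    have e3 : ((m : ℚ)⁻¹) • h (n - 1) =
        ((m : ℚ)⁻¹) • canonicalElt f l (n - 1) + (b : QAlg f) := by
      rw [e2, smul_sub]
      change _ = _ - (m : ℚ)⁻¹ • ((c (n - 1) : ℤ) : QAlg f) + _
      rw [hcn1, Int.cast_mul, ← smul_mul_assoc, hmc, one_mul, sub_add_cancel]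
    rw [e3, ← e]
    exact M.add_mem (Submodule.subset_span ⟨_, rfl⟩) (hzM b)
  have hmul : ∀ x : QAlg f, x = ((m : ℤ) : QAlg f) * ((m : ℚ)⁻¹ • x) := by
    intro x
    rw [mul_smul_comm, ← smul_mul_assoc, hmc, one_mul]
  have hhM : ∀ k, h k ∈ M := by
    intro k
    rcases Nat.lt_or_ge k n with hk | hk
    · rcases Nat.eq_zero_or_pos k with rfl | hk0
      · exact hzM (c 0)
      · rcases Nat.lt_or_ge (k + 1) n with hk1 | hk1
        · have e := canonicalElt_eq f l k (by omega) (by omega)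
          have e' : h k = canonicalElt f l k + (c k : QAlg f) := by
            rw [e, sub_add_cancel]
          rw [e']
          exact M.add_mem (hB k hk1) (hzM _)
        · obtain rfl : k = n - 1 := by omega
          rw [hmul (h (n - 1))]
          exact hint _ _ hlast
    · rw [hvan k hk]; exact M.zero_mem
  have hprod : ∀ i j, h i * h j ∈ M := by
    intro i j
    rw [hh, horner_mul]
    exact M.sub_mem (Submodule.sum_mem _ fun k _ => hint _ _ (hhM _))
      (Submodule.sum_mem _ fun k _ => hint _ _ (hhM _))
  have hkey : ∀ i, 1 ≤ i → h i * h (n - 1) =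
      (c i : QAlg f) * h (n - 1) - (c n : QAlg f) * h (i - 1) := by
    intro i hi
    rw [hh, horner_mul, Finset.sum_range_succ, Finset.sum_eq_zero, zero_add]
    · obtain ⟨i, rfl⟩ : ∃ i', i = i' + 1 := ⟨i - 1, by omega⟩
      rw [Finset.sum_range_succ', Finset.sum_eq_zero, zero_add]
      · have e1 : i + 1 + (n - 1) - (i + 1) = n - 1 := by omega
        have e2 : n - 1 + 0 + 1 = n := by omega
        rw [e1, e2, Nat.sub_zero]
      · intro u _
        rw [hcbig _ (by omega)]
        simp
    · intro k hk
      have hk' := Finset.mem_range.1 hk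
      have := hvan (i + (n - 1) - k) (by omega)
      rw [hh] at this
      rw [this, mul_zero]
  have hlastmul : ∀ i, (m : ℚ)⁻¹ • h (n - 1) * h i ∈ M := by
    intro i
    rcases Nat.eq_zero_or_pos i with rfl | hi
    · rw [mul_comm]; exact hint _ _ hlast
    · have e : (m : ℚ)⁻¹ • h (n - 1) * h i =
          (c i : QAlg f) * ((m : ℚ)⁻¹ • h (n - 1)) -
            (((m : ℤ) * a : ℤ) : QAlg f) * h (i - 1) := by
        rw [smul_mul_assoc, mul_comm, hkey i hi, smul_sub, mul_smul_comm, hcn, pow_two, mul_assoc,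
          Int.cast_mul (m : ℤ), mul_assoc ((m : ℤ) : QAlg f), ← smul_mul_assoc _ ((m : ℤ) : QAlg f),
          hmc, one_mul]
      rw [e]
      exact M.sub_mem (hint _ _ hlast) (hint _ _ (hhM _))
  have hlastsq : (m : ℚ)⁻¹ • h (n - 1) * ((m : ℚ)⁻¹ • h (n - 1)) ∈ M := by
    have e : (m : ℚ)⁻¹ • h (n - 1) * ((m : ℚ)⁻¹ • h (n - 1)) =
        (b : QAlg f) * ((m : ℚ)⁻¹ • h (n - 1)) - (a : QAlg f) * h (n - 1 - 1) := by
      have e1 : (c (n - 1) : QAlg f) = ((m : ℤ) : QAlg f) * (b : QAlg f) := by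
        rw [hcn1, Int.cast_mul]
      have e2 : (c n : QAlg f) = ((m : ℤ) : QAlg f) * (((m : ℤ) : QAlg f) * (a : QAlg f)) := by
        rw [hcn, pow_two, mul_assoc, Int.cast_mul, Int.cast_mul]
      rw [smul_mul_assoc, mul_smul_comm, hkey (n - 1) (by omega), e1, e2]
      simp only [smul_sub, mul_assoc]
      simp only [← smul_mul_assoc _ ((m : ℤ) : QAlg f), hmc, one_mul]
      simp only [mul_smul_comm]
    rw [e]
    exact M.sub_mem (hint _ _ hlast) (hint _ _ (hhM _))
  have hspan : M = Submodule.span ℤ (insert ((m : ℚ)⁻¹ • h (n - 1)) (insert 1 (Set.range h))) := by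
    apply le_antisymm
    · rw [hM, Submodule.span_le]
      set N := Submodule.span ℤ (insert ((m : ℚ)⁻¹ • h (n - 1)) (insert 1 (Set.range h)))
        with hN
      have hN1 : (1 : QAlg f) ∈ N := Submodule.subset_span (by simp)
      have hNz : ∀ z : ℤ, (z : QAlg f) ∈ N := by
        intro z
        have := N.smul_mem z hN1
        simpa [zsmul_eq_mul] using this
      rintro _ ⟨k, rfl⟩
      simp only [wdBasis, SetLike.mem_coe]
      have hk2 := k.2
      split_ifs with hk
      · have hk' : (k : ℕ) = n - 1 := by omega
        rw [hk', canonicalElt_eq f l (n - 1) (by omega) (by omega), smul_sub]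
        change _ - (m : ℚ)⁻¹ • ((c (n - 1) : ℤ) : QAlg f) ∈ N
        rw [hcn1, Int.cast_mul, ← smul_mul_assoc, hmc, one_mul]
        exact N.sub_mem (Submodule.subset_span (Or.inl rfl)) (hNz b)
      · rcases Nat.eq_zero_or_pos (k : ℕ) with h0 | h0
        · rw [h0]; simpa [canonicalElt] using hN1
        · rw [canonicalElt_eq f l k (by omega) (by omega)]
          exact N.sub_mem (Submodule.subset_span (Or.inr (Or.inr ⟨_, rfl⟩))) (hNz _)
    · rw [Submodule.span_le]
      rintro x (rfl | rfl | ⟨k, rfl⟩)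
      · exact hlast
      · exact h1M
      · exact hhM k
  have hclosed : ∀ x ∈ M, ∀ y ∈ M, x * y ∈ M := by
    intro x hx y hy
    have hle : M * M ≤ M := by
      conv_lhs => rw [hspan]
      rw [Submodule.span_mul_span, Submodule.span_le]
      rintro _ ⟨x, hx, y, hy, rfl⟩
      have key : ∀ x ∈ (insert ((m : ℚ)⁻¹ • h (n - 1)) (insert 1 (Set.range h)) : Set (QAlg f)),
          x ∈ M := fun x hx => by rw [hspan]; exact Submodule.subset_span hx
      have hx' := key x hx
      have hy' := key y hy
      rcases hx with rfl | rfl | ⟨i, rfl⟩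
      · rcases hy with rfl | rfl | ⟨j, rfl⟩
        · exact hlastsq
        · simpa using hx'
        · exact hlastmul j
      · simpa using hy'
      · rcases hy with rfl | rfl | ⟨j, rfl⟩
        · simpa [mul_comm] using hlastmul i
        · simpa using hx'
        · exact hprod i j
    exact hle (Submodule.mul_mem_mul hx hy)
  apply le_antisymm
  · intro x hx
    rw [Subalgebra.mem_toSubmodule, wdRing] at hx
    induction hx using Algebra.adjoin_induction with
    | mem x hx => exact Submodule.subset_span hx
    | algebraMap r => simpa using hzM r
    | add x y _ _ hx hy => exact M.add_mem hx hy
    | mul x y _ _ hx hy => exact hclosed x hx y hy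
  · rw [hM, Submodule.span_le]
    exact Algebra.subset_adjoin

/-! ### Isomorphism classes of rings and the sets that are counted -/

/-- Isomorphism classes of commutative rings. -/
abbrev RingClass : Type 1 :=
  Quotient (CategoryTheory.isIsomorphicSetoid CommRingCat.{0})

/-- The isomorphism class of a commutative ring. -/
def ringClass (R : Type) [CommRing R] : RingClass :=
  Quotient.mk (CategoryTheory.isIsomorphicSetoid CommRingCat.{0}) (CommRingCat.of R)

/-- Classes of rings that are free of rank `n` over `ℤ` with nonzero discriminant at most `Y` in
absolute value. -/
def discLE (n : ℕ) (Y : ℝ) : Set RingClass :=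
  {q | ∃ (R : Type) (_ : CommRing R), q = ringClass R ∧
    ∃ b : Module.Basis (Fin n) ℤ R,
      Algebra.discr ℤ b ≠ 0 ∧ |((Algebra.discr ℤ b : ℤ) : ℝ)| ≤ Y}

/-- Classes of the rings `R'_{(f,m,l)}`, where `f` has degree `n`, has the property `P` and is
weakly divisible by `m` at `l`, with nonzero discriminant at most `X` in absolute value. -/
def wdClasses (P : ℤ[X] → Prop) (n : ℕ) (X : ℝ) (m : ℕ) : Set RingClass :=
  {q | ∃ (f : ℤ[X]) (l : ℤ), f.natDegree = n ∧ P f ∧ WeaklyDivisibleAt f m l ∧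
    q = ringClass (wdRing f m l)} ∩ discLE n X

/-- The box `W(s : t)` of polynomials `a_0 x ^ n + a_1 x ^ (n-1) + ⋯ + a_n`. -/
def box (n : ℕ) (s t : ℝ) : Set ℤ[X] :=
  {f | f.natDegree = n ∧
    1 ≤ f.coeff (n - 1) ∧ (f.coeff (n - 1) : ℝ) < s / 2 ∧
    s / 2 < (f.coeff n : ℝ) ∧ (f.coeff n : ℝ) ≤ s ∧
    IsCoprime (f.coeff n) (f.coeff (n - 1)) ∧
    ∀ i : ℕ, 2 ≤ i → i ≤ n → |(f.coeff (n - i) : ℝ)| ≤ s * t ^ i}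

/-- The pairs `(f, l)` in `W(s : t : m)` such that `f` has the property `P`. -/
def boxPairs (P : ℤ[X] → Prop) (n : ℕ) (s t : ℝ) (m : ℕ) : Set (ℤ[X] × ℤ) :=
  {z | z.1 ∈ box n s t ∧ 0 ≤ z.2 ∧ z.2 < m ∧ WeaklyDivisibleAt z.1 m z.2 ∧ P z.1}

/-- Classes of the rings `R'_{(f,m,l)}`, for `(f, l)` in `W(s : t : m)` with property `P`. -/
def boxClasses (P : ℤ[X] → Prop) (n : ℕ) (s t : ℝ) (m : ℕ) : Set RingClass :=
  (fun z => ringClass (wdRing z.1 m z.2)) '' boxPairs P n s t m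

/-- The squarefree `m` with `1 ≤ m ≤ X ^ ((n-2)/(3n²-13n+12) - ε)`. -/
def mRange (n : ℕ) (ε X : ℝ) : Finset ℕ :=
  open scoped Classical in
  (Finset.Icc 1 ⌊X ^ (((n : ℝ) - 2) / (3 * (n : ℝ) ^ 2 - 13 * n + 12) - ε)⌋₊).filter Squarefree

/-- The cardinality of a set as an extended nonnegative real. -/
def count {α : Type*} (S : Set α) : ENNReal := (S.encard : ENNReal)

end UltraWeak

end

/-! For a fixed residue `l`, weak divisibility by `m` at `l` is a pair of congruences on the last
two coefficients: the condition on `f'(l)` fixes a_{n-1} modulo m, and the condition on `f(l)` then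
fixes a_n modulo m². Summing over the m residues, the expected size of the family is m · s^{n+1}
t^{2+⋯+n} / m³, and by `rpow_mul_div_eq` this is the main term. What must be shown is that a
positive proportion of these polynomials is ultra-weakly divisible and that they give pairwise
non-isomorphic rings.

Ultra-weak divisibility. Primes dividing m cause no trouble. At the other primes p ≤ M the reduction
is prescribed to be separable, which costs a constant. Now let p > M be prime to m. If p does not
divide a_0 and the reduction has a single, honest double root, then p² | disc already forces weak
divisibility by p (`weaklyDivisible_of_sq_dvd_discr`). If p divides a_0 but not a_1 and the finite
roots are simple, then p does not divide disc (`not_dvd_discr_of_dvd_leadingCoeff`). So only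
degenerate reductions must be sieved out. When p does not divide a_0 these have codimension two, and
the two conditions separate: a triple root or two double roots forces a coincidence of critical
values, which is a condition on a_{n-1} once the earlier coefficients are fixed (`critInt`); and a
double root puts -a_n among the at most n - 1 critical values of the rest. The density is thus
O(1/p²). When p divides a_0 it is only O(1/p), and a_0 is chosen so that the sum of 1/p over such p
is small. Very large p divide a_0 times a nonzero integer of polynomial size, so each a_{n-1} meets
boundedly many of them (`card_sieved_le`, `exists_good_tails`).

Strictness. At a large prime dividing m the cofactor of (x - l)² must be separable and nonzero at l.
This excludes at most n - 2 classes of a_{n-2} (`exists_excluded`), and the resulting product of 1 -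
(n-2)/p is at least (φ(m)/m)^n.

Rigidity. The middle coefficients are kept small and a_n is kept comparable to s t^n, so the roots
have size O(t) and |f'(δ)| is at least a constant times s t^{n-1} (`IsNice.root_bounds`). By
Lagrange interpolation, a ring element whose complex values differ by at most 4st is an integral
combination of 1 and a_0 δ. This smallness is an isomorphism invariant, so an isomorphism sends a_0
δ to k ± b_0 δ'. Divisibility, the trace, the bound a_1 < s/4 and gcd(a_0, n-2) = 1 then force k = 0
and the plus sign. Hence f is recovered, and the ring inside ℚ[x]/(f) determines m and l
(`IsTame.eq_of_ringClass_eq`).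

For the sum over m, prime values of m suffice, with s and t suitable powers of X. Distinct m give
distinct rings, so one lower bound for the strict union yields both estimates. -/

noncomputable section
namespace UltraWeak
open Polynomial

/-! ### Multiple roots modulo a prime and the discriminant -/

/-- `F` has a triple root or two distinct double roots in the field `k`. -/
def HasBadRoots {k : Type*} [Field k] (F : k[X]) : Prop :=
  ∃ x, F.eval x = 0 ∧ F.derivative.eval x = 0 ∧
    (F.derivative.derivative.eval x = 0 ∨
      ∃ y, y ≠ x ∧ F.eval y = 0 ∧ F.derivative.eval y = 0)

/-- Reduction of an integer polynomial modulo `p`, over an algebraic closure. -/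
abbrev redn (f : ℤ[X]) (p : ℕ) [Fact p.Prime] : (AlgebraicClosure (ZMod p))[X] :=
  f.map (Int.castRingHom (AlgebraicClosure (ZMod p)))

section

variable (p : ℕ) [Fact p.Prime]

theorem intCast_closure_eq_zero_iff (a : ℤ) :
    (a : AlgebraicClosure (ZMod p)) = 0 ↔ (p : ℤ) ∣ a :=
  CharP.intCast_eq_zero_iff _ p a

theorem redn_eq (f : ℤ[X]) : redn f p =
    (f.map (Int.castRingHom (ZMod p))).map (algebraMap (ZMod p) (AlgebraicClosure (ZMod p))) := by
  rw [Polynomial.map_map]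
  congr 1

theorem two_le_rootMultiplicity_iff {k : Type*} [Field k] {F : k[X]} (hF : F ≠ 0) (x : k) :
    2 ≤ F.rootMultiplicity x ↔ F.eval x = 0 ∧ F.derivative.eval x = 0 := by
  have := one_lt_rootMultiplicity_iff_isRoot (p := F) (t := x) hF
  simpa [IsRoot, Nat.lt_iff_add_one_le] using this

/-- Only this implication is available in all characteristics: in characteristic 2 the second
derivative vanishes at every double root, so there `HasBadRoots` holds as soon as a double root
exists. -/
theorem three_le_rootMultiplicity {k : Type*} [Field k] {F : k[X]} (x : k)
    (h : 3 ≤ F.rootMultiplicity x) : F.derivative.derivative.eval x = 0 := by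
  obtain ⟨G, hG⟩ := (pow_dvd_pow (X - C x) h).trans (pow_rootMultiplicity_dvd F x)
  rw [hG]
  simp [derivative_mul, derivative_pow]

/-- All multiplicities are at most 2, and at most one of them equals 2. -/
theorem card_roots_le_of_not_hasBadRoots {k : Type*} [Field k] [DecidableEq k] {F : k[X]}
    (hF : F ≠ 0) (h : ¬ HasBadRoots F) : F.roots.card ≤ F.roots.toFinset.card + 1 := by
  rw [← Multiset.toFinset_sum_count_eq]
  have h2 : ∀ x, F.roots.count x ≤ 2 := by
    intro x
    by_contra! hx
    rw [count_roots] at hx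
    obtain ⟨h0, h1⟩ := (two_le_rootMultiplicity_iff hF x).1 (by omega)
    exact h ⟨x, h0, h1, Or.inl (three_le_rootMultiplicity x hx)⟩
  by_cases hd : ∃ x ∈ F.roots.toFinset, F.roots.count x = 2
  · obtain ⟨x, hx, hx2⟩ := hd
    rw [← Finset.add_sum_erase _ _ hx, hx2]
    have : ∀ y ∈ F.roots.toFinset.erase x, F.roots.count y ≤ 1 := by
      intro y hy
      by_contra! hy2
      rw [count_roots] at hx2 hy2
      obtain ⟨h0, h1⟩ := (two_le_rootMultiplicity_iff hF x).1 (by omega)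
      obtain ⟨h3, h4⟩ := (two_le_rootMultiplicity_iff hF y).1 (by omega)
      exact h ⟨x, h0, h1, Or.inr ⟨y, (Finset.mem_erase.1 hy).1, h3, h4⟩⟩
    have h3 := Finset.sum_le_card_nsmul _ _ _ this
    rw [Finset.card_erase_of_mem hx] at h3
    have : 0 < F.roots.toFinset.card := Finset.card_pos.2 ⟨x, hx⟩
    simp only [smul_eq_mul, mul_one] at h3
    omega
  · push Not at hd
    have : ∀ y ∈ F.roots.toFinset, F.roots.count y ≤ 1 := by
      intro y hy
      have := hd y hy
      have := h2 y
      omega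
    have h3 := Finset.sum_le_card_nsmul _ _ _ this
    simp only [smul_eq_mul, mul_one] at h3
    omega

theorem redn_ne_zero {f : ℤ[X]}
    (hc : ¬ ((p : ℤ) ∣ f.coeff f.natDegree ∧ (p : ℤ) ∣ f.coeff (f.natDegree - 1))) :
    redn f p ≠ 0 := by
  intro h0
  apply hc
  constructor
  · rw [← intCast_closure_eq_zero_iff p]
    simpa using congrArg (fun F => F.coeff f.natDegree) h0
  · rw [← intCast_closure_eq_zero_iff p]
    simpa using congrArg (fun F => F.coeff (f.natDegree - 1)) h0

/-- Over an algebraically closed field the roots with multiplicity number the degree. If the degree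
drops, the hypothesis on the two leading coefficients makes it drop by exactly one, so the point at
infinity is a simple zero and supplies the missing one. -/
theorem nonsingularMod_of_card_le [DecidableEq (AlgebraicClosure (ZMod p))] {f : ℤ[X]}
    (h1 : (redn f p).roots.card ≤ (redn f p).roots.toFinset.card + 1)
    (hc : ¬ ((p : ℤ) ∣ f.coeff f.natDegree ∧ (p : ℤ) ∣ f.coeff (f.natDegree - 1))) :
    NonsingularMod f p := by
  have hne := redn_ne_zero p hc
  have hne' : f.map (Int.castRingHom (ZMod p)) ≠ 0 := by
    intro h0
    apply hne
    rw [redn_eq, h0, Polynomial.map_zero]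
  refine ⟨?_, hne'⟩
  have hdeg : (f.map (Int.castRingHom (ZMod p))).natDegree = (redn f p).natDegree := by
    rw [redn_eq, natDegree_map (algebraMap (ZMod p) (AlgebraicClosure (ZMod p)))]
  have hrs : ((f.map (Int.castRingHom (ZMod p))).rootSet (AlgebraicClosure (ZMod p))).ncard =
      (redn f p).roots.toFinset.card := by
    rw [rootSet, Set.ncard_coe_finset, aroots, redn_eq]
    congr!
  rw [hrs, hdeg]
  rw [← (IsAlgClosed.splits (redn f p)).natDegree_eq_card_roots] at h1
  have h2 : (redn f p).natDegree ≤ f.natDegree := natDegree_map_le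
  split_ifs with h3
  · have : f.natDegree - 1 ≤ (redn f p).natDegree := by
      by_contra! h4
      apply hc
      constructor
      · rw [← intCast_closure_eq_zero_iff p]
        simpa using coeff_eq_zero_of_natDegree_lt h3
      · rw [← intCast_closure_eq_zero_iff p]
        simpa using coeff_eq_zero_of_natDegree_lt h4
    omega
  · omega

theorem nonsingularMod_of_not_hasBadRoots {f : ℤ[X]} (h : ¬ HasBadRoots (redn f p))
    (hc : ¬ ((p : ℤ) ∣ f.coeff f.natDegree ∧ (p : ℤ) ∣ f.coeff (f.natDegree - 1))) :
    NonsingularMod f p := by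
  classical
  exact nonsingularMod_of_card_le p (card_roots_le_of_not_hasBadRoots (redn_ne_zero p hc) h) hc

/-- A double root in the algebraic closure that is unique is rational. -/
theorem exists_int_of_unique_double_root {f : ℤ[X]} {x : AlgebraicClosure (ZMod p)}
    (h0 : (redn f p).eval x = 0) (h1 : (redn f p).derivative.eval x = 0)
    (hu : ∀ y, y ≠ x → (redn f p).eval y = 0 → (redn f p).derivative.eval y ≠ 0) :
    ∃ l : ℤ, (l : AlgebraicClosure (ZMod p)) = x := by
  let k := AlgebraicClosure (ZMod p)
  -- Integer coefficients are fixed by Frobenius, so Frobenius permutes the double roots; uniqueness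
  -- then gives `x ^ p = x`.
  have hfr : ∀ g : ℤ[X], (redn g p).eval x = 0 → (redn g p).eval (x ^ p) = 0 := by
    intro g hg
    have h2 : (redn g p).map (frobenius k p) = redn g p := by
      rw [redn, Polynomial.map_map]
      congr 1
      exact RingHom.ext_int _ _
    have h3 : x ^ p = frobenius k p x := rfl
    rw [h3, ← h2, eval_map_apply, hg, map_zero]
  have hx : x ^ p = x := by
    by_contra hne
    refine hu _ hne (hfr f h0) ?_
    have := hfr f.derivative
    rw [redn, ← derivative_map] at this
    exact this h1
  -- Otherwise `X ^ p - X` would have `p + 1` roots: those in the prime field, and `x`.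
  have hmem : x ∈ (algebraMap (ZMod p) k).range := by
    have hcard := FiniteField.X_pow_card_sub_X_ne_zero k (p := p) (Fact.out : p.Prime).one_lt
    by_contra hnot
    have hinj := (algebraMap (ZMod p) k).injective
    classical
    let S : Finset k := insert x (Finset.univ.image (algebraMap (ZMod p) k))
    have hS : S ⊆ (X ^ p - X : k[X]).roots.toFinset := by
      intro y hy
      rw [Multiset.mem_toFinset, mem_roots hcard]
      rcases Finset.mem_insert.1 hy with rfl | hy
      · simp [hx]
      · obtain ⟨z, -, rfl⟩ := Finset.mem_image.1 hy
        simp [← map_pow, ZMod.pow_card]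
    have hSc : S.card = p + 1 := by
      rw [Finset.card_insert_of_notMem, Finset.card_image_of_injective _ hinj, Finset.card_univ,
        ZMod.card]
      intro hy
      obtain ⟨z, -, rfl⟩ := Finset.mem_image.1 hy
      exact hnot ⟨z, rfl⟩
    have h4 := (Finset.card_le_card hS).trans (Multiset.toFinset_card_le _) |>.trans
      (card_roots' _)
    rw [hSc, FiniteField.X_pow_card_sub_X_natDegree_eq k (Fact.out : p.Prime).one_lt] at h4
    omega
  obtain ⟨z, rfl⟩ := hmem
  obtain ⟨l, rfl⟩ := ZMod.intCast_surjective z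
  exact ⟨l, by simp⟩

theorem resultant_derivative_comm {f : ℤ[X]} (hn : 2 ≤ f.natDegree) :
    f.discr ∣ f.derivative.resultant f (f.natDegree - 1) f.natDegree := by
  rw [resultant_comm, resultant_deriv (natDegree_pos_iff_degree_pos.1 (by omega)), ← mul_assoc]
  exact Dvd.intro_left _ rfl

theorem natDegree_redn {f : ℤ[X]} (h : ¬ (p : ℤ) ∣ f.coeff f.natDegree) :
    (redn f p).natDegree = f.natDegree := by
  apply natDegree_map_of_leadingCoeff_ne_zero
  simpa [intCast_closure_eq_zero_iff] using h

theorem natDegree_derivative_redn {f : ℤ[X]} (h : ¬ (p : ℤ) ∣ f.coeff f.natDegree)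
    (hpn : ¬ p ∣ f.natDegree) : (redn f p).derivative.natDegree = f.natDegree - 1 := by
  apply le_antisymm
  · exact (natDegree_derivative_le _).trans (by rw [natDegree_redn p h])
  · apply le_natDegree_of_ne_zero
    rw [coeff_derivative]
    have : 0 < f.natDegree := Nat.pos_of_ne_zero (by rintro h0; simp [h0] at hpn)
    have e : f.natDegree - 1 + 1 = f.natDegree := by omega
    have e2 : ((f.natDegree - 1 : ℕ) : AlgebraicClosure (ZMod p)) + 1 = (f.natDegree : ℕ) := by
      rw [← e]; push_cast; simp
    rw [e, e2, coeff_map]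
    refine mul_ne_zero ?_ ?_
    · simpa [intCast_closure_eq_zero_iff] using h
    · rwa [Ne, CharP.cast_eq_zero_iff _ p]

/-- The double root is unique, hence the class of an integer l. Regard D(y) = Res(f', f - f(l) + y)
as a polynomial in y. Its value at y = f(l) is divisible by p² by hypothesis, D(0) is divisible by
p² because f - f(l) has a root at l where f' vanishes mod p as well, and the linear coefficient of D
is a unit mod p because the double root is the only critical point with critical value zero, and is
a simple one. Expanding D to second order leaves p² | f(l). -/
theorem weaklyDivisible_of_sq_dvd_discr {f : ℤ[X]} (hn : 2 ≤ f.natDegree)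
    (hpn : ¬ p ∣ f.natDegree) (h0 : ¬ (p : ℤ) ∣ f.coeff f.natDegree)
    (hb : ¬ HasBadRoots (redn f p)) (hd : (p : ℤ) ^ 2 ∣ f.discr) : WeaklyDivisible f p := by
  set k := AlgebraicClosure (ZMod p) with hk
  set n := f.natDegree with hnd
  set F := redn f p with hF
  have hp : Prime (p : ℤ) := Nat.prime_iff_prime_int.1 Fact.out
  have hFn : F.natDegree = n := natDegree_redn p h0
  have hFn' : F.derivative.natDegree = n - 1 := natDegree_derivative_redn p h0 hpn
  have hF' : F.derivative = redn f.derivative p := by rw [hF, redn, derivative_map]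
  have hres : (p : ℤ) ^ 2 ∣ f.derivative.resultant f (n - 1) n :=
    hd.trans (resultant_derivative_comm hn)
  have hsplit : F.derivative.Splits := IsAlgClosed.splits _
  have hlc : F.derivative.leadingCoeff ≠ 0 := by
    rw [leadingCoeff_ne_zero]
    rintro h
    rw [h, natDegree_zero] at hFn'
    omega
  -- a common root
  obtain ⟨x, hx0, hx1⟩ : ∃ x, F.eval x = 0 ∧ F.derivative.eval x = 0 := by
    have h2 : F.derivative.resultant F (n - 1) n = 0 := by
      rw [hF', hF, redn, resultant_map_map, eq_intCast, intCast_closure_eq_zero_iff]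
      exact (dvd_pow_self _ two_ne_zero).trans hres
    have h3 := resultant_eq_prod_eval F.derivative F n hFn.le hsplit
    rw [hFn', h2] at h3
    have h4 := (mul_eq_zero.1 h3.symm).resolve_left (pow_ne_zero _ hlc)
    rw [Multiset.prod_eq_zero_iff, Multiset.mem_map] at h4
    obtain ⟨x, hx, hx'⟩ := h4
    exact ⟨x, hx', (mem_roots'.1 hx).2⟩
  have hx2 : F.derivative.derivative.eval x ≠ 0 := fun h => hb ⟨x, hx0, hx1, Or.inl h⟩
  have hu : ∀ y, y ≠ x → F.eval y = 0 → F.derivative.eval y ≠ 0 := fun y hy h1 h2 =>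
    hb ⟨x, hx0, hx1, Or.inr ⟨y, hy, h1, h2⟩⟩
  obtain ⟨l, rfl⟩ := exists_int_of_unique_double_root p hx0 hx1 hu
  have hl0 : (p : ℤ) ∣ f.eval l := by
    rw [← intCast_closure_eq_zero_iff p]
    simpa [hF] using hx0
  have hl1 : (p : ℤ) ∣ f.derivative.eval l := by
    rw [← intCast_closure_eq_zero_iff p]
    simpa [hF'] using hx1
  refine ⟨l, ?_, hl1⟩
  -- The resultant is taken in the outer variable; the inner `X` is the shift y.
  set D : ℤ[X] := (f.derivative.map C).resultant (f.map C + C (X - C (f.eval l))) (n - 1) n with hD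
  have hev : ∀ a : ℤ, D.eval a =
      f.derivative.resultant (f + C (a - f.eval l)) (n - 1) n := by
    intro a
    rw [← coe_evalRingHom, hD, ← resultant_map_map]
    congr 1
    · rw [Polynomial.map_map]
      convert! Polynomial.map_id
      exact RingHom.ext_int _ _
    · rw [Polynomial.map_add, Polynomial.map_map, map_C]
      congr 1
      · convert! Polynomial.map_id
        exact RingHom.ext_int _ _
      · simp
  have hDl : (p : ℤ) ^ 2 ∣ D.eval (f.eval l) := by
    rw [hev, sub_self, C_0, add_zero]; exact hres
  have hDd : f.derivative.natDegree ≤ n - 1 := natDegree_derivative_le _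
  -- Write f - f(l) = (X - l) w with w(l) = f'(l). The resultant factors: one factor is f'(l) up to
  -- sign, the other lies in the ideal (f', w), all of whose elements are divisible by p at l.
  have hD0 : (p : ℤ) ^ 2 ∣ D.coeff 0 := by
    rw [coeff_zero_eq_eval_zero, hev, zero_sub, C_neg, ← sub_eq_add_neg]
    obtain ⟨w, hw⟩ := X_sub_C_dvd_sub_C_eval (p := f) (a := l)
    have hwd : (f - C (f.eval l)).natDegree = n := natDegree_sub_C
    have hw0 : w ≠ 0 := by
      rintro rfl
      rw [hw] at hwd
      simp at hwd; omega
    have hwn : w.natDegree = n - 1 := by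
      rw [hw, natDegree_mul (X_sub_C_ne_zero l) hw0, natDegree_X_sub_C] at hwd
      omega
    have hwl : w.eval l = f.derivative.eval l := by
      have := congrArg (fun g => (derivative g).eval l) hw
      simpa [derivative_mul] using this.symm
    have h5 := resultant_mul_right f.derivative (X - C l) w (n - 1) hDd
    rw [natDegree_X_sub_C, hwn, ← hw, resultant_X_sub_C_right _ _ _ hDd,
      show 1 + (n - 1) = n by omega] at h5
    rw [h5, pow_two]
    apply mul_dvd_mul
    · exact hl1.mul_left _
    · obtain ⟨a, b, -, -, h⟩ := exists_mul_add_mul_eq_C_resultant f.derivative w hDd hwn.le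
        (by omega)
      have := congrArg (eval l) h
      rw [eval_C, eval_add, eval_mul, eval_mul] at this
      rw [← this]
      exact dvd_add (hl1.mul_right _) ((hwl ▸ hl1).mul_right _)
  -- Modulo p, D is a unit times the product of F(x) + y over the roots x of F'. The root l
  -- contributes the factor y; the other factors must be nonzero at y = 0.
  have hD1 : ¬ (p : ℤ) ∣ D.coeff 1 := by
    rw [← intCast_closure_eq_zero_iff p]
    have h6 : D.map (Int.castRingHom k) =
        (F.derivative.map C).resultant (F.map C + C X) (n - 1) n := by
      rw [← coe_mapRingHom, hD, ← resultant_map_map]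
      congr 1
      · rw [hF', Polynomial.map_map, redn, Polynomial.map_map]
        congr 1
        exact RingHom.ext_int _ _
      · rw [Polynomial.map_add, Polynomial.map_map, hF, redn, Polynomial.map_map]
        congr 1
        · congr 1
          exact RingHom.ext_int _ _
        · have : ((f.eval l : ℤ) : k) = 0 := by simpa [hF] using hx0
          rw [map_C, coe_mapRingHom, Polynomial.map_sub, map_X, map_C, eq_intCast, this, C_0,
            sub_zero]
    have h7 := resultant_eq_prod_eval (F.derivative.map C) (F.map C + C X) n
      ((natDegree_add_C).trans_le (natDegree_map_le.trans hFn.le)) (hsplit.map C)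
    rw [natDegree_map_eq_of_injective C_injective, hFn', ← h6,
      leadingCoeff_map_of_injective C_injective] at h7
    have h8 : (F.derivative.map C).roots = F.derivative.roots.map C := by
      symm
      apply roots_map_of_injective_of_card_eq_natDegree C_injective
      exact hsplit.natDegree_eq_card_roots.symm
    have hmem : (l : k) ∈ F.derivative.roots := by
      rw [mem_roots (by rw [← leadingCoeff_ne_zero]; exact hlc)]
      exact hx1
    classical
    rw [h8, Multiset.map_map, ← Multiset.cons_erase hmem, Multiset.map_cons, Multiset.prod_cons]
      at h7
    have h10 : (eval (C (l : k)) (F.map C + C X)) = X := by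
      rw [eval_add, eval_C, eval_map, eval₂_hom, hx0, C_0, zero_add]
    rw [Function.comp_apply, h10, ← C_pow] at h7
    have h11 : ((D.coeff 1 : ℤ) : k) = (D.map (Int.castRingHom k)).coeff 1 := by
      rw [coeff_map]; rfl
    rw [h11, h7, coeff_C_mul, coeff_X_mul, coeff_zero_eq_eval_zero, eval_multiset_prod,
      Multiset.map_map]
    refine mul_ne_zero (pow_ne_zero _ hlc) ?_
    rw [Ne, Multiset.prod_eq_zero_iff, Multiset.mem_map]
    rintro ⟨y, hy, hy0⟩
    have hFy : F.eval y = 0 := by simpa [eval_map, eval₂_hom] using hy0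
    by_cases hyx : y = (l : k)
    · subst hyx
      have h13 : 2 ≤ F.derivative.roots.count (l : k) := by
        rw [← Multiset.count_pos, Multiset.count_erase_self] at hy
        omega
      rw [count_roots, two_le_rootMultiplicity_iff (by rwa [← leadingCoeff_ne_zero])] at h13
      exact hx2 h13.2
    · exact hu y hyx hFy (mem_roots'.1 (Multiset.mem_of_mem_erase hy)).2
  have hexp : ∃ e, D.eval (f.eval l) = D.coeff 0 + D.coeff 1 * f.eval l + f.eval l ^ 2 * e := by
    refine ⟨D.divX.divX.eval (f.eval l), ?_⟩
    conv_lhs => rw [← divX_mul_X_add D, ← divX_mul_X_add D.divX]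
    simp [coeff_divX]
    ring
  obtain ⟨e, he⟩ := hexp
  have h12 : (p : ℤ) ^ 2 ∣ D.coeff 1 * f.eval l := by
    have : D.coeff 1 * f.eval l = D.eval (f.eval l) - D.coeff 0 - f.eval l ^ 2 * e := by
      rw [he]; ring
    rw [this]
    exact dvd_sub (dvd_sub hDl hD0) ((pow_dvd_pow_of_dvd hl0 2).mul_right _)
  exact hp.pow_dvd_of_dvd_mul_left 2 hD1 h12

/-- Up to a power of the leading coefficient, the resultant of F and F' is the product of F' over
the roots of F. -/
theorem not_dvd_discr_of_separable {f : ℤ[X]} (hn : 2 ≤ f.natDegree)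
    (h0 : ¬ (p : ℤ) ∣ f.coeff f.natDegree)
    (hb : ∀ x, (redn f p).eval x = 0 → (redn f p).derivative.eval x ≠ 0) :
    ¬ (p : ℤ) ∣ f.discr := by
  intro hd
  have hFn := natDegree_redn p h0
  have h1 := resultant_deriv (f := f) (natDegree_pos_iff_degree_pos.1 (by omega))
  have h2 : (redn f p).resultant (redn f p).derivative f.natDegree (f.natDegree - 1) = 0 := by
    rw [redn, derivative_map, resultant_map_map, h1, eq_intCast, intCast_closure_eq_zero_iff]
    exact hd.mul_left _
  have h3 := resultant_eq_prod_eval (redn f p) (redn f p).derivative (f.natDegree - 1)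
    ((natDegree_derivative_le _).trans (by rw [hFn])) (IsAlgClosed.splits _)
  rw [hFn, h2] at h3
  have hne : redn f p ≠ 0 := by
    intro h
    rw [h, natDegree_zero] at hFn
    omega
  have h4 := (mul_eq_zero.1 h3.symm).resolve_left (pow_ne_zero _ (leadingCoeff_ne_zero.2 hne))
  rw [Multiset.prod_eq_zero_iff, Multiset.mem_map] at h4
  obtain ⟨x, hx, hx'⟩ := h4
  exact hb x (mem_roots'.1 hx).2 hx'

/-- The resultant of f and f' is divisible by a_0 and says nothing here, so the argument works with
`sylvesterDeriv`, where a_0 has been divided out of the last row. A kernel vector mod p is a pair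
(A, B) with f'B + fA = 0 and one further relation from that row. Coprimality and degrees give B = cf
and A = -cf' with c constant, and the further relation becomes c a_1 = 0. -/
theorem not_dvd_discr_of_dvd_leadingCoeff {f : ℤ[X]} (hn : 2 ≤ f.natDegree)
    (h0 : (p : ℤ) ∣ f.coeff f.natDegree) (h1 : ¬ (p : ℤ) ∣ f.coeff (f.natDegree - 1))
    (hb : ∀ x, (redn f p).eval x = 0 → (redn f p).derivative.eval x ≠ 0) :
    ¬ (p : ℤ) ∣ f.discr := by
  set n := f.natDegree with hnd
  intro hd
  let k := AlgebraicClosure (ZMod p)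
  have hFn0 : (redn f p).coeff n = 0 := by
    rw [coeff_map, eq_intCast, intCast_closure_eq_zero_iff]; exact h0
  have hFn1 : (redn f p).coeff (n - 1) ≠ 0 := by
    rw [coeff_map, eq_intCast, Ne, intCast_closure_eq_zero_iff]; exact h1
  have hFn : (redn f p).natDegree = n - 1 := by
    apply le_antisymm
    · rw [natDegree_le_iff_coeff_eq_zero]
      intro N hN
      rcases eq_or_ne N n with rfl | hN'
      · exact hFn0
      · rw [coeff_map, coeff_eq_zero_of_natDegree_lt (by omega), map_zero]
    · exact le_natDegree_of_ne_zero hFn1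
  have hne : redn f p ≠ 0 := fun h => hFn1 (by rw [h, coeff_zero])
  have hdF : (redn f p).natDegree ≤ n := by omega
  have hdF' : (redn f p).derivative.natDegree ≤ n - 1 := (natDegree_derivative_le _).trans (by omega)
  have hcop : IsCoprime (redn f p) (redn f p).derivative := by
    apply isCoprime_of_dvd _ _ (fun h => hne h.1)
    intro q hq hq0 h2 h3
    obtain ⟨x, hx⟩ := IsAlgClosed.exists_root q (by
      intro h
      exact hq (isUnit_iff_degree_eq_zero.2 h))
    exact hb x (IsRoot.dvd hx h2) (IsRoot.dvd hx h3)
  have hdet : (f.sylvesterDeriv.map (Int.castRingHom k)).det = 0 := by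
    rw [← RingHom.mapMatrix_apply, ← RingHom.map_det, eq_intCast, intCast_closure_eq_zero_iff]
    have := hd
    rw [discr] at this
    rcases Int.units_eq_one_or ((-1) ^ (f.natDegree * (f.natDegree - 1) / 2)) with h | h <;>
    · have h' := congrArg (Units.val) h
      push_cast at h'
      rw [h'] at this
      simpa using this
  obtain ⟨v, hv0, hv⟩ := Matrix.exists_mulVec_eq_zero_iff.2 hdet
  let b₁ := ((degreeLT.basis k (n - 1)).prod (degreeLT.basis k n)).reindex finSumFinEquiv
  let x := b₁.equivFun.symm v
  have hS : (f.sylvesterDeriv.map (Int.castRingHom k)) =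
      ((redn f p).derivative.sylvester (redn f p) (n - 1) n).updateRow ⟨2 * n - 2, by omega⟩
        (fun j ↦ if ↑j = n - 2 then 1 else (if ↑j = 2 * n - 2 then (n : k) else 0)) := by
    rw [sylvesterDeriv, dif_neg (by omega), Matrix.map_updateRow, redn, derivative_map,
      sylvester_map_map]
    congr 1
    funext j
    simp only [Function.comp]
    split_ifs <;> simp
    rfl
  -- Away from the modified row, the kernel condition is that of the ordinary Sylvester matrix.
  have hrow : ∀ i : Fin (n - 1 + n), (i : ℕ) ≠ 2 * n - 2 →
      (((redn f p).derivative.sylvester (redn f p) (n - 1) n).mulVec v) i = 0 := by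
    intro i hi
    have := congrFun hv i
    rw [hS, Matrix.mulVec, Matrix.updateRow_ne (by simpa [Fin.ext_iff] using hi)] at this
    exact this
  have hlast : v ⟨n - 2, by omega⟩ + n * v ⟨2 * n - 2, by omega⟩ = 0 := by
    have := congrFun hv ⟨2 * n - 2, by omega⟩
    rw [hS, Matrix.mulVec, Matrix.updateRow_self] at this
    rw [dotProduct, Finset.sum_eq_add ⟨n - 2, by omega⟩ ⟨2 * n - 2, by omega⟩] at this
    · simpa [show ¬ 2 * n - 2 = n - 2 by omega] using this
    · simp [Fin.ext_iff]; omega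
    · intro c _ hc
      simp only [ne_eq, Fin.ext_iff] at hc
      simp [hc.1, hc.2]
    · simp
    · simp
  -- The row that was replaced is zero in the ordinary Sylvester matrix, since both degrees drop; so
  -- `v` lies in its kernel too.
  have hMv : ((redn f p).derivative.sylvester (redn f p) (n - 1) n).mulVec v = 0 := by
    funext i
    by_cases hi : (i : ℕ) = 2 * n - 2
    · rw [Matrix.mulVec, dotProduct, Finset.sum_eq_zero]
      · rfl
      intro j _
      have : (redn f p).derivative.sylvester (redn f p) (n - 1) n i j = 0 := by
        induction j using Fin.addCases with
        | left j =>
          simp only [sylvester, Matrix.of_apply, Fin.addCases_left]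
          split_ifs
          · exact coeff_eq_zero_of_natDegree_lt (by omega)
          · rfl
        | right j =>
          simp only [sylvester, Matrix.of_apply, Fin.addCases_right]
          split_ifs
          · exact coeff_eq_zero_of_natDegree_lt
              ((natDegree_derivative_lt (by omega)).trans_le (by omega))
          · rfl
      rw [this, zero_mul]
    · exact hrow i hi
  have hrepr : b₁.repr x = v := by
    funext j
    have := b₁.equivFun.apply_symm_apply v
    exact congrFun this j
  have hmap : sylvesterMap (redn f p).derivative (redn f p) hdF' hdF x = 0 := by
    have h5 := LinearMap.toMatrix_mulVec_repr b₁ (degreeLT.basis k (n - 1 + n))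
      (sylvesterMap (redn f p).derivative (redn f p) hdF' hdF) x
    rw [toMatrix_sylvesterMap', hrepr, hMv] at h5
    apply (degreeLT.basis k (n - 1 + n)).repr.injective
    ext j
    rw [← h5]
    simp
  have hpq : (redn f p).derivative * x.2.1 + redn f p * x.1.1 = 0 := congrArg Subtype.val hmap
  have hdvd : redn f p ∣ x.2.1 := by
    apply hcop.dvd_of_dvd_mul_left
    rw [eq_neg_of_add_eq_zero_left hpq]
    exact (dvd_mul_right _ _).neg_right
  obtain ⟨e, he⟩ := hdvd
  have hp1 : x.1.1 = - ((redn f p).derivative * e) := by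
    rw [he] at hpq
    apply mul_left_cancel₀ hne
    linear_combination hpq
  have hq : x.2.1.degree < n := mem_degreeLT.1 x.2.2
  have hec : e = C (e.coeff 0) := by
    apply eq_C_of_natDegree_eq_zero
    by_contra he0
    have he0' : e ≠ 0 := by rintro rfl; simp at he0
    have := natDegree_mul hne he0'
    rw [← he] at this
    have h6 : x.2.1.natDegree < n := by
      rcases eq_or_ne x.2.1 0 with h | h
      · rw [h, natDegree_zero]; omega
      · exact (natDegree_lt_iff_degree_lt h).2 hq
    omega
  have hv1 : v ⟨n - 2, by omega⟩ = x.1.1.coeff (n - 2) := by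
    have h7 : (⟨n - 2, by omega⟩ : Fin (n - 1 + n)) =
        finSumFinEquiv (Sum.inl ⟨n - 2, by omega⟩) := by
      simp [finSumFinEquiv]
    rw [← hrepr, h7, Module.Basis.repr_reindex_apply, Equiv.symm_apply_apply]
    simp
  have hv2 : v ⟨2 * n - 2, by omega⟩ = x.2.1.coeff (n - 1) := by
    have h7 : (⟨2 * n - 2, by omega⟩ : Fin (n - 1 + n)) =
        finSumFinEquiv (Sum.inr ⟨n - 1, by omega⟩) := by
      simp [finSumFinEquiv]
      omega
    rw [← hrepr, h7, Module.Basis.repr_reindex_apply, Equiv.symm_apply_apply]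
    simp
  -- The last relation reads -(n-1) c a_1 + n c a_1 = 0.
  have he0 : e.coeff 0 = 0 := by
    rw [hv1, hv2, hp1, he, hec, coeff_neg, coeff_mul_C, coeff_mul_C, coeff_derivative,
      show n - 2 + 1 = n - 1 by omega] at hlast
    have h8 : ((n - 2 : ℕ) : k) = (n : k) - 2 := by
      rw [Nat.cast_sub hn]; norm_num
    rw [h8] at hlast
    have h9 : (redn f p).coeff (n - 1) * e.coeff 0 = 0 := by linear_combination hlast
    exact (mul_eq_zero.1 h9).resolve_left hFn1
  have hx : x = 0 := by
    rw [hec, he0, C_0, mul_zero] at he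
    rw [hec, he0, C_0, mul_zero, neg_zero] at hp1
    exact Prod.ext (Subtype.ext hp1) (Subtype.ext he)
  apply hv0
  rw [← hrepr, hx]
  simp

end
end UltraWeak

end

noncomputable section
namespace UltraWeak
open Polynomial

/-! ### A polynomial detecting coincidences among critical values -/

section

variable {A : Type*} [CommRing A]

/-- The monic polynomial `y ^ n + ∑ n ^ i c_i y ^ (n - i)`, `1 ≤ i ≤ n - 1`. -/
def critPoly (n : ℕ) (c : ℕ → A) : A[X] :=
  X ^ n + ∑ i ∈ Finset.range (n - 1), C ((n : A) ^ (i + 1) * c (i + 1)) * X ^ (n - 1 - i)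

/-- The monic polynomial whose `n`-fold multiple is the derivative of `critPoly n c`. -/
def critDeriv (n : ℕ) (c : ℕ → A) : A[X] :=
  X ^ (n - 1) + ∑ i ∈ Finset.range (n - 1),
    C (((n - 1 - i : ℕ) : A) * (n : A) ^ i * c (i + 1)) * X ^ (n - 1 - (i + 1))

/-- Coordinates of the powers of `critPoly n c` modulo `critDeriv n c`. -/
def critMatrix (n : ℕ) (c : ℕ → A) : Matrix (Fin (n - 1)) (Fin (n - 1)) A :=
  Matrix.of fun i j => ((critPoly n c ^ (i : ℕ)) %ₘ critDeriv n c).coeff j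

/-- This vanishes when two critical values of `critPoly n c` coincide. -/
def critDet (n : ℕ) (c : ℕ → A) : A := (critMatrix n c).det

theorem critDeriv_sum_degree (n : ℕ) (hn : 2 ≤ n) (c : ℕ → A) :
    (∑ i ∈ Finset.range (n - 1),
      C (((n - 1 - i : ℕ) : A) * (n : A) ^ i * c (i + 1)) * X ^ (n - 1 - (i + 1))).degree <
        ((n - 1 : ℕ) : WithBot ℕ) := by
  refine (degree_sum_le _ _).trans_lt ?_
  rw [Finset.sup_lt_iff (WithBot.bot_lt_coe _)]
  intro i hi
  refine (degree_C_mul_X_pow_le _ _).trans_lt ?_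
  have := Finset.mem_range.1 hi
  exact_mod_cast (by omega : n - 1 - (i + 1) < n - 1)

theorem critDeriv_monic (n : ℕ) (hn : 2 ≤ n) (c : ℕ → A) : (critDeriv n c).Monic :=
  monic_X_pow_add (critDeriv_sum_degree n hn c)

theorem critDeriv_natDegree [Nontrivial A] (n : ℕ) (hn : 2 ≤ n) (c : ℕ → A) :
    (critDeriv n c).natDegree = n - 1 := by
  rw [critDeriv, natDegree_add_eq_left_of_degree_lt, natDegree_X_pow]
  rw [degree_X_pow]
  exact critDeriv_sum_degree n hn c

theorem derivative_critPoly (n : ℕ) (c : ℕ → A) :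
    derivative (critPoly n c) = C (n : A) * critDeriv n c := by
  rw [critPoly, critDeriv, derivative_add, derivative_X_pow, derivative_sum, mul_add,
    Finset.mul_sum]
  congr 1
  refine Finset.sum_congr rfl fun i _ => ?_
  rw [derivative_C_mul_X_pow, ← mul_assoc, ← C_mul, show n - 1 - i - 1 = n - 1 - (i + 1) by omega]
  congr 2
  ring

variable {B : Type*} [CommRing B]

theorem map_critPoly (φ : A →+* B) (n : ℕ) (c : ℕ → A) :
    (critPoly n c).map φ = critPoly n (fun i => φ (c i)) := by
  simp [critPoly, Polynomial.map_sum]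

theorem map_critDeriv (φ : A →+* B) (n : ℕ) (c : ℕ → A) :
    (critDeriv n c).map φ = critDeriv n (fun i => φ (c i)) := by
  simp [critDeriv, Polynomial.map_sum]

/-- `critDeriv` is monic, so division with remainder by it commutes with every ring homomorphism.
The factors n^i in `critPoly` are there to make this normalization possible over ℤ. -/
theorem map_critDet (φ : A →+* B) (n : ℕ) (hn : 2 ≤ n) (c : ℕ → A) :
    φ (critDet n c) = critDet n (fun i => φ (c i)) := by
  rw [critDet, RingHom.map_det, critDet]
  congr 1
  ext i j
  simp only [critMatrix, RingHom.mapMatrix_apply, Matrix.map_apply, Matrix.of_apply]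
  rw [← coeff_map, map_modByMonic _ (critDeriv_monic n hn c), Polynomial.map_pow, map_critPoly,
    map_critDeriv]

theorem critPoly_congr {n : ℕ} {c d : ℕ → A} (h : ∀ i, 1 ≤ i → i < n → c i = d i) :
    critPoly n c = critPoly n d := by
  unfold critPoly
  congr 1
  refine Finset.sum_congr rfl fun i hi => ?_
  have := Finset.mem_range.1 hi
  rw [h (i + 1) (by omega) (by omega)]

theorem critDeriv_congr {n : ℕ} {c d : ℕ → A} (h : ∀ i, 1 ≤ i → i < n → c i = d i) :
    critDeriv n c = critDeriv n d := by
  unfold critDeriv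
  congr 1
  refine Finset.sum_congr rfl fun i hi => ?_
  have := Finset.mem_range.1 hi
  rw [h (i + 1) (by omega) (by omega)]

/-- The detector ignores the constant term of the polynomial: coincidence of critical values is
invariant under adding constants. This is what allows a_{n-1} and a_n to be sieved separately. -/
theorem critDet_congr {n : ℕ} {c d : ℕ → A} (h : ∀ i, 1 ≤ i → i < n → c i = d i) :
    critDet n c = critDet n d := by
  unfold critDet critMatrix
  rw [critPoly_congr h, critDeriv_congr h]

/-- The universal version of `critDet`. -/
def critUniv (n : ℕ) : MvPolynomial ℕ ℤ := critDet n MvPolynomial.X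

/-- Expressing all specializations through one integer polynomial makes the degree and size bounds
uniform in the field and in the prime. -/
theorem eval₂_critUniv (n : ℕ) (hn : 2 ≤ n) (c : ℕ → A) :
    MvPolynomial.eval₂Hom (Int.castRingHom A) c (critUniv n) = critDet n c := by
  rw [critUniv, map_critDet _ n hn]
  congr 1
  funext i
  simp

end

/-! ### Vanishing and non-vanishing of the detector over a field -/

section Field

variable {k : Type*} [Field k]

/-- A nonzero linear functional on polynomials modulo `critDeriv`, vanishing on the powers of
`critPoly`, kills `critDet`. -/
theorem critDet_eq_zero_of_functional {n : ℕ} (hn : 3 ≤ n) (c : ℕ → k) (L : k[X] →ₗ[k] k)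
    (hL : ∀ g, L (critDeriv n c * g) = 0) (hX : L X ≠ 0)
    (hp : ∀ i, L (critPoly n c ^ i) = 0) : critDet n c = 0 := by
  rw [critDet, ← Matrix.exists_mulVec_eq_zero_iff]
  refine ⟨fun j => L (X ^ (j : ℕ)), ?_, ?_⟩
  · intro h
    have := congrFun h ⟨1, by omega⟩
    exact hX (by simpa using this)
  · funext i
    have h1 : L (critPoly n c ^ (i : ℕ) %ₘ critDeriv n c) = 0 := by
      rw [modByMonic_eq_sub_mul_div, map_sub, hL, hp, sub_zero]
    have hdeg : (critPoly n c ^ (i : ℕ) %ₘ critDeriv n c).natDegree < n - 1 := by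
      have h3 := natDegree_modByMonic_lt (critPoly n c ^ (i : ℕ)) (critDeriv_monic n (by omega) c)
        (by
          intro h
          have := critDeriv_natDegree n (by omega) c
          rw [h, natDegree_one] at this
          omega)
      rwa [critDeriv_natDegree n (by omega) c] at h3
    have h2 := as_sum_range' (critPoly n c ^ (i : ℕ) %ₘ critDeriv n c) (n - 1) hdeg
    rw [h2, map_sum, Finset.sum_range] at h1
    simp only [Matrix.mulVec, dotProduct, critMatrix, Matrix.of_apply, Pi.zero_apply]
    rw [← h1]
    refine Finset.sum_congr rfl fun j _ => ?_
    rw [← C_mul_X_pow_eq_monomial, ← smul_eq_C_mul, map_smul, smul_eq_mul]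

/-- The functional is the difference of evaluations at the two critical points. -/
theorem critDet_eq_zero_of_eq {n : ℕ} (hn : 3 ≤ n) (c : ℕ → k) {x y : k} (hxy : x ≠ y)
    (hx : (critDeriv n c).eval x = 0) (hy : (critDeriv n c).eval y = 0)
    (h : (critPoly n c).eval x = (critPoly n c).eval y) : critDet n c = 0 := by
  refine critDet_eq_zero_of_functional hn c (leval x - leval y) ?_ ?_ ?_
  · intro g; simp [hx, hy]
  · simpa [sub_eq_zero] using hxy
  · intro i; simp [h]

/-- The functional is g ↦ g'(x): it kills multiples of a polynomial with a double root at x, and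
powers of `critPoly` because x is a critical point. -/
theorem critDet_eq_zero_of_double {n : ℕ} (hn : 3 ≤ n) (c : ℕ → k) {x : k}
    (hx : (critDeriv n c).eval x = 0) (hx' : (critDeriv n c).derivative.eval x = 0) :
    critDet n c = 0 := by
  refine critDet_eq_zero_of_functional hn c (leval x ∘ₗ derivative) ?_ ?_ ?_
  · intro g; simp [hx, hx']
  · simp
  · intro i
    simp [derivative_pow, derivative_critPoly n c, hx]

theorem critPoly_scale (n : ℕ) (c : ℕ → k) (u : k) :
    (critPoly n (fun i => u ^ i * c i)).comp (C u * X) = C (u ^ n) * critPoly n c := by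
  simp only [critPoly, add_comp, pow_comp, X_comp, Polynomial.sum_comp, mul_comp, C_comp, mul_add,
    Finset.mul_sum, mul_pow, C_pow]
  refine congrArg₂ (· + ·) rfl (Finset.sum_congr rfl fun i hi => ?_)
  have := Finset.mem_range.1 hi
  rw [show (C u ^ n : k[X]) = C u ^ (i + 1) * C u ^ (n - 1 - i) by rw [← pow_add]; congr 1; omega]
  simp only [C_mul, C_pow]
  ring

theorem critDeriv_scale (n : ℕ) (c : ℕ → k) (u : k) :
    (critDeriv n (fun i => u ^ i * c i)).comp (C u * X) = C (u ^ (n - 1)) * critDeriv n c := by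
  simp only [critDeriv, add_comp, pow_comp, X_comp, Polynomial.sum_comp, mul_comp, C_comp, mul_add,
    Finset.mul_sum, mul_pow, C_pow]
  refine congrArg₂ (· + ·) rfl (Finset.sum_congr rfl fun i hi => ?_)
  have := Finset.mem_range.1 hi
  rw [show (C u ^ (n - 1) : k[X]) = C u ^ (i + 1) * C u ^ (n - 1 - (i + 1)) by
    rw [← pow_add]; congr 1; omega]
  simp only [C_mul, C_pow]
  ring

/-- Give c_i the weight i. Substituting y ↦ uy rescales `critPoly` and `critDeriv`, so the two
matrices differ by invertible diagonal matrices on the left and right. -/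
theorem critDet_scale_eq_zero {n : ℕ} (hn : 3 ≤ n) (c : ℕ → k) {u : k} (hu : u ≠ 0)
    (h : critDet n c = 0) : critDet n (fun i => u ^ i * c i) = 0 := by
  set d : ℕ → k := fun i => u ^ i * c i with hd
  have hent : ∀ i j, critMatrix n d i j * u ^ (j : ℕ) = u ^ (n * (i : ℕ)) * critMatrix n c i j := by
    intro i j
    set r := critPoly n d ^ (i : ℕ) %ₘ critDeriv n d with hr
    have h1 := modByMonic_add_div (critPoly n d ^ (i : ℕ)) (critDeriv n d)
    have h2 := congrArg (fun g => g.comp (C u * X)) h1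
    simp only [add_comp, mul_comp, pow_comp] at h2
    rw [critDeriv_scale, critPoly_scale] at h2
    have hlt : (r.comp (C u * X)).degree < (critDeriv n c).degree := by
      rw [degree_eq_natDegree (critDeriv_monic n (by omega) c).ne_zero,
        critDeriv_natDegree n (by omega) c, degree_lt_iff_coeff_zero]
      intro N hN
      rw [comp_C_mul_X_coeff, coeff_eq_zero_of_degree_lt, zero_mul]
      refine (degree_modByMonic_lt _ (critDeriv_monic n (by omega) d)).trans_le ?_
      rw [degree_eq_natDegree (critDeriv_monic n (by omega) d).ne_zero,
        critDeriv_natDegree n (by omega) d]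
      exact_mod_cast hN
    have h3 := (div_modByMonic_unique
      (C (u ^ (n - 1)) * (critPoly n d ^ (i : ℕ) /ₘ critDeriv n d).comp (C u * X))
      (r.comp (C u * X)) (critDeriv_monic n (by omega) c)
      (f := (C (u ^ n) * critPoly n c) ^ (i : ℕ)) ⟨by rw [← h2]; ring, hlt⟩).2
    rw [mul_pow, ← C_pow, ← smul_eq_C_mul, smul_modByMonic] at h3
    have h4 := congrArg (fun g => g.coeff (j : ℕ)) h3
    simp only [coeff_smul, comp_C_mul_X_coeff, smul_eq_mul] at h4
    simp only [critMatrix, Matrix.of_apply]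
    rw [pow_mul]
    exact h4.symm
  have hmat : critMatrix n d * Matrix.diagonal (fun j : Fin (n - 1) => u ^ (j : ℕ)) =
      Matrix.diagonal (fun i : Fin (n - 1) => u ^ (n * (i : ℕ))) * critMatrix n c := by
    ext i j
    rw [Matrix.mul_diagonal, Matrix.diagonal_mul, hent]
  have hdet := congrArg Matrix.det hmat
  rw [Matrix.det_mul, Matrix.det_mul, Matrix.det_diagonal, ← critDet, ← critDet, h, mul_zero] at hdet
  refine (mul_eq_zero.1 hdet).resolve_right ?_
  exact Finset.prod_ne_zero_iff.2 fun j _ => pow_ne_zero _ hu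

/-- For y^n + n^{n-1} y the remainder modulo y^{n-1} + n^{n-2} is γy with γ = n^{n-2}(n-1). The
powers therefore have remainders γ^i y^i and the matrix is diagonal. -/
theorem critDet_single_ne_zero {n : ℕ} (hn : 3 ≤ n) (hnk : (n : k) ≠ 0)
    (hnk' : ((n - 1 : ℕ) : k) ≠ 0) (c : ℕ → k) (hc : ∀ i, 1 ≤ i → i < n - 1 → c i = 0)
    (hc1 : c (n - 1) = 1) : critDet n c ≠ 0 := by
  have hP : critPoly n c = X ^ n + C ((n : k) ^ (n - 1)) * X := by
    rw [critPoly, Finset.sum_eq_single (n - 2)]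
    · rw [show n - 2 + 1 = n - 1 by omega, hc1, show n - 1 - (n - 2) = 1 by omega, pow_one, mul_one]
    · intro i hi hi'
      have := Finset.mem_range.1 hi
      rw [hc (i + 1) (by omega) (by omega)]
      simp
    · intro h
      exact absurd (Finset.mem_range.2 (by omega)) h
  have hQ : critDeriv n c = X ^ (n - 1) + C ((n : k) ^ (n - 2)) := by
    rw [critDeriv, Finset.sum_eq_single (n - 2)]
    · rw [show n - 2 + 1 = n - 1 by omega, hc1, show n - 1 - (n - 2) = 1 by omega]
      simp
    · intro i hi hi'
      have := Finset.mem_range.1 hi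
      rw [hc (i + 1) (by omega) (by omega)]
      simp
    · intro h
      exact absurd (Finset.mem_range.2 (by omega)) h
  set γ : k := (n : k) ^ (n - 2) * ((n - 1 : ℕ) : k) with hγ
  have hγ0 : γ ≠ 0 := mul_ne_zero (pow_ne_zero _ hnk) hnk'
  have hmod : critPoly n c = critDeriv n c * X + C γ * X := by
    rw [hP, hQ, hγ, Nat.cast_sub (by omega : 1 ≤ n)]
    have e1 : (X : k[X]) ^ n = X ^ (n - 1) * X := by rw [← pow_succ]; congr 1; omega
    have e2 : (n : k) ^ (n - 1) = (n : k) ^ (n - 2) * n := by rw [← pow_succ]; congr 1; omega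
    rw [e1, e2]
    simp only [C_mul, C_sub, C_pow, Nat.cast_one, C_1]
    ring
  have hpow : ∀ i : ℕ, i < n - 1 → critPoly n c ^ i %ₘ critDeriv n c = C (γ ^ i) * X ^ i := by
    intro i hi
    have hdvd : critDeriv n c ∣ critPoly n c ^ i - (C γ * X) ^ i :=
      (Dvd.intro X (by rw [hmod]; ring)).trans (sub_dvd_pow_sub_pow _ _ i)
    obtain ⟨g, hg⟩ := hdvd
    refine (div_modByMonic_unique g _ (critDeriv_monic n (by omega) c) ⟨?_, ?_⟩).2
    · rw [← hg, mul_pow (C γ) X i, C_pow]; ring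
    · rw [degree_eq_natDegree (critDeriv_monic n (by omega) c).ne_zero,
        critDeriv_natDegree n (by omega) c]
      exact (degree_C_mul_X_pow_le _ _).trans_lt (by exact_mod_cast hi)
  have hM : critMatrix n c = Matrix.diagonal (fun i : Fin (n - 1) => γ ^ (i : ℕ)) := by
    ext i j
    rw [critMatrix, Matrix.of_apply, hpow i i.2, coeff_C_mul_X_pow, Matrix.diagonal_apply]
    simp only [Fin.ext_iff, eq_comm]
  rw [critDet, hM, Matrix.det_diagonal]
  exact Finset.prod_ne_zero_iff.2 fun j _ => pow_ne_zero _ hγ0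

/-- The number of values of the last coefficient for which `critDet` vanishes. -/
theorem exists_critDet_ne_zero [Infinite k] {n : ℕ} (hn : 3 ≤ n) (hnk : (n : k) ≠ 0)
    (hnk' : ((n - 1 : ℕ) : k) ≠ 0) (c : ℕ → k) :
    ∃ τ : k, critDet n (Function.update c (n - 1) τ) ≠ 0 := by
  by_contra! hall
  -- all scalings vanish
  let w : ℕ → k[X] := Function.update (fun i => X ^ i * C (c i)) (n - 1) 1
  have hev : ∀ u : k, (critDet n w).eval u =
      critDet n (Function.update (fun i => u ^ i * c i) (n - 1) 1) := by
    intro u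
    rw [← coe_evalRingHom, map_critDet _ n (by omega)]
    congr 1
    funext i
    by_cases hi : i = n - 1
    · subst hi; simp [w]
    · simp only [w, Function.update_of_ne hi, coe_evalRingHom, eval_mul, eval_pow, eval_X, eval_C]
  have hz : critDet n w = 0 := by
    apply eq_zero_of_infinite_isRoot
    apply Set.Infinite.mono (s := {0}ᶜ) _ (Set.Finite.infinite_compl (Set.finite_singleton 0))
    intro u hu
    have hu' : u ≠ 0 := hu
    rw [Set.mem_ofPred_eq, IsRoot, hev]
    have := critDet_scale_eq_zero hn _ hu' (hall ((u ^ (n - 1))⁻¹))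
    rw [← this]
    congr 1
    funext i
    by_cases hi : i = n - 1
    · subst hi
      simp [hu']
    · simp [hi]
  have h0 := hev 0
  rw [hz, eval_zero] at h0
  refine critDet_single_ne_zero hn hnk hnk' _ ?_ ?_ h0.symm
  · intro i hi hi'
    rw [Function.update_of_ne (by omega)]
    simp [show i ≠ 0 by omega]
  · simp

/-- As a function of the last coefficient, `critDet` is a nonzero polynomial of degree at most the
total degree of `critUniv`. -/
theorem card_critDet_zero_le [Infinite k] {n : ℕ} (hn : 3 ≤ n) (hnk : (n : k) ≠ 0)
    (hnk' : ((n - 1 : ℕ) : k) ≠ 0) (c : ℕ → k) (S : Finset k)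
    (hS : ∀ τ ∈ S, critDet n (Function.update c (n - 1) τ) = 0) :
    S.card ≤ (critUniv n).totalDegree := by
  let w : ℕ → k[X] := Function.update (fun i => C (c i)) (n - 1) X
  have hev : ∀ u : k, (critDet n w).eval u = critDet n (Function.update c (n - 1) u) := by
    intro u
    rw [← coe_evalRingHom, map_critDet _ n (by omega)]
    congr 1
    funext i
    by_cases hi : i = n - 1
    · subst hi; simp [w]
    · simp [w, hi]
  obtain ⟨τ, hτ⟩ := exists_critDet_ne_zero hn hnk hnk' c
  have hne : critDet n w ≠ 0 := by
    intro h
    rw [← hev, h, eval_zero] at hτ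
    exact hτ rfl
  have h1 : (critDet n w).natDegree ≤ (critUniv n).totalDegree := by
    have hmap : critDet n w =
        MvPolynomial.aeval w (MvPolynomial.map (Int.castRingHom k) (critUniv n)) := by
      rw [← eval₂_critUniv n (by omega) w, MvPolynomial.aeval_def, MvPolynomial.eval₂_map,
        MvPolynomial.coe_eval₂Hom]
      congr 1
    rw [hmap]
    refine (MvPolynomial.aeval_natDegree_le _ (Finset.sup_mono (MvPolynomial.support_map_subset _ _)) w
      (n := 1) ?_).trans (by rw [mul_one]; rfl)
    intro i
    by_cases hi : i = n - 1
    · subst hi; simp [w]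
    · simp [w, hi]
  refine le_trans ?_ h1
  classical
  refine (Finset.card_le_card (t := (critDet n w).roots.toFinset) ?_).trans
    ((Multiset.toFinset_card_le _).trans (card_roots' _))
  intro u hu
  rw [Multiset.mem_toFinset, mem_roots hne, IsRoot, hev, hS u hu]

end Field
end UltraWeak

end

noncomputable section
namespace UltraWeak
open Polynomial

/-! ### Polynomials with given coefficients -/

/-- The polynomial `a_0 x ^ n + a_1 x ^ (n-1) + ⋯ + a_n`. -/
def polyOf {A : Type*} [CommRing A] (n : ℕ) (a : ℕ → A) : A[X] :=
  ∑ i ∈ Finset.range (n + 1), C (a i) * X ^ (n - i)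

section

variable {A B : Type*} [CommRing A] [CommRing B]

theorem polyOf_coeff (n : ℕ) (a : ℕ → A) {i : ℕ} (hi : i ≤ n) :
    (polyOf n a).coeff (n - i) = a i := by
  rw [polyOf, finsetSum_coeff, Finset.sum_eq_single i]
  · simp
  · intro j hj hji
    have := Finset.mem_range.1 hj
    rw [coeff_C_mul, coeff_X_pow, if_neg (by omega), mul_zero]
  · intro h
    exact absurd (Finset.mem_range.2 (by omega)) h

theorem polyOf_natDegree_le (n : ℕ) (a : ℕ → A) : (polyOf n a).natDegree ≤ n := by
  apply natDegree_sum_le_of_forall_le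
  intro i _
  exact (natDegree_C_mul_X_pow_le _ _).trans (by omega)

theorem polyOf_natDegree (n : ℕ) (a : ℕ → A) (h : a 0 ≠ 0) : (polyOf n a).natDegree = n := by
  apply le_antisymm (polyOf_natDegree_le n a)
  apply le_natDegree_of_ne_zero
  have := polyOf_coeff n a (Nat.zero_le n)
  rw [Nat.sub_zero] at this
  rwa [this]

theorem map_polyOf (φ : A →+* B) (n : ℕ) (a : ℕ → A) :
    (polyOf n a).map φ = polyOf n (fun i => φ (a i)) := by
  simp [polyOf, Polynomial.map_sum]

theorem polyOf_congr {n : ℕ} {a b : ℕ → A} (h : ∀ i ≤ n, a i = b i) : polyOf n a = polyOf n b := by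
  refine Finset.sum_congr rfl fun i hi => ?_
  rw [h i (by have := Finset.mem_range.1 hi; omega)]

theorem eq_polyOf (n : ℕ) (f : A[X]) (hf : f.natDegree ≤ n) :
    f = polyOf n (fun i => f.coeff (n - i)) := by
  ext j
  by_cases hj : j ≤ n
  · have := polyOf_coeff n (fun i => f.coeff (n - i)) (i := n - j) (by omega)
    rw [show n - (n - j) = j by omega] at this
    rw [this]
  · rw [coeff_eq_zero_of_natDegree_lt (by omega),
      coeff_eq_zero_of_natDegree_lt ((polyOf_natDegree_le _ _).trans_lt (by omega))]

theorem polyOf_update_last (n : ℕ) (a : ℕ → A) (y : A) :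
    polyOf n (Function.update a n y) = polyOf n (Function.update a n 0) + C y := by
  rw [polyOf, polyOf, Finset.sum_range_succ, Finset.sum_range_succ]
  have : ∀ z, ∑ x ∈ Finset.range n, C (Function.update a n z x) * X ^ (n - x) =
      ∑ x ∈ Finset.range n, C (a x) * X ^ (n - x) := by
    intro z
    refine Finset.sum_congr rfl fun i hi => ?_
    rw [Function.update_of_ne (by have := Finset.mem_range.1 hi; omega)]
  rw [this, this]
  simp

/-- The normalized coefficients used to compare `polyOf` and `critPoly`. -/
def critCoeff (a : ℕ → A) (i : ℕ) : A := a 0 ^ (i - 1) * a i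

/-- The substitution y = n a_0 x, after multiplication by n^n a_0^{n-1}, makes f - a_n monic with
coefficients divisible by the required powers of n. -/
theorem critPoly_comp (n : ℕ) (hn : 1 ≤ n) (a : ℕ → A) :
    (critPoly n (critCoeff a)).comp (C ((n : A) * a 0) * X) =
      C ((n : A) ^ n * a 0 ^ (n - 1)) * (polyOf n a - C (a n)) := by
  obtain ⟨N, rfl⟩ : ∃ N, n = N + 1 := ⟨n - 1, by omega⟩
  have e : polyOf (N + 1) a - C (a (N + 1)) =
      C (a 0) * X ^ (N + 1) + ∑ i ∈ Finset.range N, C (a (i + 1)) * X ^ (N - i) := by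
    rw [polyOf, Finset.sum_range_succ, Finset.sum_range_succ']
    simp
    ring
  rw [e, critPoly, add_comp, Polynomial.sum_comp, mul_add, Finset.mul_sum]
  simp only [pow_comp, X_comp, mul_comp, C_comp, Nat.add_sub_cancel]
  refine congrArg₂ (· + ·) ?_ (Finset.sum_congr rfl fun i hi => ?_)
  · simp only [mul_pow, C_mul, C_pow]
    ring
  · have := Finset.mem_range.1 hi
    have e2 : ((N + 1 : ℕ) : A) ^ (N + 1) * a 0 ^ N =
        ((N + 1 : ℕ) : A) ^ (i + 1) * ((N + 1 : ℕ) : A) ^ (N - i) * (a 0 ^ i * a 0 ^ (N - i)) := by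
      rw [← pow_add, ← pow_add]
      congr 2 <;> omega
    rw [e2, critCoeff, Nat.add_sub_cancel]
    simp only [mul_pow, C_mul, C_pow]
    ring

end

/-- Two double roots are two critical points with the same critical value, and a vanishing second
derivative is a double critical point. Both survive the rescaling by n a_0. -/
theorem critDet_eq_zero_of_hasBadRoots {k : Type*} [Field k] {n : ℕ} (hn : 3 ≤ n) (a : ℕ → k)
    (hnk : (n : k) ≠ 0) (ha : a 0 ≠ 0) (h : HasBadRoots (polyOf n a)) :
    critDet n (critCoeff a) = 0 := by
  set F := polyOf n a with hF
  set c := critCoeff a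
  set N : k := (n : k) * a 0 with hN
  have hN0 : N ≠ 0 := mul_ne_zero hnk ha
  set e : k := (n : k) ^ n * a 0 ^ (n - 1) with he
  have h0 := critPoly_comp n (by omega) a
  rw [← hF, ← hN, ← he] at h0
  have h1 := congrArg derivative h0
  rw [derivative_comp, derivative_critPoly, derivative_C_mul, derivative_C_mul, derivative_sub, derivative_C,
    sub_zero, derivative_X, mul_one, mul_comp, C_comp, ← mul_assoc, ← C_mul] at h1
  have h2 := congrArg derivative h1
  rw [derivative_C_mul, derivative_comp, derivative_C_mul, derivative_C_mul, derivative_X,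
    mul_one] at h2
  have v0 : ∀ x, (critPoly n c).eval (N * x) = e * (F.eval x - a n) := by
    intro x
    simpa using congrArg (eval x) h0
  have v1 : ∀ x, F.derivative.eval x = 0 → (critDeriv n c).eval (N * x) = 0 := by
    intro x hx
    have := congrArg (eval x) h1
    simpa [hx, hN0, hnk] using this
  have v2 : ∀ x, F.derivative.derivative.eval x = 0 →
      (critDeriv n c).derivative.eval (N * x) = 0 := by
    intro x hx
    have := congrArg (eval x) h2
    simpa [hx, hN0, hnk] using this
  obtain ⟨x, hx0, hx1, hx2 | ⟨y, hyx, hy0, hy1⟩⟩ := h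
  · exact critDet_eq_zero_of_double hn c (v1 x hx1) (v2 x hx2)
  · refine critDet_eq_zero_of_eq hn c (x := N * y) (y := N * x) ?_ (v1 y hy1) (v1 x hx1) ?_
    · intro h
      exact hyx (mul_left_cancel₀ hN0 h)
    · rw [v0, v0, hx0, hy0]

theorem critCoeff_update {A : Type*} [CommRing A] {n : ℕ} (hn : 2 ≤ n) (a : ℕ → A) (τ : A) :
    critCoeff (Function.update a (n - 1) τ) =
      Function.update (critCoeff a) (n - 1) (a 0 ^ (n - 2) * τ) := by
  funext i
  by_cases hi : i = n - 1
  · subst hi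
    simp [critCoeff, show (0 : ℕ) ≠ n - 1 by omega, show n - 1 - 1 = n - 2 by omega]
  · simp [critCoeff, hi, show (0 : ℕ) ≠ n - 1 by omega]

/-- The integer whose prime divisors are the primes at which `polyOf n a` may have bad roots. -/
def critInt (n : ℕ) (a : ℕ → ℤ) (T : ℤ) : ℤ :=
  critDet n (critCoeff (Function.update a (n - 1) T))

theorem map_critInt {A : Type*} [CommRing A] {n : ℕ} (hn : 2 ≤ n) (a : ℕ → ℤ) (T : ℤ) :
    ((critInt n a T : ℤ) : A) =
      critDet n (Function.update (critCoeff fun i => (a i : A)) (n - 1) ((a 0 : A) ^ (n - 2) * T)) := by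
  have := map_critDet (Int.castRingHom A) n hn (critCoeff (Function.update a (n - 1) T))
  rw [critInt, ← eq_intCast (Int.castRingHom A), this, ← critCoeff_update hn]
  congr 1
  funext i
  simp only [critCoeff, map_mul, map_pow, eq_intCast]
  by_cases hi : i = n - 1
  · subst hi; simp [show (0 : ℕ) ≠ n - 1 by omega]
  · simp [hi, show (0 : ℕ) ≠ n - 1 by omega]

theorem card_critInt_eq_zero_le {n : ℕ} (hn : 3 ≤ n) (a : ℕ → ℤ) (ha : a 0 ≠ 0) (S : Finset ℤ)
    (hS : ∀ T ∈ S, critInt n a T = 0) : S.card ≤ (critUniv n).totalDegree := by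
  have ha' : (a 0 : ℚ) ≠ 0 := by exact_mod_cast ha
  have hinj : Function.Injective fun T : ℤ => (a 0 : ℚ) ^ (n - 2) * (T : ℚ) := by
    intro x y hxy
    exact_mod_cast mul_left_cancel₀ (pow_ne_zero _ ha') hxy
  rw [← Finset.card_image_of_injective S hinj]
  refine card_critDet_zero_le (k := ℚ) hn (by positivity) ?_ (critCoeff fun i => (a i : ℚ)) _ ?_
  · exact_mod_cast (by omega : n - 1 ≠ 0)
  · intro τ hτ
    obtain ⟨T, hT, rfl⟩ := Finset.mem_image.1 hτ
    rw [← map_critInt (by omega), hS T hT, Int.cast_zero]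

theorem not_dvd_of_lt {p n : ℕ} (h0 : n ≠ 0) (h : n < p) : ¬ p ∣ n :=
  fun hd => absurd (Nat.le_of_dvd (Nat.pos_of_ne_zero h0) hd) (by omega)

section

variable (p : ℕ) [Fact p.Prime]

/-- The number of bad classes of a_{n-1} is bounded independently of p and of the other
coefficients, since n, n - 1 and a_0 are units mod p. -/
theorem exists_finset_of_dvd_critInt {n : ℕ} (hn : 3 ≤ n) (hpn : n < p) (a : ℕ → ℤ)
    (ha : ¬ (p : ℤ) ∣ a 0) : ∃ S : Finset (ZMod p), S.card ≤ (critUniv n).totalDegree ∧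
      ∀ T : ℤ, (p : ℤ) ∣ critInt n a T → (T : ZMod p) ∈ S := by
  classical
  let k := AlgebraicClosure (ZMod p)
  let S : Finset (ZMod p) := Finset.univ.filter fun z => ∃ T : ℤ, (T : ZMod p) = z ∧
    (p : ℤ) ∣ critInt n a T
  refine ⟨S, ?_, fun T hT => by simp only [S, Finset.mem_filter_univ]; exact ⟨T, rfl, hT⟩⟩
  have ha' : (a 0 : k) ≠ 0 := by rwa [Ne, intCast_closure_eq_zero_iff]
  have hinj : Function.Injective fun z : ZMod p =>
      (a 0 : k) ^ (n - 2) * algebraMap (ZMod p) k z := by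
    intro x y hxy
    exact (algebraMap (ZMod p) k).injective (mul_left_cancel₀ (pow_ne_zero _ ha') hxy)
  rw [← Finset.card_image_of_injective S hinj]
  refine card_critDet_zero_le (k := k) hn ?_ ?_ (critCoeff fun i => (a i : k)) _ ?_
  · rw [Ne, CharP.cast_eq_zero_iff k p]
    exact not_dvd_of_lt (by omega) hpn
  · rw [Ne, CharP.cast_eq_zero_iff k p]
    exact not_dvd_of_lt (by omega) (by omega)
  · intro τ hτ
    obtain ⟨z, hz, rfl⟩ := Finset.mem_image.1 hτ
    obtain ⟨T, rfl, hT⟩ := (Finset.mem_filter_univ _).1 hz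
    have := map_critInt (A := k) (by omega : 2 ≤ n) a T
    rw [(intCast_closure_eq_zero_iff p _).2 hT] at this
    simp only [map_intCast]
    exact this.symm

theorem redn_polyOf (n : ℕ) (a : ℕ → ℤ) :
    redn (polyOf n a) p = polyOf n fun i => (a i : AlgebraicClosure (ZMod p)) :=
  map_polyOf _ n a

theorem dvd_critInt_of_hasBadRoots {n : ℕ} (hn : 3 ≤ n) (hpn : n < p) (a : ℕ → ℤ)
    (ha : ¬ (p : ℤ) ∣ a 0) (T Y : ℤ)
    (h : HasBadRoots (redn (polyOf n (Function.update (Function.update a (n - 1) T) n Y)) p)) :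
    (p : ℤ) ∣ critInt n a T := by
  rw [redn_polyOf] at h
  have h1 := critDet_eq_zero_of_hasBadRoots hn _ (by
    rw [Ne, CharP.cast_eq_zero_iff _ p]
    exact not_dvd_of_lt (by omega) hpn) (by
    rwa [Function.update_of_ne (by omega), Function.update_of_ne (by omega), Ne,
      intCast_closure_eq_zero_iff]) h
  rw [← intCast_closure_eq_zero_iff p, map_critInt (by omega), ← h1, ← critCoeff_update (by omega)]
  refine critDet_congr fun i hi hi' => ?_
  have hup : ∀ j, j < n → (Function.update (Function.update a (n - 1) T) n Y j : ℤ) =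
      Function.update a (n - 1) T j := fun j hj => Function.update_of_ne (by omega) _ _
  simp only [critCoeff]
  rw [hup 0 (by omega), hup i hi', Function.update_of_ne (by omega : (0 : ℕ) ≠ n - 1),
    Function.update_of_ne (by omega : (0 : ℕ) ≠ n - 1)]
  by_cases h : i = n - 1
  · subst h; simp
  · simp [h]

/-- Having a double root restricts the constant coefficient to few classes modulo `p`. -/
theorem exists_finset_of_double_root {n : ℕ} (hn : 3 ≤ n) (hpn : n < p) (a : ℕ → ℤ)
    (ha : ¬ ((p : ℤ) ∣ a 0 ∧ (p : ℤ) ∣ a 1)) : ∃ S : Finset (ZMod p), S.card ≤ n - 1 ∧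
      ∀ Y : ℤ, (∃ x, (redn (polyOf n (Function.update a n Y)) p).eval x = 0 ∧
        (redn (polyOf n (Function.update a n Y)) p).derivative.eval x = 0) → (Y : ZMod p) ∈ S := by
  classical
  let k := AlgebraicClosure (ZMod p)
  let G : k[X] := redn (polyOf n (Function.update a n 0)) p
  have hG : ∀ Y : ℤ, redn (polyOf n (Function.update a n Y)) p = G + C (Y : k) := by
    intro Y
    rw [polyOf_update_last, redn, Polynomial.map_add, map_C]
    rfl
  have hGc : ∀ i, i < n → G.coeff (n - i) = (a i : k) := by
    intro i hi
    have := polyOf_coeff n (Function.update a n 0) (i := i) (by omega)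
    simp only [G, coeff_map, this, Function.update_of_ne (by omega : i ≠ n)]
    rfl
  have hG' : G.derivative ≠ 0 := by
    intro h
    apply ha
    constructor
    · have h1 := congrArg (fun g => g.coeff (n - 1)) h
      simp only [coeff_derivative, coeff_zero] at h1
      rw [show n - 1 + 1 = n - 0 by omega, hGc 0 (by omega)] at h1
      rw [← intCast_closure_eq_zero_iff p]
      refine (mul_eq_zero.1 h1).resolve_right ?_
      have : ((n - 1 : ℕ) : k) + 1 = ((n : ℕ) : k) := by
        rw [Nat.cast_sub (by omega)]; simp
      rw [this, CharP.cast_eq_zero_iff k p]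
      exact not_dvd_of_lt (by omega) hpn
    · have h1 := congrArg (fun g => g.coeff (n - 2)) h
      simp only [coeff_derivative, coeff_zero] at h1
      rw [show n - 2 + 1 = n - 1 by omega, hGc 1 (by omega)] at h1
      rw [← intCast_closure_eq_zero_iff p]
      refine (mul_eq_zero.1 h1).resolve_right ?_
      have : ((n - 2 : ℕ) : k) + 1 = ((n - 1 : ℕ) : k) := by
        rw [show n - 1 = n - 2 + 1 by omega]; push_cast; rfl
      rw [this, CharP.cast_eq_zero_iff k p]
      exact not_dvd_of_lt (by omega) (by omega)
  -- The critical points do not involve the constant coefficient, so it must be minus one of at most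
  -- n - 1 critical values.
  let R : Finset k := G.derivative.roots.toFinset.image fun x => - G.eval x
  have hR : R.card ≤ n - 1 := by
    refine Finset.card_image_le.trans ((Multiset.toFinset_card_le _).trans ((card_roots' _).trans ?_))
    refine (natDegree_derivative_le _).trans ?_
    have : G.natDegree ≤ n := natDegree_map_le.trans (polyOf_natDegree_le _ _)
    omega
  refine ⟨Finset.univ.filter fun z => algebraMap (ZMod p) k z ∈ R, ?_, ?_⟩
  · refine le_trans ?_ hR
    apply Finset.card_le_card_of_injOn (algebraMap (ZMod p) k)
    · intro z hz
      simpa using hz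
    · exact (algebraMap (ZMod p) k).injective.injOn
  · rintro Y ⟨x, hx0, hx1⟩
    rw [Finset.mem_filter_univ, map_intCast]
    rw [hG] at hx0 hx1
    rw [derivative_add, derivative_C, add_zero] at hx1
    rw [eval_add, eval_C] at hx0
    refine Finset.mem_image.2 ⟨x, ?_, ?_⟩
    · rw [Multiset.mem_toFinset, mem_roots hG']
      exact hx1
    · linear_combination -hx0

end

/-- Only the coordinates of index 1, …, n - 1 matter; once the others are set to 0, each monomial is
at most B to the total degree. -/
theorem exists_critDet_bound (n : ℕ) (hn : 2 ≤ n) : ∃ K : ℕ, 1 ≤ K ∧ ∀ (c : ℕ → ℤ) (B : ℤ), 1 ≤ B →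
    (∀ i, 1 ≤ i → i < n → |c i| ≤ B) → |critDet n c| ≤ K * B ^ (critUniv n).totalDegree := by
  refine ⟨∑ s ∈ (critUniv n).support, ((critUniv n).coeff s).natAbs + 1, by omega, ?_⟩
  intro c B hB hc
  let c' : ℕ → ℤ := fun i => if 1 ≤ i ∧ i < n then c i else 0
  have hcc : critDet n c = critDet n c' := critDet_congr fun i h1 h2 => by simp [c', h1, h2]
  have hc' : ∀ i, |c' i| ≤ B := by
    intro i
    simp only [c']
    split_ifs with h
    · exact hc i h.1 h.2
    · simpa using by omega
  rw [hcc, ← eval₂_critUniv n hn c', MvPolynomial.coe_eval₂Hom, MvPolynomial.eval₂_eq]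
  have hB0 : (0 : ℤ) ≤ B ^ (critUniv n).totalDegree := by positivity
  calc _ ≤ ∑ s ∈ (critUniv n).support, |Int.castRingHom ℤ ((critUniv n).coeff s) *
          ∏ i ∈ s.support, c' i ^ s i| := Finset.abs_sum_le_sum_abs _ _
    _ ≤ ∑ s ∈ (critUniv n).support, (((critUniv n).coeff s).natAbs : ℤ) *
          B ^ (critUniv n).totalDegree := by
        refine Finset.sum_le_sum fun s hs => ?_
        rw [abs_mul]
        refine mul_le_mul (by simp) ?_ (abs_nonneg _) (by positivity)
        rw [Finset.abs_prod]
        calc _ ≤ ∏ i ∈ s.support, B ^ s i := by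
              refine Finset.prod_le_prod (fun i _ => abs_nonneg _) fun i _ => ?_
              rw [abs_pow]
              exact pow_le_pow_left₀ (abs_nonneg _) (hc' i) _
          _ = B ^ (∑ i ∈ s.support, s i) := Finset.prod_pow_eq_pow_sum _ _ _
          _ ≤ _ := pow_le_pow_right₀ hB (MvPolynomial.le_totalDegree hs)
    _ ≤ _ := by
        rw [← Finset.sum_mul]
        refine mul_le_mul_of_nonneg_right ?_ hB0
        push_cast
        omega

/-- The factor a_0 is included because the sieve also has to control the primes dividing a_0: every
prime at which the polynomial degenerates divides this product. -/
theorem exists_critInt_bound (n : ℕ) (hn : 2 ≤ n) : ∃ K D : ℕ, 1 ≤ K ∧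
    ∀ (a : ℕ → ℤ) (T B : ℤ), 1 ≤ B → (∀ i, i + 1 < n → |a i| ≤ B) → |T| ≤ B →
      |a 0 * critInt n a T| ≤ K * B ^ D := by
  obtain ⟨K, hK, h⟩ := exists_critDet_bound n hn
  refine ⟨K, 1 + n * (critUniv n).totalDegree, hK, fun a T B hB ha hT => ?_⟩
  have h1 : |critInt n a T| ≤ K * (B ^ n) ^ (critUniv n).totalDegree := by
    refine h _ _ (one_le_pow₀ hB) fun i hi hi' => ?_
    have h2 : ∀ j, j < n → |Function.update a (n - 1) T j| ≤ B := by
      intro j hj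
      by_cases hj' : j = n - 1
      · subst hj'; simpa using hT
      · rw [Function.update_of_ne hj']; exact ha j (by omega)
    rw [critCoeff, abs_mul, abs_pow]
    calc _ ≤ B ^ (i - 1) * B :=
          mul_le_mul (pow_le_pow_left₀ (abs_nonneg _) (h2 0 (by omega)) _) (h2 i hi')
            (abs_nonneg _) (by positivity)
      _ = B ^ i := by rw [← pow_succ]; congr 1; omega
      _ ≤ B ^ n := pow_le_pow_right₀ hB hi'.le
  rw [abs_mul]
  calc _ ≤ B * (K * (B ^ n) ^ (critUniv n).totalDegree) :=
        mul_le_mul (by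
          rcases Nat.lt_or_ge 1 n with h3 | h3
          · exact ha 0 (by omega)
          · omega) h1 (abs_nonneg _) (by omega)
    _ = _ := by rw [← pow_mul, pow_add]; ring

end UltraWeak

end

noncomputable section
namespace UltraWeak
open Polynomial

/-! ### A sieve in two variables -/

theorem card_filter_residue_le {p : ℕ} (L : ℕ) (c : ZMod p) :
    ((Finset.range L).filter fun k : ℕ => (k : ZMod p) = c).card ≤ L / p + 1 := by
  rw [← Finset.card_range (L / p + 1)]
  apply Finset.card_le_card_of_injOn (fun k => k / p)
  · intro k hk
    have hk' := Finset.mem_range.1 (Finset.mem_filter.1 (Finset.mem_coe.1 hk)).1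
    exact Finset.mem_coe.2 (Finset.mem_range.2 (Nat.lt_succ_of_le (Nat.div_le_div_right hk'.le)))
  · intro x hx y hy hxy
    have hx' := (Finset.mem_filter.1 (Finset.mem_coe.1 hx)).2
    have hy' := (Finset.mem_filter.1 (Finset.mem_coe.1 hy)).2
    have h := (ZMod.natCast_eq_natCast_iff' x y p).1 (hx'.trans hy'.symm)
    rw [← Nat.div_add_mod x p, ← Nat.div_add_mod y p, h]
    simp only at hxy
    rw [hxy]

theorem card_filter_progression_le {p : ℕ} [Fact p.Prime] (L : ℕ) (v B : ℤ)
    (hB : ¬ (p : ℤ) ∣ B) (S : Finset (ZMod p)) :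
    ((Finset.range L).filter fun k : ℕ => ((v + B * k : ℤ) : ZMod p) ∈ S).card ≤
      S.card * (L / p + 1) := by
  classical
  have hB' : (B : ZMod p) ≠ 0 := by rwa [Ne, ZMod.intCast_zmod_eq_zero_iff_dvd]
  calc _ ≤ (S.biUnion fun s =>
        (Finset.range L).filter fun k : ℕ => (k : ZMod p) = (s - v) / B).card := by
        apply Finset.card_le_card
        intro k hk
        obtain ⟨hk1, hk2⟩ := Finset.mem_filter.1 hk
        refine Finset.mem_biUnion.2 ⟨_, hk2, Finset.mem_filter.2 ⟨hk1, ?_⟩⟩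
        push_cast
        field_simp
        ring
    _ ≤ ∑ s ∈ S, (L / p + 1) :=
        Finset.card_biUnion_le.trans (Finset.sum_le_sum fun s _ => card_filter_residue_le L _)
    _ = _ := by rw [Finset.sum_const, smul_eq_mul]

/-- Their product divides N, and each factor exceeds Z. -/
theorem card_large_primeFactors_le {N Z r : ℕ} (hN : N ≠ 0) (hZ : 1 < Z) (h : N < Z ^ r) :
    (N.primeFactors.filter (Z < ·)).card ≤ r := by
  by_contra! hr
  have h1 : Z ^ (N.primeFactors.filter (Z < ·)).card ≤ ∏ p ∈ N.primeFactors.filter (Z < ·), p :=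
    Finset.pow_card_le_prod _ _ _ fun p hp => (Finset.mem_filter.1 hp).2.le
  have h2 : ∏ p ∈ N.primeFactors.filter (Z < ·), p ≤ N := by
    refine Nat.le_of_dvd (Nat.pos_of_ne_zero hN) ((Finset.prod_dvd_prod_of_subset _ _ _
      (Finset.filter_subset _ _)).trans (Nat.prod_primeFactors_dvd N))
  have h3 : Z ^ r ≤ Z ^ (N.primeFactors.filter (Z < ·)).card := Nat.pow_le_pow_right (by omega) hr.le
  omega

theorem sum_inv_sq_Ioc_le (M Z : ℕ) :
    ∑ p ∈ Finset.Ioc M Z, ((p : ℝ) ^ 2)⁻¹ ≤ 2 / (M + 1) := by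
  have := sum_Ioo_inv_sq_le (α := ℝ) M (Z + 1)
  refine le_trans (le_of_eq ?_) this
  refine Finset.sum_congr ?_ fun _ _ => rfl
  ext x; simp

theorem div_add_one_le {p L : ℕ} (hp : 0 < p) (h : p ≤ L) :
    ((L / p + 1 : ℕ) : ℝ) ≤ 2 * L / p := by
  have hp' : (0 : ℝ) < p := by exact_mod_cast hp
  have h1 : ((L / p : ℕ) : ℝ) ≤ L / p := Nat.cast_div_le
  have h2 : (1 : ℝ) ≤ L / p := by
    rw [one_le_div hp']; exact_mod_cast h
  push_cast
  rw [mul_div_assoc]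
  linarith

/-- Here j indexes a_{n-1}, k indexes a_n, `a` is the leading coefficient and `E j` is the detector.
Bad pairs fall into four groups. For p ≤ Z not dividing `a`, both coordinates lie in few classes,
giving O(JL/p²). For p ≤ Z dividing `a`, only k is restricted, giving O(JL/p), summed by δ. The few
j with `E j = 0` are discarded outright. For any other j the primes beyond Z divide the nonzero
integer `a * E j < Z ^ r`, so there are at most r of them, each removing O(L/Z) values of k. -/
theorem card_sieved_le (J L Z M d e r : ℕ) (hZ : 1 < Z) (hJ : Z ≤ J) (hL : Z ≤ L)
    (P : ℕ → Prop) (bad : ℕ → ℕ → ℕ → Prop) (a : ℤ) (ha : a ≠ 0) (E : ℕ → ℤ) (δ : ℝ)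
    (hY : ∀ p, p.Prime → M < p → P p → ∀ j, ∃ S : Finset ℕ, S.card ≤ e * (L / p + 1) ∧
      ∀ k < L, bad p j k → k ∈ S)
    (hT : ∀ p, p.Prime → M < p → P p → ¬ (p : ℤ) ∣ a → ∃ S : Finset ℕ, S.card ≤ d * (J / p + 1) ∧
      ∀ j < J, ∀ k < L, bad p j k → j ∈ S)
    (hE : ∀ p, p.Prime → M < p → P p → ∀ j k, bad p j k → (p : ℤ) ∣ a * E j)
    (hE0 : ∃ S : Finset ℕ, S.card ≤ d ∧ ∀ j < J, E j = 0 → j ∈ S)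
    (hEr : ∀ j < J, (a * E j).natAbs < Z ^ r)
    (hδ : ∑ p ∈ a.natAbs.primeFactors.filter (M < ·), ((p : ℝ))⁻¹ ≤ δ) :
    ∃ U : Finset (ℕ × ℕ), (∀ j < J, ∀ k < L, ∀ p, p.Prime → M < p → P p → bad p j k → (j, k) ∈ U) ∧
      (U.card : ℝ) ≤ J * L * (8 * d * e / (M + 1) + 2 * e * δ) + d * L + 2 * r * e * J * (L / Z) := by
  classical
  choose! SY hSY1 hSY2 using hY
  choose! ST hST1 hST2 using hT
  obtain ⟨S0, hS01, hS02⟩ := hE0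
  let Q : Finset ℕ := (Finset.Ioc M Z).filter fun p => p.Prime ∧ P p
  let U1 : Finset (ℕ × ℕ) := (Q.filter fun p : ℕ => ¬ (p : ℤ) ∣ a).biUnion fun p =>
    (ST p).biUnion fun j => (SY p j).image fun k => (j, k)
  let U2 : Finset (ℕ × ℕ) := (Q.filter fun p : ℕ => (p : ℤ) ∣ a).biUnion fun p =>
    (Finset.range J).biUnion fun j => (SY p j).image fun k => (j, k)
  let U3 : Finset (ℕ × ℕ) := S0 ×ˢ Finset.range L
  let U4 : Finset (ℕ × ℕ) := ((Finset.range J).filter fun j => E j ≠ 0).biUnion fun j =>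
    ((a * E j).natAbs.primeFactors.filter fun p => Z < p ∧ M < p ∧ P p).biUnion fun p =>
      (SY p j).image fun k => (j, k)
  have hQ : ∀ p ∈ Q, p.Prime ∧ M < p ∧ p ≤ Z ∧ P p := by
    intro p hp
    simp only [Q, Finset.mem_filter, Finset.mem_Ioc] at hp
    exact ⟨hp.2.1, hp.1.1, hp.1.2, hp.2.2⟩
  have hSYr : ∀ p ∈ Q, ∀ j, ((SY p j).card : ℝ) ≤ e * (2 * L / p) := by
    intro p hp j
    obtain ⟨h1, h2, h3, h4⟩ := hQ p hp
    calc ((SY p j).card : ℝ) ≤ ((e * (L / p + 1) : ℕ) : ℝ) := by exact_mod_cast hSY1 p h1 h2 h4 j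
      _ = e * ((L / p + 1 : ℕ) : ℝ) := by rw [Nat.cast_mul]
      _ ≤ _ := by gcongr; exact div_add_one_le h1.pos (h3.trans hL)
  refine ⟨U1 ∪ U2 ∪ U3 ∪ U4, ?_, ?_⟩
  · intro j hj k hk p hp hM hP hb
    simp only [Finset.mem_union]
    by_cases hpZ : p ≤ Z
    · left; left
      have hpQ : p ∈ Q := by simp [Q, hM, hpZ, hp, hP]
      by_cases hpa : (p : ℤ) ∣ a
      · right
        simp only [U2, Finset.mem_biUnion, Finset.mem_filter, Finset.mem_image, Finset.mem_range]
        exact ⟨p, ⟨hpQ, hpa⟩, j, hj, k, hSY2 p hp hM hP j k hk hb, rfl⟩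
      · left
        simp only [U1, Finset.mem_biUnion, Finset.mem_filter, Finset.mem_image]
        exact ⟨p, ⟨hpQ, hpa⟩, j, hST2 p hp hM hP hpa j hj k hk hb, k,
          hSY2 p hp hM hP j k hk hb, rfl⟩
    · by_cases h0 : E j = 0
      · left; right
        exact Finset.mem_product.2 ⟨hS02 j hj h0, Finset.mem_range.2 hk⟩
      · right
        simp only [U4, Finset.mem_biUnion, Finset.mem_filter, Finset.mem_image, Finset.mem_range]
        refine ⟨j, ⟨hj, h0⟩, p, ⟨?_, by omega, hM, hP⟩, k, hSY2 p hp hM hP j k hk hb, rfl⟩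
        rw [Nat.mem_primeFactors]
        refine ⟨hp, ?_, ?_⟩
        · exact Int.natCast_dvd.1 (hE p hp hM hP j k hb)
        · simp [ha, h0]
  · have hZ0 : (0 : ℝ) < Z := by exact_mod_cast (by omega : 0 < Z)
    have b1 : (U1.card : ℝ) ≤ J * L * (8 * d * e / (M + 1)) := by
      calc (U1.card : ℝ) ≤ ∑ p ∈ Q.filter (fun p : ℕ => ¬ (p : ℤ) ∣ a),
            ∑ j ∈ ST p, ((SY p j).card : ℝ) := by
            exact_mod_cast Finset.card_biUnion_le.trans (Finset.sum_le_sum fun p _ =>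
              Finset.card_biUnion_le.trans (Finset.sum_le_sum fun j _ => Finset.card_image_le))
        _ ≤ ∑ p ∈ Q.filter (fun p : ℕ => ¬ (p : ℤ) ∣ a), 4 * d * e * J * L * ((p : ℝ) ^ 2)⁻¹ := by
            refine Finset.sum_le_sum fun p hp => ?_
            obtain ⟨hpQ, hpa⟩ := Finset.mem_filter.1 hp
            obtain ⟨h1, h2, h3, h4⟩ := hQ p hpQ
            have hp0 : (0 : ℝ) < p := by exact_mod_cast h1.pos
            calc _ ≤ ∑ j ∈ ST p, (e * (2 * L / p) : ℝ) :=
                  Finset.sum_le_sum fun j _ => hSYr p hpQ j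
              _ = (ST p).card * (e * (2 * L / p) : ℝ) := by rw [Finset.sum_const, nsmul_eq_mul]
              _ ≤ (d * (2 * J / p)) * (e * (2 * L / p) : ℝ) := by
                  refine mul_le_mul_of_nonneg_right ?_ (by positivity)
                  calc ((ST p).card : ℝ) ≤ ((d * (J / p + 1) : ℕ) : ℝ) := by
                        exact_mod_cast hST1 p h1 h2 h4 hpa
                    _ = d * ((J / p + 1 : ℕ) : ℝ) := by rw [Nat.cast_mul]
                    _ ≤ _ := by gcongr; exact div_add_one_le h1.pos (h3.trans hJ)
              _ = _ := by field_simp; ring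
        _ ≤ ∑ p ∈ Finset.Ioc M Z, 4 * d * e * J * L * ((p : ℝ) ^ 2)⁻¹ := by
            refine Finset.sum_le_sum_of_subset_of_nonneg ?_ fun _ _ _ => by positivity
            exact (Finset.filter_subset _ _).trans (Finset.filter_subset _ _)
        _ = 4 * d * e * J * L * ∑ p ∈ Finset.Ioc M Z, ((p : ℝ) ^ 2)⁻¹ := by rw [Finset.mul_sum]
        _ ≤ 4 * d * e * J * L * (2 / (M + 1)) := by
            gcongr
            exact sum_inv_sq_Ioc_le M Z
        _ = _ := by ring
    have b2 : (U2.card : ℝ) ≤ J * L * (2 * e * δ) := by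
      calc (U2.card : ℝ) ≤ ∑ p ∈ Q.filter (fun p : ℕ => (p : ℤ) ∣ a),
            ∑ j ∈ Finset.range J, ((SY p j).card : ℝ) := by
            exact_mod_cast Finset.card_biUnion_le.trans (Finset.sum_le_sum fun p _ =>
              Finset.card_biUnion_le.trans (Finset.sum_le_sum fun j _ => Finset.card_image_le))
        _ ≤ ∑ p ∈ Q.filter (fun p : ℕ => (p : ℤ) ∣ a), J * (e * (2 * L / p) : ℝ) := by
            refine Finset.sum_le_sum fun p hp => ?_
            obtain ⟨hpQ, hpa⟩ := Finset.mem_filter.1 hp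
            calc _ ≤ ∑ j ∈ Finset.range J, (e * (2 * L / p) : ℝ) :=
                  Finset.sum_le_sum fun j _ => hSYr p hpQ j
              _ = _ := by rw [Finset.sum_const, nsmul_eq_mul, Finset.card_range]
        _ = ∑ p ∈ Q.filter (fun p : ℕ => (p : ℤ) ∣ a), J * L * (2 * e) * ((p : ℝ))⁻¹ :=
            Finset.sum_congr rfl fun p _ => by ring
        _ ≤ ∑ p ∈ a.natAbs.primeFactors.filter (M < ·), J * L * (2 * e) * ((p : ℝ))⁻¹ := by
            refine Finset.sum_le_sum_of_subset_of_nonneg ?_ fun _ _ _ => by positivity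
            intro p hp
            obtain ⟨hpQ, hpa⟩ := Finset.mem_filter.1 hp
            obtain ⟨h1, h2, h3, h4⟩ := hQ p hpQ
            rw [Finset.mem_filter, Nat.mem_primeFactors]
            exact ⟨⟨h1, Int.natCast_dvd.1 hpa, by simpa using ha⟩, h2⟩
        _ = J * L * (2 * e) * ∑ p ∈ a.natAbs.primeFactors.filter (M < ·), ((p : ℝ))⁻¹ := by
            rw [Finset.mul_sum]
        _ ≤ J * L * (2 * e) * δ := by gcongr
        _ = _ := by ring
    have b3 : (U3.card : ℝ) ≤ d * L := by
      rw [Finset.card_product, Finset.card_range, Nat.cast_mul]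
      gcongr
    have b4 : (U4.card : ℝ) ≤ 2 * r * e * J * (L / Z) := by
      calc (U4.card : ℝ) ≤ ∑ j ∈ (Finset.range J).filter (fun j => E j ≠ 0),
            ∑ p ∈ (a * E j).natAbs.primeFactors.filter (fun p => Z < p ∧ M < p ∧ P p),
              ((SY p j).card : ℝ) := by
            exact_mod_cast Finset.card_biUnion_le.trans (Finset.sum_le_sum fun p _ =>
              Finset.card_biUnion_le.trans (Finset.sum_le_sum fun j _ => Finset.card_image_le))
        _ ≤ ∑ j ∈ (Finset.range J).filter (fun j => E j ≠ 0), (r * (e * (2 * L / Z)) : ℝ) := by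
            refine Finset.sum_le_sum fun j hj => ?_
            obtain ⟨hj1, hj2⟩ := Finset.mem_filter.1 hj
            have hne : (a * E j).natAbs ≠ 0 := by simp [ha, hj2]
            calc _ ≤ ∑ p ∈ (a * E j).natAbs.primeFactors.filter (fun p => Z < p ∧ M < p ∧ P p),
                  (e * (2 * L / Z) : ℝ) := by
                  refine Finset.sum_le_sum fun p hp => ?_
                  obtain ⟨hp1, hp2, hp3, hp4⟩ := Finset.mem_filter.1 hp
                  have hpp := (Nat.mem_primeFactors.1 hp1).1
                  calc ((SY p j).card : ℝ) ≤ ((e * (L / p + 1) : ℕ) : ℝ) := by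
                        exact_mod_cast hSY1 p hpp hp3 hp4 j
                    _ ≤ ((e * (L / Z + 1) : ℕ) : ℝ) := by
                        have := Nat.div_le_div_left (a := L) hp2.le (by omega)
                        exact_mod_cast Nat.mul_le_mul_left e (by omega)
                    _ = e * ((L / Z + 1 : ℕ) : ℝ) := by rw [Nat.cast_mul]
                    _ ≤ _ := by gcongr; exact div_add_one_le (by omega) hL
              _ = ((a * E j).natAbs.primeFactors.filter (fun p => Z < p ∧ M < p ∧ P p)).card *
                  (e * (2 * L / Z) : ℝ) := by rw [Finset.sum_const, nsmul_eq_mul]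
              _ ≤ _ := by
                  refine mul_le_mul_of_nonneg_right ?_ (by positivity)
                  have h1 := card_large_primeFactors_le hne hZ (hEr j (Finset.mem_range.1 hj1))
                  have h2 : ((a * E j).natAbs.primeFactors.filter
                      (fun p => Z < p ∧ M < p ∧ P p)).card ≤ r :=
                    (Finset.card_le_card (Finset.monotone_filter_right _
                      fun p _ h => h.1)).trans h1
                  exact_mod_cast h2
        _ ≤ ∑ j ∈ Finset.range J, (r * (e * (2 * L / Z)) : ℝ) := by
            refine Finset.sum_le_sum_of_subset_of_nonneg (Finset.filter_subset _ _)
              fun _ _ _ => by positivity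
        _ = _ := by rw [Finset.sum_const, nsmul_eq_mul, Finset.card_range]; ring
    have hU : ((U1 ∪ U2 ∪ U3 ∪ U4).card : ℝ) ≤ U1.card + U2.card + U3.card + U4.card := by
      have h1 := Finset.card_union_le (U1 ∪ U2 ∪ U3) U4
      have h2 := Finset.card_union_le (U1 ∪ U2) U3
      have h3 := Finset.card_union_le U1 U2
      exact_mod_cast (by omega :
        (U1 ∪ U2 ∪ U3 ∪ U4).card ≤ U1.card + U2.card + U3.card + U4.card)
    linarith

/-! ### Polynomials with a given head -/

/-- `f` has bad roots modulo `p`, or `p` divides the leading coefficient and `f` has a double root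
modulo `p`. -/
def DegenerateAt (n p : ℕ) (f : ℤ[X]) : Prop :=
  ∃ _ : Fact p.Prime, HasBadRoots (redn f p) ∨ ((p : ℤ) ∣ f.coeff n ∧
    ∃ x, (redn f p).eval x = 0 ∧ (redn f p).derivative.eval x = 0)

/-- Replace the last two coefficients. -/
def withTail (n : ℕ) (a : ℕ → ℤ) (T Y : ℤ) : ℕ → ℤ :=
  Function.update (Function.update a (n - 1) T) n Y

theorem withTail_of_lt {n : ℕ} (a : ℕ → ℤ) (T Y : ℤ) {i : ℕ} (h : i + 1 < n) :
    withTail n a T Y i = a i := by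
  rw [withTail, Function.update_of_ne (by omega), Function.update_of_ne (by omega)]

theorem withTail_last {n : ℕ} (a : ℕ → ℤ) (T Y : ℤ) : withTail n a T Y n = Y := by
  rw [withTail, Function.update_self]

theorem withTail_pred {n : ℕ} (hn : 1 ≤ n) (a : ℕ → ℤ) (T Y : ℤ) :
    withTail n a T Y (n - 1) = T := by
  rw [withTail, Function.update_of_ne (by omega), Function.update_self]

/-- The two-variable sieve is applied along progressions with steps A and B. Primes p > M prime to m
divide neither step, so residue classes mod p are hit evenly. The classes of a_n come from critical
values, those of a_{n-1} from `critInt`. -/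
theorem exists_good_tails (n : ℕ) (hn : 3 ≤ n) : ∃ M₁ : ℕ, ∃ δ > (0 : ℝ), ∃ D K : ℕ,
    ∀ M, M₁ ≤ M → ∀ (r : ℕ), ∃ Z₀ : ℕ, ∀ (J L Z : ℕ), Z₀ ≤ Z → Z ≤ J → Z ≤ L →
    ∀ (m : ℕ) (a : ℕ → ℤ) (u A B H : ℤ) (v : ℕ → ℤ), a 0 ≠ 0 → IsCoprime (a 0) (a 1) → 1 ≤ H →
      A ≠ 0 →
      (∀ i, i + 1 < n → |a i| ≤ H) → (∀ j < J, |u + A * j| ≤ H) → K * H ^ D < (Z : ℤ) ^ r →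
      (∀ p : ℕ, p.Prime → M < p → ¬ p ∣ m → ¬ (p : ℤ) ∣ A ∧ ¬ (p : ℤ) ∣ B) →
      (∑ p ∈ (a 0).natAbs.primeFactors.filter (M < ·), ((p : ℝ))⁻¹ ≤ δ) →
      ∃ G : Finset (ℕ × ℕ), G ⊆ Finset.range J ×ˢ Finset.range L ∧ (J * L / 2 : ℝ) ≤ G.card ∧
        ∀ x ∈ G, ∀ p : ℕ, p.Prime → M < p → ¬ p ∣ m →
          ¬ DegenerateAt n p (polyOf n (withTail n a (u + A * x.1) (v x.1 + B * x.2))) := by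
  classical
  set d := (critUniv n).totalDegree with hd
  set e := n - 1 with he
  obtain ⟨K, D, hK, hKD⟩ := exists_critInt_bound n (by omega)
  have he0 : (0 : ℝ) < e := by exact_mod_cast (by omega : 0 < e)
  -- These constants make each of the four error terms of the sieve at most JL/8, so half of the
  -- pairs survive. The summand n also guarantees p > n.
  refine ⟨64 * d * e + n, (16 * e : ℝ)⁻¹, by positivity, D, K, fun M hM r => ?_⟩
  refine ⟨8 * d + 16 * r * e + 2, ?_⟩
  intro J L Z hZ hJ hL m a u A B H v ha0 hcop hH hA haH huH hKH hAB hδ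
  let f : ℕ → ℕ → ℤ[X] := fun j k => polyOf n (withTail n a (u + A * j) (v j + B * k))
  have hcoef : ∀ j k, (f j k).coeff n = a 0 := by
    intro j k
    have := polyOf_coeff n (withTail n a (u + A * j) (v j + B * k)) (Nat.zero_le n)
    rw [Nat.sub_zero, withTail_of_lt _ _ _ (by omega)] at this
    exact this
  have hcop' : ∀ p : ℕ, p.Prime → ¬ ((p : ℤ) ∣ a 0 ∧ (p : ℤ) ∣ a 1) := by
    rintro p hp ⟨h0, h1⟩
    have := hcop.isUnit_of_dvd' h0 h1
    exact (Nat.prime_iff_prime_int.1 hp).not_isUnit this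
  refine Exists.elim (card_sieved_le J L Z M d e r (by omega) hJ hL (fun p => ¬ p ∣ m)
    (fun p j k => DegenerateAt n p (f j k)) (a 0) ha0 (fun j => critInt n a (u + A * j))
    (16 * e : ℝ)⁻¹ ?_ ?_ ?_ ?_ ?_ hδ) ?_
  · intro p hp hMp hpm j
    have : Fact p.Prime := ⟨hp⟩
    obtain ⟨S, hS1, hS2⟩ := exists_finset_of_double_root p hn (by omega)
      (Function.update a (n - 1) (u + A * j)) (by
        by_cases h1n : 1 = n - 1
        · omega
        · rw [Function.update_of_ne (by omega), Function.update_of_ne h1n]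
          exact hcop' p hp)
    refine ⟨(Finset.range L).filter fun k : ℕ => ((v j + B * k : ℤ) : ZMod p) ∈ S, ?_, ?_⟩
    · exact (card_filter_progression_le L (v j) B (hAB p hp hMp hpm).2 S).trans
        (Nat.mul_le_mul_right _ hS1)
    · rintro k hk ⟨_, h⟩
      refine Finset.mem_filter.2 ⟨Finset.mem_range.2 hk, hS2 _ ?_⟩
      rcases h with ⟨x, h0, h1, -⟩ | ⟨-, x, h0, h1⟩
      · exact ⟨x, h0, h1⟩
      · exact ⟨x, h0, h1⟩
  · intro p hp hMp hpm hpa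
    have : Fact p.Prime := ⟨hp⟩
    obtain ⟨S, hS1, hS2⟩ := exists_finset_of_dvd_critInt p hn (by omega) a hpa
    refine ⟨(Finset.range J).filter fun j : ℕ => ((u + A * j : ℤ) : ZMod p) ∈ S, ?_, ?_⟩
    · exact (card_filter_progression_le J u A (hAB p hp hMp hpm).1 S).trans
        (Nat.mul_le_mul_right _ hS1)
    · rintro j hj k hk ⟨_, h⟩
      refine Finset.mem_filter.2 ⟨Finset.mem_range.2 hj, hS2 _ ?_⟩
      rcases h with h | ⟨h, -⟩
      · exact dvd_critInt_of_hasBadRoots p hn (by omega) a hpa _ _ h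
      · rw [hcoef] at h
        exact absurd h hpa
  · rintro p hp hMp hpm j k ⟨_, h⟩
    have : Fact p.Prime := ⟨hp⟩
    by_cases hpa : (p : ℤ) ∣ a 0
    · exact hpa.mul_right _
    · rcases h with h | ⟨h, -⟩
      · exact (dvd_critInt_of_hasBadRoots p hn (by omega) a hpa _ _ h).mul_left _
      · rw [hcoef] at h
        exact absurd h hpa
  · refine ⟨(Finset.range J).filter fun j => critInt n a (u + A * j) = 0, ?_, ?_⟩
    · have hinj : Function.Injective fun j : ℕ => u + A * (j : ℤ) := by
        intro x y hxy
        have := mul_left_cancel₀ hA (add_left_cancel hxy)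
        exact_mod_cast this
      rw [← Finset.card_image_of_injective _ hinj]
      refine card_critInt_eq_zero_le hn a ha0 _ ?_
      intro T hT
      obtain ⟨j, hj, rfl⟩ := Finset.mem_image.1 hT
      exact (Finset.mem_filter.1 hj).2
    · intro j hj h
      exact Finset.mem_filter.2 ⟨Finset.mem_range.2 hj, h⟩
  · intro j hj
    have h1 := (hKD a (u + A * j) H hH haH (huH j hj)).trans_lt hKH
    zify
    exact h1
  · rintro U ⟨hU1, hU2⟩
    refine ⟨(Finset.range J ×ˢ Finset.range L) \ U, Finset.sdiff_subset, ?_, ?_⟩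
    · have h1 := Finset.le_card_sdiff U (Finset.range J ×ˢ Finset.range L)
      rw [Finset.card_product, Finset.card_range, Finset.card_range] at h1
      have h2 : ((J * L : ℕ) : ℝ) ≤ (((Finset.range J ×ˢ Finset.range L) \ U).card : ℝ) + U.card := by
        exact_mod_cast (by omega)
      have hMr : (64 * d * e : ℝ) ≤ M + 1 := by
        exact_mod_cast (by omega : 64 * d * e ≤ M + 1)
      have h3 : (8 * d * e / (M + 1) : ℝ) ≤ 1 / 8 := by
        rw [div_le_div_iff₀ (by positivity) (by norm_num)]
        linarith
      have h4 : (2 * e * (16 * e : ℝ)⁻¹) = 1 / 8 := by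
        field_simp
        norm_num
      have hZ0 : (0 : ℝ) < Z := by exact_mod_cast (by omega : 0 < Z)
      have h5 : (d * L : ℝ) ≤ J * L / 8 := by
        have : (8 * d : ℝ) ≤ J := by exact_mod_cast (by omega : 8 * d ≤ J)
        have : (8 * d * L : ℝ) ≤ J * L := by gcongr
        linarith
      have h6 : (2 * r * e * J * (L / Z) : ℝ) ≤ J * L / 8 := by
        have : (16 * r * e : ℝ) ≤ Z := by exact_mod_cast (by omega : 16 * r * e ≤ Z)
        rw [← mul_div_assoc, div_le_div_iff₀ hZ0 (by norm_num)]
        have : (16 * r * e * (J * L) : ℝ) ≤ Z * (J * L) := by gcongr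
        linarith
      have h7 : (J * L * (8 * d * e / (M + 1) + 2 * e * (16 * e : ℝ)⁻¹) : ℝ) ≤ J * L * (1 / 4) := by
        rw [h4]
        gcongr
        linarith
      push_cast at h2
      linarith
    · intro x hx p hp hM hpm hdeg
      obtain ⟨h1, h2⟩ := Finset.mem_sdiff.1 hx
      obtain ⟨h3, h4⟩ := Finset.mem_product.1 h1
      exact h2 (hU1 x.1 (Finset.mem_range.1 h3) x.2 (Finset.mem_range.1 h4) p hp hM hpm hdeg)

end UltraWeak

end

noncomputable section
namespace UltraWeak
open Polynomial

/-! ### Synthetic division -/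

theorem polyOf_succ {A : Type*} [CommRing A] (n : ℕ) (a : ℕ → A) :
    polyOf (n + 1) a = X * polyOf n a + C (a (n + 1)) := by
  rw [polyOf, Finset.sum_range_succ, polyOf, Finset.mul_sum, Nat.sub_self, pow_zero, mul_one]
  congr 1
  refine Finset.sum_congr rfl fun i hi => ?_
  have := Finset.mem_range.1 hi
  rw [show n + 1 - i = (n - i) + 1 by omega, pow_succ]
  ring

theorem polyOf_eq_horner (n : ℕ) (a : ℕ → ℤ) (l : ℤ) :
    polyOf (n + 1) a = (X - C l) * polyOf n (horner a l) + C (horner a l (n + 1)) := by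
  induction n with
  | zero =>
    simp [polyOf, horner, Finset.sum_range_succ]
    ring
  | succ n ih =>
    rw [polyOf_succ (n + 1) a, ih, polyOf_succ n (horner a l)]
    have : horner a l (n + 1 + 1) = l * horner a l (n + 1) + a (n + 1 + 1) := by
      simp [horner]
    rw [this, C_add, C_mul]
    ring

theorem horner_congr {a b : ℕ → ℤ} {l : ℤ} {k : ℕ} (h : ∀ i ≤ k, a i = b i) :
    horner a l k = horner b l k := by
  rw [horner_eq_sum, horner_eq_sum]
  refine Finset.sum_congr rfl fun i hi => ?_
  rw [h i (by have := Finset.mem_range.1 hi; omega)]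

/-- The coefficients of the quotient of `polyOf n a` by `(X - l) ^ 2`. -/
def dblHorner (a : ℕ → ℤ) (l : ℤ) : ℕ → ℤ := horner (horner a l) l

theorem dblHorner_congr {a b : ℕ → ℤ} {l : ℤ} {k : ℕ} (h : ∀ i ≤ k, a i = b i) :
    dblHorner a l k = dblHorner b l k :=
  horner_congr fun _ hi => horner_congr fun j hj => h j (hj.trans hi)

theorem dblHorner_succ (a : ℕ → ℤ) (l : ℤ) (k : ℕ) :
    dblHorner a l (k + 1) = l * dblHorner a l k + (l * horner a l k + a (k + 1)) := by
  simp [dblHorner, horner]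

theorem eval_polyOf_eq_horner (n : ℕ) (a : ℕ → ℤ) (l : ℤ) :
    (polyOf (n + 1) a).eval l = horner a l (n + 1) := by
  rw [polyOf_eq_horner n a l]; simp

theorem eval_derivative_polyOf (n : ℕ) (a : ℕ → ℤ) (l : ℤ) :
    (polyOf (n + 2) a).derivative.eval l = dblHorner a l (n + 1) := by
  rw [polyOf_eq_horner (n + 1) a l]
  simp [derivative_mul, eval_polyOf_eq_horner, dblHorner]

/-- Dividing twice by X - l leaves the remainder f'(l)(X - l) + f(l), so weak divisibility makes the
reduction (X - l)² times an explicit cofactor. The head alone determines this cofactor. -/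
theorem polyOf_eq_dblHorner (n : ℕ) (a : ℕ → ℤ) (l : ℤ) :
    polyOf (n + 2) a = (X - C l) ^ 2 * polyOf n (dblHorner a l) +
      C (dblHorner a l (n + 1)) * (X - C l) + C (horner a l (n + 2)) := by
  rw [polyOf_eq_horner (n + 1) a l, polyOf_eq_horner n (horner a l) l]
  simp only [dblHorner]
  ring

section

variable (p : ℕ) [Fact p.Prime]

theorem redn_eq_sq_mul {n : ℕ} {a : ℕ → ℤ} {l : ℤ} (h0 : (p : ℤ) ∣ (polyOf (n + 2) a).eval l)
    (h1 : (p : ℤ) ∣ (polyOf (n + 2) a).derivative.eval l) :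
    redn (polyOf (n + 2) a) p = (X - C (l : AlgebraicClosure (ZMod p))) ^ 2 *
      redn (polyOf n (dblHorner a l)) p := by
  rw [eval_polyOf_eq_horner (n + 1), ← intCast_closure_eq_zero_iff p] at h0
  rw [eval_derivative_polyOf, ← intCast_closure_eq_zero_iff p] at h1
  have h0' : ((horner a l (n + 2) : ℤ) : AlgebraicClosure (ZMod p)) = 0 := h0
  rw [polyOf_eq_dblHorner n a l]
  simp only [redn, Polynomial.map_add, Polynomial.map_mul, Polynomial.map_pow, Polynomial.map_sub,
    map_X, map_C]
  rw [show (Int.castRingHom (AlgebraicClosure (ZMod p))) (horner a l (n + 2)) = 0 from h0',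
    show (Int.castRingHom (AlgebraicClosure (ZMod p))) (dblHorner a l (n + 1)) = 0 from h1,
    C_0, zero_mul, add_zero, add_zero]
  rfl

/-- A form that is a square of a linear factor times a separable cofactor is nonsingular. -/
theorem nonsingularMod_of_redn_eq {f : ℤ[X]} {l : AlgebraicClosure (ZMod p)}
    {G : (AlgebraicClosure (ZMod p))[X]}
    (hc : ¬ ((p : ℤ) ∣ f.coeff f.natDegree ∧ (p : ℤ) ∣ f.coeff (f.natDegree - 1)))
    (h : redn f p = (X - C l) ^ 2 * G) (hl : G.eval l ≠ 0)
    (hG : ∀ x, G.eval x = 0 → G.derivative.eval x ≠ 0) : NonsingularMod f p := by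
  classical
  have hG0 : G ≠ 0 := by rintro rfl; simp at hl
  apply nonsingularMod_of_card_le p _ hc
  have hX : (X - C l) ^ 2 ≠ 0 := pow_ne_zero _ (X_sub_C_ne_zero l)
  have hr : (redn f p).roots = l ::ₘ l ::ₘ G.roots := by
    rw [h, roots_mul (mul_ne_zero hX hG0), roots_pow, roots_X_sub_C, two_nsmul]
    rw [add_assoc, Multiset.singleton_add, Multiset.singleton_add]
  have hnd : G.roots.Nodup := by
    rw [Multiset.nodup_iff_count_le_one]
    intro x
    by_contra! hx
    rw [count_roots] at hx
    obtain ⟨h1, h2⟩ := (two_le_rootMultiplicity_iff hG0 x).1 hx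
    exact hG x h1 h2
  have hlG : l ∉ G.roots := fun hm => hl (mem_roots'.1 hm).2
  have h2 : G.roots.card = G.roots.toFinset.card := by
    rw [Multiset.toFinset_card_of_nodup hnd]
  have h3 : (insert l G.roots.toFinset).card = G.roots.toFinset.card + 1 :=
    Finset.card_insert_of_notMem (by simpa using hlG)
  have h4 : (redn f p).roots.toFinset = insert l G.roots.toFinset := by
    rw [hr]; ext x; simp
  rw [h4, h3, hr, Multiset.card_cons, Multiset.card_cons]
  omega

theorem not_hasBadRoots_of_separable {k : Type*} [Field k] {F : k[X]}
    (h : ∀ x, F.eval x = 0 → F.derivative.eval x ≠ 0) : ¬ HasBadRoots F :=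
  fun ⟨x, h0, h1, _⟩ => h x h0 h1

/-- Irreducible polynomials of every degree. -/
theorem exists_monic_irreducible {d : ℕ} (hd : d ≠ 0) :
    ∃ g : (ZMod p)[X], g.Monic ∧ Irreducible g ∧ g.natDegree = d := by
  obtain ⟨x, hx⟩ := Field.exists_primitive_element (ZMod p) (GaloisField p d)
  have hi : IsIntegral (ZMod p) x := Algebra.IsIntegral.isIntegral x
  refine ⟨minpoly (ZMod p) x, minpoly.monic hi, minpoly.irreducible hi, ?_⟩
  rw [(Field.primitive_element_iff_minpoly_natDegree_eq (ZMod p) x).1 hx, GaloisField.finrank p hd]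

/-- Take an irreducible polynomial of degree d ≥ 2 over 𝔽_p: it is separable because 𝔽_p is perfect,
and it has no root in 𝔽_p. -/
theorem exists_separable_coeffs {d : ℕ} (hd : 2 ≤ d) : ∃ b : ℕ → ℤ, b 0 = 1 ∧
    (∀ x, (redn (polyOf d b) p).eval x = 0 → (redn (polyOf d b) p).derivative.eval x ≠ 0) ∧
    ∀ l : ℤ, (redn (polyOf d b) p).eval (l : AlgebraicClosure (ZMod p)) ≠ 0 := by
  obtain ⟨g, hg, hgi, hgd⟩ := exists_monic_irreducible p (by omega : d ≠ 0)
  choose z hz using ZMod.intCast_surjective (n := p)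
  let b : ℕ → ℤ := fun i => if i = 0 then 1 else z (g.coeff (d - i))
  have hb : (polyOf d b).map (Int.castRingHom (ZMod p)) = g := by
    rw [map_polyOf, eq_polyOf d g hgd.le]
    apply polyOf_congr
    intro i hi
    simp only [b]
    split_ifs with h0
    · have := hg.coeff_natDegree
      rw [hgd] at this
      simp [h0, this]
    · simp [hz]
  refine ⟨b, by simp [b], ?_, ?_⟩
  · intro x h0 h1
    rw [redn_eq, hb] at h0 h1
    have hs : (g.map (algebraMap (ZMod p) (AlgebraicClosure (ZMod p)))).Separable :=
      (PerfectField.separable_of_irreducible hgi).map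
    obtain ⟨u, v, huv⟩ := hs
    have := congrArg (eval x) huv
    simp only [eval_add, eval_mul, h0, h1, mul_zero, add_zero, eval_one] at this
    exact zero_ne_one this
  · intro l h0
    rw [redn_eq, hb] at h0
    have h1 : g.IsRoot (l : ZMod p) := by
      apply (algebraMap (ZMod p) (AlgebraicClosure (ZMod p))).injective
      rw [← eval_map_apply, map_intCast, h0, map_zero]
    have h2 := degree_eq_one_of_irreducible_of_root hgi h1
    rw [degree_eq_natDegree hg.ne_zero, hgd] at h2
    have : d = 1 := by exact_mod_cast h2
    omega

/-- The prescribed reductions at small primes. -/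
theorem exists_target (n : ℕ) (hn : 4 ≤ n) (m : ℕ) (l : ℤ) : ∃ b : ℕ → ℤ, b 0 = 1 ∧
    (¬ p ∣ m → ∀ x, (redn (polyOf n b) p).eval x = 0 →
      (redn (polyOf n b) p).derivative.eval x ≠ 0) ∧
    (p ∣ m → ∃ G : (AlgebraicClosure (ZMod p))[X],
      redn (polyOf n b) p = (X - C (l : AlgebraicClosure (ZMod p))) ^ 2 * G ∧ G.eval (l : AlgebraicClosure (ZMod p)) ≠ 0 ∧
      ∀ x, G.eval x = 0 → G.derivative.eval x ≠ 0) := by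
  by_cases hpm : p ∣ m
  -- At a prime dividing m a double root at l is unavoidable, so the target is (X - l)² times an
  -- irreducible cofactor of degree n - 2.
  · obtain ⟨b, hb0, hb1, hb2⟩ := exists_separable_coeffs p (by omega : 2 ≤ n - 2)
    set f : ℤ[X] := (X - C l) ^ 2 * polyOf (n - 2) b with hf
    have hbd : (polyOf (n - 2) b).natDegree = n - 2 := polyOf_natDegree _ _ (by simp [hb0])
    have hbm : (polyOf (n - 2) b).Monic := by
      rw [Monic, leadingCoeff, hbd]
      have := polyOf_coeff (n - 2) b (Nat.zero_le _)
      rwa [Nat.sub_zero, hb0] at this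
    have hfm : f.Monic := ((monic_X_sub_C l).pow 2).mul hbm
    have hfd : f.natDegree = n := by
      rw [hf, ((monic_X_sub_C l).pow 2).natDegree_mul hbm, natDegree_pow, natDegree_X_sub_C, hbd]
      omega
    refine ⟨fun i => f.coeff (n - i), ?_, fun h => absurd hpm h, fun _ => ?_⟩
    · have := hfm.coeff_natDegree
      rwa [hfd] at this
    · rw [← eq_polyOf n f hfd.le]
      refine ⟨redn (polyOf (n - 2) b) p, ?_, hb2 l, hb1⟩
      simp [hf, redn]
  · obtain ⟨b, hb0, hb1, -⟩ := exists_separable_coeffs p (by omega : 2 ≤ n)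
    exact ⟨b, hb0, fun _ => hb1, fun h => absurd h hpm⟩

theorem redn_polyOf_eq_of_forall {n : ℕ} {a b : ℕ → ℤ} (h : ∀ i ≤ n, (p : ℤ) ∣ a i - b i) :
    redn (polyOf n a) p = redn (polyOf n b) p := by
  rw [redn_polyOf, redn_polyOf]
  refine polyOf_congr fun i hi => ?_
  rw [← sub_eq_zero, ← Int.cast_sub, intCast_closure_eq_zero_iff]
  exact h i hi

/-- Two polynomials with the same leading coefficients and a common double root agree. -/
theorem redn_polyOf_eq_of_double {n : ℕ} (hn : 2 ≤ n) {a b : ℕ → ℤ} {l : AlgebraicClosure (ZMod p)}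
    (h : ∀ i, i + 1 < n → (p : ℤ) ∣ a i - b i)
    (ha0 : (redn (polyOf n a) p).eval l = 0) (ha1 : (redn (polyOf n a) p).derivative.eval l = 0)
    (hb0 : (redn (polyOf n b) p).eval l = 0) (hb1 : (redn (polyOf n b) p).derivative.eval l = 0) :
    redn (polyOf n a) p = redn (polyOf n b) p := by
  obtain ⟨N, rfl⟩ : ∃ N, n = N + 2 := ⟨n - 2, by omega⟩
  rw [← sub_eq_zero]
  have hD : redn (polyOf (N + 2) a) p - redn (polyOf (N + 2) b) p =
      C ((a (N + 1) : AlgebraicClosure (ZMod p)) - b (N + 1)) * X + C (a (N + 2) - b (N + 2) : AlgebraicClosure (ZMod p)) := by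
    rw [redn_polyOf, redn_polyOf, polyOf_succ, polyOf_succ, polyOf_succ, polyOf_succ]
    have : polyOf N (fun i => (a i : AlgebraicClosure (ZMod p))) = polyOf N (fun i => (b i : AlgebraicClosure (ZMod p))) := by
      rw [← redn_polyOf, ← redn_polyOf]
      exact redn_polyOf_eq_of_forall p fun i hi => h i (by omega)
    rw [this, C_sub, C_sub]
    ring
  have e0 := congrArg (eval l) hD
  have e1 := congrArg (fun g => g.derivative.eval l) hD
  simp only [eval_sub, derivative_sub, ha0, ha1, hb0, hb1, eval_add, eval_mul, eval_C, eval_X,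
    derivative_add, derivative_C_mul, derivative_X, derivative_C, mul_one, add_zero, sub_zero] at e0 e1
  rw [← e1, zero_mul, zero_add] at e0
  rw [hD, ← e1, ← e0, C_0, zero_mul, add_zero]

/-- The excluded classes for the coefficient `a_{n-2}`. -/
theorem exists_excluded {n : ℕ} (hn : 3 ≤ n) (hpn : n + 2 < p) (a : ℕ → ℤ) (l : ℤ)
    (ha : ¬ ((p : ℤ) ∣ a 0 ∧ (p : ℤ) ∣ a 1)) : ∃ S : Finset (ZMod p), S.card ≤ n ∧
      ∀ x T Y : ℤ, (x : ZMod p) ∉ S →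
        (polyOf (n + 2) (withTail (n + 2) (Function.update a n x) T Y)).natDegree = n + 2 →
        (p : ℤ) ∣ (polyOf (n + 2) (withTail (n + 2) (Function.update a n x) T Y)).eval l →
        (p : ℤ) ∣ (polyOf (n + 2) (withTail (n + 2) (Function.update a n x) T Y)).derivative.eval l →
        NonsingularMod (polyOf (n + 2) (withTail (n + 2) (Function.update a n x) T Y)) p := by
  classical
  set g : ℕ → ℤ := dblHorner a l with hg
  have hg0 : g 0 = a 0 := by simp [hg, dblHorner, horner]
  have hg1 : g 1 = l * a 0 + (l * a 0 + a 1) := by simp [hg, dblHorner, horner]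
  -- The cofactor has degree n here and its constant term is x plus a quantity fixed by the earlier
  -- coefficients. At most n - 1 values of it give a double root.
  obtain ⟨S, hS1, hS2⟩ := exists_finset_of_double_root p hn (by omega) g (by
    rw [hg0, hg1]
    rintro ⟨h0, h1⟩
    refine ha ⟨h0, ?_⟩
    have : a 1 = l * a 0 + (l * a 0 + a 1) - 2 * l * a 0 := by ring
    rw [this]
    exact dvd_sub h1 (h0.mul_left _))
  obtain ⟨N, rfl⟩ : ∃ N, n = N + 1 := ⟨n - 1, by omega⟩
  set w : ℤ := l * dblHorner a l N + l * horner a l N with hw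
  -- The one further excluded value, for which the cofactor vanishes at l.
  set e : ZMod p := - ((polyOf (N + 1) (Function.update g (N + 1) 0)).eval l : ℤ) with he
  refine ⟨(insert e S).image fun z => z - (w : ZMod p), ?_, ?_⟩
  · refine Finset.card_image_le.trans ((Finset.card_insert_le _ _).trans ?_)
    omega
  intro x T Y hx hdeg h0 h1
  set b : ℕ → ℤ := withTail (N + 1 + 2) (Function.update a (N + 1) x) T Y with hb
  have hbi : ∀ i, i < N + 1 → b i = a i := by
    intro i hi
    rw [hb, withTail_of_lt _ _ _ (by omega), Function.update_of_ne (by omega)]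
  have hbN : b (N + 1) = x := by
    rw [hb, withTail_of_lt _ _ _ (by omega), Function.update_self]
  have hgb : polyOf (N + 1) (dblHorner b l) = polyOf (N + 1) (Function.update g (N + 1) (w + x)) := by
    refine polyOf_congr fun i hi => ?_
    rcases Nat.lt_or_ge i (N + 1) with h | h
    · rw [Function.update_of_ne (by omega)]
      exact dblHorner_congr fun j hj => hbi j (by omega)
    · obtain rfl : i = N + 1 := by omega
      rw [Function.update_self, dblHorner_succ, hbN, hw,
        dblHorner_congr (b := a) fun j hj => hbi j (by omega),
        horner_congr (b := a) fun j hj => hbi j (by omega)]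
      ring
  have hnot : ((w + x : ℤ) : ZMod p) ∉ insert e S := by
    intro hmem
    apply hx
    exact Finset.mem_image.2 ⟨_, hmem, by push_cast; ring⟩
  have hcb : ¬ ((p : ℤ) ∣ (polyOf (N + 1 + 2) b).coeff (polyOf (N + 1 + 2) b).natDegree ∧
      (p : ℤ) ∣ (polyOf (N + 1 + 2) b).coeff ((polyOf (N + 1 + 2) b).natDegree - 1)) := by
    rw [hdeg]
    have c0 := polyOf_coeff (N + 1 + 2) b (Nat.zero_le _)
    have c1 := polyOf_coeff (N + 1 + 2) b (i := 1) (by omega)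
    rw [Nat.sub_zero] at c0
    rw [c0, c1, hbi 0 (by omega), hbi 1 (by omega)]
    exact ha
  refine nonsingularMod_of_redn_eq p hcb (redn_eq_sq_mul p h0 h1) ?_ ?_
  · rw [hgb]
    intro h
    apply hnot
    apply Finset.mem_insert.2
    left
    rw [polyOf_update_last] at h
    rw [redn, ← eq_intCast (Int.castRingHom (AlgebraicClosure (ZMod p))) l, eval_map_apply, eq_intCast,
      intCast_closure_eq_zero_iff, ← ZMod.intCast_zmod_eq_zero_iff_dvd, eval_add, eval_C] at h
    rw [he]
    push_cast at h ⊢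
    linear_combination h
  · rw [hgb]
    intro y hy0 hy1
    exact hnot (Finset.mem_insert_of_mem (hS2 _ ⟨y, hy0, hy1⟩))

end
end UltraWeak

end

noncomputable section
namespace UltraWeak
open Polynomial

/-! ### Local conditions imply ultra-weak divisibility -/

theorem WeaklyDivisibleAt.of_dvd {f : ℤ[X]} {m d : ℕ} {l : ℤ} (h : WeaklyDivisibleAt f m l)
    (hd : d ∣ m) : WeaklyDivisibleAt f d l := by
  have hd' : (d : ℤ) ∣ m := Int.natCast_dvd_natCast.2 hd
  exact ⟨(pow_dvd_pow_of_dvd hd' 2).trans h.1, hd'.trans h.2⟩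

theorem not_dvd_both_of_isCoprime {p : ℕ} (hp : p.Prime) {a b : ℤ} (h : IsCoprime a b) :
    ¬ ((p : ℤ) ∣ a ∧ (p : ℤ) ∣ b) := fun ⟨h0, h1⟩ =>
  (Nat.prime_iff_prime_int.1 hp).not_isUnit (h.isUnit_of_dvd' h0 h1)

/-- Three ranges of primes: at p | m the given l works; at small p the discriminant is a unit; at
large p non-degeneracy gives either a unit discriminant or weak divisibility. The condition deg f ≤
M ensures that large primes do not divide the degree. -/
theorem ultraWeaklyDivisible_of_forall {f : ℤ[X]} {m M : ℕ} {l : ℤ} (hn : 2 ≤ f.natDegree)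
    (hM : f.natDegree ≤ M) (hw : WeaklyDivisibleAt f m l)
    (hcop : IsCoprime (f.coeff f.natDegree) (f.coeff (f.natDegree - 1)))
    (hs : ∀ (p : ℕ) [Fact p.Prime], p ≤ M → ¬ p ∣ m → ¬ (p : ℤ) ∣ f.coeff f.natDegree ∧
      ∀ x, (redn f p).eval x = 0 → (redn f p).derivative.eval x ≠ 0)
    (hl : ∀ p : ℕ, p.Prime → M < p → ¬ p ∣ m → ¬ DegenerateAt f.natDegree p f) :
    UltraWeaklyDivisible f := by
  intro p hp hpd
  have : Fact p.Prime := ⟨hp⟩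
  by_cases hpm : p ∣ m
  · exact ⟨l, hw.of_dvd hpm⟩
  have hpd' : (p : ℤ) ∣ f.discr := (Dvd.intro_left _ (by rw [pow_two])).trans hpd
  rcases Nat.lt_or_ge M p with hMp | hMp
  · have hdeg := hl p hp hMp hpm
    by_cases h0 : (p : ℤ) ∣ f.coeff f.natDegree
    · refine absurd hpd' (not_dvd_discr_of_dvd_leadingCoeff p hn h0
        (fun h1 => not_dvd_both_of_isCoprime hp hcop ⟨h0, h1⟩) fun x hx0 hx1 => ?_)
      exact hdeg ⟨this, Or.inr ⟨h0, x, hx0, hx1⟩⟩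
    · exact weaklyDivisible_of_sq_dvd_discr p hn
        (not_dvd_of_lt (by omega) (by omega)) h0 (fun hb => hdeg ⟨this, Or.inl hb⟩) hpd
  · exact absurd hpd' (not_dvd_discr_of_separable p hn (hs p hMp hpm).1 (hs p hMp hpm).2)

theorem nonsingularMod_of_forall {f : ℤ[X]} {m M : ℕ}
    (hcop : IsCoprime (f.coeff f.natDegree) (f.coeff (f.natDegree - 1)))
    (hs : ∀ (p : ℕ) [Fact p.Prime], p ≤ M → ¬ p ∣ m → ¬ (p : ℤ) ∣ f.coeff f.natDegree ∧
      ∀ x, (redn f p).eval x = 0 → (redn f p).derivative.eval x ≠ 0)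
    (hl : ∀ p : ℕ, p.Prime → M < p → ¬ p ∣ m → ¬ DegenerateAt f.natDegree p f)
    (p : ℕ) [hp : Fact p.Prime] (hpm : ¬ p ∣ m) : NonsingularMod f p := by
  refine nonsingularMod_of_not_hasBadRoots p ?_ (not_dvd_both_of_isCoprime hp.out hcop)
  rcases Nat.lt_or_ge M p with hMp | hMp
  · exact fun hb => hl p hp.out hMp hpm ⟨hp, Or.inl hb⟩
  · exact not_hasBadRoots_of_separable (hs p hMp hpm).2

/-! ### Residue classes -/

/-- Elements x + Qj with 0 ≤ x < Q are distinct for distinct pairs (x, j). -/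
theorem exists_card_progressions {X : Finset ℤ} {Q : ℕ} (hX : ∀ x ∈ X, 0 ≤ x ∧ x < Q)
    (F : ℤ → Finset ℕ) (N : ℕ) (hN : ∀ x ∈ X, N ≤ (F x).card) :
    ∃ Y : Finset ℤ, N * X.card ≤ Y.card ∧ ∀ y ∈ Y, ∃ x ∈ X, ∃ j ∈ F x, y = x + Q * j := by
  classical
  refine ⟨(X.sigma F).image fun z => z.1 + Q * (z.2 : ℤ), ?_, ?_⟩
  · rw [Finset.card_image_of_injOn, Finset.card_sigma, mul_comm, ← smul_eq_mul]
    · exact Finset.card_nsmul_le_sum _ _ _ hN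
    · rintro ⟨x, j⟩ hx ⟨y, k⟩ hy hxy
      have hx' := hX x (Finset.mem_sigma.1 (Finset.mem_coe.1 hx)).1
      have hy' := hX y (Finset.mem_sigma.1 (Finset.mem_coe.1 hy)).1
      simp only at hxy
      have h1 : x = y := by
        have := congrArg (· % (Q : ℤ)) hxy
        simpa [Int.add_mul_emod_self_left, Int.emod_eq_of_lt hx'.1 hx'.2,
          Int.emod_eq_of_lt hy'.1 hy'.2] using this
      subst h1
      have hQ : (Q : ℤ) ≠ 0 := by omega
      have h2 : j = k := by
        have := mul_left_cancel₀ hQ (add_left_cancel hxy)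
        exact_mod_cast this
      rw [h2]
  · intro y hy
    obtain ⟨z, hz, rfl⟩ := Finset.mem_image.1 hy
    obtain ⟨h1, h2⟩ := Finset.mem_sigma.1 hz
    exact ⟨z.1, h1, z.2, h2, rfl⟩

/-- The Chinese remainder theorem with excluded classes. -/
theorem exists_crt_set {Q : ℕ} (hQ : 0 < Q) (c : ℤ) (E : ∀ p : ℕ, Finset (ZMod p)) (𝒬 : Finset ℕ)
    (h𝒬 : ∀ p ∈ 𝒬, p.Prime ∧ ¬ p ∣ Q) : ∃ X : Finset ℤ, ∏ p ∈ 𝒬, (p - (E p).card) ≤ X.card ∧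
      ∀ x ∈ X, 0 ≤ x ∧ x < ((Q * ∏ p ∈ 𝒬, p : ℕ) : ℤ) ∧ (Q : ℤ) ∣ x - c ∧
        ∀ p ∈ 𝒬, (x : ZMod p) ∉ E p := by
  classical
  induction 𝒬 using Finset.induction_on with
  | empty =>
    refine ⟨{c % Q}, by simp, ?_⟩
    intro x hx
    obtain rfl := Finset.mem_singleton.1 hx
    refine ⟨Int.emod_nonneg _ (by omega), ?_, ?_, by simp⟩
    · simpa using Int.emod_lt_of_pos c (by exact_mod_cast hQ : (0 : ℤ) < Q)
    · exact (Int.mod_modEq c Q).symm.dvd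
  | insert p 𝒬 hp ih =>
    obtain ⟨X, hX1, hX2⟩ := ih fun r hr => h𝒬 r (Finset.mem_insert_of_mem hr)
    obtain ⟨hpp, hpQ⟩ := h𝒬 p (Finset.mem_insert_self _ _)
    have : Fact p.Prime := ⟨hpp⟩
    set R := Q * ∏ p ∈ 𝒬, p with hR
    have hpR : ¬ (p : ℤ) ∣ (R : ℤ) := by
      rw [Int.natCast_dvd_natCast, hR, hpp.dvd_mul, hpp.prime.dvd_finsetProd_iff]
      rintro (h | ⟨r, hr, h⟩)
      · exact hpQ h
      · rw [Nat.prime_dvd_prime_iff_eq hpp (h𝒬 r (Finset.mem_insert_of_mem hr)).1] at h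
        exact hp (h ▸ hr)
    obtain ⟨Y, hY1, hY2⟩ := exists_card_progressions (X := X) (Q := R)
      (fun x hx => ⟨(hX2 x hx).1, (hX2 x hx).2.1⟩)
      -- Each solution modulo R lifts to p candidates modulo Rp. Since p does not divide R they run
      -- through all classes mod p once, and those in `E p` are dropped.
      (fun x => (Finset.range p).filter fun k : ℕ => ((x + R * k : ℤ) : ZMod p) ∉ E p)
      (p - (E p).card) (by
        intro x _
        have h1 := Finset.card_filter_add_card_filter_not (s := Finset.range p)
          (fun k : ℕ => ((x + R * k : ℤ) : ZMod p) ∈ E p)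
        rw [Finset.card_range] at h1
        have h2 : ((Finset.range p).filter fun k : ℕ => ((x + R * k : ℤ) : ZMod p) ∈ E p).card ≤
            (E p).card := by
          apply Finset.card_le_card_of_injOn (fun k : ℕ => ((x + R * k : ℤ) : ZMod p))
          · intro k hk
            exact (Finset.mem_filter.1 (Finset.mem_coe.1 hk)).2
          · intro j hj k hk hjk
            have hj' := Finset.mem_range.1 (Finset.mem_filter.1 (Finset.mem_coe.1 hj)).1
            have hk' := Finset.mem_range.1 (Finset.mem_filter.1 (Finset.mem_coe.1 hk)).1
            have hR0 : ((R : ℤ) : ZMod p) ≠ 0 := by rwa [Ne, ZMod.intCast_zmod_eq_zero_iff_dvd]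
            simp only [Int.cast_add, Int.cast_mul] at hjk
            have := mul_left_cancel₀ hR0 (add_left_cancel hjk)
            simp only [Int.cast_natCast] at this
            have := (ZMod.natCast_eq_natCast_iff' j k p).1 this
            rwa [Nat.mod_eq_of_lt hj', Nat.mod_eq_of_lt hk'] at this
        omega)
    refine ⟨Y, ?_, ?_⟩
    · rw [Finset.prod_insert hp]
      exact (Nat.mul_le_mul_left _ hX1).trans hY1
    · intro y hy
      obtain ⟨x, hx, j, hj, rfl⟩ := hY2 y hy
      obtain ⟨hj1, hj2⟩ := Finset.mem_filter.1 hj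
      obtain ⟨h1, h2, h3, h4⟩ := hX2 x hx
      refine ⟨by positivity, ?_, ?_, ?_⟩
      · rw [Finset.prod_insert hp, mul_left_comm, ← hR]
        have : (j : ℤ) + 1 ≤ p := by exact_mod_cast Finset.mem_range.1 hj1
        push_cast
        nlinarith
      · rw [add_sub_right_comm]
        refine dvd_add h3 (Dvd.dvd.mul_right ?_ _)
        rw [hR]
        push_cast
        exact Dvd.intro _ rfl
      · intro r hr
        rcases Finset.mem_insert.1 hr with rfl | hr
        · exact hj2
        · have hrR : (r : ℤ) ∣ R := by
            rw [Int.natCast_dvd_natCast, hR]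
            exact (Finset.dvd_prod_of_mem _ hr).mul_left _
          have : ((x + R * j : ℤ) : ZMod r) = x := by
            rw [Int.cast_add, Int.cast_mul, (ZMod.intCast_zmod_eq_zero_iff_dvd _ _).2 hrR]
            simp
          rw [this]
          exact h4 r hr

/-- Prescribed classes modulo distinct primes. -/
theorem exists_crt {Q : ℕ} (hQ : 0 < Q) (c : ℤ) (b : ℕ → ℤ) (𝒬 : Finset ℕ)
    (h𝒬 : ∀ p ∈ 𝒬, p.Prime ∧ ¬ p ∣ Q) : ∃ x : ℤ, 0 ≤ x ∧ x < ((Q * ∏ p ∈ 𝒬, p : ℕ) : ℤ) ∧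
      (Q : ℤ) ∣ x - c ∧ ∀ p ∈ 𝒬, (p : ℤ) ∣ x - b p := by
  classical
  -- Excluding all classes but one prescribes that class.
  obtain ⟨X, hX1, hX2⟩ := exists_crt_set hQ c
    (fun p => if h : p.Prime then
      have : Fact p.Prime := ⟨h⟩
      Finset.univ.erase (b p : ZMod p) else ∅) 𝒬 h𝒬
  have hX : 0 < X.card := by
    refine lt_of_lt_of_le (Finset.prod_pos fun p hp => ?_) hX1
    have h := (h𝒬 p hp).1
    have : Fact p.Prime := ⟨h⟩
    rw [dif_pos h]
    simp only [Finset.card_erase_of_mem (Finset.mem_univ _), Finset.card_univ, ZMod.card]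
    have := h.pos
    omega
  obtain ⟨x, hx⟩ := Finset.card_pos.1 hX
  obtain ⟨h1, h2, h3, h4⟩ := hX2 x hx
  refine ⟨x, h1, h2, h3, fun p hp => ?_⟩
  have h5 := h4 p hp
  have h := (h𝒬 p hp).1
  have : Fact p.Prime := ⟨h⟩
  rw [dif_pos h] at h5
  simp only [Finset.mem_erase, Finset.mem_univ, and_true, not_not] at h5
  rw [← ZMod.intCast_zmod_eq_zero_iff_dvd, Int.cast_sub, h5, sub_self]

/-! ### Counting sequences -/

/-- Counts sequences coefficient by coefficient. Entries from index k on are zero, so an updated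
sequence determines both the old one and the new entry. -/
theorem exists_card_update {S : Finset (ℕ → ℤ)} {k : ℕ} (hS : ∀ a ∈ S, ∀ i, k ≤ i → a i = 0)
    (T : (ℕ → ℤ) → Finset ℤ) (N : ℝ) (hN : ∀ a ∈ S, N ≤ (T a).card) :
    ∃ S' : Finset (ℕ → ℤ), S.card * N ≤ S'.card ∧ ∀ b ∈ S', (∀ i, k + 1 ≤ i → b i = 0) ∧
      ∃ a ∈ S, ∃ x ∈ T a, b = Function.update a k x := by
  classical
  refine ⟨(S.sigma T).image fun z => Function.update z.1 k z.2, ?_, ?_⟩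
  · rw [Finset.card_image_of_injOn, Finset.card_sigma, Nat.cast_sum, ← nsmul_eq_mul]
    · exact Finset.card_nsmul_le_sum _ _ _ hN
    · rintro ⟨a, x⟩ ha ⟨b, y⟩ hb hab
      have ha' := hS a (Finset.mem_sigma.1 (Finset.mem_coe.1 ha)).1 k le_rfl
      have hb' := hS b (Finset.mem_sigma.1 (Finset.mem_coe.1 hb)).1 k le_rfl
      simp only at hab
      have h1 : a = b := by
        funext i
        by_cases hi : i = k
        · rw [hi, ha', hb']
        · have := congrFun hab i
          rwa [Function.update_of_ne hi, Function.update_of_ne hi] at this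
      have h2 : x = y := by simpa using congrFun hab k
      rw [h1, h2]
  · intro b hb
    obtain ⟨z, hz, rfl⟩ := Finset.mem_image.1 hb
    obtain ⟨h1, h2⟩ := Finset.mem_sigma.1 hz
    refine ⟨fun i hi => ?_, z.1, h1, z.2, h2, rfl⟩
    rw [Function.update_of_ne (by omega)]
    exact hS z.1 h1 i (by omega)

end UltraWeak

end

noncomputable section
namespace UltraWeak
open Polynomial

/-! ### Pairs of leading coefficients -/

theorem card_filter_dvd_le {p : ℕ} (hp : p.Prime) (L : ℕ) (v B : ℤ) (hB : ¬ (p : ℤ) ∣ B) :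
    ((Finset.range L).filter fun k : ℕ => (p : ℤ) ∣ v + B * k).card ≤ L / p + 1 := by
  have : Fact p.Prime := ⟨hp⟩
  have h := card_filter_progression_le (p := p) L v B hB {0}
  simpa only [Finset.mem_singleton, ZMod.intCast_zmod_eq_zero_iff_dvd, Finset.card_singleton,
    one_mul] using h

/-- Exchange the sums: a prime M < p ≤ J divides O(J/p) of the terms, contributing O(J/p²). A term
below J³ has at most three prime factors above J, together contributing at most 3/J. -/
theorem sum_inv_primeFactors_progression_le {J M : ℕ} {v B : ℤ}
    (hB : ∀ p : ℕ, p.Prime → M < p → ¬ (p : ℤ) ∣ B) (hJ : 1 < J)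
    (hv : ∀ x < J, v + B * x ≠ 0 ∧ (v + B * x).natAbs < J ^ 3) :
    ∑ x ∈ Finset.range J, ∑ p ∈ (v + B * x : ℤ).natAbs.primeFactors.filter (M < ·), (p : ℝ)⁻¹ ≤
      4 * J / (M + 1) + 3 := by
  have hJ0 : (0 : ℝ) < J := by exact_mod_cast (by omega : 0 < J)
  have key : ∀ x ∈ Finset.range J,
      ∑ p ∈ (v + B * x : ℤ).natAbs.primeFactors.filter (M < ·), (p : ℝ)⁻¹ ≤
      ∑ p ∈ Finset.Ioc M J, (if p.Prime ∧ (p : ℤ) ∣ v + B * x then (p : ℝ)⁻¹ else 0) + 3 / J := by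
    intro x hx
    obtain ⟨h0, h1⟩ := hv x (Finset.mem_range.1 hx)
    rw [← Finset.sum_filter_add_sum_filter_not _ (fun p : ℕ => p ≤ J)]
    refine add_le_add ?_ ?_
    · rw [← Finset.sum_filter]
      refine Finset.sum_le_sum_of_subset_of_nonneg ?_ fun _ _ _ => by positivity
      intro p hp
      obtain ⟨hp1, hp2⟩ := Finset.mem_filter.1 hp
      obtain ⟨hp3, hp4⟩ := Finset.mem_filter.1 hp1
      exact Finset.mem_filter.2 ⟨Finset.mem_Ioc.2 ⟨hp4, hp2⟩, Nat.prime_of_mem_primeFactors hp3,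
        Int.natCast_dvd.2 (Nat.dvd_of_mem_primeFactors hp3)⟩
    · have h2 := card_large_primeFactors_le (Int.natAbs_ne_zero.2 h0) hJ h1
      calc _ ≤ ∑ p ∈ (v + B * x : ℤ).natAbs.primeFactors.filter (J < ·), (J : ℝ)⁻¹ := by
            refine (Finset.sum_le_sum (g := fun _ => (J : ℝ)⁻¹) fun p hp => ?_).trans
              (Finset.sum_le_sum_of_subset_of_nonneg ?_ fun _ _ _ => by positivity)
            · have := (Finset.mem_filter.1 hp).2
              apply inv_anti₀ hJ0
              exact_mod_cast (by omega : J ≤ p)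
            · intro p hp
              obtain ⟨hp1, hp2⟩ := Finset.mem_filter.1 hp
              exact Finset.mem_filter.2 ⟨(Finset.mem_filter.1 hp1).1, by omega⟩
        _ ≤ 3 / J := by
            rw [Finset.sum_const, nsmul_eq_mul, div_eq_mul_inv]
            gcongr
            exact_mod_cast h2
  refine (Finset.sum_le_sum key).trans ?_
  rw [Finset.sum_add_distrib, Finset.sum_comm]
  refine add_le_add ?_ ?_
  · calc _ ≤ ∑ p ∈ Finset.Ioc M J, 2 * (J : ℝ) * ((p : ℝ) ^ 2)⁻¹ := by
          refine Finset.sum_le_sum fun p hp => ?_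
          obtain ⟨hp1, hp2⟩ := Finset.mem_Ioc.1 hp
          have hp0 : (0 : ℝ) < p := by exact_mod_cast (by omega : 0 < p)
          by_cases hpp : p.Prime
          · simp only [hpp, true_and]
            rw [← Finset.sum_filter, Finset.sum_const, nsmul_eq_mul]
            have h1 : (((Finset.range J).filter fun k : ℕ => (p : ℤ) ∣ v + B * k).card : ℝ) ≤
                2 * J / p := by
              refine le_trans ?_ (div_add_one_le hpp.pos hp2)
              exact_mod_cast card_filter_dvd_le hpp J v B (hB p hpp hp1)
            calc _ ≤ 2 * J / p * (p : ℝ)⁻¹ := by gcongr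
              _ = _ := by field_simp
          · simp only [hpp, false_and, if_false, Finset.sum_const_zero]
            positivity
      _ ≤ 2 * J * (2 / (M + 1)) := by
          rw [← Finset.mul_sum]
          gcongr
          exact sum_inv_sq_Ioc_le M J
      _ = _ := by ring
  · rw [Finset.sum_const, Finset.card_range, nsmul_eq_mul]
    rw [mul_div_cancel₀ _ hJ0.ne']

/-- Union bound over the primes dividing a, all of which exceed M. Each prime p ≤ J costs at most
2J/p, and each of the at most three larger ones costs 1. -/
theorem card_filter_not_isCoprime_le {J M : ℕ} {a v B : ℤ}
    (hB : ∀ p : ℕ, p.Prime → M < p → ¬ (p : ℤ) ∣ B) (hJ : 1 < J) (ha : a ≠ 0)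
    (hv : a.natAbs < J ^ 3) (hM : ∀ p : ℕ, p.Prime → p ≤ M → ¬ (p : ℤ) ∣ a) :
    (((Finset.range J).filter fun y : ℕ => ¬ IsCoprime a (v + B * y)).card : ℝ) ≤
      2 * J * (∑ p ∈ a.natAbs.primeFactors.filter (M < ·), (p : ℝ)⁻¹) + 3 := by
  have h1 : ((Finset.range J).filter fun y : ℕ => ¬ IsCoprime a (v + B * y)) ⊆
      (a.natAbs.primeFactors.filter (M < ·)).biUnion fun p =>
        (Finset.range J).filter fun y : ℕ => (p : ℤ) ∣ v + B * y := by
    intro y hy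
    obtain ⟨hy1, hy2⟩ := Finset.mem_filter.1 hy
    rw [Int.isCoprime_iff_gcd_eq_one] at hy2
    obtain ⟨p, hp, hpd⟩ := Nat.exists_prime_and_dvd hy2
    have hd1 : (p : ℤ) ∣ a := (Int.natCast_dvd_natCast.2 hpd).trans (Int.gcd_dvd_left _ _)
    have hd2 : (p : ℤ) ∣ v + B * y := (Int.natCast_dvd_natCast.2 hpd).trans (Int.gcd_dvd_right _ _)
    have hMp : M < p := by
      by_contra! h
      exact hM p hp h hd1
    exact Finset.mem_biUnion.2 ⟨p, Finset.mem_filter.2 ⟨Nat.mem_primeFactors.2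
      ⟨hp, Int.natCast_dvd.1 hd1, Int.natAbs_ne_zero.2 ha⟩, hMp⟩, Finset.mem_filter.2 ⟨hy1, hd2⟩⟩
  have h2 : (((Finset.range J).filter fun y : ℕ => ¬ IsCoprime a (v + B * y)).card : ℝ) ≤
      ∑ p ∈ a.natAbs.primeFactors.filter (M < ·), ((J / p + 1 : ℕ) : ℝ) := by
    have h3 := (Finset.card_le_card h1).trans Finset.card_biUnion_le
    refine (Nat.cast_le (α := ℝ).2 h3).trans ?_
    rw [Nat.cast_sum]
    refine Finset.sum_le_sum fun p hp => ?_
    obtain ⟨hp1, hp2⟩ := Finset.mem_filter.1 hp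
    have hpp := Nat.prime_of_mem_primeFactors hp1
    exact Nat.cast_le.2 (card_filter_dvd_le hpp J v B (hB p hpp hp2))
  refine h2.trans ?_
  rw [← Finset.sum_filter_add_sum_filter_not _ (fun p : ℕ => p ≤ J)]
  refine add_le_add ?_ ?_
  · rw [Finset.mul_sum]
    calc _ ≤ ∑ p ∈ (a.natAbs.primeFactors.filter (M < ·)).filter (fun p : ℕ => p ≤ J),
          2 * (J : ℝ) * (p : ℝ)⁻¹ := by
          refine Finset.sum_le_sum fun p hp => ?_
          obtain ⟨hp1, hp2⟩ := Finset.mem_filter.1 hp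
          have hpp := Nat.prime_of_mem_primeFactors (Finset.mem_filter.1 hp1).1
          rw [← div_eq_mul_inv]
          exact div_add_one_le hpp.pos hp2
      _ ≤ _ := Finset.sum_le_sum_of_subset_of_nonneg (Finset.filter_subset _ _)
          fun _ _ _ => by positivity
  · calc _ ≤ ∑ p ∈ a.natAbs.primeFactors.filter (J < ·), (1 : ℝ) := by
          refine (Finset.sum_le_sum (g := fun _ => (1 : ℝ)) fun p hp => ?_).trans
              (Finset.sum_le_sum_of_subset_of_nonneg ?_ fun _ _ _ => by positivity)
          · have := (Finset.mem_filter.1 hp).2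
            rw [Nat.div_eq_of_lt (by omega)]
            simp
          · intro p hp
            obtain ⟨hp1, hp2⟩ := Finset.mem_filter.1 hp
            exact Finset.mem_filter.2 ⟨(Finset.mem_filter.1 hp1).1, by omega⟩
      _ ≤ 3 := by
          rw [Finset.sum_const, nsmul_eq_mul, mul_one]
          exact_mod_cast card_large_primeFactors_le (Int.natAbs_ne_zero.2 ha) hJ hv

theorem half_le_floor {x : ℝ} (hx : 1 ≤ x) : x / 2 ≤ (⌊x⌋₊ : ℝ) := by
  have h1 := Nat.lt_floor_add_one x
  have h2 : (1 : ℝ) ≤ (⌊x⌋₊ : ℝ) := by exact_mod_cast (Nat.one_le_floor_iff x).2 hx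
  linarith

-- W contains exactly the primes up to M. With a_0 ≡ 1 mod W the leading coefficient has no prime
-- factor ≤ M. The sum of 1/p over p | a_0 is small on average, so Markov's inequality keeps at
-- least three quarters of the a_0, and for each of these at least half of the a_1 are coprime to
-- it. The range a_1 < s/4, smaller than the box allows, is used later for rigidity.
set_option maxHeartbeats 1000000 in
theorem exists_leading_pairs (δ : ℝ) (hδ : 0 < δ) : ∃ M₁ : ℕ, ∀ M, M₁ ≤ M → ∀ W : ℕ, 0 < W →
    (∀ p : ℕ, p.Prime → (p ∣ W ↔ p ≤ M)) → ∃ S₀ : ℝ, ∀ (r : ℤ) (s : ℝ), S₀ ≤ s →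
      ∃ P : Finset (ℤ × ℤ), s ^ 2 / (512 * W ^ 2) ≤ P.card ∧ ∀ z ∈ P,
        (W : ℤ) ∣ z.1 - 1 ∧ (W : ℤ) ∣ z.2 - r ∧ s / 2 < z.1 ∧ z.1 ≤ s ∧ 1 ≤ z.2 ∧ z.2 < s / 4 ∧
        IsCoprime z.1 z.2 ∧ ∑ p ∈ z.1.natAbs.primeFactors.filter (M < ·), (p : ℝ)⁻¹ ≤ δ := by
  classical
  obtain ⟨δ₁, hδ₁, hδ₁δ, hδ₁8⟩ : ∃ δ₁ : ℝ, 0 < δ₁ ∧ δ₁ ≤ δ ∧ δ₁ ≤ 1 / 8 :=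
    ⟨min δ (1 / 8), by positivity, min_le_left _ _, min_le_right _ _⟩
  refine ⟨⌈32 / δ₁⌉₊, fun M hM W hW hWM => ?_⟩
  have hM' : 32 / δ₁ ≤ M := (Nat.le_ceil _).trans (by exact_mod_cast hM)
  have hWr : (1 : ℝ) ≤ W := by exact_mod_cast hW
  -- The cube ensures s < J₁³, so that a_0 has at most three prime factors beyond the range of
  -- summation; the factor 24/δ₁ absorbs the additive constants 3.
  refine ⟨(16 * W) ^ 3 * (24 / δ₁), fun r s hs => ?_⟩
  have h24 : 24 * 8 ≤ 24 / δ₁ := by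
    rw [le_div_iff₀ hδ₁]; nlinarith
  have hsW3 : (16 * W : ℝ) ^ 3 ≤ s := by
    refine le_trans ?_ hs
    have : (0 : ℝ) ≤ (16 * W : ℝ) ^ 3 := by positivity
    nlinarith
  have hW16 : (1 : ℝ) ≤ (16 * W : ℝ) ^ 3 := one_le_pow₀ (by linarith)
  have hs1 : 1 ≤ s := hW16.trans hsW3
  have hsW : 24 / δ₁ * (16 * W) ≤ s := by
    refine le_trans ?_ hs
    rw [mul_comm]
    gcongr
    exact le_self_pow₀ (by linarith) (by norm_num)
  set J₀ := ⌊s / (4 * W)⌋₊ with hJ₀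
  set J₁ := ⌊s / (8 * W)⌋₊ with hJ₁
  have hx1 : 24 / δ₁ * 2 ≤ s / (8 * W) := by
    rw [le_div_iff₀ (by positivity)]; linarith
  have hJ₁l : s / (8 * W) / 2 ≤ J₁ := half_le_floor (by linarith)
  have hx0 : s / (8 * W) ≤ s / (4 * W) := by gcongr; linarith
  have hJ₀l : s / (4 * W) / 2 ≤ J₀ := half_le_floor (by linarith)
  have hJ₀u : (J₀ : ℝ) ≤ s / (4 * W) := Nat.floor_le (by positivity)
  have hJ₁u : (J₁ : ℝ) ≤ s / (8 * W) := Nat.floor_le (by positivity)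
  have hJ₁₀ : J₁ ≤ J₀ := Nat.floor_le_floor hx0
  have hJ₁b : 24 / δ₁ ≤ J₁ := by linarith
  have hJ₀b : 24 / δ₁ ≤ J₀ := hJ₁b.trans (by exact_mod_cast hJ₁₀)
  have hJ₁2 : 1 < J₁ := by
    have : (1 : ℝ) < J₁ := by linarith
    exact_mod_cast this
  have hsJ₁ : s < (J₁ : ℝ) ^ 3 := by
    have h1 : s / (16 * W) ≤ J₁ := by
      refine le_trans (le_of_eq ?_) hJ₁l
      field_simp; norm_num
    have h2 : s < (s / (16 * W)) ^ 3 := by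
      rw [div_pow, lt_div_iff₀ (by positivity)]
      have h3 : (1 : ℝ) < s := by
        have : (1 : ℝ) < (16 * W : ℝ) ^ 3 := one_lt_pow₀ (by linarith) (by norm_num)
        linarith
      calc s * (16 * W) ^ 3 ≤ s * s := by gcongr
        _ < s ^ 3 := by nlinarith [mul_pos (by linarith : (0 : ℝ) < s) (by linarith : (0 : ℝ) < s)]
    exact h2.trans_le (by gcongr)
  have hWz : (W : ℤ) ≠ 0 := by exact_mod_cast hW.ne'
  have hWpos : (0 : ℤ) < W := by exact_mod_cast hW
  obtain ⟨c₀, hc₀1, hc₀l, hc₀u⟩ : ∃ c : ℤ, (W : ℤ) ∣ c - 1 ∧ s / 2 < c ∧ (c : ℝ) ≤ s / 2 + W := by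
    refine ⟨⌊s / 2⌋ + 1 + (1 - (⌊s / 2⌋ + 1)) % W, ?_, ?_, ?_⟩
    · have := (Int.mod_modEq (1 - (⌊s / 2⌋ + 1)) W).symm.dvd
      convert this using 1
      ring
    · have h1 := Int.lt_floor_add_one (s / 2)
      have h2 : (0 : ℝ) ≤ (((1 - (⌊s / 2⌋ + 1)) % W : ℤ) : ℝ) := by
        exact_mod_cast Int.emod_nonneg _ hWz
      push_cast at h2 ⊢
      linarith
    · have h1 := Int.floor_le (s / 2)
      have h2 : (((1 - (⌊s / 2⌋ + 1)) % W : ℤ) : ℝ) + 1 ≤ W := by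
        exact_mod_cast Int.add_one_le_of_lt (Int.emod_lt_of_pos _ hWpos)
      push_cast at h2 ⊢
      linarith
  obtain ⟨c₁, hc₁1, hc₁l, hc₁u⟩ : ∃ c : ℤ, (W : ℤ) ∣ c - r ∧ 1 ≤ c ∧ c ≤ W := by
    refine ⟨1 + (r - 1) % W, ?_, ?_, ?_⟩
    · have := (Int.mod_modEq (r - 1) W).symm.dvd
      convert this using 1
      ring
    · have := Int.emod_nonneg (r - 1) hWz
      omega
    · have := Int.emod_lt_of_pos (r - 1) hWpos
      omega
  have hBW : ∀ p : ℕ, p.Prime → M < p → ¬ (p : ℤ) ∣ W := by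
    intro p hp hMp h
    have := (hWM p hp).1 (Int.natCast_dvd_natCast.1 h)
    omega
  have hs4W : (W : ℝ) ≤ s / 8 := by
    have : (16 * W : ℝ) ≤ (16 * W : ℝ) ^ 3 := le_self_pow₀ (by linarith) (by norm_num)
    linarith
  have hrange0 : ∀ x < J₀, s / 2 < ((c₀ + W * x : ℤ) : ℝ) ∧ ((c₀ + W * x : ℤ) : ℝ) ≤ s := by
    intro x hx
    have h1 : (x : ℝ) ≤ s / (4 * W) := le_trans (by exact_mod_cast hx.le) hJ₀u
    have h2 : (W : ℝ) * x ≤ s / 4 := by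
      rw [le_div_iff₀ (by positivity)] at h1
      linarith
    have h3 : (0 : ℝ) ≤ (W : ℝ) * x := by positivity
    push_cast
    constructor <;> linarith
  have hrange1 : ∀ y < J₁, 1 ≤ c₁ + W * (y : ℤ) ∧ ((c₁ + W * y : ℤ) : ℝ) < s / 4 := by
    intro y hy
    refine ⟨by nlinarith, ?_⟩
    have h1 : (y : ℝ) + 1 ≤ s / (8 * W) := le_trans (by exact_mod_cast hy) hJ₁u
    have h2 : (W : ℝ) * y + W ≤ s / 8 := by
      rw [le_div_iff₀ (by positivity)] at h1
      linarith
    have h3 : (c₁ : ℝ) ≤ W := by exact_mod_cast hc₁u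
    push_cast
    linarith
  have hne0 : ∀ x < J₀, c₀ + W * (x : ℤ) ≠ 0 ∧ (c₀ + W * (x : ℤ)).natAbs < J₁ ^ 3 := by
    intro x hx
    obtain ⟨h1, h2⟩ := hrange0 x hx
    have h3 : (0 : ℝ) < ((c₀ + W * x : ℤ) : ℝ) := by linarith
    have h4 : 0 < c₀ + W * (x : ℤ) := by exact_mod_cast h3
    refine ⟨h4.ne', ?_⟩
    have h5 : ((c₀ + W * (x : ℤ)).natAbs : ℝ) = ((c₀ + W * x : ℤ) : ℝ) := by
      rw [Nat.cast_natAbs, abs_of_pos h4]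
    have h6 : ((c₀ + W * (x : ℤ)).natAbs : ℝ) < (J₁ : ℝ) ^ 3 := by rw [h5]; linarith
    exact_mod_cast h6
  have hsum := sum_inv_primeFactors_progression_le (v := c₀) hBW (hJ₁2.trans_le hJ₁₀)
    fun x hx => ⟨(hne0 x hx).1, (hne0 x hx).2.trans_le (Nat.pow_le_pow_left hJ₁₀ 3)⟩
  set g : ℕ → ℝ := fun x => ∑ p ∈ (c₀ + W * x : ℤ).natAbs.primeFactors.filter (M < ·), (p : ℝ)⁻¹
    with hg
  have hg0 : ∀ x, 0 ≤ g x := fun x => Finset.sum_nonneg fun _ _ => by positivity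
  set good := (Finset.range J₀).filter fun x => g x ≤ δ₁ with hgood
  have hJ₀pos : (0 : ℝ) < J₀ := by linarith
  -- Markov: the average of g is at most δ₁/4, so at most a quarter of the x have g x > δ₁.
  have hgoodcard : 3 / 4 * (J₀ : ℝ) ≤ good.card := by
    have h1 := Finset.card_filter_add_card_filter_not (s := Finset.range J₀) fun x => g x ≤ δ₁
    rw [Finset.card_range] at h1
    have h2 : (((Finset.range J₀).filter fun x => ¬ g x ≤ δ₁).card : ℝ) * δ₁ ≤
        4 * J₀ / (M + 1) + 3 := by
      refine le_trans ?_ hsum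
      rw [← nsmul_eq_mul]
      refine (Finset.card_nsmul_le_sum _ g _ fun x hx => ?_).trans
        (Finset.sum_le_sum_of_subset_of_nonneg (Finset.filter_subset _ _) fun x _ _ => hg0 x)
      exact (not_le.1 (Finset.mem_filter.1 hx).2).le
    have h3 : 4 * J₀ / (M + 1) ≤ J₀ * δ₁ / 8 := by
      rw [div_le_iff₀ (by positivity)]
      rw [div_le_iff₀ hδ₁] at hM'
      nlinarith
    have h4 : 3 ≤ J₀ * δ₁ / 8 := by
      rw [div_le_iff₀ hδ₁] at hJ₀b
      linarith
    have h5 : (((Finset.range J₀).filter fun x => ¬ g x ≤ δ₁).card : ℝ) ≤ J₀ / 4 := by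
      by_contra h
      have := mul_lt_mul_of_pos_right (not_le.1 h) hδ₁
      linarith
    have h6 : (good.card : ℝ) + (((Finset.range J₀).filter fun x => ¬ g x ≤ δ₁).card : ℝ) = J₀ := by
      exact_mod_cast h1
    linarith
  set T : ℕ → Finset ℕ := fun x =>
    (Finset.range J₁).filter fun y : ℕ => IsCoprime (c₀ + W * (x : ℤ)) (c₁ + W * (y : ℤ)) with hT
  have hcong : ∀ x : ℕ, (W : ℤ) ∣ c₀ + W * (x : ℤ) - 1 := by
    intro x
    have : c₀ + W * (x : ℤ) - 1 = (c₀ - 1) + W * x := by ring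
    rw [this]
    exact dvd_add hc₀1 (Dvd.intro _ rfl)
  have hTcard : ∀ x ∈ good, (J₁ : ℝ) / 2 ≤ (T x).card := by
    intro x hx
    obtain ⟨hx1, hx2⟩ := Finset.mem_filter.1 hx
    obtain ⟨h0, h1⟩ := hne0 x (Finset.mem_range.1 hx1)
    have h2 := card_filter_not_isCoprime_le (v := c₁) hBW hJ₁2 h0 h1 (by
      intro p hp hpM hpd
      have h3 : (p : ℤ) ∣ W := Int.natCast_dvd_natCast.2 ((hWM p hp).2 hpM)
      have h4 := dvd_sub hpd (h3.trans (hcong x))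
      rw [sub_sub_cancel] at h4
      exact (Nat.prime_iff_prime_int.1 hp).not_isUnit (isUnit_of_dvd_one h4))
    have h3 := Finset.card_filter_add_card_filter_not (s := Finset.range J₁)
      fun y : ℕ => IsCoprime (c₀ + W * (x : ℤ)) (c₁ + W * (y : ℤ))
    rw [Finset.card_range] at h3
    have h4 : ((T x).card : ℝ) + (((Finset.range J₁).filter
        fun y : ℕ => ¬ IsCoprime (c₀ + W * (x : ℤ)) (c₁ + W * (y : ℤ))).card : ℝ) = J₁ := by
      exact_mod_cast h3
    have h5 : 2 * (J₁ : ℝ) * g x ≤ 2 * J₁ * (1 / 8) := by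
      gcongr
      exact hx2.trans hδ₁8
    linarith
  refine ⟨(good.sigma T).image fun z => (c₀ + W * (z.1 : ℤ), c₁ + W * (z.2 : ℤ)), ?_, ?_⟩
  · rw [Finset.card_image_of_injective]
    · rw [Finset.card_sigma, Nat.cast_sum]
      have h1 : (good.card : ℝ) * (J₁ / 2) ≤ ∑ x ∈ good, ((T x).card : ℝ) := by
        rw [← nsmul_eq_mul]
        exact Finset.card_nsmul_le_sum _ _ _ hTcard
      refine le_trans ?_ h1
      calc s ^ 2 / (512 * W ^ 2) ≤ 3 / 4 * (s / (4 * W) / 2) * (s / (8 * W) / 2 / 2) := by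
            have : 3 / 4 * (s / (4 * W) / 2) * (s / (8 * W) / 2 / 2) =
              (3 / 2) * (s ^ 2 / (512 * W ^ 2)) := by field_simp; norm_num
            rw [this]
            have : 0 ≤ s ^ 2 / (512 * (W : ℝ) ^ 2) := by positivity
            linarith
        _ ≤ 3 / 4 * J₀ * (J₁ / 2) := by gcongr
        _ ≤ _ := by gcongr
    · rintro ⟨x, y⟩ ⟨x', y'⟩ h
      simp only [Prod.mk.injEq, add_right_inj, mul_eq_mul_left_iff, hWz, or_false,
        Nat.cast_inj] at h
      rw [h.1, h.2]
  · intro z hz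
    obtain ⟨⟨x, y⟩, hxy, rfl⟩ := Finset.mem_image.1 hz
    obtain ⟨hx, hy⟩ := Finset.mem_sigma.1 hxy
    obtain ⟨hx1, hx2⟩ := Finset.mem_filter.1 hx
    obtain ⟨hy1, hy2⟩ := Finset.mem_filter.1 hy
    obtain ⟨h1, h2⟩ := hrange0 x (Finset.mem_range.1 hx1)
    obtain ⟨h3, h4⟩ := hrange1 y (Finset.mem_range.1 hy1)
    refine ⟨hcong x, ?_, h1, h2, h3, h4, hy2, hx2.trans hδ₁δ⟩
    have : c₁ + W * (y : ℤ) - r = (c₁ - r) + W * y := by ring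
    rw [this]
    exact dvd_add hc₁1 (Dvd.intro _ rfl)

end UltraWeak

end

noncomputable section
namespace UltraWeak
open Polynomial

/-! ### Heads -/

/-- At least x/(2R) full periods of length R = Q∏p fit into [0, x], which needs R ≤ x. Each period
contains at least ∏(p - d) admissible residues. -/
theorem exists_crt_interval {Q : ℕ} (hQ : 0 < Q) (c : ℤ) (E : ∀ p : ℕ, Finset (ZMod p))
    (𝒬 : Finset ℕ) (h𝒬 : ∀ p ∈ 𝒬, p.Prime ∧ ¬ p ∣ Q) (d : ℕ)
    (hE : ∀ p ∈ 𝒬, (E p).card ≤ d ∧ d ≤ p) (x : ℝ)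
    (hx : ((Q * ∏ p ∈ 𝒬, p : ℕ) : ℝ) ≤ x) :
    ∃ T : Finset ℤ, x / (2 * Q) * ∏ p ∈ 𝒬, (1 - (d : ℝ) / p) ≤ T.card ∧
      ∀ y ∈ T, 0 ≤ y ∧ (y : ℝ) ≤ x ∧ (Q : ℤ) ∣ y - c ∧ ∀ p ∈ 𝒬, (y : ZMod p) ∉ E p := by
  obtain ⟨X, hX1, hX2⟩ := exists_crt_set hQ c E 𝒬 h𝒬
  set R := Q * ∏ p ∈ 𝒬, p with hR
  have hRpos : 0 < R := Nat.mul_pos hQ (Finset.prod_pos fun p hp => (h𝒬 p hp).1.pos)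
  have hRr : (0 : ℝ) < R := by exact_mod_cast hRpos
  have hQr : (0 : ℝ) < Q := by exact_mod_cast hQ
  set J := ⌊x / R⌋₊ with hJ
  have hJl : x / R / 2 ≤ J := half_le_floor (by rwa [one_le_div hRr])
  obtain ⟨Y, hY1, hY2⟩ := exists_card_progressions (X := X) (Q := R)
    (fun y hy => ⟨(hX2 y hy).1, (hX2 y hy).2.1⟩) (fun _ => Finset.range J) J
    (fun _ _ => (Finset.card_range J).ge)
  have hx0 : 0 ≤ x := hRr.le.trans hx
  have hprod : (∏ p ∈ 𝒬, (1 - (d : ℝ) / p)) * ∏ p ∈ 𝒬, (p : ℝ) ≤ X.card := by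
    rw [← Finset.prod_mul_distrib]
    refine le_trans ?_ (Nat.cast_le (α := ℝ).2 hX1)
    rw [Nat.cast_prod]
    refine Finset.prod_le_prod (fun p hp => ?_) fun p hp => ?_
    · have hp0 : (0 : ℝ) < p := by exact_mod_cast (h𝒬 p hp).1.pos
      refine mul_nonneg (sub_nonneg.2 ?_) hp0.le
      rw [div_le_one hp0]
      exact_mod_cast (hE p hp).2
    · have hp0 : (0 : ℝ) < p := by exact_mod_cast (h𝒬 p hp).1.pos
      rw [Nat.cast_sub ((hE p hp).1.trans (hE p hp).2), sub_mul, one_mul,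
        div_mul_cancel₀ _ hp0.ne']
      have : ((E p).card : ℝ) ≤ d := by exact_mod_cast (hE p hp).1
      linarith
  refine ⟨Y, ?_, ?_⟩
  · refine le_trans ?_ (Nat.cast_le (α := ℝ).2 hY1)
    rw [Nat.cast_mul]
    have hprod0 : 0 ≤ (∏ p ∈ 𝒬, (1 - (d : ℝ) / p)) * ∏ p ∈ 𝒬, (p : ℝ) := by
      rw [← Finset.prod_mul_distrib]
      refine Finset.prod_nonneg fun p hp => ?_
      have hp0 : (0 : ℝ) < p := by exact_mod_cast (h𝒬 p hp).1.pos
      refine mul_nonneg (sub_nonneg.2 ?_) hp0.le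
      rw [div_le_one hp0]
      exact_mod_cast (hE p hp).2
    have hP0 : (∏ p ∈ 𝒬, (p : ℝ)) ≠ 0 := by
      refine Finset.prod_ne_zero_iff.2 fun p hp => ?_
      exact_mod_cast (h𝒬 p hp).1.ne_zero
    calc _ = x / R / 2 * ((∏ p ∈ 𝒬, (1 - (d : ℝ) / p)) * ∏ p ∈ 𝒬, (p : ℝ)) := by
          rw [hR]
          push_cast
          field_simp
      _ ≤ _ := by gcongr
  · intro y hy
    obtain ⟨z, hz, j, hj, rfl⟩ := hY2 y hy
    obtain ⟨h1, h2, h3, h4⟩ := hX2 z hz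
    refine ⟨by positivity, ?_, ?_, ?_⟩
    · have hj' : (j : ℝ) + 1 ≤ x / R :=
        le_trans (by exact_mod_cast Finset.mem_range.1 hj) (Nat.floor_le (by positivity))
      rw [le_div_iff₀ hRr] at hj'
      have h2' : (z : ℝ) < R := by exact_mod_cast h2
      push_cast
      linarith
    · rw [add_sub_right_comm]
      refine dvd_add h3 (Dvd.dvd.mul_right ?_ _)
      rw [hR]
      push_cast
      exact Dvd.intro _ rfl
    · intro p hp
      have hpR : (p : ℤ) ∣ R := by
        rw [Int.natCast_dvd_natCast, hR]
        exact (Finset.dvd_prod_of_mem _ hp).mul_left _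
      have : ((z + R * j : ℤ) : ZMod p) = z := by
        rw [Int.cast_add, Int.cast_mul, (ZMod.intCast_zmod_eq_zero_iff_dvd _ _).2 hpR]
        simp
      rw [this]
      exact h4 p hp

/-- Admissible pairs of leading coefficients. -/
structure IsLeading (W M : ℕ) (r : ℕ → ℤ) (s δ : ℝ) (a : ℕ → ℤ) : Prop where
  dvd_zero : (W : ℤ) ∣ a 0 - r 0
  dvd_one : (W : ℤ) ∣ a 1 - r 1
  lower : s / 2 < a 0
  upper : a 0 ≤ s
  one_le : 1 ≤ a 1
  lt : a 1 < s / 4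
  coprime : IsCoprime (a 0) (a 1)
  sum_le : ∑ p ∈ (a 0).natAbs.primeFactors.filter (M < ·), (p : ℝ)⁻¹ ≤ δ

theorem IsLeading.update {W M : ℕ} {r : ℕ → ℤ} {s δ : ℝ} {a : ℕ → ℤ} (h : IsLeading W M r s δ a)
    {k : ℕ} (hk : 2 ≤ k) (x : ℤ) : IsLeading W M r s δ (Function.update a k x) := by
  have h0 : Function.update a k x 0 = a 0 := Function.update_of_ne (by omega) _ _
  have h1 : Function.update a k x 1 = a 1 := Function.update_of_ne (by omega) _ _
  constructor <;> (try rw [h0]) <;> (try rw [h1])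
  exacts [h.dvd_zero, h.dvd_one, h.lower, h.upper, h.one_le, h.lt, h.coprime, h.sum_le]

/-- Admissible coefficients `a_i`, for `2 ≤ i < k`. -/
def IsMiddle (W : ℕ) (r : ℕ → ℤ) (κ s t : ℝ) (k : ℕ) (a : ℕ → ℤ) : Prop :=
  ∀ i, 2 ≤ i → i < k → 0 ≤ a i ∧ (a i : ℝ) ≤ κ * (s * t ^ i) ∧ (W : ℤ) ∣ a i - r i

theorem IsMiddle.update {W : ℕ} {r : ℕ → ℤ} {κ s t : ℝ} {k : ℕ} {a : ℕ → ℤ}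
    (h : IsMiddle W r κ s t k a) {x : ℤ}
    (hx : 0 ≤ x ∧ (x : ℝ) ≤ κ * (s * t ^ k) ∧ (W : ℤ) ∣ x - r k) :
    IsMiddle W r κ s t (k + 1) (Function.update a k x) := by
  intro i hi2 hik
  rcases Nat.lt_or_ge i k with hlt | hge
  · rw [Function.update_of_ne hlt.ne]
    exact h i hi2 hlt
  · obtain rfl : i = k := by omega
    rw [Function.update_self]
    exact hx

/-- The coefficients of index 2, …, k - 1 only have to lie in a class mod W, so each of them
contributes its range divided by 2W. -/
theorem exists_middle {W M : ℕ} (hW : 0 < W) {r : ℕ → ℤ} {κ s t δ : ℝ} (hκ : 0 < κ)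
    (hs : (W : ℝ) ≤ κ * s) (ht : 1 ≤ t) {S : Finset (ℕ → ℤ)}
    (hS : ∀ a ∈ S, (∀ i, 2 ≤ i → a i = 0) ∧ IsLeading W M r s δ a) (k : ℕ) (hk : 2 ≤ k) :
    ∃ S' : Finset (ℕ → ℤ), S.card * ∏ i ∈ Finset.Ico 2 k, (κ * (s * t ^ i) / (2 * W)) ≤ S'.card ∧
      ∀ a ∈ S', (∀ i, k ≤ i → a i = 0) ∧ IsLeading W M r s δ a ∧ IsMiddle W r κ s t k a := by
  have hs0 : 0 < s := by
    have : (0 : ℝ) < W := by exact_mod_cast hW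
    exact pos_of_mul_pos_right (this.trans_le hs) hκ.le
  induction k, hk using Nat.le_induction with
  | base =>
    refine ⟨S, by simp, fun a ha => ⟨(hS a ha).1, (hS a ha).2, fun i h1 h2 => by omega⟩⟩
  | succ k hk ih =>
    obtain ⟨S₁, h1, h2⟩ := ih
    obtain ⟨T, hT1, hT2⟩ := exists_crt_interval hW (r k) (fun _ => ∅) ∅ (by simp) 0 (by simp)
      (κ * (s * t ^ k)) (by
        simp only [Finset.prod_empty, mul_one]
        refine hs.trans ?_
        have := one_le_pow₀ ht (n := k)
        have h3 : s * 1 ≤ s * t ^ k := by gcongr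
        rw [mul_one] at h3
        gcongr)
    rw [Finset.prod_empty, mul_one] at hT1
    obtain ⟨S₂, h3, h4⟩ := exists_card_update (fun a ha => (h2 a ha).1) (fun _ => T) _
      (fun _ _ => hT1)
    refine ⟨S₂, ?_, ?_⟩
    · rw [Finset.prod_Ico_succ_top hk, ← mul_assoc]
      refine le_trans ?_ h3
      gcongr
    · intro b hb
      obtain ⟨h5, a, ha, x, hx, rfl⟩ := h4 b hb
      obtain ⟨h6, h7, h8⟩ := h2 a ha
      obtain ⟨h9, h10, h11, -⟩ := hT2 x hx
      exact ⟨h5, h7.update hk x, h8.update ⟨h9, h10, h11⟩⟩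

/-- Admissible heads `a_0, …, a_N` of polynomials of degree `N + 2`. -/
structure IsHead (N W M q : ℕ) (l : ℤ) (r : ℕ → ℤ) (κ s t δ : ℝ) (a : ℕ → ℤ) : Prop where
  leading : IsLeading W M r s δ a
  middle : IsMiddle W r κ s t (N + 1) a
  nonsingular : ∀ (p : ℕ) [Fact p.Prime], p ∣ q → ∀ T Y : ℤ,
    (p : ℤ) ∣ (polyOf (N + 2) (withTail (N + 2) a T Y)).eval l →
    (p : ℤ) ∣ (polyOf (N + 2) (withTail (N + 2) a T Y)).derivative.eval l →
    NonsingularMod (polyOf (N + 2) (withTail (N + 2) a T Y)) p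

/-- The degree is N + 2 and the last head coefficient is a_N. It is the one that avoids the excluded
classes at primes dividing q, which gives the factors 1 - N/p. The condition q ≤ t^N lets the
modulus Wq fit into the range of a_N. -/
theorem exists_heads {N : ℕ} (hN : 3 ≤ N) {κ δ : ℝ} (hκ : 0 < κ) (hδ : 0 < δ) :
    ∃ M₁ : ℕ, ∀ M, M₁ ≤ M → ∀ W : ℕ, 0 < W → (∀ p : ℕ, p.Prime → (p ∣ W ↔ p ≤ M)) →
    ∃ S₀ : ℝ, ∀ s t : ℝ, S₀ ≤ s → 1 ≤ t → ∀ q : ℕ, Squarefree q → (∀ p ∈ q.primeFactors, M < p) →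
      (q : ℝ) ≤ t ^ N → ∀ (l : ℤ) (r : ℕ → ℤ), r 0 = 1 →
      ∃ S : Finset (ℕ → ℤ), s ^ 2 / (512 * W ^ 2) *
          (∏ i ∈ Finset.Ico 2 N, (κ * (s * t ^ i) / (2 * W))) *
          (κ * (s * t ^ N) / (2 * W) * ∏ p ∈ q.primeFactors, (1 - (N : ℝ) / p)) ≤ S.card ∧
        ∀ a ∈ S, (∀ i, N + 1 ≤ i → a i = 0) ∧ IsHead N W M q l r κ s t δ a := by
  classical
  obtain ⟨M₁, hM₁⟩ := exists_leading_pairs δ hδ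
  refine ⟨max M₁ (N + 2), fun M hM W hW hWM => ?_⟩
  obtain ⟨S₀, hS₀⟩ := hM₁ M (le_of_max_le_left hM) W hW hWM
  have hNM : N + 2 ≤ M := le_of_max_le_right hM
  have hWr : (0 : ℝ) < W := by exact_mod_cast hW
  refine ⟨max S₀ (W / κ), fun s t hs ht q hq hqM hqt l r hr => ?_⟩
  obtain ⟨P, hP1, hP2⟩ := hS₀ (r 1) s (le_of_max_le_left hs)
  have hsW : (W : ℝ) ≤ κ * s := by
    have := le_of_max_le_right hs
    rwa [div_le_iff₀' hκ] at this
  have hs0 : 0 < s := pos_of_mul_pos_right (hWr.trans_le hsW) hκ.le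
  have ht0 : 0 < t := by linarith
  let φ : ℤ × ℤ → ℕ → ℤ := fun z i => if i = 0 then z.1 else if i = 1 then z.2 else 0
  have hφ : Function.Injective φ := by
    intro z w h
    have h0 := congrFun h 0
    have h1 := congrFun h 1
    simp only [φ, if_true, one_ne_zero, if_false] at h0 h1
    exact Prod.ext h0 h1
  obtain ⟨S₁, h1, h2⟩ := exists_middle (M := M) (r := r) (δ := δ) hW hκ hsW ht (S := P.image φ) (by
    intro a ha
    obtain ⟨z, hz, rfl⟩ := Finset.mem_image.1 ha
    obtain ⟨h1, h2, h3, h4, h5, h6, h7, h8⟩ := hP2 z hz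
    refine ⟨fun i hi => ?_, ?_⟩
    · simp only [φ]
      rw [if_neg (by omega), if_neg (by omega)]
    · constructor <;> simp only [φ, if_true, one_ne_zero, if_false, hr] <;> assumption) N (by omega)
  rw [Finset.card_image_of_injective _ hφ] at h1
  have hprime : ∀ p ∈ q.primeFactors, p.Prime := fun p hp => Nat.prime_of_mem_primeFactors hp
  have hexc : ∀ a ∈ S₁, ∃ E : ∀ p : ℕ, Finset (ZMod p), ∀ (p : ℕ) [Fact p.Prime], p ∣ q →
      (E p).card ≤ N ∧ ∀ x T Y : ℤ, (x : ZMod p) ∉ E p →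
        (p : ℤ) ∣ (polyOf (N + 2) (withTail (N + 2) (Function.update a N x) T Y)).eval l →
        (p : ℤ) ∣ (polyOf (N + 2) (withTail (N + 2) (Function.update a N x) T Y)).derivative.eval l →
        NonsingularMod (polyOf (N + 2) (withTail (N + 2) (Function.update a N x) T Y)) p := by
    intro a ha
    obtain ⟨-, hlead, -⟩ := h2 a ha
    have : ∀ p : ℕ, ∃ E : Finset (ZMod p), ∀ [Fact p.Prime], p ∣ q →
      E.card ≤ N ∧ ∀ x T Y : ℤ, (x : ZMod p) ∉ E →
        (p : ℤ) ∣ (polyOf (N + 2) (withTail (N + 2) (Function.update a N x) T Y)).eval l →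
        (p : ℤ) ∣ (polyOf (N + 2) (withTail (N + 2) (Function.update a N x) T Y)).derivative.eval l →
        NonsingularMod (polyOf (N + 2) (withTail (N + 2) (Function.update a N x) T Y)) p := by
      intro p
      by_cases hp : p.Prime ∧ p ∣ q
      · have : Fact p.Prime := ⟨hp.1⟩
        have hpM := hqM p (Nat.mem_primeFactors.2 ⟨hp.1, hp.2, hq.ne_zero⟩)
        obtain ⟨E, hE1, hE2⟩ := exists_excluded p hN (by omega) a l
          (not_dvd_both_of_isCoprime hp.1 hlead.coprime)
        refine ⟨E, fun _ => ⟨hE1, fun x T Y hx => hE2 x T Y hx (polyOf_natDegree _ _ ?_)⟩⟩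
        rw [withTail_of_lt _ _ _ (by omega), Function.update_of_ne (by omega)]
        intro h0
        have := hlead.lower
        rw [h0] at this
        simp at this
        linarith
      · refine ⟨∅, fun {h} hpq => absurd ⟨h.out, hpq⟩ hp⟩
    choose E hE using this
    exact ⟨E, fun p _ => hE p⟩
  have hT : ∀ a ∈ S₁, ∃ T : Finset ℤ, κ * (s * t ^ N) / (2 * W) *
      ∏ p ∈ q.primeFactors, (1 - (N : ℝ) / p) ≤ T.card ∧ ∀ x ∈ T,
        (0 ≤ x ∧ (x : ℝ) ≤ κ * (s * t ^ N) ∧ (W : ℤ) ∣ x - r N) ∧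
        ∀ (p : ℕ) [Fact p.Prime], p ∣ q → ∀ T Y : ℤ,
        (p : ℤ) ∣ (polyOf (N + 2) (withTail (N + 2) (Function.update a N x) T Y)).eval l →
        (p : ℤ) ∣ (polyOf (N + 2) (withTail (N + 2) (Function.update a N x) T Y)).derivative.eval l →
        NonsingularMod (polyOf (N + 2) (withTail (N + 2) (Function.update a N x) T Y)) p := by
    intro a ha
    obtain ⟨E, hE⟩ := hexc a ha
    obtain ⟨T, hT1, hT2⟩ := exists_crt_interval hW (r N) E q.primeFactors (by
      intro p hp
      refine ⟨hprime p hp, fun h => ?_⟩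
      have := (hWM p (hprime p hp)).1 h
      have := hqM p hp
      omega) N (by
      intro p hp
      have : Fact p.Prime := ⟨hprime p hp⟩
      have := hqM p hp
      exact ⟨(hE p (Nat.dvd_of_mem_primeFactors hp)).1, by omega⟩) (κ * (s * t ^ N)) (by
      rw [Nat.prod_primeFactors_of_squarefree hq]
      push_cast
      rw [← mul_assoc]
      gcongr)
    refine ⟨T, hT1, fun x hx => ?_⟩
    obtain ⟨h5, h6, h7, h8⟩ := hT2 x hx
    refine ⟨⟨h5, h6, h7⟩, fun p hp hpq A Y => (hE p hpq).2 x A Y (h8 p ?_)⟩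
    exact Nat.mem_primeFactors.2 ⟨hp.out, hpq, hq.ne_zero⟩
  choose! T hT1 hT2 using hT
  obtain ⟨S₂, h3, h4⟩ := exists_card_update (fun a ha => (h2 a ha).1) T _ hT1
  refine ⟨S₂, ?_, ?_⟩
  · refine le_trans ?_ h3
    gcongr
    · refine mul_nonneg (by positivity) (Finset.prod_nonneg fun p hp => sub_nonneg.2 ?_)
      have := hqM p hp
      rw [div_le_one (by exact_mod_cast (hprime p hp).pos)]
      exact_mod_cast (by omega : N ≤ p)
    · refine le_trans ?_ h1
      gcongr
  · intro b hb
    obtain ⟨h5, a, ha, x, hx, rfl⟩ := h4 b hb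
    obtain ⟨h6, h7, h8⟩ := h2 a ha
    obtain ⟨h9, h10⟩ := hT2 a ha x hx
    exact ⟨h5, h7.update (by omega) x, h8.update h9, h10⟩

end UltraWeak

end

noncomputable section
namespace UltraWeak
open Polynomial

/-! ### Tails and the resulting family -/

theorem horner_succ (a : ℕ → ℤ) (l : ℤ) (k : ℕ) :
    horner a l (k + 1) = l * horner a l k + a (k + 1) := rfl

theorem eval_withTail (N : ℕ) (a : ℕ → ℤ) (l T Y : ℤ) :
    (polyOf (N + 2) (withTail (N + 2) a T Y)).eval l = l * (l * horner a l N + T) + Y := by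
  rw [eval_polyOf_eq_horner, horner_succ, horner_succ, withTail_last,
    show N + 1 = N + 2 - 1 from rfl, withTail_pred (by omega),
    horner_congr (b := a) fun i hi => withTail_of_lt _ _ _ (by omega)]

theorem eval_derivative_withTail (N : ℕ) (a : ℕ → ℤ) (l T Y : ℤ) :
    (polyOf (N + 2) (withTail (N + 2) a T Y)).derivative.eval l =
      l * dblHorner a l N + (l * horner a l N + T) := by
  rw [eval_derivative_polyOf, dblHorner_succ,
    show N + 1 = N + 2 - 1 from rfl, withTail_pred (by omega),
    horner_congr (b := a) fun i hi => withTail_of_lt _ _ _ (by omega),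
    dblHorner_congr (b := a) fun i hi => withTail_of_lt _ _ _ (by omega)]

/-- The tail coefficients that are counted, for a given head. -/
structure IsTail (N M m : ℕ) (l : ℤ) (r : ℕ → ℤ) (κ s t : ℝ) (a : ℕ → ℤ) (T Y : ℤ) : Prop where
  nonneg : 0 ≤ T
  le : T ≤ κ * (s * t ^ (N + 1))
  lower : s * t ^ (N + 2) / 4 ≤ Y
  upper : Y ≤ s * t ^ (N + 2)
  weaklyDivisibleAt : WeaklyDivisibleAt (polyOf (N + 2) (withTail (N + 2) a T Y)) m l
  dvd : ∀ p : ℕ, p.Prime → p ≤ M → ¬ p ∣ m → (p : ℤ) ∣ T - r (N + 1) ∧ (p : ℤ) ∣ Y - r (N + 2)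
  not_degenerateAt : ∀ p : ℕ, p.Prime → M < p → ¬ p ∣ m →
    ¬ DegenerateAt (N + 2) p (polyOf (N + 2) (withTail (N + 2) a T Y))

/-- The room for a_n modulo m² thus implies the room for a_{n-1} modulo m, so one parameter h
controls both ranges. -/
theorem le_pow_of_sq {s t h m : ℝ} {N : ℕ} (hs : 1 ≤ s) (ht : 1 ≤ t) (hm : 0 ≤ m) (hh : 0 ≤ h)
    (hmh : m ^ 2 * h ^ 2 ≤ s * t ^ (N + 2)) : m * h ≤ s * t ^ (N + 1) := by
  refine (pow_le_pow_iff_left₀ (by positivity) (by positivity) two_ne_zero).1 ?_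
  calc (m * h) ^ 2 ≤ s * t ^ (N + 2) := by rwa [mul_pow]
    _ ≤ s * t ^ (N + 2) * (s * t ^ N) := by
        refine le_mul_of_one_le_right (by positivity) ?_
        exact one_le_mul_of_one_le_of_one_le hs (one_le_pow₀ ht)
    _ = (s * t ^ (N + 1)) ^ 2 := by ring

-- For a fixed head, a_{n-1} runs through a progression of step mP and a_n through one of step m²P,
-- where P is the product of the primes ≤ M not dividing m. Both progressions have length at least a
-- constant times h, while all coefficients are at most about h^ρ. The sieve therefore applies with
-- a fixed exponent.
set_option maxHeartbeats 1000000 in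
theorem exists_tails {N : ℕ} (hN : 1 ≤ N) : ∃ M₁ : ℕ, ∃ δ > (0 : ℝ), ∀ M, M₁ ≤ M → ∀ W : ℕ, 0 < W →
    (∀ p : ℕ, p.Prime → (p ∣ W ↔ p ≤ M)) → ∀ κ : ℝ, 0 < κ → κ ≤ 1 → ∀ ρ : ℕ, ∃ Y₀ : ℝ,
    ∀ (s t h : ℝ) (m q : ℕ) (l : ℤ) (r a : ℕ → ℤ), Y₀ ≤ h → 1 ≤ s → 1 ≤ t →
      s * t ^ (N + 2) ≤ h ^ ρ → (m : ℝ) ^ 2 * h ^ 2 ≤ s * t ^ (N + 2) → 0 < m →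
      IsHead N W M q l r κ s t δ a →
      ∃ G : Finset (ℤ × ℤ), κ * (s * t ^ (N + 1)) / (2 * m * W) * (s * t ^ (N + 2) / (4 * m ^ 2 * W)) / 2
          ≤ G.card ∧
        ∀ z ∈ G, IsTail N M m l r κ s t a z.1 z.2 := by
  classical
  obtain ⟨M₁, δ, hδ, D, K, hgood⟩ := exists_good_tails (N + 2) (by omega)
  refine ⟨M₁, δ, hδ, fun M hM W hW hWM κ hκ hκ1 ρ => ?_⟩
  -- The quantity K H^D is O(h^{ρD}); the extra power of Z absorbs the constants once h is large.
  obtain ⟨Z₀, hZ₀⟩ := hgood M hM (ρ * D + 1)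
  have hWr : (1 : ℝ) ≤ W := by exact_mod_cast hW
  set c₀ : ℝ := κ / (4 * W) with hc₀
  have hc₀pos : 0 < c₀ := by positivity
  have hc₀1 : c₀ ≤ 1 := by
    rw [hc₀, div_le_one (by positivity)]
    linarith
  refine ⟨max (max (4 * W / κ) (Z₀ / c₀)) (K * 2 ^ D / c₀ ^ (ρ * D + 1) + 1), ?_⟩
  intro s t h m q l r a hh hs ht hH hmh hm hhead
  have hh1 : 1 ≤ c₀ * h := by
    have := le_of_max_le_left (le_of_max_le_left hh)
    rw [div_le_iff₀ hκ] at this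
    rw [hc₀, div_mul_eq_mul_div, le_div_iff₀ (by positivity)]
    linarith
  have hhpos : 0 < h := pos_of_mul_pos_right (by linarith) hc₀pos.le
  have hh1' : 1 ≤ h := by nlinarith
  have hhZ : (Z₀ : ℝ) ≤ c₀ * h := by
    have := le_of_max_le_right (le_of_max_le_left hh)
    rwa [div_le_iff₀' hc₀pos] at this
  have hhK : K * 2 ^ D < c₀ ^ (ρ * D + 1) * h := by
    have := le_of_max_le_right hh
    have h2 : K * 2 ^ D / c₀ ^ (ρ * D + 1) < h := by linarith
    rwa [div_lt_iff₀' (by positivity)] at h2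
  have hmr : (0 : ℝ) < m := by exact_mod_cast hm
  have hs0 : 0 < s := by linarith
  have ht0 : 0 < t := by linarith
  set 𝒬 := (Finset.range (M + 1)).filter fun p => p.Prime ∧ ¬ p ∣ m with h𝒬
  have h𝒬p : ∀ p ∈ 𝒬, p.Prime ∧ ¬ p ∣ m := fun p hp => (Finset.mem_filter.1 hp).2
  set P := ∏ p ∈ 𝒬, p with hP
  have hPpos : 0 < P := Finset.prod_pos fun p hp => (h𝒬p p hp).1.pos
  have hPW : P ∣ W := by
    refine Finset.prod_primes_dvd W (fun p hp => (h𝒬p p hp).1.prime) fun p hp => ?_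
    exact (hWM p (h𝒬p p hp).1).2 (Nat.lt_succ_iff.1 (Finset.mem_range.1 (Finset.mem_filter.1 hp).1))
  have hPr : (0 : ℝ) < P := by exact_mod_cast hPpos
  have hPWr : (P : ℝ) ≤ W := by exact_mod_cast Nat.le_of_dvd hW hPW
  obtain ⟨u, hu0, hu1, hu2, hu3⟩ := exists_crt hm (-(l * dblHorner a l N + l * horner a l N))
    (fun _ => r (N + 1)) 𝒬 h𝒬p
  have hm2 : 0 < m ^ 2 := pow_pos hm 2
  -- The class of a_n modulo m² depends on the value T already chosen for a_{n-1}.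
  have hV : ∀ T : ℤ, ∃ v : ℤ, 0 ≤ v ∧ v < ((m ^ 2 * P : ℕ) : ℤ) ∧
      ((m ^ 2 : ℕ) : ℤ) ∣ v - -(l * (l * horner a l N + T)) ∧ ∀ p ∈ 𝒬, (p : ℤ) ∣ v - r (N + 2) :=
    fun T => exists_crt hm2 _ (fun _ => r (N + 2)) 𝒬
      fun p hp => ⟨(h𝒬p p hp).1, fun hd => (h𝒬p p hp).2 ((h𝒬p p hp).1.dvd_of_dvd_pow hd)⟩
  choose V hV0 hV1 hV2 hV3 using hV
  have hH2 : m * h ≤ s * t ^ (N + 1) := le_pow_of_sq hs ht hmr.le hhpos.le hmh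
  set xJ : ℝ := κ * (s * t ^ (N + 1)) / (m * P) with hxJ
  set xL : ℝ := s * t ^ (N + 2) / (2 * (m ^ 2 * P)) with hxL
  set J := ⌊xJ⌋₊ with hJ
  set L := ⌊xL⌋₊ with hL
  have hxJ0 : 0 ≤ xJ := by positivity
  have hxL0 : 0 ≤ xL := by positivity
  have hxJl : 4 * (c₀ * h) ≤ xJ := by
    rw [hxJ, le_div_iff₀ (by positivity), hc₀]
    calc 4 * (κ / (4 * W) * h) * (m * P) = κ * (m * h) * (P / W) := by field_simp
      _ ≤ κ * (m * h) * 1 := by gcongr; rwa [div_le_one (by positivity)]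
      _ ≤ _ := by rw [mul_one]; gcongr
  have hxLl : 2 * (c₀ * h) ≤ xL := by
    rw [hxL, le_div_iff₀ (by positivity), hc₀]
    calc 2 * (κ / (4 * W) * h) * (2 * (m ^ 2 * P)) = κ * (m ^ 2 * (1 * h)) * (P / W) := by
          field_simp; norm_num
      _ ≤ 1 * (m ^ 2 * (h * h)) * 1 := by
          gcongr; rwa [div_le_one (by positivity)]
      _ ≤ _ := by rw [mul_one, one_mul, ← pow_two]; exact hmh
  have hJl : xJ / 2 ≤ J := half_le_floor (by linarith)
  have hLl : xL / 2 ≤ L := half_le_floor (by linarith)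
  set Z := min J L with hZ
  have hZl : c₀ * h ≤ Z := by
    rw [hZ, Nat.cast_min]
    exact le_min (by linarith) (by linarith)
  have hTrange : ∀ j < J, 0 ≤ u + ((m * P : ℕ) : ℤ) * j ∧
      ((u + ((m * P : ℕ) : ℤ) * j : ℤ) : ℝ) ≤ κ * (s * t ^ (N + 1)) := by
    intro j hj
    refine ⟨by positivity, ?_⟩
    have h1 : (j : ℝ) + 1 ≤ xJ := le_trans (by exact_mod_cast hj) (Nat.floor_le hxJ0)
    rw [hxJ, le_div_iff₀ (by positivity)] at h1
    have h2 : (u : ℝ) < m * P := by exact_mod_cast hu1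
    push_cast
    linarith
  set H : ℤ := ⌈s * t ^ (N + 2)⌉ with hHdef
  have hH0 : s * t ^ (N + 2) ≤ H := Int.le_ceil _
  have hst1 : 1 ≤ s * t ^ (N + 2) := one_le_mul_of_one_le_of_one_le hs (one_le_pow₀ ht)
  have hHu : (H : ℝ) ≤ 2 * h ^ ρ := by
    have := (Int.ceil_lt_add_one (s * t ^ (N + 2))).le
    linarith
  have hle : ∀ (κ' : ℝ) (i : ℕ), 0 ≤ κ' → κ' ≤ 1 → i ≤ N + 2 → κ' * (s * t ^ i) ≤ H := by
    intro κ' i h0 h1 hi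
    calc κ' * (s * t ^ i) ≤ 1 * (s * t ^ (N + 2)) := by gcongr
      _ ≤ H := by rwa [one_mul]
  have hlead := hhead.leading
  have hapos : (0 : ℝ) < a 0 := by linarith [hlead.lower]
  have ha0 : 0 < a 0 := by exact_mod_cast hapos
  -- The offset m²P·L moves a_n into [s t^n / 4, s t^n]; the lower bound keeps the complex roots
  -- away from zero.
  obtain ⟨G, hG1, hG2, hG3⟩ := hZ₀ J L Z (by exact_mod_cast hhZ.trans hZl) (min_le_left _ _)
    (min_le_right _ _) m a u ((m * P : ℕ) : ℤ) ((m ^ 2 * P : ℕ) : ℤ) H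
    (fun j => V (u + ((m * P : ℕ) : ℤ) * j) + ((m ^ 2 * P : ℕ) : ℤ) * L) ha0.ne' hlead.coprime
    (by exact_mod_cast hst1.trans hH0) (by positivity) (by
      intro i hi
      rw [abs_of_nonneg]
      · have : (a i : ℝ) ≤ H := by
          rcases Nat.lt_or_ge i 2 with h2 | h2
          · have := hle 1 0 zero_le_one le_rfl (by omega)
            rw [pow_zero, one_mul, mul_one] at this
            interval_cases i
            · exact hlead.upper.trans this
            · linarith [hlead.lt]
          · exact (hhead.middle i h2 (by omega)).2.1.trans (hle κ i hκ.le hκ1 (by omega))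
        exact_mod_cast this
      · rcases Nat.lt_or_ge i 2 with h2 | h2
        · interval_cases i
          · exact ha0.le
          · exact zero_le_one.trans hlead.one_le
        · exact (hhead.middle i h2 (by omega)).1) (by
      intro j hj
      obtain ⟨h1, h2⟩ := hTrange j hj
      rw [abs_of_nonneg h1]
      exact_mod_cast h2.trans (hle κ (N + 1) hκ.le hκ1 (by omega))) (by
      have h1 : (K : ℝ) * H ^ D < (Z : ℝ) ^ (ρ * D + 1) := by
        calc (K : ℝ) * H ^ D ≤ K * (2 * h ^ ρ) ^ D := by
              have : (0 : ℝ) ≤ H := by linarith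
              gcongr
          _ = K * 2 ^ D * h ^ (ρ * D) := by rw [mul_pow, pow_mul]; ring
          _ < c₀ ^ (ρ * D + 1) * h * h ^ (ρ * D) := by gcongr
          _ = (c₀ * h) ^ (ρ * D + 1) := by rw [mul_pow, pow_succ h]; ring
          _ ≤ _ := by gcongr
      exact_mod_cast h1) (by
      intro p hp hMp hpm
      have hpP : ¬ p ∣ P := by
        intro hd
        have := (hWM p hp).1 (hd.trans hPW)
        omega
      constructor
      · rw [Int.natCast_dvd_natCast, hp.dvd_mul]
        exact not_or.2 ⟨hpm, hpP⟩
      · rw [Int.natCast_dvd_natCast, hp.dvd_mul]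
        exact not_or.2 ⟨fun hd => hpm (hp.dvd_of_dvd_pow hd), hpP⟩) hlead.sum_le
  refine ⟨G.image fun x => (u + ((m * P : ℕ) : ℤ) * x.1,
    V (u + ((m * P : ℕ) : ℤ) * x.1) + ((m ^ 2 * P : ℕ) : ℤ) * L + ((m ^ 2 * P : ℕ) : ℤ) * x.2), ?_, ?_⟩
  · rw [Finset.card_image_of_injective]
    · refine le_trans ?_ hG2
      calc _ ≤ (xJ / 2) * (xL / 2) / 2 := by
            rw [hxJ, hxL]
            have e1 : κ * (s * t ^ (N + 1)) / (2 * m * W) ≤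
                κ * (s * t ^ (N + 1)) / (m * P) / 2 := by
              rw [div_div]
              refine div_le_div_of_nonneg_left (by positivity) (by positivity) ?_
              calc (m : ℝ) * P * 2 ≤ m * W * 2 := by gcongr
                _ = _ := by ring
            have e2 : s * t ^ (N + 2) / (4 * m ^ 2 * W) ≤
                s * t ^ (N + 2) / (2 * (m ^ 2 * P)) / 2 := by
              rw [div_div]
              refine div_le_div_of_nonneg_left (by positivity) (by positivity) ?_
              calc 2 * ((m : ℝ) ^ 2 * P) * 2 ≤ 2 * (m ^ 2 * W) * 2 := by gcongr
                _ = _ := by ring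
            gcongr
        _ ≤ _ := by gcongr
    · rintro ⟨x, y⟩ ⟨x', y'⟩ hxy
      have e1 : ((m * P : ℕ) : ℤ) ≠ 0 := by positivity
      have e2 : ((m ^ 2 * P : ℕ) : ℤ) ≠ 0 := by positivity
      obtain ⟨h1, h2⟩ := Prod.mk.inj hxy
      simp only at h1 h2
      have h3 := mul_left_cancel₀ e1 (add_left_cancel h1)
      have h4 : x = x' := by exact_mod_cast h3
      subst h4
      have h5 := mul_left_cancel₀ e2 (add_left_cancel h2)
      have h6 : y = y' := by exact_mod_cast h5
      rw [h6]
  · intro z hz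
    obtain ⟨⟨j, k⟩, hjk, rfl⟩ := Finset.mem_image.1 hz
    obtain ⟨hj, hk⟩ := Finset.mem_product.1 (hG1 hjk)
    have hj' := hTrange j (Finset.mem_range.1 hj)
    set T := u + ((m * P : ℕ) : ℤ) * j with hT
    have hdm : (m : ℤ) ∣ ((m * P : ℕ) : ℤ) := Int.natCast_dvd_natCast.2 (Dvd.intro _ rfl)
    have hdm2 : ((m ^ 2 : ℕ) : ℤ) ∣ ((m ^ 2 * P : ℕ) : ℤ) :=
      Int.natCast_dvd_natCast.2 (Dvd.intro _ rfl)
    have hm2r : (0 : ℝ) < (m : ℝ) ^ 2 * P := by positivity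
    have hLu : (L : ℝ) ≤ xL := Nat.floor_le hxL0
    have hkr : (k : ℝ) + 1 ≤ L := by exact_mod_cast Finset.mem_range.1 hk
    have hV0' : (0 : ℝ) ≤ V T := by exact_mod_cast hV0 T
    have hV1' : (V T : ℝ) < m ^ 2 * P := by exact_mod_cast hV1 T
    have hxLe : xL * (m ^ 2 * P) = s * t ^ (N + 2) / 2 := by
      rw [hxL]; field_simp
    refine ⟨hj'.1, hj'.2, ?_, ?_, ⟨?_, ?_⟩, ?_, ?_⟩
    · push_cast
      nlinarith [mul_le_mul_of_nonneg_right hLl hm2r.le,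
        mul_nonneg hm2r.le (Nat.cast_nonneg k : (0 : ℝ) ≤ k)]
    · push_cast
      nlinarith [mul_le_mul_of_nonneg_right hLu hm2r.le, mul_le_mul_of_nonneg_right hkr hm2r.le]
    · rw [eval_withTail]
      have h1 := hV2 T
      push_cast at h1 hdm2 ⊢
      have h2 : l * (l * horner a l N + T) + (V T + (m : ℤ) ^ 2 * P * L + (m : ℤ) ^ 2 * P * k) =
        (V T - -(l * (l * horner a l N + T))) + (m : ℤ) ^ 2 * P * (L + k) := by ring
      rw [h2]
      exact dvd_add h1 (hdm2.mul_right _)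
    · rw [eval_derivative_withTail]
      have h2 : l * dblHorner a l N + (l * horner a l N + T) =
        (u - -(l * dblHorner a l N + l * horner a l N)) + ((m * P : ℕ) : ℤ) * j := by
        rw [hT]; ring
      rw [h2]
      exact dvd_add hu2 (hdm.mul_right _)
    · intro p hp hpM hpm
      have hp𝒬 : p ∈ 𝒬 := Finset.mem_filter.2 ⟨Finset.mem_range.2 (by omega), hp, hpm⟩
      have hpP : (p : ℤ) ∣ (P : ℤ) := Int.natCast_dvd_natCast.2 (Finset.dvd_prod_of_mem _ hp𝒬)
      constructor
      · have h2 : T - r (N + 1) = (u - r (N + 1)) + P * (m * j) := by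
          rw [hT]; push_cast; ring
        rw [h2]
        exact dvd_add (hu3 p hp𝒬) (hpP.mul_right _)
      · have h2 : V T + ((m ^ 2 * P : ℕ) : ℤ) * L + ((m ^ 2 * P : ℕ) : ℤ) * k - r (N + 2) =
            (V T - r (N + 2)) + P * (m ^ 2 * (L + k)) := by
          push_cast; ring
        rw [h2]
        exact dvd_add (hV3 T p hp𝒬) (hpP.mul_right _)
    · exact hG3 (j, k) hjk

end UltraWeak

end

/-! ### Assembling heads and tails into the counted family -/

noncomputable section
namespace UltraWeak
open Polynomial

/-- Polynomials of degree `n` in a sub-box of `W(s : t)`. -/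
structure IsNice (n : ℕ) (κ s t : ℝ) (f : ℤ[X]) : Prop where
  natDegree_eq : f.natDegree = n
  lower : s / 2 < f.coeff n
  upper : f.coeff n ≤ s
  one_le : 1 ≤ f.coeff (n - 1)
  lt : f.coeff (n - 1) < s / 4
  coprime : IsCoprime (f.coeff n) (f.coeff (n - 1))
  coprime_degree : IsCoprime (f.coeff n) ((n : ℤ) - 2)
  middle : ∀ i, 2 ≤ i → i < n → 0 ≤ f.coeff (n - i) ∧ (f.coeff (n - i) : ℝ) ≤ κ * (s * t ^ i)
  const_lower : s * t ^ n / 4 ≤ f.coeff 0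
  const_upper : f.coeff 0 ≤ s * t ^ n

theorem isNice_withTail {N W M m q : ℕ} {l : ℤ} {r : ℕ → ℤ} {κ s t δ : ℝ} {a : ℕ → ℤ} {T Y : ℤ}
    (hs : 0 < s) (ha : IsHead N W M q l r κ s t δ a) (h : IsTail N M m l r κ s t a T Y) (hN : 1 ≤ N)
    (hcop : IsCoprime (a 0) N) :
    IsNice (N + 2) κ s t (polyOf (N + 2) (withTail (N + 2) a T Y)) := by
  set b := withTail (N + 2) a T Y with hb
  have hb' : ∀ i, i ≤ N → b i = a i := fun i hi => withTail_of_lt _ _ _ (by omega)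
  have hc : ∀ {i}, i ≤ N + 2 → (polyOf (N + 2) b).coeff (N + 2 - i) = b i := polyOf_coeff (N + 2) b
  have h0 := hc (i := 0) (by omega)
  have h1 := hc (i := 1) (by omega)
  have h2 := hc (i := N + 2) le_rfl
  rw [hb' _ (by omega), Nat.sub_zero] at h0
  rw [hb' _ (by omega)] at h1
  rw [hb, withTail_last, Nat.sub_self] at h2
  obtain ⟨hl1, hl2, hl3, hl4, hl5, hl6, hl7, hl8⟩ := ha.leading
  constructor
  · refine polyOf_natDegree _ _ ?_
    rw [hb' _ (by omega)]
    intro h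
    rw [h] at hl3
    simp at hl3
    linarith
  · rwa [h0]
  · rwa [h0]
  · rwa [h1]
  · rwa [h1]
  · rwa [h0, h1]
  · rw [h0]
    convert! hcop using 1
    push_cast
    ring
  · intro i hi2 hi
    rw [hc (by omega)]
    rcases Nat.lt_or_ge i (N + 1) with h' | h'
    · rw [hb' i (by omega)]
      have := ha.middle i hi2 h'
      exact ⟨this.1, this.2.1⟩
    · obtain rfl : i = N + 2 - 1 := by omega
      rw [hb, withTail_pred (by omega)]
      exact ⟨h.nonneg, h.le⟩
  · rw [h2]; exact h.lower
  · rw [h2]; exact h.upper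

/-- Heads vanish from index n - 1 on, so the polynomial recovers head and tail. -/
theorem withTail_polyOf_injective {n : ℕ} {a a' : ℕ → ℤ} {T T' Y Y' : ℤ} (hn : 1 ≤ n)
    (ha : ∀ i, n ≤ i + 1 → a i = 0) (ha' : ∀ i, n ≤ i + 1 → a' i = 0)
    (h : polyOf n (withTail n a T Y) = polyOf n (withTail n a' T' Y')) :
    a = a' ∧ T = T' ∧ Y = Y' := by
  have hc : ∀ i ≤ n, withTail n a T Y i = withTail n a' T' Y' i := by
    intro i hi
    rw [← polyOf_coeff n (withTail n a T Y) hi, h, polyOf_coeff n _ hi]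
  refine ⟨funext fun i => ?_, ?_, ?_⟩
  · by_cases hi : i + 1 < n
    · have := hc i (by omega)
      rwa [withTail_of_lt _ _ _ hi, withTail_of_lt _ _ _ hi] at this
    · rw [ha i (by omega), ha' i (by omega)]
  · have := hc (n - 1) (by omega)
    rwa [withTail_pred hn, withTail_pred hn] at this
  · have := hc n le_rfl
    rwa [withTail_last, withTail_last] at this

/-- The common properties of the pairs `(f, l)` that are counted. -/
structure IsGood (n M m q : ℕ) (κ s t : ℝ) (f : ℤ[X]) (l : ℤ) : Prop where
  isNice : IsNice n κ s t f
  nonneg : 0 ≤ l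
  lt : l < m
  weaklyDivisibleAt : WeaklyDivisibleAt f m l
  ultraWeaklyDivisible : UltraWeaklyDivisible f
  nonsingularMod : ∀ (p : ℕ) [Fact p.Prime], (p ∣ m → M < p → p ∣ q) → NonsingularMod f p

theorem eval_derivative_sq_mul {k : Type*} [CommRing k] (c : k) (G : k[X]) :
    ((X - C c) ^ 2 * G).derivative.eval c = 0 := by
  simp [derivative_mul, pow_two]

/-- Modulo each p ≤ M the polynomial reduces to the prescribed target; modulo larger primes the tail
is non-degenerate or, if p | q, the head guarantees nonsingularity. -/
theorem isGood_withTail {N W M m q : ℕ} {l : ℤ} {b : ℕ → ℕ → ℤ} {r : ℕ → ℤ} {κ s t δ : ℝ}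
    {a : ℕ → ℤ} {T Y : ℤ} (hN : 3 ≤ N) (hM : N + 2 ≤ M)
    (hW : ∀ p : ℕ, p.Prime → p ≤ M → p ∣ W) (hs : 0 < s) (hl : 0 ≤ l ∧ l < m)
    (hb0 : ∀ p, b p 0 = 1)
    (hb1 : ∀ (p : ℕ) [Fact p.Prime], ¬ p ∣ m → ∀ x, (redn (polyOf (N + 2) (b p)) p).eval x = 0 →
      (redn (polyOf (N + 2) (b p)) p).derivative.eval x ≠ 0)
    (hb2 : ∀ (p : ℕ) [Fact p.Prime], p ∣ m → ∃ G : (AlgebraicClosure (ZMod p))[X],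
      redn (polyOf (N + 2) (b p)) p = (X - C (l : AlgebraicClosure (ZMod p))) ^ 2 * G ∧
      G.eval (l : AlgebraicClosure (ZMod p)) ≠ 0 ∧ ∀ x, G.eval x = 0 → G.derivative.eval x ≠ 0)
    (hr : ∀ p : ℕ, p.Prime → p ≤ M → ∀ i, (p : ℤ) ∣ r i - b p i)
    (ha : IsHead N W M q l r κ s t δ a) (h : IsTail N M m l r κ s t a T Y) :
    IsGood (N + 2) M m q κ s t (polyOf (N + 2) (withTail (N + 2) a T Y)) l := by
  -- A prime factor of N = n - 2 is at most M, while a_0 ≡ 1 modulo all such primes. This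
  -- coprimality is needed for rigidity.
  have hcopN : IsCoprime (a 0) N := by
    rw [Int.isCoprime_iff_gcd_eq_one]
    by_contra h1
    obtain ⟨p, hp, hpd⟩ := Nat.exists_prime_and_dvd h1
    have hd1 : (p : ℤ) ∣ a 0 := (Int.natCast_dvd_natCast.2 hpd).trans (Int.gcd_dvd_left _ _)
    have hd2 : (p : ℤ) ∣ N := (Int.natCast_dvd_natCast.2 hpd).trans (Int.gcd_dvd_right _ _)
    have hpM : p ≤ M := by
      have := Nat.le_of_dvd (by omega) (Int.natCast_dvd_natCast.1 hd2)
      omega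
    have h3 := (Int.natCast_dvd_natCast.2 (hW p hp hpM)).trans ha.leading.dvd_zero
    have h4 := dvd_sub (dvd_sub hd1 h3) (hr p hp hpM 0)
    rw [sub_sub_cancel, hb0, sub_sub_cancel] at h4
    exact (Nat.prime_iff_prime_int.1 hp).not_isUnit (isUnit_of_dvd_one h4)
  have hnice := isNice_withTail hs ha h (by omega) hcopN
  set c := withTail (N + 2) a T Y with hc
  set f := polyOf (N + 2) c with hf
  have hdeg := hnice.natDegree_eq
  have hac : ∀ i, i ≤ N → c i = a i := fun i hi => withTail_of_lt _ _ _ (by omega)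
  have hW' : ∀ p : ℕ, p.Prime → p ≤ M → ∀ i ≤ N, (p : ℤ) ∣ c i - b p i := by
    intro p hp hpM i hi
    have h1 : (p : ℤ) ∣ W := Int.natCast_dvd_natCast.2 (hW p hp hpM)
    have h2 : (W : ℤ) ∣ a i - r i := by
      rcases Nat.lt_or_ge i 2 with h2 | h2
      · interval_cases i
        · exact ha.leading.dvd_zero
        · exact ha.leading.dvd_one
      · exact (ha.middle i h2 (by omega)).2.2
    rw [hac i hi, ← sub_add_sub_cancel (a i) (r i) (b p i)]
    exact dvd_add (h1.trans h2) (hr p hp hpM i)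
  have hcop : IsCoprime (f.coeff f.natDegree) (f.coeff (f.natDegree - 1)) := by
    rw [hdeg]; exact hnice.coprime
  -- For p | m the tail is not prescribed mod p, but both polynomials have a double root at l, and
  -- that fixes the last two coefficients.
  have hred : ∀ (p : ℕ) [Fact p.Prime], p ≤ M → redn f p = redn (polyOf (N + 2) (b p)) p := by
    intro p hp hpM
    by_cases hpm : p ∣ m
    · obtain ⟨G, hG, -, -⟩ := hb2 p hpm
      have hw := h.weaklyDivisibleAt.of_dvd hpm
      have hw0 : (p : ℤ) ∣ f.eval l := (Dvd.intro_left _ (by rw [pow_two])).trans hw.1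
      refine redn_polyOf_eq_of_double p (by omega) (l := (l : AlgebraicClosure (ZMod p)))
        (fun i hi => hW' p hp.out hpM i (by omega)) ?_ ?_ ?_ ?_
      · rw [redn_eq_sq_mul p hw0 hw.2]; simp
      · rw [redn_eq_sq_mul p hw0 hw.2]; exact eval_derivative_sq_mul _ _
      · rw [hG]; simp
      · rw [hG]; exact eval_derivative_sq_mul _ _
    · refine redn_polyOf_eq_of_forall p fun i hi => ?_
      obtain ⟨h1, h2⟩ := h.dvd p hp.out hpM hpm
      rcases Nat.lt_or_ge i (N + 1) with h' | h'
      · exact hW' p hp.out hpM i (by omega)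
      · rcases Nat.lt_or_ge i (N + 2) with h'' | h''
        · obtain rfl : i = N + 2 - 1 := by omega
          rw [hc, withTail_pred (by omega), ← sub_add_sub_cancel T (r (N + 2 - 1))]
          exact dvd_add h1 (hr p hp.out hpM _)
        · obtain rfl : i = N + 2 := by omega
          rw [hc, withTail_last, ← sub_add_sub_cancel Y (r (N + 2))]
          exact dvd_add h2 (hr p hp.out hpM _)
  have hsmall : ∀ (p : ℕ) [Fact p.Prime], p ≤ M → ¬ p ∣ m → ¬ (p : ℤ) ∣ f.coeff f.natDegree ∧
      ∀ x, (redn f p).eval x = 0 → (redn f p).derivative.eval x ≠ 0 := by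
    intro p hp hpM hpm
    constructor
    · rw [hdeg]
      have h0 := polyOf_coeff (N + 2) c (Nat.zero_le _)
      rw [Nat.sub_zero] at h0
      rw [h0]
      intro hd
      have := dvd_sub hd (hW' p hp.out hpM 0 (Nat.zero_le _))
      rw [sub_sub_cancel, hb0] at this
      exact (Nat.prime_iff_prime_int.1 hp.out).not_isUnit (isUnit_of_dvd_one this)
    · rw [hred p hpM]
      exact hb1 p hpm
  have hlarge : ∀ p : ℕ, p.Prime → M < p → ¬ p ∣ m → ¬ DegenerateAt f.natDegree p f := by
    rw [hdeg]; exact h.not_degenerateAt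
  refine ⟨hnice, hl.1, hl.2, h.weaklyDivisibleAt, ?_, ?_⟩
  · exact ultraWeaklyDivisible_of_forall (by omega) (by omega) h.weaklyDivisibleAt hcop hsmall hlarge
  · intro p hp hpq
    by_cases hpm : p ∣ m
    · rcases Nat.lt_or_ge M p with hMp | hMp
      · have hw := h.weaklyDivisibleAt.of_dvd hpm
        exact ha.nonsingular p (hpq hpm hMp) T Y
          ((Dvd.intro_left _ (by rw [pow_two])).trans hw.1) hw.2
      · obtain ⟨G, hG1, hG2, hG3⟩ := hb2 p hpm
        exact nonsingularMod_of_redn_eq p (not_dvd_both_of_isCoprime hp.out hcop)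
          ((hred p hMp).trans hG1) hG2 hG3
    · exact nonsingularMod_of_forall hcop hsmall hlarge p hpm

/-- The targets at the primes up to M are merged by the Chinese remainder theorem; r 0 can be taken
to be exactly 1 since all targets are monic. -/
theorem exists_targets (N : ℕ) (hN : 3 ≤ N) (M m : ℕ) (l : ℤ) : ∃ b : ℕ → ℕ → ℤ, ∃ r : ℕ → ℤ,
    (∀ p, b p 0 = 1) ∧
    (∀ (p : ℕ) [Fact p.Prime], ¬ p ∣ m → ∀ x, (redn (polyOf (N + 2) (b p)) p).eval x = 0 →
      (redn (polyOf (N + 2) (b p)) p).derivative.eval x ≠ 0) ∧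
    (∀ (p : ℕ) [Fact p.Prime], p ∣ m → ∃ G : (AlgebraicClosure (ZMod p))[X],
      redn (polyOf (N + 2) (b p)) p = (X - C (l : AlgebraicClosure (ZMod p))) ^ 2 * G ∧
      G.eval (l : AlgebraicClosure (ZMod p)) ≠ 0 ∧ ∀ x, G.eval x = 0 → G.derivative.eval x ≠ 0) ∧
    r 0 = 1 ∧ ∀ p : ℕ, p.Prime → p ≤ M → ∀ i, (p : ℤ) ∣ r i - b p i := by
  have h1 : ∀ p : ℕ, ∃ b : ℕ → ℤ, b 0 = 1 ∧ ∀ [Fact p.Prime],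
      (¬ p ∣ m → ∀ x, (redn (polyOf (N + 2) b) p).eval x = 0 →
        (redn (polyOf (N + 2) b) p).derivative.eval x ≠ 0) ∧
      (p ∣ m → ∃ G : (AlgebraicClosure (ZMod p))[X],
        redn (polyOf (N + 2) b) p = (X - C (l : AlgebraicClosure (ZMod p))) ^ 2 * G ∧
        G.eval (l : AlgebraicClosure (ZMod p)) ≠ 0 ∧
        ∀ x, G.eval x = 0 → G.derivative.eval x ≠ 0) := by
    intro p
    by_cases hp : p.Prime
    · have : Fact p.Prime := ⟨hp⟩
      obtain ⟨b, hb0, hb1, hb2⟩ := exists_target p (N + 2) (by omega) m l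
      exact ⟨b, hb0, fun {_} => ⟨hb1, hb2⟩⟩
    · exact ⟨fun _ => 1, rfl, fun {h} => absurd h.out hp⟩
  choose b hb0 hb using h1
  have h2 : ∀ i, ∃ x : ℤ, ∀ p : ℕ, p.Prime → p ≤ M → (p : ℤ) ∣ x - b p i := by
    intro i
    obtain ⟨x, -, -, -, hx⟩ := exists_crt one_pos 0 (fun p => b p i)
      ((Finset.range (M + 1)).filter Nat.Prime) (fun p hp => by
        have := (Finset.mem_filter.1 hp).2
        exact ⟨this, this.not_dvd_one⟩)
    exact ⟨x, fun p hp hpM => hx p (Finset.mem_filter.2 ⟨Finset.mem_range.2 (by omega), hp⟩)⟩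
  choose r hr using h2
  refine ⟨b, Function.update r 0 1, hb0, fun p _ => (hb p).1, fun p _ => (hb p).2,
    Function.update_self _ _ _, fun p hp hpM i => ?_⟩
  by_cases hi : i = 0
  · rw [hi, Function.update_self, hb0]; simp
  · rw [Function.update_of_ne hi]; exact hr i p hp hpM

theorem family_card_eq {κ s t m W Q : ℝ} (hm : 0 < m) (hW : 0 < W) {e E : ℕ} :
    1 / (512 * W ^ 2) * (κ / (2 * W)) ^ (e + 2) / (8 * W) * Q *
      (s ^ (e + 2 + 3) * t ^ (E + (e + 2) + (e + 2 + 1) + (e + 2 + 2)) / m ^ 2) =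
    m * (s ^ 2 / (512 * W ^ 2) * ((κ / (2 * W)) ^ e * s ^ e * t ^ E) *
      (κ * (s * t ^ (e + 2)) / (2 * W) * Q) *
      (κ * (s * t ^ (e + 2 + 1)) / (2 * m * W) * (s * t ^ (e + 2 + 2) / (4 * m ^ 2 * W)) / 2)) := by
  obtain ⟨x, rfl⟩ : ∃ x, κ = x * (2 * W) := ⟨κ / (2 * W), by field_simp⟩
  rw [mul_div_cancel_right₀ x (by positivity : 2 * W ≠ 0)]
  field_simp
  ring

/-- The count is m residues l, times heads, times tails per head. Taking q = 1 asks nothing extra at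
large primes dividing m; taking q to be their product makes f strictly ultra-weakly divisible at the
price of the Euler factors. -/
theorem exists_family {N : ℕ} (hN : 3 ≤ N) {κ : ℝ} (hκ : 0 < κ) (hκ1 : κ ≤ 1) :
    ∃ c > (0 : ℝ), ∃ M : ℕ, (N + 2) ^ 2 ≤ M ∧ ∀ ρ : ℕ, ∃ Y₀ : ℝ, ∀ (s t h : ℝ) (m q : ℕ),
      Y₀ ≤ s → Y₀ ≤ h → 1 ≤ t → s * t ^ (N + 2) ≤ h ^ ρ →
      (m : ℝ) ^ 2 * h ^ 2 ≤ s * t ^ (N + 2) → Squarefree m → q ∣ m → (∀ p ∈ q.primeFactors, M < p) →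
      (q : ℝ) ≤ t ^ N →
      ∃ G : Finset (ℤ[X] × ℤ), c * (∏ p ∈ q.primeFactors, (1 - (N : ℝ) / p)) *
          (s ^ (N + 3) * t ^ (∑ i ∈ Finset.Ico 2 (N + 3), i) / (m : ℝ) ^ 2) ≤ G.card ∧
        ∀ z ∈ G, IsGood (N + 2) M m q κ s t z.1 z.2 := by
  classical
  obtain ⟨M₁, δ, hδ, htails⟩ := exists_tails (N := N) (by omega)
  obtain ⟨M₂, hheads⟩ := exists_heads hN hκ hδ
  set M := max (max M₁ M₂) ((N + 2) ^ 2) with hM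
  have hMN : (N + 2) ^ 2 ≤ M := le_max_right _ _
  set W := ∏ p ∈ (Finset.range (M + 1)).filter Nat.Prime, p with hW
  have hW0 : 0 < W := Finset.prod_pos fun p hp => (Finset.mem_filter.1 hp).2.pos
  have hWM : ∀ p : ℕ, p.Prime → (p ∣ W ↔ p ≤ M) := by
    intro p hp
    rw [hW, hp.prime.dvd_finsetProd_iff]
    constructor
    · rintro ⟨r, hr, hd⟩
      obtain ⟨hr1, hr2⟩ := Finset.mem_filter.1 hr
      rw [Nat.prime_dvd_prime_iff_eq hp hr2] at hd
      have := Finset.mem_range.1 hr1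
      omega
    · intro hpM
      exact ⟨p, Finset.mem_filter.2 ⟨Finset.mem_range.2 (by omega), hp⟩, dvd_rfl⟩
  have hWr : (0 : ℝ) < W := by exact_mod_cast hW0
  obtain ⟨S₀, hS₀⟩ := hheads M (le_trans (le_max_right _ _) (le_max_left _ _)) W hW0 hWM
  refine ⟨1 / (512 * W ^ 2) * (κ / (2 * W)) ^ N / (8 * W), by positivity, M, hMN, fun ρ => ?_⟩
  obtain ⟨Y₀, hY₀⟩ := htails M (le_trans (le_max_left _ _) (le_max_left _ _)) W hW0 hWM κ hκ hκ1 ρ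
  refine ⟨max (max S₀ 1) Y₀, fun s t h m q hs hh ht hH hmh hm hqm hqM hqt => ?_⟩
  have hs1 : 1 ≤ s := le_trans (le_max_right _ _) (le_of_max_le_left hs)
  have hs0 : 0 < s := by linarith
  have ht0 : 0 < t := by linarith
  have hm0 : 0 < m := Nat.pos_of_ne_zero hm.ne_zero
  have hmr : (0 : ℝ) < m := by exact_mod_cast hm0
  have hl : ∀ l : ℕ, ∃ S : Finset (ℕ → ℤ), ∃ T : (ℕ → ℤ) → Finset (ℤ × ℤ), l < m →
      (s ^ 2 / (512 * W ^ 2) * (∏ i ∈ Finset.Ico 2 N, (κ * (s * t ^ i) / (2 * W))) *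
          (κ * (s * t ^ N) / (2 * W) * ∏ p ∈ q.primeFactors, (1 - (N : ℝ) / p)) ≤ S.card) ∧
      ∀ a ∈ S, (∀ i, N + 1 ≤ i → a i = 0) ∧
        (κ * (s * t ^ (N + 1)) / (2 * m * W) * (s * t ^ (N + 2) / (4 * m ^ 2 * W)) / 2
          ≤ (T a).card) ∧
        ∀ z ∈ T a, IsGood (N + 2) M m q κ s t (polyOf (N + 2) (withTail (N + 2) a z.1 z.2)) l := by
    intro l
    by_cases hlm : l < m
    · obtain ⟨b, r, hb0, hb1, hb2, hr0, hr⟩ := exists_targets N hN M m l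
      obtain ⟨S, hS1, hS2⟩ := hS₀ s t (le_of_max_le_left (le_of_max_le_left hs)) ht q
        (hm.squarefree_of_dvd hqm) hqM hqt l r hr0
      have hT : ∀ a ∈ S, ∃ T : Finset (ℤ × ℤ),
          (κ * (s * t ^ (N + 1)) / (2 * m * W) * (s * t ^ (N + 2) / (4 * m ^ 2 * W)) / 2
          ≤ T.card) ∧
          ∀ z ∈ T, IsGood (N + 2) M m q κ s t (polyOf (N + 2) (withTail (N + 2) a z.1 z.2)) l := by
        intro a ha
        obtain ⟨T, hT1, hT2⟩ := hY₀ s t h m q l r a (le_of_max_le_right hh) hs1 ht hH hmh hm0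
          (hS2 a ha).2
        refine ⟨T, hT1, fun z hz => ?_⟩
        exact isGood_withTail hN (le_trans (by nlinarith) hMN) (fun p hp => (hWM p hp).2) hs0
          ⟨by positivity, by exact_mod_cast hlm⟩ hb0 hb1 hb2 hr (hS2 a ha).2 (hT2 z hz)
      choose! T hT1 hT2 using hT
      exact ⟨S, T, fun _ => ⟨hS1, fun a ha => ⟨(hS2 a ha).1, hT1 a ha, hT2 a ha⟩⟩⟩
    · exact ⟨∅, fun _ => ∅, fun h => absurd h hlm⟩
  choose S T hST using hl
  set I := (Finset.range m).sigma fun l => (S l).sigma (T l) with hI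
  set φ : (Σ _ : ℕ, Σ _ : ℕ → ℤ, ℤ × ℤ) → ℤ[X] × ℤ := fun x =>
    (polyOf (N + 2) (withTail (N + 2) x.2.1 x.2.2.1 x.2.2.2), x.1) with hφ
  -- The residue l is part of the pair, so families for different l are disjoint even if they share
  -- polynomials.
  have hφinj : Set.InjOn φ I := by
    rintro ⟨l, a, z⟩ hx ⟨l', a', z'⟩ hx' hxx
    obtain ⟨h1, h2⟩ := Finset.mem_sigma.1 (Finset.mem_coe.1 hx)
    obtain ⟨h1', h2'⟩ := Finset.mem_sigma.1 (Finset.mem_coe.1 hx')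
    obtain ⟨e1, e2⟩ := Prod.mk.inj hxx
    simp only at e1 e2 h1 h2 h1' h2'
    have e3 : l = l' := by exact_mod_cast e2
    subst e3
    have h3 := (hST l (Finset.mem_range.1 h1)).2
    obtain ⟨h4, h5⟩ := Finset.mem_sigma.1 h2
    obtain ⟨h4', h5'⟩ := Finset.mem_sigma.1 h2'
    obtain ⟨e4, e5, e6⟩ := withTail_polyOf_injective (by omega)
      (fun i hi => (h3 a h4).1 i (by omega)) (fun i hi => (h3 a' h4').1 i (by omega)) e1
    rw [e4, Prod.ext e5 e6]
  refine ⟨I.image φ, ?_, ?_⟩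
  · rw [Finset.card_image_of_injOn hφinj, hI, Finset.card_sigma, Nat.cast_sum]
    set A := s ^ 2 / (512 * W ^ 2) * (∏ i ∈ Finset.Ico 2 N, (κ * (s * t ^ i) / (2 * W))) *
          (κ * (s * t ^ N) / (2 * W) * ∏ p ∈ q.primeFactors, (1 - (N : ℝ) / p)) with hA
    set B := κ * (s * t ^ (N + 1)) / (2 * m * W) * (s * t ^ (N + 2) / (4 * m ^ 2 * W)) / 2 with hB
    have hB0 : 0 ≤ B := by positivity
    have h1 : ∀ l ∈ Finset.range m, A * B ≤ (((S l).sigma (T l)).card : ℝ) := by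
      intro l hl
      obtain ⟨h2, h3⟩ := hST l (Finset.mem_range.1 hl)
      rw [Finset.card_sigma, Nat.cast_sum]
      calc A * B ≤ (S l).card * B := by gcongr
        _ ≤ _ := by
          rw [← nsmul_eq_mul]
          exact Finset.card_nsmul_le_sum _ _ _ fun a ha => (h3 a ha).2.1
    refine le_trans (le_of_eq ?_) (Finset.card_nsmul_le_sum _ _ _ h1)
    rw [Finset.card_range, nsmul_eq_mul, hA, hB]
    have h2 : ∏ i ∈ Finset.Ico 2 N, (κ * (s * t ^ i) / (2 * W)) =
        (κ / (2 * W)) ^ (N - 2) * s ^ (N - 2) * t ^ (∑ i ∈ Finset.Ico 2 N, i) := by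
      rw [← Finset.prod_pow_eq_pow_sum, ← Nat.card_Ico 2 N, ← Finset.prod_const, ← Finset.prod_const,
        ← Finset.prod_mul_distrib, ← Finset.prod_mul_distrib]
      exact Finset.prod_congr rfl fun i _ => by ring
    rw [h2, Finset.sum_Ico_succ_top (by omega), Finset.sum_Ico_succ_top (by omega),
      Finset.sum_Ico_succ_top (by omega)]
    rw [show N = N - 2 + 2 by omega, Nat.add_sub_cancel]
    exact family_card_eq hmr hWr
  · intro z hz
    obtain ⟨⟨l, a, y⟩, hx, rfl⟩ := Finset.mem_image.1 hz
    obtain ⟨h1, h2⟩ := Finset.mem_sigma.1 hx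
    obtain ⟨h4, h5⟩ := Finset.mem_sigma.1 h2
    exact ((hST l (Finset.mem_range.1 h1)).2 a h4).2.2 y h5

end UltraWeak

end

noncomputable section
namespace UltraWeak
open Polynomial

/-! ### Complex roots -/

/-- The size of the middle coefficients that is allowed in `IsNice`. -/
def middleBound (n : ℕ) : ℝ := 1 / (8 * n * 4 ^ n)

theorem norm_middle_le {n : ℕ} {κ K Y : ℝ} {c : ℕ → ℝ} {w : ℕ → ℂ} (hκ : 0 ≤ κ) (hY : 0 ≤ Y)
    (hc : ∀ i, 1 ≤ i → i < n → |c i| ≤ κ) (hw : ∀ i, 1 ≤ i → i < n → ‖w i‖ ≤ Y)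
    (hK : K = n * (κ * Y)) : ‖∑ i ∈ Finset.Ico 1 n, (c i : ℂ) * w i‖ ≤ K := by
  refine (norm_sum_le _ _).trans ?_
  calc _ ≤ ∑ i ∈ Finset.Ico 1 n, κ * Y := by
        refine Finset.sum_le_sum fun i hi => ?_
        obtain ⟨h1, h2⟩ := Finset.mem_Ico.1 hi
        rw [norm_mul, Complex.norm_real, Real.norm_eq_abs]
        exact mul_le_mul (hc i h1 h2) (hw i h1 h2) (norm_nonneg _) hκ
    _ ≤ K := by
        rw [Finset.sum_const, nsmul_eq_mul, Nat.card_Ico, hK]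
        gcongr
        exact Nat.sub_le _ _

/-- After rescaling, the polynomial is c_0 y^n + c_n up to small terms: if |y| > 2 the first term
dominates, if |y| < 1/2 the last does. For 1/2 ≤ |y| the derivative is dominated by n c_0 y^{n-1}.
-/
theorem norm_root_bounds {n : ℕ} (hn : 5 ≤ n) {c : ℕ → ℝ} (h0 : 1 / 2 < c 0) (h0' : c 0 ≤ 1)
    (hc : ∀ i, 1 ≤ i → i < n → |c i| ≤ middleBound n) (hl : 1 / 4 ≤ c n) (hl' : c n ≤ 1) {y : ℂ}
    (hy : ∑ i ∈ Finset.range (n + 1), (c i : ℂ) * y ^ (n - i) = 0) :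
    ‖y‖ ≤ 2 ∧ 1 / 2 ^ n ≤ ‖∑ i ∈ Finset.range n, (c i : ℂ) * ((n - i : ℕ) * y ^ (n - i - 1))‖ := by
  have hn0 : (0 : ℝ) < n := by exact_mod_cast (by omega : 0 < n)
  have hκ0 : 0 ≤ middleBound n := by unfold middleBound; positivity
  have h2n : (2 : ℝ) ^ 5 ≤ 2 ^ n := pow_le_pow_right₀ (by norm_num) hn
  have h4n : (4 : ℝ) ^ n = 2 ^ n * 2 ^ n := by rw [← mul_pow]; norm_num
  have hκn : n * middleBound n = 1 / (8 * 4 ^ n) := by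
    unfold middleBound; field_simp
  have hκn' : n * middleBound n ≤ 1 / 8 := by
    rw [hκn]
    refine one_div_le_one_div_of_le (by norm_num) ?_
    have : (1 : ℝ) ≤ 4 ^ n := one_le_pow₀ (by norm_num)
    linarith
  rw [Finset.sum_range_succ, Nat.sub_self, pow_zero, mul_one, Finset.range_eq_Ico,
    Finset.sum_eq_sum_Ico_succ_bot (by omega), Nat.sub_zero, zero_add] at hy
  set w := ∑ i ∈ Finset.Ico 1 n, (c i : ℂ) * y ^ (n - i) with hw
  have hc0n : ‖(c 0 : ℂ) * y ^ n‖ = c 0 * ‖y‖ ^ n := by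
    rw [norm_mul, norm_pow, Complex.norm_real, Real.norm_eq_abs, abs_of_pos (by linarith)]
  have hcn : ‖(c n : ℂ)‖ = c n := by
    rw [Complex.norm_real, Real.norm_eq_abs, abs_of_pos (by linarith)]
  have hy2 : ‖y‖ ≤ 2 := by
    by_contra! h
    have h1 : ‖w‖ ≤ n * (middleBound n * ‖y‖ ^ n) := by
      refine norm_middle_le hκ0 (by positivity) hc (fun i _ _ => ?_) rfl
      rw [norm_pow]
      exact pow_le_pow_right₀ (by linarith) (Nat.sub_le _ _)
    have h2 : ‖(c 0 : ℂ) * y ^ n‖ ≤ ‖w‖ + ‖(c n : ℂ)‖ := by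
      have : (c 0 : ℂ) * y ^ n = -(w + c n) := by linear_combination hy
      rw [this, norm_neg]
      exact norm_add_le _ _
    have h3 : (2 : ℝ) ^ n ≤ ‖y‖ ^ n := by gcongr
    rw [hc0n, hcn] at h2
    rw [← mul_assoc] at h1
    nlinarith
  have hy1 : 1 / 2 ≤ ‖y‖ := by
    by_contra! h
    have h1 : ‖w‖ ≤ n * (middleBound n * 1) := by
      refine norm_middle_le hκ0 zero_le_one hc (fun i _ _ => ?_) rfl
      rw [norm_pow]
      exact pow_le_one₀ (norm_nonneg _) (by linarith)
    have h2 : ‖(c n : ℂ)‖ ≤ ‖(c 0 : ℂ) * y ^ n‖ + ‖w‖ := by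
      have : (c n : ℂ) = -((c 0 : ℂ) * y ^ n + w) := by linear_combination hy
      rw [this, norm_neg]
      exact norm_add_le _ _
    have h3 : ‖y‖ ^ n ≤ 1 / 2 ^ n := by
      rw [← one_div_pow]
      exact pow_le_pow_left₀ (norm_nonneg _) h.le n
    have h4 : (1 : ℝ) / 2 ^ n ≤ 1 / 2 ^ 5 := one_div_le_one_div_of_le (by norm_num) h2n
    rw [hc0n, hcn] at h2
    have h5 : c 0 * ‖y‖ ^ n ≤ 1 * ‖y‖ ^ n := by gcongr
    have h6 : (1 : ℝ) / 2 ^ n ≤ 1 / 32 := h4.trans (by norm_num)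
    linarith
  refine ⟨hy2, ?_⟩
  rw [Finset.range_eq_Ico, Finset.sum_eq_sum_Ico_succ_bot (by omega), Nat.sub_zero, zero_add]
  set v := ∑ i ∈ Finset.Ico 1 n, (c i : ℂ) * ((n - i : ℕ) * y ^ (n - i - 1)) with hv
  have h1 : ‖v‖ ≤ n * (middleBound n * (n * 2 ^ n)) := by
    refine norm_middle_le hκ0 (by positivity) hc (fun i _ _ => ?_) rfl
    rw [norm_mul, norm_pow, Complex.norm_natCast]
    have h2 : ‖y‖ ^ (n - i - 1) ≤ 2 ^ n :=
      (pow_le_pow_left₀ (norm_nonneg _) hy2 _).trans (pow_le_pow_right₀ (by norm_num) (by omega))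
    gcongr
    exact Nat.sub_le _ _
  have h2 : ‖(c 0 : ℂ) * (n * y ^ (n - 1))‖ = c 0 * (n * ‖y‖ ^ (n - 1)) := by
    rw [norm_mul, norm_mul, norm_pow, Complex.norm_real, Complex.norm_natCast, Real.norm_eq_abs,
      abs_of_pos (by linarith)]
  have h3 : 2 / 2 ^ n ≤ ‖y‖ ^ (n - 1) := by
    have : (2 : ℝ) / 2 ^ n = (1 / 2) ^ (n - 1) := by
      obtain ⟨k, rfl⟩ : ∃ k, n = k + 1 := ⟨n - 1, by omega⟩
      rw [Nat.add_sub_cancel, one_div_pow, pow_succ]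
      field_simp
    rw [this]
    exact pow_le_pow_left₀ (by norm_num) hy1 _
  have h4 : ‖(c 0 : ℂ) * (n * y ^ (n - 1))‖ - ‖v‖ ≤ ‖(c 0 : ℂ) * (n * y ^ (n - 1)) + v‖ := by
    have := norm_sub_le ((c 0 : ℂ) * (n * y ^ (n - 1)) + v) v
    rw [add_sub_cancel_right] at this
    linarith
  have h5 : n * (middleBound n * (n * 2 ^ n)) = n / 8 * (1 / 2 ^ n) := by
    rw [← mul_assoc, hκn, h4n]
    field_simp
  have h6 : n * (1 / 2 ^ n) ≤ c 0 * (n * ‖y‖ ^ (n - 1)) := by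
    calc (n : ℝ) * (1 / 2 ^ n) = 1 / 2 * (n * (2 / 2 ^ n)) := by ring
      _ ≤ _ := by gcongr
  have h7 : (5 : ℝ) ≤ n := by exact_mod_cast hn
  have h8 : (0 : ℝ) < 1 / 2 ^ n := by positivity
  rw [h2] at h4
  nlinarith

theorem IsNice.pos {n : ℕ} {κ s t : ℝ} {f : ℤ[X]} (h : IsNice n κ s t f) : 0 < s := by
  have h1 := h.lt
  have : (1 : ℝ) ≤ f.coeff (n - 1) := by exact_mod_cast h.one_le
  linarith

/-- Substitute z = ty and divide by s t^n. -/
theorem IsNice.root_bounds {n : ℕ} (hn : 5 ≤ n) {s t : ℝ} {f : ℤ[X]}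
    (h : IsNice n (middleBound n) s t f) (ht : n * 4 ^ (n + 2) ≤ t) {z : ℂ} (hz : aeval z f = 0) :
    ‖z‖ ≤ 2 * t ∧ s * t ^ (n - 1) / 2 ^ n ≤ ‖aeval z f.derivative‖ := by
  have hs := h.pos
  have hn0 : (1 : ℝ) ≤ n := by exact_mod_cast (by omega : 1 ≤ n)
  have h4n : (0 : ℝ) < 4 ^ n := by positivity
  have ht0 : 0 < t := lt_of_lt_of_le (by positivity) ht
  have htc : (t : ℂ) ≠ 0 := by exact_mod_cast ht0.ne'
  have hsc : (s : ℂ) ≠ 0 := by exact_mod_cast hs.ne'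
  set c : ℕ → ℝ := fun i => f.coeff (n - i) / (s * t ^ i) with hc
  have hcoef : ∀ i, ((f.coeff (n - i) : ℤ) : ℂ) = (c i : ℂ) * (s * t ^ i) := by
    intro i
    simp only [hc]
    push_cast
    rw [div_mul_cancel₀]
    exact mul_ne_zero hsc (pow_ne_zero _ htc)
  set y : ℂ := z / t with hy
  have hzy : z = t * y := by rw [hy]; field_simp
  have hfe := eq_polyOf n f h.natDegree_eq.le
  have hroot : ∑ i ∈ Finset.range (n + 1), (c i : ℂ) * y ^ (n - i) = 0 := by
    have h1 : ((s : ℂ) * t ^ n) * ∑ i ∈ Finset.range (n + 1), (c i : ℂ) * y ^ (n - i) = 0 := by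
      rw [← hz]
      conv_rhs => rw [hfe]
      rw [polyOf, map_sum, Finset.mul_sum]
      refine Finset.sum_congr rfl fun i hi => ?_
      have hi' := Finset.mem_range.1 hi
      simp only [map_mul, map_pow, aeval_X, eq_intCast, map_intCast]
      rw [hcoef i, hzy, mul_pow, show (t : ℂ) ^ n = t ^ i * t ^ (n - i) by
        rw [← pow_add]; congr 1; omega]
      ring
    exact (mul_eq_zero.1 h1).resolve_left (mul_ne_zero hsc (pow_ne_zero _ htc))
  have hder : aeval z f.derivative = ((s : ℂ) * t ^ (n - 1)) *
      ∑ i ∈ Finset.range n, (c i : ℂ) * ((n - i : ℕ) * y ^ (n - i - 1)) := by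
    conv_lhs => rw [hfe]
    rw [polyOf, derivative_sum, map_sum, Finset.sum_range_succ, Nat.sub_self, pow_zero, mul_one,
      derivative_C, map_zero, add_zero, Finset.mul_sum]
    refine Finset.sum_congr rfl fun i hi => ?_
    have hi' := Finset.mem_range.1 hi
    rw [derivative_C_mul_X_pow]
    simp only [map_mul, map_pow, aeval_X, eq_intCast, map_intCast, map_natCast]
    rw [hcoef i, hzy, mul_pow, show (t : ℂ) ^ (n - 1) = t ^ i * t ^ (n - i - 1) by
        rw [← pow_add]; congr 1; omega]
    ring
  have ht1 : 1 ≤ t := le_trans (one_le_mul_of_one_le_of_one_le hn0 (one_le_pow₀ (by norm_num))) ht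
  obtain ⟨h1, h2⟩ := norm_root_bounds (y := y) hn (c := c) (by
      simp only [hc, Nat.sub_zero, pow_zero, mul_one]
      rw [lt_div_iff₀ hs]
      linarith [h.lower]) (by
      simp only [hc, Nat.sub_zero, pow_zero, mul_one]
      rw [div_le_one hs]
      exact h.upper) (by
      intro i hi1 hin
      have hpos : 0 < s * t ^ i := by positivity
      simp only [hc]
      rcases Nat.lt_or_ge 1 i with hi | hi
      · obtain ⟨h3, h4⟩ := h.middle i (by omega) hin
        have h3' : (0 : ℝ) ≤ f.coeff (n - i) := by exact_mod_cast h3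
        rw [abs_of_nonneg (by positivity), div_le_iff₀ hpos]
        exact h4
      -- The coefficient a_1 is not restricted by κ; it is small after rescaling because a_1 < s/4
      -- and t is large.
      · obtain rfl : i = 1 := by omega
        have h3' : (1 : ℝ) ≤ f.coeff (n - 1) := by exact_mod_cast h.one_le
        rw [abs_of_nonneg (by positivity), div_le_iff₀ hpos, pow_one, middleBound, div_mul_eq_mul_div,
          le_div_iff₀ (by positivity)]
        have h4 := h.lt
        rw [pow_add] at ht
        have h5 : f.coeff (n - 1) * (8 * n * 4 ^ n : ℝ) ≤ s / 4 * (8 * n * 4 ^ n) := by gcongr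
        have h6 : s * (n * (4 ^ n * 4 ^ 2)) ≤ s * t := by gcongr
        have h7 : 0 < s * (n * 4 ^ n : ℝ) := by positivity
        nlinarith) (by
      simp only [hc, Nat.sub_self]
      rw [le_div_iff₀ (by positivity)]
      linarith [h.const_lower]) (by
      simp only [hc, Nat.sub_self]
      rw [div_le_one (by positivity)]
      exact h.const_upper) hroot
  constructor
  · rw [hzy, norm_mul, Complex.norm_real, Real.norm_eq_abs, abs_of_pos ht0]
    nlinarith
  · rw [hder, norm_mul, norm_mul, norm_pow, Complex.norm_real, Complex.norm_real, Real.norm_eq_abs,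
      Real.norm_eq_abs, abs_of_pos ht0, abs_of_pos hs, div_eq_mul_one_div]
    gcongr

/-! ### Enumerated roots and Lagrange interpolation -/

/-- An enumeration of the roots of `f`. -/
structure IsRoots {n : ℕ} (f : ℤ[X]) (δ : Fin n → ℂ) : Prop where
  injective : Function.Injective δ
  map_eq : f.map (Int.castRingHom ℂ) = C (f.coeff n : ℂ) * ∏ i, (X - C (δ i))

theorem IsRoots.aeval_eq_zero_iff {n : ℕ} {f : ℤ[X]} {δ : Fin n → ℂ} (h : IsRoots f δ)
    (h0 : f.coeff n ≠ 0) {z : ℂ} : aeval z f = 0 ↔ ∃ i, z = δ i := by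
  have h1 : aeval z f = (f.map (Int.castRingHom ℂ)).eval z := by
    rw [eval_map, aeval_def, algebraMap_int_eq]
  rw [h1, h.map_eq, eval_mul, eval_C, eval_prod]
  simp [h0, Finset.prod_eq_zero_iff, sub_eq_zero]

theorem IsRoots.aeval_derivative {n : ℕ} {f : ℤ[X]} {δ : Fin n → ℂ} (h : IsRoots f δ) (i : Fin n) :
    aeval (δ i) f.derivative = f.coeff n * ∏ j ∈ Finset.univ.erase i, (δ i - δ j) := by
  have h1 : aeval (δ i) f.derivative = ((f.map (Int.castRingHom ℂ)).derivative).eval (δ i) := by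
    rw [derivative_map, eval_map, aeval_def, algebraMap_int_eq]
  rw [h1, h.map_eq, derivative_C_mul, eval_mul, eval_C]
  have := Lagrange.eval_nodal_derivative_eval_node_eq (s := Finset.univ) (v := δ)
    (Finset.mem_univ i)
  rw [Lagrange.nodal_eq, Lagrange.eval_nodal] at this
  rw [this]

/-- Irreducibility of f is not needed: a nonvanishing derivative at every root gives n distinct
roots. -/
theorem exists_isRoots {n : ℕ} {f : ℤ[X]} (hf : f.natDegree = n) (h0 : f.coeff n ≠ 0)
    (hd : ∀ z : ℂ, aeval z f = 0 → aeval z f.derivative ≠ 0) : ∃ δ : Fin n → ℂ, IsRoots f δ := by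
  classical
  set F := f.map (Int.castRingHom ℂ) with hF
  have hinj : Function.Injective (Int.castRingHom ℂ) := Int.cast_injective
  have hF0 : F ≠ 0 := by
    rw [hF, Ne, Polynomial.map_eq_zero_iff hinj]
    rintro rfl
    simp at h0
  have hnd : F.roots.Nodup := by
    rw [Multiset.nodup_iff_count_le_one]
    intro x
    by_contra! hx
    rw [count_roots] at hx
    obtain ⟨h1, h2⟩ := (two_le_rootMultiplicity_iff hF0 x).1 hx
    rw [hF, eval_map] at h1
    rw [hF, derivative_map, eval_map] at h2
    exact hd x (by rw [aeval_def, algebraMap_int_eq]; exact h1)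
      (by rw [aeval_def, algebraMap_int_eq]; exact h2)
  have hs := IsAlgClosed.splits F
  have hc : F.roots.toFinset.card = n := by
    rw [Multiset.toFinset_card_of_nodup hnd, ← hs.natDegree_eq_card_roots, hF,
      natDegree_map_eq_of_injective hinj, hf]
  set e := (F.roots.toFinset.equivFinOfCardEq hc).symm with he
  refine ⟨fun i => (e i : ℂ), fun i j hij => e.injective (Subtype.ext hij), ?_⟩
  have h1 := hs.eq_prod_roots
  have h2 : F.leadingCoeff = f.coeff n := by
    rw [hF, leadingCoeff_map_of_injective hinj, leadingCoeff, hf]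
    rfl
  rw [← h2]
  refine h1.trans ?_
  congr 1
  rw [e.prod_comp (fun x => X - C (x : ℂ)), Finset.prod_coe_sort F.roots.toFinset
    (fun x => X - C x), Finset.prod_multiset_map_count]
  refine Finset.prod_congr rfl fun x hx => ?_
  rw [Multiset.count_eq_one_of_mem hnd (Multiset.mem_toFinset.1 hx), pow_one]

/-- Lagrange interpolation bounds coefficients by differences of values. -/
theorem IsRoots.norm_coeff_mul_le {n : ℕ} {f : ℤ[X]} {δ : Fin n → ℂ} (h : IsRoots f δ)
    {B R D : ℝ} (hB : ∀ i, B ≤ ‖aeval (δ i) f.derivative‖) (hB0 : 0 < B) (hR : ∀ i, ‖δ i‖ ≤ R)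
    {P : ℂ[X]} {k : ℕ} (hk : 1 ≤ k) (hkn : k < n) (hP : P.natDegree ≤ k)
    (hD : ∀ i j, ‖P.eval (δ i) - P.eval (δ j)‖ ≤ D) :
    ‖P.coeff k‖ * B ≤ n * (|(f.coeff n : ℝ)| * D * R ^ (n - 1 - k)) := by
  set i₀ : Fin n := ⟨0, by omega⟩ with hi₀
  -- Multiplying by a power of X moves the wanted coefficient to degree n - 1, where Lagrange's
  -- formula gives it as the sum of a_0 Q(δ_i)/f'(δ_i). Subtracting a constant first replaces values
  -- of P by differences and leaves the coefficient unchanged, as k ≥ 1.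
  set Q : ℂ[X] := (P - C (P.eval (δ i₀))) * X ^ (n - 1 - k) with hQ
  have hQc : Q.coeff (n - 1) = P.coeff k := by
    rw [hQ, show n - 1 = k + (n - 1 - k) by omega, Nat.add_sub_cancel_left, coeff_mul_X_pow, coeff_sub,
      coeff_C_of_ne_zero (by omega), sub_zero]
  have hQd : Q.degree < (Finset.univ : Finset (Fin n)).card := by
    rw [Finset.card_univ, Fintype.card_fin]
    refine lt_of_le_of_lt degree_le_natDegree ?_
    have h1 : (P - C (P.eval (δ i₀))).natDegree ≤ k :=
      (natDegree_sub_le _ _).trans (by simpa using hP)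
    have h2 : Q.natDegree ≤ n - 1 := by
      refine natDegree_mul_le.trans ?_
      rw [natDegree_X_pow]
      omega
    exact_mod_cast (by omega : Q.natDegree < n)
  have hL := Lagrange.coeff_eq_sum (s := Finset.univ) (v := δ) (h.injective.injOn) hQd
  rw [Finset.card_univ, Fintype.card_fin, hQc] at hL
  have hR0 : 0 ≤ R := (norm_nonneg _).trans (hR i₀)
  have hD0 : 0 ≤ D := (norm_nonneg _).trans (hD i₀ i₀)
  rw [hL, ← le_div_iff₀ hB0]
  refine (norm_sum_le _ _).trans ?_
  calc _ ≤ ∑ i : Fin n, |(f.coeff n : ℝ)| * D * R ^ (n - 1 - k) / B := by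
        refine Finset.sum_le_sum fun i _ => ?_
        have h1 := hB i
        rw [h.aeval_derivative i, norm_mul, Complex.norm_intCast] at h1
        have h2 : 0 < ‖∏ j ∈ Finset.univ.erase i, (δ i - δ j)‖ := by
          by_contra! h3
          have := abs_nonneg (f.coeff n : ℝ)
          nlinarith
        rw [norm_div, div_le_div_iff₀ h2 hB0, hQ, eval_mul, norm_mul, eval_sub, eval_C, eval_pow,
          eval_X, norm_pow]
        calc _ ≤ D * R ^ (n - 1 - k) * (|(f.coeff n : ℝ)| * ‖∏ j ∈ Finset.univ.erase i, (δ i - δ j)‖) := by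
              gcongr
              · exact hD i i₀
              · exact hR i
          _ = _ := by ring
    _ = _ := by rw [Finset.sum_const, Finset.card_univ, Fintype.card_fin, nsmul_eq_mul]; ring

end UltraWeak

end

noncomputable section
namespace UltraWeak
open Polynomial

/-! ### Embeddings and the discriminant -/

theorem exists_basis_of_forall {n : ℕ} {R : Type*} [CommRing R] (v : Fin n → R)
    (hli : ∀ x : Fin n → ℤ, ∑ k, (x k : R) * v k = 0 → x = 0)
    (hspan : ∀ r : R, ∃ x : Fin n → ℤ, r = ∑ k, (x k : R) * v k) :
    ∃ b : Module.Basis (Fin n) ℤ R, ∀ k, b k = v k := by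
  have h1 : LinearIndependent ℤ v := by
    rw [Fintype.linearIndependent_iff]
    intro x hx i
    exact congrFun (hli x (by simpa [zsmul_eq_mul] using hx)) i
  refine ⟨Module.Basis.mk h1 ?_, fun k => Module.Basis.mk_apply _ _ k⟩
  rintro r -
  obtain ⟨x, rfl⟩ := hspan r
  refine Submodule.sum_mem _ fun k _ => ?_
  rw [← zsmul_eq_mul]
  exact Submodule.smul_mem _ _ (Submodule.subset_span ⟨k, rfl⟩)

/-- The matrix E of embeddings diagonalizes multiplication by every element, so the trace is the sum
of the φ_i and the trace matrix is EᵀE. -/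
theorem discr_eq_det_sq {n : ℕ} {R : Type*} [CommRing R] (b : Module.Basis (Fin n) ℤ R)
    (φ : Fin n → R →+* ℂ) (hdet : (Matrix.of fun i k => φ i (b k)).det ≠ 0) :
    ((Algebra.discr ℤ b : ℤ) : ℂ) = (Matrix.of fun i k => φ i (b k)).det ^ 2 := by
  set E := Matrix.of fun i k => φ i (b k) with hE
  have hu : IsUnit E.det := isUnit_iff_ne_zero.2 hdet
  have htr : ∀ x : R, ((Algebra.trace ℤ R x : ℤ) : ℂ) = ∑ i, φ i x := by
    intro x
    set L := (Algebra.leftMulMatrix b x).map (Int.cast : ℤ → ℂ) with hL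
    have h1 : Matrix.diagonal (fun i => φ i x) * E = E * L := by
      ext i k
      rw [Matrix.diagonal_mul, Matrix.mul_apply, hE, Matrix.of_apply, ← map_mul]
      have h2 : x * b k = ∑ j, (Algebra.leftMulMatrix b x j k : R) * b j := by
        conv_lhs => rw [← b.sum_repr (x * b k)]
        refine Finset.sum_congr rfl fun j _ => ?_
        rw [Algebra.leftMulMatrix_eq_repr_mul, zsmul_eq_mul]
      rw [h2, map_sum]
      refine Finset.sum_congr rfl fun j _ => ?_
      rw [map_mul, map_intCast, hL, Matrix.map_apply, Matrix.of_apply, mul_comm]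
    have h3 : L = E⁻¹ * (Matrix.diagonal (fun i => φ i x) * E) := by
      rw [h1, ← Matrix.mul_assoc, Matrix.nonsing_inv_mul _ hu, Matrix.one_mul]
    have h4 : L.trace = ∑ i, φ i x := by
      rw [h3, Matrix.trace_mul_comm, Matrix.mul_assoc, Matrix.mul_nonsing_inv _ hu, Matrix.mul_one,
        Matrix.trace_diagonal]
    rw [← h4, Algebra.trace_eq_matrix_trace b, Matrix.trace, Matrix.trace, Int.cast_sum]
    rfl
  have h5 : (Algebra.traceMatrix ℤ b).map (Int.cast : ℤ → ℂ) = E.transpose * E := by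
    ext j k
    rw [Matrix.map_apply, Algebra.traceMatrix_apply, Algebra.traceForm_apply, htr, Matrix.mul_apply]
    refine Finset.sum_congr rfl fun i _ => ?_
    rw [map_mul]
    rfl
  rw [Algebra.discr_def, Int.cast_det, pow_two]
  rw [h5, Matrix.det_mul, Matrix.det_transpose]

theorem ringClass_mem_discLE_of_forall {n : ℕ} {R : Type} [CommRing R] (v : Fin n → R)
    (hli : ∀ x : Fin n → ℤ, ∑ k, (x k : R) * v k = 0 → x = 0)
    (hspan : ∀ r : R, ∃ x : Fin n → ℤ, r = ∑ k, (x k : R) * v k) (φ : Fin n → R →+* ℂ)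
    (hdet : (Matrix.of fun i k => φ i (v k)).det ≠ 0) {Y : ℝ}
    (hY : ‖(Matrix.of fun i k => φ i (v k)).det‖ ^ 2 ≤ Y) : ringClass R ∈ discLE n Y := by
  obtain ⟨b, hb⟩ := exists_basis_of_forall v hli hspan
  obtain rfl : ⇑b = v := funext hb
  have hdisc := discr_eq_det_sq b φ hdet
  refine ⟨R, inferInstance, rfl, b, ?_, ?_⟩
  · intro h
    rw [h] at hdisc
    exact hdet (by simpa using hdisc.symm)
  · rwa [← Complex.norm_intCast, hdisc, norm_pow]

/-- Evaluation at a complex root. -/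
def evalRoot (f : ℤ[X]) {z : ℂ} (hz : aeval z f = 0) : QAlg f →+* ℂ :=
  AdjoinRoot.lift (algebraMap ℚ ℂ) z (by
    rw [eval₂_map, ← hz, aeval_def]
    congr 1)

theorem evalRoot_root (f : ℤ[X]) {z : ℂ} (hz : aeval z f = 0) :
    evalRoot f hz (AdjoinRoot.root (f.map (Int.castRingHom ℚ))) = z :=
  AdjoinRoot.lift_root _

theorem evalRoot_smul (f : ℤ[X]) {z : ℂ} (hz : aeval z f = 0) (c : ℚ) (x : QAlg f) :
    evalRoot f hz (c • x) = c * evalRoot f hz x := by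
  rw [Algebra.smul_def, map_mul]
  congr 1
  exact (AdjoinRoot.lift_of (i := algebraMap ℚ ℂ) _).trans (by simp)

/-- The polynomial that gives the value of `canonicalElt` at a root. -/
def canonicalPoly (f : ℤ[X]) (l : ℤ) (k : ℕ) : ℂ[X] :=
  if k = 0 then 1
  else ∑ j ∈ Finset.range k,
    C (((translate f l).coeff (f.natDegree - j) : ℤ) : ℂ) * (X - C (l : ℂ)) ^ (k - j)

theorem evalRoot_canonicalElt (f : ℤ[X]) {z : ℂ} (hz : aeval z f = 0) (l : ℤ) (k : ℕ) :
    evalRoot f hz (canonicalElt f l k) = (canonicalPoly f l k).eval z := by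
  unfold canonicalElt canonicalPoly
  split_ifs
  · simp
  · rw [map_sum, eval_finsetSum]
    refine Finset.sum_congr rfl fun j _ => ?_
    rw [map_mul, map_pow, map_intCast, transRoot, map_sub, evalRoot_root, map_intCast]
    simp

theorem coeff_translate_natDegree (f : ℤ[X]) (l : ℤ) :
    (translate f l).coeff f.natDegree = f.coeff f.natDegree := by
  have h1 : (translate f l).leadingCoeff = f.leadingCoeff := by
    rw [translate, leadingCoeff_comp (by rw [natDegree_X_add_C]; exact one_ne_zero),
      leadingCoeff_X_add_C, one_pow, mul_one]
  rwa [leadingCoeff, translate_natDegree] at h1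

theorem natDegree_canonicalPoly_le (f : ℤ[X]) (l : ℤ) (k : ℕ) :
    (canonicalPoly f l k).natDegree ≤ k := by
  unfold canonicalPoly
  split_ifs
  · simp
  · refine natDegree_sum_le_of_forall_le _ _ fun j _ => ?_
    refine (natDegree_C_mul_le _ _).trans ?_
    rw [natDegree_pow, natDegree_X_sub_C]
    omega

theorem coeff_canonicalPoly (f : ℤ[X]) (l : ℤ) (k : ℕ) :
    (canonicalPoly f l k).coeff k = if k = 0 then 1 else (f.coeff f.natDegree : ℂ) := by
  unfold canonicalPoly
  split_ifs with hk
  · simp [hk]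
  · rw [finsetSum_coeff, Finset.sum_eq_single 0]
    · rw [coeff_C_mul, Nat.sub_zero, Nat.sub_zero, coeff_translate_natDegree, sub_eq_add_neg, ← C_neg,
        coeff_X_add_C_pow]
      simp
    · intro j _ hj
      have : ((X - C (l : ℂ)) ^ (k - j)).natDegree < k := by
        rw [natDegree_pow, natDegree_X_sub_C]
        omega
      rw [coeff_C_mul, coeff_eq_zero_of_natDegree_lt this, mul_zero]
    · intro h
      exact absurd (Finset.mem_range.2 (Nat.pos_of_ne_zero hk)) h

/-- The polynomial that gives the value of `wdBasis` at a root. -/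
def wdPoly (f : ℤ[X]) (m : ℕ) (l : ℤ) (k : ℕ) : ℂ[X] :=
  C (if k + 1 = f.natDegree then (m : ℂ)⁻¹ else 1) * canonicalPoly f l k

/-- The leading coefficient of `wdPoly`. -/
def wdLead (f : ℤ[X]) (m : ℕ) (k : ℕ) : ℂ :=
  (if k + 1 = f.natDegree then (m : ℂ)⁻¹ else 1) * if k = 0 then 1 else (f.coeff f.natDegree : ℂ)

theorem evalRoot_wdBasis (f : ℤ[X]) {z : ℂ} (hz : aeval z f = 0) (m : ℕ) (l : ℤ)
    (k : Fin f.natDegree) : evalRoot f hz (wdBasis f m l k) = (wdPoly f m l k).eval z := by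
  unfold wdBasis wdPoly
  split_ifs
  · rw [evalRoot_smul, evalRoot_canonicalElt, eval_mul, eval_C]
    push_cast
    rfl
  · rw [evalRoot_canonicalElt, C_1, one_mul]

theorem natDegree_wdPoly_le (f : ℤ[X]) (m : ℕ) (l : ℤ) (k : ℕ) : (wdPoly f m l k).natDegree ≤ k :=
  (natDegree_C_mul_le _ _).trans (natDegree_canonicalPoly_le f l k)

theorem coeff_wdPoly (f : ℤ[X]) (m : ℕ) (l : ℤ) (k : ℕ) :
    (wdPoly f m l k).coeff k = wdLead f m k := by
  rw [wdPoly, coeff_C_mul, coeff_canonicalPoly, wdLead]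

section

variable {f : ℤ[X]} {m : ℕ} {l : ℤ} {δ : Fin f.natDegree → ℂ}

theorem wdLead_ne_zero (hm : 0 < m) (h0 : f.coeff f.natDegree ≠ 0) (k : ℕ) : wdLead f m k ≠ 0 := by
  unfold wdLead
  refine mul_ne_zero ?_ ?_
  · split_ifs
    · exact inv_ne_zero (by exact_mod_cast hm.ne')
    · exact one_ne_zero
  · split_ifs
    · exact one_ne_zero
    · exact_mod_cast h0

/-- The k-th basis element is a polynomial of degree at most k in the root, so the matrix is
triangular over the Vandermonde matrix. -/
theorem det_wdPoly (hm : 0 < m) (h0 : f.coeff f.natDegree ≠ 0) :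
    (Matrix.of fun i k : Fin f.natDegree => (wdPoly f m l k).eval (δ i)).det =
      (∏ k : Fin f.natDegree, wdLead f m k) * (Matrix.vandermonde δ).det := by
  have hne := wdLead_ne_zero hm h0
  have hdeg : ∀ k : ℕ, (C (wdLead f m k)⁻¹ * wdPoly f m l k).natDegree ≤ k := fun k =>
    (natDegree_C_mul_le _ _).trans (natDegree_wdPoly_le f m l k)
  have hco : ∀ k : ℕ, (C (wdLead f m k)⁻¹ * wdPoly f m l k).coeff k = 1 := fun k => by
    rw [coeff_C_mul, coeff_wdPoly, inv_mul_cancel₀ (hne k)]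
  rw [Matrix.det_eval_matrixOfPolynomials_eq_det_vandermonde δ
    (fun k => C (wdLead f m k)⁻¹ * wdPoly f m l k)
    (fun k => natDegree_eq_of_le_of_coeff_ne_zero (hdeg k) (by rw [hco]; exact one_ne_zero))
    (fun k => monic_of_natDegree_le_of_coeff_eq_one _ (hdeg k) (hco k)), ← Matrix.det_mul_row]
  congr 1
  ext i k
  simp only [Matrix.of_apply, eval_mul, eval_C]
  rw [mul_inv_cancel_left₀ (hne k)]

theorem det_wdPoly_ne_zero (hm : 0 < m) (h0 : f.coeff f.natDegree ≠ 0)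
    (hδ : Function.Injective δ) :
    (Matrix.of fun i k : Fin f.natDegree => (wdPoly f m l k).eval (δ i)).det ≠ 0 := by
  rw [det_wdPoly hm h0]
  exact mul_ne_zero (Finset.prod_ne_zero_iff.2 fun k _ => wdLead_ne_zero hm h0 k)
    (Matrix.det_vandermonde_ne_zero_iff.2 hδ)

theorem linearIndependent_wdBasis (hm : 0 < m) (h0 : f.coeff f.natDegree ≠ 0) (hδ : IsRoots f δ)
    {x : Fin f.natDegree → ℤ} (hx : ∑ k, (x k : QAlg f) * wdBasis f m l k = 0) : x = 0 := by
  have h1 := Matrix.eq_zero_of_mulVec_eq_zero (det_wdPoly_ne_zero (l := l) hm h0 hδ.injective)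
    (v := fun k => (x k : ℂ)) (by
      funext i
      have hz : aeval (δ i) f = 0 := (hδ.aeval_eq_zero_iff h0).2 ⟨i, rfl⟩
      have h2 := congrArg (evalRoot f hz) hx
      rw [map_sum, map_zero] at h2
      rw [Matrix.mulVec, dotProduct, Pi.zero_apply, ← h2]
      refine Finset.sum_congr rfl fun k _ => ?_
      rw [map_mul, map_intCast, evalRoot_wdBasis, Matrix.of_apply, mul_comm])
  funext k
  have : (x k : ℂ) = 0 := congrFun h1 k
  exact_mod_cast this

theorem exists_eq_sum_wdBasis (hn : 2 ≤ f.natDegree) (hm : 0 < m) (hw : WeaklyDivisibleAt f m l)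
    {w : QAlg f} (hwm : w ∈ wdRing f m l) :
    ∃ x : Fin f.natDegree → ℤ, w = ∑ k, (x k : QAlg f) * wdBasis f m l k := by
  rw [← Subalgebra.mem_toSubmodule, toSubmodule_wdRing f m l hn hm hw,
    Submodule.mem_span_range_iff_exists_fun] at hwm
  obtain ⟨x, rfl⟩ := hwm
  exact ⟨x, Finset.sum_congr rfl fun k _ => zsmul_eq_mul _ _⟩

/-- The elements of `wdBasis` in the ring they generate. -/
def wdElt (f : ℤ[X]) (m : ℕ) (l : ℤ) (k : Fin f.natDegree) : wdRing f m l :=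
  ⟨wdBasis f m l k, Algebra.subset_adjoin ⟨k, rfl⟩⟩

theorem coe_sum_wdElt (x : Fin f.natDegree → ℤ) :
    ((∑ k, (x k : wdRing f m l) * wdElt f m l k : wdRing f m l) : QAlg f) =
      ∑ k, (x k : QAlg f) * wdBasis f m l k := by
  rw [AddSubmonoidClass.coe_finsetSum]
  exact Finset.sum_congr rfl fun k _ => rfl

theorem linearIndependent_wdElt (hm : 0 < m) (h0 : f.coeff f.natDegree ≠ 0) (hδ : IsRoots f δ)
    {x : Fin f.natDegree → ℤ} (hx : ∑ k, (x k : wdRing f m l) * wdElt f m l k = 0) : x = 0 := by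
  refine linearIndependent_wdBasis (l := l) hm h0 hδ ?_
  rw [← coe_sum_wdElt, hx]
  rfl

theorem exists_eq_sum_wdElt (hn : 2 ≤ f.natDegree) (hm : 0 < m) (hw : WeaklyDivisibleAt f m l)
    (w : wdRing f m l) :
    ∃ x : Fin f.natDegree → ℤ, w = ∑ k, (x k : wdRing f m l) * wdElt f m l k := by
  obtain ⟨x, hx⟩ := exists_eq_sum_wdBasis hn hm hw w.2
  exact ⟨x, Subtype.ext (hx.trans (coe_sum_wdElt x).symm)⟩

/-- The restriction of `evalRoot` to `wdRing`. -/
def wdEval (f : ℤ[X]) (m : ℕ) (l : ℤ) {z : ℂ} (hz : aeval z f = 0) : wdRing f m l →+* ℂ :=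
  (evalRoot f hz).comp (wdRing f m l).val.toRingHom

/-- The squared determinant is a product of n(n-1) root differences. -/
theorem norm_vandermonde_le {n : ℕ} {v : Fin n → ℂ} {R : ℝ} (hR : ∀ i j, ‖v i - v j‖ ≤ R) :
    ‖(Matrix.vandermonde v).det‖ ^ 2 ≤ R ^ (n * (n - 1)) := by
  rw [Matrix.det_vandermonde, norm_prod]
  have h1 : ∀ i : Fin n, ‖∏ j ∈ Finset.Ioi i, (v j - v i)‖ ≤ R ^ (n - 1 - i) := by
    intro i
    rw [norm_prod]
    refine (Finset.prod_le_prod (fun _ _ => norm_nonneg _) fun j _ => hR j i).trans ?_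
    rw [Finset.prod_const, Fin.card_Ioi]
  have h2 : ∏ i : Fin n, ‖∏ j ∈ Finset.Ioi i, (v j - v i)‖ ≤ ∏ i : Fin n, R ^ (n - 1 - (i : ℕ)) :=
    Finset.prod_le_prod (fun _ _ => norm_nonneg _) fun i _ => h1 i
  have h3 : ∏ i : Fin n, R ^ (n - 1 - (i : ℕ)) = R ^ (n * (n - 1) / 2) := by
    rw [Finset.prod_pow_eq_pow_sum, Fin.sum_univ_eq_sum_range (fun i => n - 1 - i),
      Finset.sum_range_reflect (fun i => i), Finset.sum_range_id]
  rw [h3] at h2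
  have h4 : n * (n - 1) / 2 * 2 = n * (n - 1) := Nat.div_mul_cancel (Nat.even_mul_pred_self n).two_dvd
  calc _ ≤ (R ^ (n * (n - 1) / 2)) ^ 2 := by gcongr
    _ = _ := by rw [← pow_mul, h4]

theorem prod_wdLead (hn : 2 ≤ f.natDegree) :
    ∏ k : Fin f.natDegree, wdLead f m k = (f.coeff f.natDegree : ℂ) ^ (f.natDegree - 1) * (m : ℂ)⁻¹ := by
  have h1 : ∏ k : Fin f.natDegree, wdLead f m k = ∏ k ∈ Finset.range f.natDegree, wdLead f m k :=
    Fin.prod_univ_eq_prod_range _ _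
  rw [h1]
  unfold wdLead
  rw [Finset.prod_mul_distrib, mul_comm]
  congr 1
  · obtain ⟨k, hk⟩ : ∃ k, f.natDegree = k + 1 := ⟨f.natDegree - 1, by omega⟩
    generalize (f.coeff f.natDegree : ℂ) = A
    rw [hk, Finset.prod_range_succ']
    simp
  · rw [Finset.prod_eq_single (f.natDegree - 1)]
    · rw [if_pos (by omega)]
    · intro k _ hk
      rw [if_neg (by omega)]
    · intro h
      exact absurd (Finset.mem_range.2 (by omega)) h

/-- The determinant is a_0^{n-1}/m times the Vandermonde determinant, and root differences are at
most 4t; this is the source of the constant 4^{n(n-1)}. -/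
theorem ringClass_mem_discLE (hn : 2 ≤ f.natDegree) (hm : 0 < m) (hw : WeaklyDivisibleAt f m l)
    (hδ : IsRoots f δ) {s t : ℝ} (h0 : 0 < f.coeff f.natDegree) (h0' : f.coeff f.natDegree ≤ s)
    (hR : ∀ i, ‖δ i‖ ≤ 2 * t) :
    ringClass (wdRing f m l) ∈ discLE f.natDegree (4 ^ (f.natDegree * (f.natDegree - 1)) *
      (s ^ (2 * f.natDegree - 2) * t ^ (f.natDegree * (f.natDegree - 1)) / (m : ℝ) ^ 2)) := by
  have hz : ∀ i, aeval (δ i) f = 0 := fun i => (hδ.aeval_eq_zero_iff h0.ne').2 ⟨i, rfl⟩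
  have hE : (Matrix.of fun i k => wdEval f m l (hz i) (wdElt f m l k)) =
      Matrix.of fun i k : Fin f.natDegree => (wdPoly f m l k).eval (δ i) := by
    ext i k
    rw [Matrix.of_apply, Matrix.of_apply, ← evalRoot_wdBasis f (hz i)]
    rfl
  refine ringClass_mem_discLE_of_forall (wdElt f m l)
    (fun x hx => linearIndependent_wdElt hm h0.ne' hδ hx) (exists_eq_sum_wdElt hn hm hw)
    (fun i => wdEval f m l (hz i)) ?_ ?_
  · rw [hE]
    exact det_wdPoly_ne_zero (l := l) hm h0.ne' hδ.injective
  · have ha : (0 : ℝ) ≤ f.coeff f.natDegree := by exact_mod_cast h0.le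
    have hmr : (0 : ℝ) < m := by exact_mod_cast hm
    rw [hE, det_wdPoly hm h0.ne', prod_wdLead hn, norm_mul, norm_mul, norm_pow,
      norm_inv, Complex.norm_natCast, Complex.norm_intCast, abs_of_nonneg ha, mul_pow]
    have h2 := norm_vandermonde_le (v := δ) (R := 4 * t) fun i j =>
      (norm_sub_le _ _).trans (by linarith [hR i, hR j])
    calc _ ≤ (s ^ (f.natDegree - 1) * (m : ℝ)⁻¹) ^ 2 * (4 * t) ^ (f.natDegree * (f.natDegree - 1)) := by
          gcongr
      _ = _ := by
          rw [mul_pow, mul_pow, ← pow_mul, show (f.natDegree - 1) * 2 = 2 * f.natDegree - 2 by omega]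
          field_simp

end

end UltraWeak

end

noncomputable section
namespace UltraWeak
open Polynomial

/-! ### Rigidity of the rings -/

theorem coeff_translate_pred {f : ℤ[X]} (hn : 1 ≤ f.natDegree) (l : ℤ) :
    (translate f l).coeff (f.natDegree - 1) =
      f.coeff (f.natDegree - 1) + f.natDegree * f.coeff f.natDegree * l := by
  have h1 : translate f l = ∑ i ∈ Finset.range (f.natDegree + 1), C (f.coeff i) * (X + C l) ^ i := by
    conv_lhs => rw [translate, f.as_sum_range_C_mul_X_pow]
    rw [sum_comp]
    exact Finset.sum_congr rfl fun i _ => by simp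
  rw [h1, finsetSum_coeff]
  obtain ⟨k, hk⟩ : ∃ k, f.natDegree = k + 1 := ⟨f.natDegree - 1, by omega⟩
  rw [hk, Finset.sum_range_succ, Finset.sum_range_succ, Finset.sum_eq_zero]
  · simp only [Nat.add_sub_cancel, coeff_C_mul, coeff_X_add_C_pow, Nat.sub_self, pow_zero,
      Nat.choose_self, Nat.cast_one, mul_one, Nat.add_sub_cancel_left, pow_one, Nat.choose_succ_self_right]
    push_cast
    ring
  · intro i hi
    have hi' := Finset.mem_range.1 hi
    rw [coeff_C_mul, coeff_X_add_C_pow, Nat.choose_eq_zero_of_lt (by omega)]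
    simp

/-- The standing assumptions on `(f, m, l)`. -/
structure IsTame (n : ℕ) (s t : ℝ) (f : ℤ[X]) (m : ℕ) (l : ℤ) : Prop where
  five_le : 5 ≤ n
  isNice : IsNice n (middleBound n) s t f
  le_t : n * 4 ^ (n + 2) ≤ t
  le_pow : n * 4 ^ (n + 2) * m ≤ t ^ (n - 2)
  pos : 0 < m
  weaklyDivisibleAt : WeaklyDivisibleAt f m l
  nonneg : 0 ≤ l
  lt : l < m

section

variable {n : ℕ} {s t : ℝ} {f : ℤ[X]} {m : ℕ} {l : ℤ}

theorem IsNice.coeff_pos {κ : ℝ} (h : IsNice n κ s t f) : 0 < f.coeff n := by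
  have h1 := h.pos
  have h2 := h.lower
  have : (0 : ℝ) < f.coeff n := by linarith
  exact_mod_cast this

theorem IsTame.one_le_t (h : IsTame n s t f m l) : 1 ≤ t := by
  refine le_trans ?_ h.le_t
  have hn : (1 : ℝ) ≤ n := by
    have := h.five_le
    exact_mod_cast (by omega : 1 ≤ n)
  exact one_le_mul_of_one_le_of_one_le hn (one_le_pow₀ (by norm_num))

theorem IsTame.exists_isRoots (h : IsTame n s t f m l) : ∃ δ : Fin n → ℂ, IsRoots f δ := by
  refine UltraWeak.exists_isRoots h.isNice.natDegree_eq h.isNice.coeff_pos.ne' fun z hz h0 => ?_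
  have h1 := (h.isNice.root_bounds h.five_le h.le_t hz).2
  have h2 := h.isNice.pos
  have h3 := h.one_le_t
  rw [h0, norm_zero] at h1
  have : 0 < s * t ^ (n - 1) / 2 ^ n := by positivity
  linarith

/-- The element `a_0 δ`. -/
def scaledRoot (f : ℤ[X]) : QAlg f :=
  (f.coeff f.natDegree : QAlg f) * AdjoinRoot.root (f.map (Int.castRingHom ℚ))

/-- The element `a_0 δ ^ 2 + a_1 δ`. -/
def quadElt (f : ℤ[X]) : QAlg f :=
  (f.coeff f.natDegree : QAlg f) * AdjoinRoot.root (f.map (Int.castRingHom ℚ)) ^ 2 +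
    (f.coeff (f.natDegree - 1) : QAlg f) * AdjoinRoot.root (f.map (Int.castRingHom ℚ))

/-- The elements a_0 δ and a_0 δ² + a_1 δ do not involve l or m, yet up to lower terms they are B_1
and B_2. They are the handle for comparing two rings. -/
theorem scaledRoot_eq (hn : 3 ≤ f.natDegree) (m : ℕ) (l : ℤ) :
    scaledRoot f = wdBasis f m l ⟨1, by omega⟩ + ((f.coeff f.natDegree * l : ℤ) : QAlg f) := by
  rw [wdBasis, if_neg (by simp only; omega), canonicalElt, if_neg one_ne_zero, Finset.sum_range_one,
    Nat.sub_zero, coeff_translate_natDegree, transRoot, scaledRoot]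
  push_cast
  ring

theorem quadElt_eq (hn : 4 ≤ f.natDegree) (m : ℕ) (l : ℤ) :
    quadElt f = wdBasis f m l ⟨2, by omega⟩ + ((2 - f.natDegree) * l : ℤ) * scaledRoot f +
      (((f.natDegree - 1) * f.coeff f.natDegree * l ^ 2 + f.coeff (f.natDegree - 1) * l : ℤ) :
        QAlg f) := by
  rw [wdBasis, if_neg (by simp only; omega), canonicalElt, if_neg two_ne_zero, Finset.sum_range_succ,
    Finset.sum_range_one, Nat.sub_zero, coeff_translate_natDegree, coeff_translate_pred (by omega),
    transRoot, scaledRoot, quadElt]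
  push_cast
  ring

theorem scaledRoot_sq (f : ℤ[X]) : scaledRoot f ^ 2 + (f.coeff (f.natDegree - 1) : QAlg f) * scaledRoot f =
    (f.coeff f.natDegree : QAlg f) * quadElt f := by
  rw [scaledRoot, quadElt]
  ring

theorem scaledRoot_mem (hn : 3 ≤ f.natDegree) (m : ℕ) (l : ℤ) : scaledRoot f ∈ wdRing f m l := by
  rw [scaledRoot_eq hn m l]
  exact add_mem (wdElt f m l _).2 (intCast_mem _ _)

theorem quadElt_mem (hn : 4 ≤ f.natDegree) (m : ℕ) (l : ℤ) : quadElt f ∈ wdRing f m l := by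
  rw [quadElt_eq hn m l]
  exact add_mem (add_mem (wdElt f m l _).2 (mul_mem (intCast_mem _ _) (scaledRoot_mem (by omega) m l)))
    (intCast_mem _ _)

theorem aeval_scaledRoot (f : ℤ[X]) :
    aeval (scaledRoot f) (scaleRoots f (f.coeff f.natDegree)) = 0 := by
  have h : aeval (AdjoinRoot.root (f.map (Int.castRingHom ℚ))) f = 0 := by
    have := AdjoinRoot.eval₂_root (f.map (Int.castRingHom ℚ))
    rw [eval₂_map] at this
    rw [aeval_def]
    convert! this using 2
  have := scaleRoots_aeval_eq_zero (r := f.coeff f.natDegree) h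
  convert! this using 2

theorem IsTame.deg (h : IsTame n s t f m l) : f.natDegree = n := h.isNice.natDegree_eq

theorem IsTame.scaledRoot_mem (h : IsTame n s t f m l) : scaledRoot f ∈ wdRing f m l :=
  UltraWeak.scaledRoot_mem (by have := h.five_le; have := h.deg; omega) m l

/-- An arbitrary homomorphism to ℂ sends a_0 δ to a root of the monic polynomial `scaleRoots f a_0`,
that is, to a_0 times a root of f. -/
theorem IsTame.aeval_hom_div (h : IsTame n s t f m l) (φ : wdRing f m l →+* ℂ) :
    aeval (φ ⟨scaledRoot f, h.scaledRoot_mem⟩ / f.coeff n) f = 0 := by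
  have h0 : (f.coeff n : ℂ) ≠ 0 := by exact_mod_cast h.isNice.coeff_pos.ne'
  set v : wdRing f m l := ⟨scaledRoot f, h.scaledRoot_mem⟩ with hv
  have h1 : aeval v (scaleRoots f (f.coeff n)) = 0 := by
    apply Subtype.ext
    have h2 := aeval_scaledRoot f
    rw [h.deg] at h2
    rw [← Subalgebra.coe_val, ← aeval_algHom_apply]
    exact h2
  have h3 : eval₂ (Int.castRingHom ℂ) (φ v) (scaleRoots f (f.coeff n)) = 0 := by
    have h4 := congrArg φ h1
    rw [aeval_def, hom_eval₂, map_zero] at h4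
    convert! h4 using 2
    exact RingHom.ext_int _ _
  have h5 := scaleRoots_eval₂_mul (p := f) (Int.castRingHom ℂ) (φ v / f.coeff n) (f.coeff n)
  rw [eq_intCast, mul_div_cancel₀ _ h0, h3] at h5
  have h6 := (mul_eq_zero.1 h5.symm).resolve_left (pow_ne_zero _ h0)
  rwa [aeval_def, algebraMap_int_eq]

theorem IsTame.wdEval_scaledRoot (h : IsTame n s t f m l) {z : ℂ} (hz : aeval z f = 0) :
    wdEval f m l hz ⟨scaledRoot f, h.scaledRoot_mem⟩ = f.coeff n * z := by
  change evalRoot f hz (scaledRoot f) = _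
  rw [scaledRoot, map_mul, map_intCast, evalRoot_root, h.deg]

/-- The spread over all complex homomorphisms is an invariant of the abstract ring, which is why it
is bounded in this form. -/
theorem IsTame.norm_sub_le (h : IsTame n s t f m l) (φ ψ : wdRing f m l →+* ℂ) :
    ‖φ ⟨scaledRoot f, h.scaledRoot_mem⟩ - ψ ⟨scaledRoot f, h.scaledRoot_mem⟩‖ ≤ 4 * s * t := by
  have h0 : (f.coeff n : ℂ) ≠ 0 := by exact_mod_cast h.isNice.coeff_pos.ne'
  have h1 : ∀ φ : wdRing f m l →+* ℂ, ‖φ ⟨scaledRoot f, h.scaledRoot_mem⟩‖ ≤ s * (2 * t) := by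
    intro φ
    have h2 := (h.isNice.root_bounds h.five_le h.le_t (h.aeval_hom_div φ)).1
    have h3 := h.isNice.upper
    have h4 : (0 : ℝ) < f.coeff n := by exact_mod_cast h.isNice.coeff_pos
    have h5 := h.one_le_t
    rw [norm_div, div_le_iff₀ (by simpa using h.isNice.coeff_pos.ne'), Complex.norm_intCast,
      abs_of_pos h4] at h2
    refine h2.trans ?_
    rw [mul_comm]
    gcongr
  refine (_root_.norm_sub_le _ _).trans ?_
  linarith [h1 φ, h1 ψ]

/-- Elements of small spread are integral combinations of `1` and `a_0 δ`. -/
theorem IsTame.exists_of_norm_le (h : IsTame n s t f m l) (w : wdRing f m l)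
    (hwD : ∀ φ ψ : wdRing f m l →+* ℂ, ‖φ w - ψ w‖ ≤ 4 * s * t) :
    ∃ c₀ c₁ : ℤ, w = (c₀ : wdRing f m l) + c₁ * ⟨scaledRoot f, h.scaledRoot_mem⟩ := by
  obtain ⟨δ, hδ⟩ := h.exists_isRoots
  obtain rfl := h.deg
  have hn := h.five_le
  have hs := h.isNice.pos
  have ht := h.one_le_t
  have ht0 : 0 < t := by linarith
  have ha0 := h.isNice.coeff_pos
  have hz : ∀ i, aeval (δ i) f = 0 := fun i => (hδ.aeval_eq_zero_iff ha0.ne').2 ⟨i, rfl⟩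
  have ha : (0 : ℝ) < f.coeff f.natDegree := by exact_mod_cast ha0
  have hmr : (0 : ℝ) < m := by exact_mod_cast h.pos
  have hnr : (0 : ℝ) < f.natDegree := by exact_mod_cast (by omega : 0 < f.natDegree)
  obtain ⟨x, hx⟩ := exists_eq_sum_wdElt (by omega) h.pos h.weaklyDivisibleAt w
  -- Let k ≥ 2 be the largest index with a nonzero integer coordinate. Interpolation bounds the
  -- corresponding leading coefficient, but an integer that is not zero has absolute value at least
  -- 1.
  have hx0 : ∀ k : Fin f.natDegree, 2 ≤ (k : ℕ) → x k = 0 := by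
    by_contra! hne
    obtain ⟨k₀, hk₀2, hk₀⟩ := hne
    obtain ⟨k, hk, hmax⟩ := Finset.exists_max_image (Finset.univ.filter fun k => x k ≠ 0)
      (fun k : Fin f.natDegree => (k : ℕ)) ⟨k₀, by simpa using hk₀⟩
    have hxk : x k ≠ 0 := (Finset.mem_filter.1 hk).2
    have hk2 : 2 ≤ (k : ℕ) := hk₀2.trans (hmax k₀ (by simpa using hk₀))
    have hxj : ∀ j : Fin f.natDegree, (k : ℕ) < j → x j = 0 := by
      intro j hj
      by_contra h1
      have := hmax j (by simpa using h1)
      omega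
    set P : ℂ[X] := ∑ j, C (x j : ℂ) * wdPoly f m l j with hP
    have hPd : P.natDegree ≤ k := by
      refine natDegree_sum_le_of_forall_le _ _ fun j _ => ?_
      rcases Nat.lt_or_ge k j with h1 | h1
      · simp [hxj j h1]
      · exact (natDegree_C_mul_le _ _).trans ((natDegree_wdPoly_le f m l j).trans h1)
    have hPc : P.coeff k = x k * wdLead f m k := by
      rw [hP, finsetSum_coeff, Finset.sum_eq_single k]
      · rw [coeff_C_mul, coeff_wdPoly]
      · intro j _ hj
        rw [coeff_C_mul]
        rcases Nat.lt_or_ge k j with h1 | h1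
        · simp [hxj j h1]
        · have h2 : (j : ℕ) ≠ k := fun h2 => hj (Fin.ext h2)
          rw [coeff_eq_zero_of_natDegree_lt
            (lt_of_le_of_lt (natDegree_wdPoly_le f m l j) (by omega)), mul_zero]
      · intro h1
        exact absurd (Finset.mem_univ _) h1
    have hPe : ∀ i, P.eval (δ i) = wdEval f m l (hz i) w := by
      intro i
      rw [hx, map_sum, hP, eval_finsetSum]
      refine Finset.sum_congr rfl fun j _ => ?_
      rw [eval_mul, eval_C, map_mul, map_intCast, ← evalRoot_wdBasis f (hz i)]
      rfl
    have hk1 : 1 ≤ (k : ℕ) := by omega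
    have hbound := hδ.norm_coeff_mul_le (B := s * t ^ (f.natDegree - 1) / 2 ^ f.natDegree) (R := 2 * t) (D := 4 * s * t)
      (fun i => (h.isNice.root_bounds hn h.le_t (hz i)).2) (by positivity)
      (fun i => (h.isNice.root_bounds hn h.le_t (hz i)).1) hk1 k.2 hPd
      (fun i j => by rw [hPe, hPe]; exact hwD _ _)
    rw [hPc, norm_mul, Complex.norm_intCast, wdLead, if_neg (by omega : ¬ (k : ℕ) = 0), norm_mul,
      Complex.norm_intCast, abs_of_pos ha] at hbound
    have hx1 : (1 : ℝ) ≤ |(x k : ℝ)| := by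
      exact_mod_cast Int.one_le_abs hxk
    have h2N : (4 : ℝ) ^ (f.natDegree + 2) = 2 ^ f.natDegree * 2 ^ f.natDegree * 16 := by
      rw [pow_add, ← mul_pow]; norm_num
    have h2N1 : (1 : ℝ) ≤ 2 ^ f.natDegree := one_le_pow₀ (by norm_num)
    have htN : t ^ (f.natDegree - 1) = t * t ^ (f.natDegree - 2) := by
      rw [← pow_succ']; congr 1; omega
    have hle_t := h.le_t
    have hle_pow := h.le_pow
    -- For the last basis element the denominator m must be beaten by t^{n-2}, which is `le_pow`;
    -- for the others `le_t` suffices.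
    by_cases hkN : (k : ℕ) + 1 = f.natDegree
    · rw [if_pos hkN, norm_inv, Complex.norm_natCast, show f.natDegree - 1 - (k : ℕ) = 0 by omega, pow_zero,
        mul_one, htN] at hbound
      have h1 : 1 * ((m : ℝ)⁻¹ * f.coeff f.natDegree) * (s * (t * t ^ (f.natDegree - 2)) / 2 ^ f.natDegree) ≤
          f.natDegree * (f.coeff f.natDegree * (4 * s * t)) := le_trans (by gcongr) hbound
      have h3 : 1 * ((m : ℝ)⁻¹ * f.coeff f.natDegree) * (s * (t * t ^ (f.natDegree - 2)) / 2 ^ f.natDegree) =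
        (f.coeff f.natDegree * s * t) * (t ^ (f.natDegree - 2) / (m * 2 ^ f.natDegree)) := by field_simp
      have h4 : f.natDegree * (f.coeff f.natDegree * (4 * s * t)) = (f.coeff f.natDegree * s * t) * (4 * f.natDegree) := by ring
      rw [h3, h4] at h1
      have h5 := le_of_mul_le_mul_left h1 (by positivity)
      rw [div_le_iff₀ (by positivity)] at h5
      rw [h2N] at hle_pow
      have h6 : 0 < (f.natDegree : ℝ) * m * 2 ^ f.natDegree := by positivity
      nlinarith
    · rw [if_neg hkN, norm_one, one_mul] at hbound
      have h1 : 1 * (f.coeff f.natDegree : ℝ) * (s * t ^ (f.natDegree - 1) / 2 ^ f.natDegree) ≤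
          f.natDegree * (f.coeff f.natDegree * (4 * s * t) * (2 * t) ^ (f.natDegree - 1 - k)) := le_trans (by gcongr) hbound
      have hk2' : t ^ (f.natDegree - 1) = t * t * t ^ (k - 2 : ℕ) * t ^ (f.natDegree - 1 - k) := by
        rw [mul_assoc (t * t), ← pow_add, ← pow_two, ← pow_add]; congr 1; omega
      have h3 : 1 * (f.coeff f.natDegree : ℝ) * (s * t ^ (f.natDegree - 1) / 2 ^ f.natDegree) =
        (f.coeff f.natDegree * s * t * t ^ (f.natDegree - 1 - k)) * (t * t ^ (k - 2 : ℕ) / 2 ^ f.natDegree) := by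
        rw [hk2']; ring
      have h4 : f.natDegree * (f.coeff f.natDegree * (4 * s * t) * (2 * t) ^ (f.natDegree - 1 - k)) =
        (f.coeff f.natDegree * s * t * t ^ (f.natDegree - 1 - k)) * (4 * f.natDegree * 2 ^ (f.natDegree - 1 - k)) := by
        rw [mul_pow]; ring
      rw [h3, h4] at h1
      have h5 := le_of_mul_le_mul_left h1 (by positivity)
      have h7 : t * 1 ≤ t * t ^ (k - 2 : ℕ) := by gcongr; exact one_le_pow₀ ht
      have h8 : (2 : ℝ) ^ (f.natDegree - 1 - k) ≤ 2 ^ f.natDegree := pow_le_pow_right₀ (by norm_num) (by omega)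
      rw [div_le_iff₀ (by positivity)] at h5
      have h9 : 4 * f.natDegree * 2 ^ (f.natDegree - 1 - k) * 2 ^ f.natDegree ≤ 4 * f.natDegree * 2 ^ f.natDegree * (2 : ℝ) ^ f.natDegree := by gcongr
      have h10 : 0 < (f.natDegree : ℝ) * 2 ^ f.natDegree * 2 ^ f.natDegree := by positivity
      rw [h2N] at hle_t
      nlinarith
  refine ⟨x ⟨0, by omega⟩ - x ⟨1, by omega⟩ * (f.coeff f.natDegree * l), x ⟨1, by omega⟩, ?_⟩
  have h1 : (w : QAlg f) = ∑ k, (x k : QAlg f) * wdBasis f m l k := by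
    rw [hx, coe_sum_wdElt]
  apply Subtype.ext
  rw [h1, Finset.sum_eq_add ⟨0, by omega⟩ ⟨1, by omega⟩]
  · have h2 := scaledRoot_eq (f := f) (by omega) m l
    have h3 : wdBasis f m l ⟨0, by omega⟩ = 1 := by
      rw [wdBasis, if_neg (by simp only; omega), canonicalElt, if_pos rfl]
    change _ = ((x ⟨0, by omega⟩ - x ⟨1, by omega⟩ * (f.coeff f.natDegree * l) : ℤ) : QAlg f) +
      (x ⟨1, by omega⟩ : QAlg f) * scaledRoot f
    rw [h2, h3]
    push_cast
    ring
  · simp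
  · intro k _ hk
    have : 2 ≤ (k : ℕ) := by
      have h2 : (k : ℕ) ≠ 0 := fun h2 => hk.1 (Fin.ext h2)
      have h3 : (k : ℕ) ≠ 1 := fun h3 => hk.2 (Fin.ext h3)
      omega
    rw [hx0 k this]
    simp
  · intro h2; exact absurd (Finset.mem_univ _) h2
  · intro h2; exact absurd (Finset.mem_univ _) h2

/-- Compare coordinates at B_1 and B_2, which belong to the unmodified part of the basis because n ≥
5. With A = 0 this also yields linear independence. -/
theorem IsTame.dvd_of_eq (h : IsTame n s t f m l) {c₀ c₁ c₂ A : ℤ} {z : QAlg f}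
    (hz : z ∈ wdRing f m l) (he : (c₀ : QAlg f) + c₁ * scaledRoot f + c₂ * quadElt f = A * z) :
    A ∣ c₁ ∧ A ∣ c₂ := by
  obtain ⟨δ, hδ⟩ := h.exists_isRoots
  obtain rfl := h.deg
  have hn := h.five_le
  obtain ⟨x, hx⟩ := exists_eq_sum_wdBasis (by omega) h.pos h.weaklyDivisibleAt hz
  set i0 : Fin f.natDegree := ⟨0, by omega⟩ with hi0
  set i1 : Fin f.natDegree := ⟨1, by omega⟩ with hi1
  set i2 : Fin f.natDegree := ⟨2, by omega⟩ with hi2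
  have h01 : i0 ≠ i1 := fun h => by simp [hi0, hi1] at h
  have h02 : i0 ≠ i2 := fun h => by simp [hi0, hi2] at h
  have h12 : i1 ≠ i2 := fun h => by simp [hi1, hi2] at h
  set d₁ : ℤ := c₁ + c₂ * ((2 - f.natDegree) * l) with hd₁
  set d₀ : ℤ := c₀ + d₁ * (f.coeff f.natDegree * l) + c₂ *
    ((f.natDegree - 1) * f.coeff f.natDegree * l ^ 2 + f.coeff (f.natDegree - 1) * l) with hd₀
  set y : Fin f.natDegree → ℤ := Pi.single i0 d₀ + Pi.single i1 d₁ + Pi.single i2 c₂ with hy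
  have h3 : wdBasis f m l i0 = 1 := by
    rw [wdBasis, if_neg (by simp only [hi0]; omega), canonicalElt, if_pos rfl]
  have hsum : ∑ k, (y k : QAlg f) * wdBasis f m l k =
      d₀ + d₁ * wdBasis f m l i1 + c₂ * wdBasis f m l i2 := by
    have hs : ∀ (i : Fin f.natDegree) (d : ℤ),
        ∑ k, ((Pi.single i d : Fin f.natDegree → ℤ) k : QAlg f) * wdBasis f m l k =
          d * wdBasis f m l i := by
      intro i d
      rw [Finset.sum_eq_single i]
      · rw [Pi.single_eq_same]
      · intro k _ hk
        rw [Pi.single_eq_of_ne hk]; simp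
      · intro h2; exact absurd (Finset.mem_univ _) h2
    simp only [hy, Pi.add_apply, Int.cast_add, add_mul, Finset.sum_add_distrib, hs, h3, mul_one]
  have hli := linearIndependent_wdBasis (l := l) h.pos h.isNice.coeff_pos.ne' hδ
    (x := fun k => y k - A * x k) (by
      simp only [Int.cast_sub, Int.cast_mul, sub_mul, Finset.sum_sub_distrib, hsum]
      simp only [mul_assoc, ← Finset.mul_sum]
      rw [← hx, ← he, quadElt_eq (by omega) m l, scaledRoot_eq (by omega) m l]
      simp only [hd₀, hd₁]
      push_cast
      ring)
  have e1 : d₁ = A * x i1 := by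
    have := congrFun hli i1
    simp only [hy, Pi.add_apply, Pi.single_eq_same, Pi.single_eq_of_ne h01.symm,
      Pi.single_eq_of_ne h12, Pi.zero_apply, zero_add, add_zero] at this
    linarith
  have e2 : c₂ = A * x i2 := by
    have := congrFun hli i2
    simp only [hy, Pi.add_apply, Pi.single_eq_same, Pi.single_eq_of_ne h02.symm,
      Pi.single_eq_of_ne h12.symm, Pi.zero_apply, zero_add] at this
    linarith
  have h2 : A ∣ c₂ := ⟨_, e2⟩
  refine ⟨?_, h2⟩
  have : c₁ = d₁ - c₂ * ((2 - f.natDegree) * l) := by rw [hd₁]; ring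
  rw [this]
  exact dvd_sub ⟨_, e1⟩ (h2.mul_right _)

end

end UltraWeak

end

/-! ### Recovering f, m and l from the isomorphism class -/

noncomputable section
namespace UltraWeak
open Polynomial

section

variable {n : ℕ} {s t : ℝ} {f g : ℤ[X]} {m m' : ℕ} {l l' : ℤ}

theorem IsTame.exists_apply_scaledRoot (h : IsTame n s t f m l) (h' : IsTame n s t g m' l')
    (e : wdRing f m l ≃+* wdRing g m' l') :
    ∃ k σ : ℤ, e ⟨scaledRoot f, h.scaledRoot_mem⟩ =
      (k : wdRing g m' l') + σ * ⟨scaledRoot g, h'.scaledRoot_mem⟩ :=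
  h'.exists_of_norm_le _ fun φ ψ => h.norm_sub_le (φ.comp e.toRingHom) (ψ.comp e.toRingHom)

/-- The inverse isomorphism has the same shape, and the two linear coefficients multiply to 1. -/
theorem IsTame.isUnit_of_apply (h : IsTame n s t f m l) (h' : IsTame n s t g m' l')
    (e : wdRing f m l ≃+* wdRing g m' l') {k σ : ℤ}
    (he : e ⟨scaledRoot f, h.scaledRoot_mem⟩ =
      (k : wdRing g m' l') + σ * ⟨scaledRoot g, h'.scaledRoot_mem⟩) : IsUnit σ := by
  obtain ⟨d₀, d₁, hd⟩ := h'.exists_apply_scaledRoot h e.symm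
  have h1 := congrArg e hd
  rw [RingEquiv.apply_symm_apply, map_add, map_mul, map_intCast, map_intCast, he] at h1
  have h2 : (scaledRoot g : QAlg g) = d₀ + d₁ * (k + σ * scaledRoot g) := congrArg Subtype.val h1
  have h3 := (h'.dvd_of_eq (c₀ := d₀ + d₁ * k) (c₁ := d₁ * σ - 1) (c₂ := 0) (A := 0)
    (zero_mem (wdRing g m' l')) (by
      push_cast
      linear_combination -h2)).1
  rw [zero_dvd_iff] at h3
  exact IsUnit.of_mul_eq_one d₁ (by linarith)

/-- With α = a_0 δ, the element α² + a_1 α is divisible by a_0 in the ring. Transport this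
divisibility through α ↦ k + σβ, reduce β² by the analogous relation for g, and compare coordinates.
-/
theorem IsTame.dvd_of_apply (h : IsTame n s t f m l) (h' : IsTame n s t g m' l')
    (e : wdRing f m l ≃+* wdRing g m' l') {k σ : ℤ}
    (he : e ⟨scaledRoot f, h.scaledRoot_mem⟩ =
      (k : wdRing g m' l') + σ * ⟨scaledRoot g, h'.scaledRoot_mem⟩) :
    f.coeff n ∣ g.coeff n ∧
      f.coeff n ∣ 2 * k * σ + f.coeff (n - 1) * σ - g.coeff (n - 1) := by
  have hn := h.five_le
  have hu := h.isUnit_of_apply h' e he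
  have hσ : (σ : QAlg g) ^ 2 = 1 := by
    rw [pow_two, ← Int.cast_mul, Int.isUnit_mul_self hu, Int.cast_one]
  have hy : quadElt f ∈ wdRing f m l := quadElt_mem (by rw [h.deg]; omega) m l
  have h1 : (⟨scaledRoot f, h.scaledRoot_mem⟩ : wdRing f m l) ^ 2 +
      (f.coeff (n - 1) : wdRing f m l) * ⟨scaledRoot f, h.scaledRoot_mem⟩ =
      (f.coeff n : wdRing f m l) * ⟨quadElt f, hy⟩ := by
    apply Subtype.ext
    have := scaledRoot_sq f
    rw [h.deg] at this
    exact this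
  have h2 := congrArg e h1
  rw [map_add, map_pow, map_mul, map_mul, map_intCast, map_intCast, he] at h2
  have h3 : ((k : QAlg g) + σ * scaledRoot g) ^ 2 + f.coeff (n - 1) * (k + σ * scaledRoot g) =
      f.coeff n * (e ⟨quadElt f, hy⟩ : QAlg g) := congrArg Subtype.val h2
  have h4 := scaledRoot_sq g
  rw [h'.deg] at h4
  have h5 := h'.dvd_of_eq (c₀ := k ^ 2 + f.coeff (n - 1) * k)
    (c₁ := 2 * k * σ + f.coeff (n - 1) * σ - g.coeff (n - 1)) (c₂ := g.coeff n) (A := f.coeff n)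
    (e ⟨quadElt f, hy⟩).2 (by
      push_cast
      linear_combination h3 - h4 - (scaledRoot g) ^ 2 * hσ)
  exact h5.symm

theorem IsRoots.sum_eq {δ : Fin n → ℂ} (hδ : IsRoots f δ) (hn : 0 < n) :
    (f.coeff n : ℂ) * ∑ i, δ i = -f.coeff (n - 1) := by
  have h1 := congrArg (fun p => p.coeff (n - 1)) hδ.map_eq
  have h2 := prod_X_sub_C_coeff_card_pred Finset.univ δ (by simpa using hn)
  rw [Finset.card_univ, Fintype.card_fin] at h2
  simp only [coeff_map, coeff_C_mul, h2, eq_intCast] at h1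
  rw [h1]
  ring

/-- Write b_i for the coefficients of g. By symmetry a_0 = b_0. The embeddings match the roots of f
with those of g, and summing gives σ b_1 = a_1 + nk. Together with a_0 | 2kσ + a_1 σ - b_1 this
yields a_0 | (n-2)k, hence a_0 | k. Then a_1 + b_1 < a_0 forces k = 0, and positivity of a_1 and b_1
forces σ = 1. -/
theorem IsTame.eq_of_ringEquiv (h : IsTame n s t f m l) (h' : IsTame n s t g m' l')
    (e : wdRing f m l ≃+* wdRing g m' l') :
    f = g ∧ e ⟨scaledRoot f, h.scaledRoot_mem⟩ = ⟨scaledRoot g, h'.scaledRoot_mem⟩ := by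
  have hn := h.five_le
  obtain ⟨k, σ, he⟩ := h.exists_apply_scaledRoot h' e
  obtain ⟨k', σ', he'⟩ := h'.exists_apply_scaledRoot h e.symm
  have hu := h.isUnit_of_apply h' e he
  obtain ⟨hd1, hd2⟩ := h.dvd_of_apply h' e he
  have hd3 := (h'.dvd_of_apply h e.symm he').1
  have ha0 := h.isNice.coeff_pos
  have hlead : f.coeff n = g.coeff n := Int.dvd_antisymm ha0.le h'.isNice.coeff_pos.le hd1 hd3
  have hc0 : (f.coeff n : ℂ) ≠ 0 := by exact_mod_cast ha0.ne'
  obtain ⟨δ, hδ⟩ := h.exists_isRoots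
  obtain ⟨δ', hδ'⟩ := h'.exists_isRoots
  have hσc : (σ : ℂ) ≠ 0 := by exact_mod_cast hu.ne_zero
  have hz' : ∀ i, aeval (δ' i) g = 0 := fun i =>
    (hδ'.aeval_eq_zero_iff h'.isNice.coeff_pos.ne').2 ⟨i, rfl⟩
  have hex : ∀ i, ∃ j, (k + σ * (f.coeff n * δ' i)) / f.coeff n = δ j := by
    intro i
    have h1 := h.aeval_hom_div ((wdEval g m' l' (hz' i)).comp e.toRingHom)
    have h2 : ((wdEval g m' l' (hz' i)).comp e.toRingHom) ⟨scaledRoot f, h.scaledRoot_mem⟩ =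
        k + σ * (f.coeff n * δ' i) := by
      change wdEval g m' l' (hz' i) (e _) = _
      rw [he, map_add, map_mul, map_intCast, map_intCast, h'.wdEval_scaledRoot, hlead]
    rw [h2] at h1
    exact (hδ.aeval_eq_zero_iff ha0.ne').1 h1
  choose τ hτ using hex
  -- The roots of g correspond to roots of f injectively, hence bijectively, so their sums can be
  -- compared.
  have hτi : Function.Injective τ := by
    intro i j hij
    apply hδ'.injective
    have h1 := hτ i
    rw [hij, ← hτ j, div_left_inj' hc0, add_right_inj, mul_right_inj' hσc, mul_right_inj' hc0] at h1
    exact h1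
  have hτb : Function.Bijective τ := hτi.bijective_of_finite
  have hsum : ∑ i, δ i = ∑ i, (k + σ * (f.coeff n * δ' i)) / f.coeff n := by
    rw [← hτb.sum_comp δ]
    exact Finset.sum_congr rfl fun i _ => (hτ i).symm
  have hvieta : σ * g.coeff (n - 1) = f.coeff (n - 1) + n * k := by
    have h1 := hδ.sum_eq (by omega)
    have h2 := hδ'.sum_eq (by omega)
    rw [hsum, ← Finset.sum_div, mul_div_cancel₀ _ hc0, Finset.sum_add_distrib, ← Finset.mul_sum,
      ← Finset.mul_sum, hlead, h2, Finset.sum_const, Finset.card_univ, Fintype.card_fin,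
      nsmul_eq_mul] at h1
    have h3 : (σ : ℂ) * g.coeff (n - 1) = f.coeff (n - 1) + n * k := by linear_combination -h1
    exact_mod_cast h3
  have hσ2 : σ * σ = 1 := Int.isUnit_mul_self hu
  have hk : f.coeff n ∣ k := by
    refine h.isNice.coprime_degree.dvd_of_dvd_mul_left ?_
    have h1 : ((n : ℤ) - 2) * k =
        -σ * (2 * k * σ + f.coeff (n - 1) * σ - g.coeff (n - 1)) := by
      linear_combination (2 * k + f.coeff (n - 1)) * hσ2 - hvieta
    rw [h1]
    exact hd2.mul_left _
  have hf1 := h.isNice.one_le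
  have hg1 := h'.isNice.one_le
  -- Each a_1 is below s/4 while a_0 exceeds s/2; the upper bound s/2 of the box would not suffice
  -- here.
  have hsize : |σ * g.coeff (n - 1) - f.coeff (n - 1)| < f.coeff n := by
    have h1 : |σ * g.coeff (n - 1) - f.coeff (n - 1)| ≤ g.coeff (n - 1) + f.coeff (n - 1) := by
      refine (abs_sub _ _).trans ?_
      rw [abs_mul, Int.isUnit_iff_abs_eq.1 hu, one_mul, abs_of_pos (by omega), abs_of_pos (by omega)]
    have h2 : ((g.coeff (n - 1) + f.coeff (n - 1) : ℤ) : ℝ) < f.coeff n := by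
      have h3 := h.isNice.lt
      have h4 := h'.isNice.lt
      have h5 := h.isNice.lower
      push_cast
      linarith
    exact lt_of_le_of_lt h1 (by exact_mod_cast h2)
  have hk0 : k = 0 := by
    have h1 : σ * g.coeff (n - 1) - f.coeff (n - 1) = 0 := by
      refine Int.eq_zero_of_abs_lt_dvd ?_ hsize
      rw [hvieta, add_sub_cancel_left]
      exact hk.mul_left _
    rw [hvieta, add_sub_cancel_left] at h1
    exact (mul_eq_zero.1 h1).resolve_left (by omega)
  have hσ1 : σ = 1 := by
    rcases Int.isUnit_iff.1 hu with h1 | h1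
    · exact h1
    · rw [h1, hk0] at hvieta
      omega
  subst hk0 hσ1
  have hτ' : ∀ i, δ' i = δ (τ i) := by
    intro i
    rw [← hτ i, Int.cast_zero, zero_add, Int.cast_one, one_mul, mul_div_cancel_left₀ _ hc0]
  refine ⟨?_, ?_⟩
  · apply map_injective (Int.castRingHom ℂ) (RingHom.injective_int _)
    rw [hδ.map_eq, hδ'.map_eq, hlead]
    congr 1
    rw [← hτb.prod_comp fun i => X - C (δ i)]
    exact Finset.prod_congr rfl fun i _ => by rw [hτ']
  · rw [he, Int.cast_zero, zero_add, Int.cast_one, one_mul]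

/-- The element a_0 δ generates ℚ[x]/(f) over ℚ; clear denominators. -/
theorem exists_int_mul_eq_aeval (h0 : f.coeff f.natDegree ≠ 0) (x : QAlg f) :
    ∃ N : ℤ, N ≠ 0 ∧ ∃ q : ℤ[X], (N : QAlg f) * x = aeval (scaledRoot f) q := by
  obtain ⟨p, rfl⟩ := AdjoinRoot.mk_surjective x
  obtain ⟨a, ha⟩ : ∃ a : ℚ, a = (f.coeff f.natDegree : ℤ) := ⟨_, rfl⟩
  have ha0 : a ≠ 0 := by rw [ha]; exact_mod_cast h0
  obtain ⟨b, hb0, hb⟩ := IsLocalization.integerNormalization_spec (nonZeroDivisors ℤ)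
    (p.comp (C a⁻¹ * X))
  refine ⟨b, nonZeroDivisors.ne_zero hb0, IsLocalization.integerNormalization (nonZeroDivisors ℤ)
    (p.comp (C a⁻¹ * X)), ?_⟩
  rw [← aeval_map_algebraMap ℚ, hb]
  have h1 : aeval (scaledRoot f) (C a⁻¹ * X) = AdjoinRoot.root (f.map (Int.castRingHom ℚ)) := by
    rw [map_mul, aeval_C, aeval_X, scaledRoot, ← mul_assoc]
    have : ((f.coeff f.natDegree : ℤ) : QAlg f) = algebraMap ℚ (QAlg f) a := by
      rw [ha, map_intCast]
    rw [this, ← map_mul, inv_mul_cancel₀ ha0, map_one, one_mul]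
  rw [map_zsmul, zsmul_eq_mul, aeval_comp, h1, AdjoinRoot.aeval_eq]

/-- An isomorphism fixing a_0 δ fixes all integer polynomials in it, and a nonzero integer multiple
of every element is one. -/
theorem IsTame.apply_eq (h : IsTame n s t f m l) (h' : IsTame n s t f m' l')
    (e : wdRing f m l ≃+* wdRing f m' l')
    (he : e ⟨scaledRoot f, h.scaledRoot_mem⟩ = ⟨scaledRoot f, h'.scaledRoot_mem⟩)
    (x : wdRing f m l) : (e x : QAlg f) = x := by
  obtain ⟨N, hN, q, hq⟩ := exists_int_mul_eq_aeval (f := f)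
    (by rw [h.deg]; exact h.isNice.coeff_pos.ne') x
  have h1 : (N : wdRing f m l) * x = aeval (⟨scaledRoot f, h.scaledRoot_mem⟩ : wdRing f m l) q := by
    apply Subtype.ext
    exact hq.trans (aeval_algHom_apply (wdRing f m l).val ⟨scaledRoot f, h.scaledRoot_mem⟩ q)
  have h2 := congrArg e h1
  have h3 : e (aeval (⟨scaledRoot f, h.scaledRoot_mem⟩ : wdRing f m l) q) =
      aeval (⟨scaledRoot f, h'.scaledRoot_mem⟩ : wdRing f m' l') q := by
    rw [← he]
    exact (aeval_algHom_apply e.toRingHom.toIntAlgHom _ q).symm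
  rw [map_mul, map_intCast, h3] at h2
  have h4 : (N : QAlg f) * (e x : QAlg f) = (N : QAlg f) * x := by
    rw [hq]
    have h5 := congrArg (wdRing f m' l').val h2
    rw [← aeval_algHom_apply] at h5
    exact h5
  have hNu : IsUnit (N : QAlg f) := by
    have : (N : QAlg f) = algebraMap ℚ (QAlg f) N := by rw [map_intCast]
    rw [this]
    exact (isUnit_iff_ne_zero.2 (by exact_mod_cast hN)).map _
  exact hNu.mul_left_cancel h4

theorem coeff_wdPoly_last (hn : 3 ≤ f.natDegree) (m : ℕ) (l : ℤ) :
    (wdPoly f m l (f.natDegree - 1)).coeff (f.natDegree - 2) =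
      (m : ℂ)⁻¹ * (f.coeff (f.natDegree - 1) + f.coeff f.natDegree * l) := by
  obtain ⟨k, hk⟩ : ∃ k, f.natDegree = k + 3 := ⟨f.natDegree - 3, by omega⟩
  have h1 := coeff_translate_pred (f := f) (by omega) l
  rw [wdPoly, if_pos (by omega), coeff_C_mul, canonicalPoly, if_neg (by omega), finsetSum_coeff]
  congr 1
  have h2 : f.natDegree - 1 = k + 2 := by omega
  have h3 : f.natDegree - 2 = k + 1 := by omega
  rw [h2, Finset.sum_range_succ', Finset.sum_range_succ', Finset.sum_eq_zero, zero_add, zero_add,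
    h3, h1, Nat.sub_zero, Nat.sub_zero, coeff_translate_natDegree, sub_eq_add_neg, ← C_neg,
    coeff_C_mul, coeff_C_mul, coeff_X_add_C_pow, coeff_X_add_C_pow, h2, hk]
  · rw [show k + 2 - 1 - (k + 1) = 0 by omega, show k + 2 - (k + 1) = 1 by omega,
      show k + 2 - 1 = k + 1 by omega, Nat.choose_self, Nat.choose_succ_self_right]
    push_cast
    ring
  · intro j hj
    have hj' := Finset.mem_range.1 hj
    have h4 : ((X - C (l : ℂ)) ^ (k + 2 - (j + 1 + 1))).coeff (f.natDegree - 2) = 0 := by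
      apply coeff_eq_zero_of_natDegree_lt
      rw [natDegree_pow, natDegree_X_sub_C]
      omega
    rw [coeff_C_mul, h4, mul_zero]

/-- If one weakly divisible ring of `f` contains another, their parameters are related. -/
theorem IsTame.exists_of_le (h : IsTame n s t f m l) (h' : IsTame n s t f m' l')
    (hle : wdRing f m l ≤ wdRing f m' l') :
    m ∣ m' ∧ (m = m' → (m : ℤ) ∣ l - l') := by
  obtain ⟨δ, hδ⟩ := h.exists_isRoots
  obtain rfl := h.deg
  have hn := h.five_le
  have ha0 := h.isNice.coeff_pos
  have hc0 : (f.coeff f.natDegree : ℂ) ≠ 0 := by exact_mod_cast ha0.ne'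
  have hm : (m : ℂ) ≠ 0 := by exact_mod_cast h.pos.ne'
  have hm' : (m' : ℂ) ≠ 0 := by exact_mod_cast h'.pos.ne'
  have hz : ∀ i, aeval (δ i) f = 0 := fun i => (hδ.aeval_eq_zero_iff ha0.ne').2 ⟨i, rfl⟩
  set i1 : Fin f.natDegree := ⟨f.natDegree - 1, by omega⟩ with hi1
  set i2 : Fin f.natDegree := ⟨f.natDegree - 2, by omega⟩ with hi2
  have hv1 : (i1 : ℕ) = f.natDegree - 1 := rfl
  have hv2 : (i2 : ℕ) = f.natDegree - 2 := rfl
  have hlast : ∀ μ, wdLead f μ (f.natDegree - 1) = (μ : ℂ)⁻¹ * f.coeff f.natDegree := fun μ => by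
    rw [wdLead, if_pos (by omega), if_neg (by omega)]
  have h12 : i2 ≠ i1 := fun h => by simp [hi1, hi2] at h; omega
  obtain ⟨x, hx⟩ := exists_eq_sum_wdBasis (by omega) h'.pos h'.weaklyDivisibleAt
    (hle (wdElt f m l i1).2)
  -- Both sides have degree below n and agree at the n roots, so the identity holds between
  -- polynomials and coefficients can be compared.
  have hP : wdPoly f m l i1 = ∑ k : Fin f.natDegree, C (x k : ℂ) * wdPoly f m' l' k := by
    refine eq_of_degrees_lt_of_eval_index_eq Finset.univ hδ.injective.injOn ?_ ?_ fun i _ => ?_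
    · rw [Finset.card_univ, Fintype.card_fin]
      refine lt_of_le_of_lt (degree_le_of_natDegree_le (natDegree_wdPoly_le f m l i1)) ?_
      exact_mod_cast i1.2
    · rw [Finset.card_univ, Fintype.card_fin]
      refine lt_of_le_of_lt (degree_le_of_natDegree_le (n := f.natDegree - 1) ?_) ?_
      · refine natDegree_sum_le_of_forall_le _ _ fun k _ => ?_
        exact (natDegree_C_mul_le _ _).trans ((natDegree_wdPoly_le f m' l' k).trans (by omega))
      · exact_mod_cast (by omega : f.natDegree - 1 < f.natDegree)
    · have h1 := congrArg (evalRoot f (hz i)) hx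
      change evalRoot f (hz i) (wdBasis f m l i1) = _ at h1
      rw [evalRoot_wdBasis, map_sum] at h1
      rw [h1, eval_finsetSum]
      refine Finset.sum_congr rfl fun k _ => ?_
      rw [map_mul, map_intCast, evalRoot_wdBasis, eval_mul, eval_C]
  have hlow : ∀ j k : ℕ, j < k → (wdPoly f m' l' j).coeff k = 0 := fun j k hjk =>
    coeff_eq_zero_of_natDegree_lt (lt_of_le_of_lt (natDegree_wdPoly_le f m' l' j) hjk)
  -- The top coefficients give 1/m = x/m' with x an integer.
  have e1 : (m' : ℂ) = m * x i1 := by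
    have h1 := congrArg (fun p => p.coeff (f.natDegree - 1)) hP
    simp only [finsetSum_coeff, coeff_C_mul] at h1
    rw [Finset.sum_eq_single i1 (fun k _ hk => ?_) (fun h2 => absurd (Finset.mem_univ _) h2)] at h1
    · rw [hv1, coeff_wdPoly, coeff_wdPoly, hlast, hlast] at h1
      field_simp at h1
      linear_combination h1
    · have : (k : ℕ) ≠ f.natDegree - 1 := fun h2 => hk (Fin.ext h2)
      rw [hlow _ _ (by omega), mul_zero]
  have e1' : (m' : ℤ) = m * x i1 := by exact_mod_cast e1
  refine ⟨Int.natCast_dvd_natCast.1 ⟨_, e1'⟩, ?_⟩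
  rintro rfl
  have hx1 : x i1 = 1 := by
    have h1 : (m : ℤ) ≠ 0 := by exact_mod_cast h.pos.ne'
    exact mul_left_cancel₀ h1 (by linarith)
  -- For m = m' the next coefficients are (a_1 + a_0 l)/m and (a_1 + a_0 l')/m, differing by an
  -- integer multiple of a_0.
  refine ⟨x i2, ?_⟩
  have h1 := congrArg (fun p => p.coeff (f.natDegree - 2)) hP
  simp only [finsetSum_coeff, coeff_C_mul] at h1
  rw [Finset.sum_eq_add i2 i1 h12 (fun k _ hk => ?_) (fun h2 => absurd (Finset.mem_univ _) h2)
    (fun h2 => absurd (Finset.mem_univ _) h2)] at h1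
  · rw [hv1, hv2, coeff_wdPoly_last (by omega), coeff_wdPoly_last (by omega), coeff_wdPoly, wdLead,
      if_neg (by omega), if_neg (by omega), hx1] at h1
    have h2 : (f.coeff f.natDegree : ℂ) * (l - l') = f.coeff f.natDegree * (m * x i2) := by
      field_simp at h1
      push_cast at h1
      linear_combination h1
    have h3 := mul_left_cancel₀ hc0 h2
    exact_mod_cast h3
  · have h3 : (k : ℕ) ≠ f.natDegree - 2 := fun h2 => hk.1 (Fin.ext h2)
    have h4 : (k : ℕ) ≠ f.natDegree - 1 := fun h2 => hk.2 (Fin.ext h2)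
    rw [hlow _ _ (by omega), mul_zero]

/-- The ring determines the polynomial and the weak divisor. -/
theorem IsTame.eq_of_ringClass_eq (h : IsTame n s t f m l) (h' : IsTame n s t g m' l')
    (heq : ringClass (wdRing f m l) = ringClass (wdRing g m' l')) : f = g ∧ m = m' ∧ l = l' := by
  obtain ⟨i⟩ := Quotient.exact heq
  have e : wdRing f m l ≃+* wdRing g m' l' := i.commRingCatIsoToRingEquiv
  obtain ⟨rfl, he⟩ := h.eq_of_ringEquiv h' e
  have he' : e.symm ⟨scaledRoot f, h'.scaledRoot_mem⟩ = ⟨scaledRoot f, h.scaledRoot_mem⟩ := by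
    rw [← he, e.symm_apply_apply]
  have hle : wdRing f m l ≤ wdRing f m' l' := fun x hx => by
    have := (e ⟨x, hx⟩).2
    rwa [h.apply_eq h' e he] at this
  have hle' : wdRing f m' l' ≤ wdRing f m l := fun x hx => by
    have := (e.symm ⟨x, hx⟩).2
    rwa [h'.apply_eq h e.symm he'] at this
  obtain ⟨h1, h2⟩ := h.exists_of_le h' hle
  have hm := Nat.dvd_antisymm h1 (h'.exists_of_le h hle').1
  have hl : l - l' = 0 := by
    refine Int.eq_zero_of_abs_lt_dvd (h2 hm) ?_
    have := h.nonneg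
    have := h.lt
    have := h'.nonneg
    have := h'.lt
    rw [abs_lt]
    constructor <;> omega
  exact ⟨rfl, hm, by omega⟩

end

end UltraWeak

end

noncomputable section
namespace UltraWeak
open Polynomial

/-! ### Counting rings -/

theorem ofReal_le_count {α : Type*} {S : Set α} {G : Finset α} (hG : ∀ z ∈ G, z ∈ S) {c : ℝ}
    (hc : c ≤ G.card) : ENNReal.ofReal c ≤ count S := by
  refine (ENNReal.ofReal_le_ofReal hc).trans ?_
  rw [ENNReal.ofReal_natCast, count, ← ENat.toENNReal_coe, ← Set.encard_coe_eq_coe_finsetCard]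
  exact ENat.toENNReal_le.2 (Set.encard_le_encard hG)

theorem count_biUnion_le {α : Type*} (S : Finset ℕ) (A : ℕ → Set α) :
    count (⋃ m ∈ S, A m) ≤ ∑ m ∈ S, count (A m) := by
  refine (ENat.toENNReal_le.2 (Finset.set_encard_biUnion_le S A)).trans ?_
  exact (map_sum ENat.toENNRealRingHom _ _).le

theorem count_mono {α : Type*} {A B : Set α} (h : A ⊆ B) : count A ≤ count B :=
  ENat.toENNReal_le.2 (Set.encard_le_encard h)

section

variable {n M m q : ℕ} {κ s t : ℝ} {f : ℤ[X]} {l : ℤ} {P : ℤ[X] → Prop}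

theorem IsGood.mem_boxPairs (h : IsGood n M m q κ s t f l) (hn : 2 ≤ n) (hκ : κ ≤ 1) (ht : 0 < t)
    (hP : P f) : (f, l) ∈ boxPairs P n s t m := by
  have hs := h.isNice.pos
  have h4 := h.isNice.lt
  refine ⟨⟨h.isNice.natDegree_eq, h.isNice.one_le, by linarith, h.isNice.lower, h.isNice.upper,
    h.isNice.coprime, fun i hi hin => ?_⟩, h.nonneg, h.lt, h.weaklyDivisibleAt, hP⟩
  have hst : 0 < s * t ^ i := by positivity
  rcases hin.lt_or_eq with hin | rfl
  · obtain ⟨h1, h2⟩ := h.isNice.middle i hi hin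
    rw [abs_of_nonneg (by exact_mod_cast h1)]
    exact h2.trans (mul_le_of_le_one_left hst.le hκ)
  · have h1 := h.isNice.const_lower
    rw [Nat.sub_self, abs_of_nonneg (by linarith)]
    exact h.isNice.const_upper

theorem IsGood.strictlyUltraWeaklyDivisible (h : IsGood n M m q κ s t f l)
    (hq : ∀ p : ℕ, p.Prime → p ∣ m → M < p → p ∣ q) : StrictlyUltraWeaklyDivisible f :=
  ⟨h.ultraWeaklyDivisible, fun p hp => h.nonsingularMod p (hq p hp.out)⟩

theorem IsGood.isTame (h : IsGood n M m q (middleBound n) s t f l) (hn : 5 ≤ n)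
    (ht : n * 4 ^ (n + 2) ≤ t) (htm : n * 4 ^ (n + 2) * m ≤ t ^ (n - 2)) :
    IsTame n s t f m l where
  five_le := hn
  isNice := h.isNice
  le_t := ht
  le_pow := htm
  pos := by have h1 := h.nonneg; have h2 := h.lt; omega
  weaklyDivisibleAt := h.weaklyDivisibleAt
  nonneg := h.nonneg
  lt := h.lt

theorem IsTame.ringClass_mem_discLE (h : IsTame n s t f m l) :
    ringClass (wdRing f m l) ∈ discLE n (4 ^ (n * (n - 1)) *
      (s ^ (2 * n - 2) * t ^ (n * (n - 1)) / (m : ℝ) ^ 2)) := by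
  obtain ⟨δ, hδ⟩ := h.exists_isRoots
  obtain rfl := h.deg
  have hn := h.five_le
  exact UltraWeak.ringClass_mem_discLE (by omega) h.pos h.weaklyDivisibleAt hδ h.isNice.coeff_pos
    h.isNice.upper fun i => (h.isNice.root_bounds hn h.le_t
      ((hδ.aeval_eq_zero_iff h.isNice.coeff_pos.ne').2 ⟨i, rfl⟩)).1

theorem discLE_mono {Y Z : ℝ} (h : Y ≤ Z) : discLE n Y ⊆ discLE n Z := by
  rintro _ ⟨R, _, rfl, b, h0, hb⟩
  exact ⟨R, _, rfl, b, h0, hb.trans h⟩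

theorem ofReal_le_count_boxClasses {G : Finset (ℤ[X] × ℤ)}
    (hG : ∀ z ∈ G, IsTame n s t z.1 m z.2 ∧ z ∈ boxPairs P n s t m) {c : ℝ} (hc : c ≤ G.card) :
    ENNReal.ofReal c ≤ count (boxClasses P n s t m ∩ discLE n (4 ^ (n * (n - 1)) *
      (s ^ (2 * n - 2) * t ^ (n * (n - 1)) / (m : ℝ) ^ 2))) := by
  classical
  have hinj : Set.InjOn (fun z : ℤ[X] × ℤ => ringClass (wdRing z.1 m z.2)) G := by
    intro z hz w hw hzw
    obtain ⟨h1, -, h2⟩ := (hG z hz).1.eq_of_ringClass_eq (hG w hw).1 hzw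
    exact Prod.ext h1 h2
  refine ofReal_le_count (G := G.image fun z => ringClass (wdRing z.1 m z.2)) ?_
    (by rwa [Finset.card_image_of_injOn hinj])
  intro q hq
  obtain ⟨z, hz, rfl⟩ := Finset.mem_image.1 hq
  exact ⟨⟨z, (hG z hz).2, rfl⟩, (hG z hz).1.ringClass_mem_discLE⟩

/-- Since the ring determines m as well, contributions of different m to the union are disjoint and
add up. -/
theorem ofReal_le_count_wdClasses {S T : Finset ℕ} (hST : S ⊆ T) {X c : ℝ}
    {G : ℕ → Finset (ℤ[X] × ℤ)}
    (hX : ∀ m ∈ S, 4 ^ (n * (n - 1)) * (s ^ (2 * n - 2) * t ^ (n * (n - 1)) / (m : ℝ) ^ 2) ≤ X)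
    (hG : ∀ m ∈ S, ∀ z ∈ G m, IsTame n s t z.1 m z.2 ∧ P z.1)
    (hc : ∀ m ∈ S, c ≤ (G m).card) :
    ENNReal.ofReal (S.card * c) ≤ count (⋃ m ∈ T, wdClasses P n X m) := by
  classical
  have hinj : Set.InjOn (fun z : (_ : ℕ) × (ℤ[X] × ℤ) => ringClass (wdRing z.2.1 z.1 z.2.2))
      (S.sigma G) := by
    rintro ⟨m, f, l⟩ hz ⟨m', f', l'⟩ hw hzw
    obtain ⟨h1, h2⟩ := Finset.mem_sigma.1 hz
    obtain ⟨h3, h4⟩ := Finset.mem_sigma.1 hw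
    obtain ⟨rfl, rfl, rfl⟩ := (hG m h1 _ h2).1.eq_of_ringClass_eq (hG m' h3 _ h4).1 hzw
    rfl
  refine ofReal_le_count
    (G := (S.sigma G).image fun z => ringClass (wdRing z.2.1 z.1 z.2.2)) ?_ ?_
  · intro q hq
    obtain ⟨⟨m, f, l⟩, hz, rfl⟩ := Finset.mem_image.1 hq
    obtain ⟨h1, h2⟩ := Finset.mem_sigma.1 hz
    obtain ⟨h3, h4⟩ := hG m h1 _ h2
    exact Set.mem_biUnion (hST h1) ⟨⟨f, l, h3.deg, h4, h3.weaklyDivisibleAt, rfl⟩,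
      discLE_mono (hX m h1) h3.ringClass_mem_discLE⟩
  · rw [Finset.card_image_of_injOn hinj, Finset.card_sigma, Nat.cast_sum, ← nsmul_eq_mul]
    exact Finset.card_nsmul_le_sum _ _ _ hc

end

/-! ### Euler factors -/

/-- With x = 1/p, Bernoulli gives (1 - x)^n (1 + nx) ≤ (1 - x²)^n ≤ 1, while (1 - (n-2)x)(1 + nx) =
1 + 2x - n(n-2)x² ≥ 1 once n²x ≤ 1. -/
theorem one_sub_inv_pow_le {n p : ℕ} (hn : 2 ≤ n) (hp : n ^ 2 < p) :
    (1 - 1 / (p : ℝ)) ^ n ≤ 1 - ((n : ℝ) - 2) / p := by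
  have hp0 : (0 : ℝ) < p := by exact_mod_cast (Nat.zero_le _).trans_lt hp
  have hp1 : (1 : ℝ) ≤ p := by exact_mod_cast Nat.one_le_iff_ne_zero.2 (by rintro rfl; simp at hp0)
  have hn2 : (2 : ℝ) ≤ n := by exact_mod_cast hn
  have hpn : (n : ℝ) ^ 2 < p := by exact_mod_cast hp
  set x : ℝ := 1 / p with hx
  have hx0 : 0 < x := by positivity
  have hx1 : x ≤ 1 := by rw [hx, div_le_one hp0]; exact hp1
  have hxn : (n : ℝ) ^ 2 * x ≤ 1 := by rw [hx, mul_one_div, div_le_one hp0]; exact hpn.le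
  have h1 : (1 : ℝ) + n * x ≤ (1 + x) ^ n := one_add_mul_le_pow (by linarith) n
  have h2 : (1 - x) ^ n * (1 + x) ^ n ≤ 1 := by
    rw [← mul_pow]
    exact pow_le_one₀ (by nlinarith) (by nlinarith)
  have h3 : ((n : ℝ) - 2) / p = (n - 2) * x := by rw [hx, mul_one_div]
  rw [h3]
  have h4 : (1 - x) ^ n * (1 + n * x) ≤ 1 :=
    (mul_le_mul_of_nonneg_left h1 (pow_nonneg (by linarith) _)).trans h2
  have h5 : 1 ≤ (1 - ((n : ℝ) - 2) * x) * (1 + n * x) := by nlinarith [mul_pos hx0 hx0]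
  have h6 : 0 < 1 + n * x := by positivity
  exact le_of_mul_le_mul_right (h4.trans h5) h6

/-- The product of the primes above `M` that divide `m`. -/
def largePart (M m : ℕ) : ℕ := ∏ p ∈ m.primeFactors.filter (M < ·), p

theorem primeFactors_largePart (M m : ℕ) :
    (largePart M m).primeFactors = m.primeFactors.filter (M < ·) :=
  Nat.primeFactors_prod fun _ hp => Nat.prime_of_mem_primeFactors (Finset.mem_of_mem_filter _ hp)

theorem largePart_dvd (M m : ℕ) : largePart M m ∣ m :=
  (Finset.prod_dvd_prod_of_subset _ _ _ (Finset.filter_subset _ _)).trans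
    (Nat.prod_primeFactors_dvd m)

/-- The factors of φ(m)/m at primes ≤ M are at most 1 and can be dropped; the others are compared
one by one. -/
theorem totient_div_pow_le {n M m : ℕ} (hn : 2 ≤ n) (hM : n ^ 2 ≤ M) (hm : 0 < m) :
    ((Nat.totient m : ℝ) / m) ^ n ≤
      ∏ p ∈ (largePart M m).primeFactors, (1 - ((n : ℝ) - 2) / p) := by
  have hm0 : (m : ℝ) ≠ 0 := by exact_mod_cast hm.ne'
  have h1 : (Nat.totient m : ℝ) / m = ∏ p ∈ m.primeFactors, (1 - 1 / (p : ℝ)) := by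
    have := Nat.totient_eq_mul_prod_factors m
    have h2 : (Nat.totient m : ℝ) = ((Nat.totient m : ℚ) : ℝ) := by norm_cast
    rw [h2, this]
    push_cast
    rw [mul_div_cancel_left₀ _ hm0]
    simp
  have hpos : ∀ p ∈ m.primeFactors, 0 ≤ 1 - 1 / (p : ℝ) ∧ 1 - 1 / (p : ℝ) ≤ 1 := by
    intro p hp
    have : (1 : ℝ) ≤ p := by exact_mod_cast (Nat.prime_of_mem_primeFactors hp).one_lt.le
    have h2 : 1 / (p : ℝ) ≤ 1 := by rw [div_le_one (by linarith)]; exact this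
    have h3 : 0 ≤ 1 / (p : ℝ) := by positivity
    constructor <;> linarith
  rw [primeFactors_largePart, h1]
  calc (∏ p ∈ m.primeFactors, (1 - 1 / (p : ℝ))) ^ n
      ≤ (∏ p ∈ m.primeFactors.filter (M < ·), (1 - 1 / (p : ℝ))) ^ n := by
        refine pow_le_pow_left₀ (Finset.prod_nonneg fun p hp => (hpos p hp).1) ?_ n
        rw [← Finset.prod_filter_mul_prod_filter_not m.primeFactors (M < ·)]
        exact mul_le_of_le_one_right
          (Finset.prod_nonneg fun p hp => (hpos p (Finset.mem_of_mem_filter _ hp)).1)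
          (Finset.prod_le_one (fun p hp => (hpos p (Finset.mem_of_mem_filter _ hp)).1)
            fun p hp => (hpos p (Finset.mem_of_mem_filter _ hp)).2)
    _ = ∏ p ∈ m.primeFactors.filter (M < ·), (1 - 1 / (p : ℝ)) ^ n := (Finset.prod_pow _ _ _).symm
    _ ≤ _ := by
        refine Finset.prod_le_prod (fun p hp => pow_nonneg (hpos p (Finset.mem_of_mem_filter _ hp)).1 _)
          fun p hp => one_sub_inv_pow_le hn (hM.trans_lt (Finset.mem_filter.1 hp).2)

/-! ### Primes in intervals -/

/-- Chebyshev's bound, with the logarithm absorbed by a small power. -/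
theorem eventually_le_primeCounting {d : ℝ} (hd : 0 < d) :
    ∀ᶠ x : ℝ in Filter.atTop, 2 * x ^ (1 - d) ≤ Nat.primeCounting ⌊x⌋₊ := by
  have h1 := (isLittleO_log_rpow_atTop hd).bound (by norm_num : (0 : ℝ) < 1 / 8)
  have h2 := (isLittleO_log_rpow_atTop one_pos).bound (by norm_num : (0 : ℝ) < 1 / 16)
  have h3 : ∀ᶠ x : ℝ in Filter.atTop, ‖Real.log (x + 2)‖ ≤ 1 / 16 * ‖(x + 2) ^ (1 : ℝ)‖ :=
    (Filter.tendsto_atTop_add_const_right _ 2 Filter.tendsto_id).eventually h2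
  filter_upwards [h1, h3, Filter.eventually_ge_atTop 16] with x h1 h3 hx
  have hx0 : 0 < x := by linarith
  have hlog : 0 < Real.log x := Real.log_pos (by linarith)
  rw [Real.rpow_one, Real.norm_of_nonneg (Real.log_nonneg (by linarith)),
    Real.norm_of_nonneg (by linarith)] at h3
  rw [Real.norm_of_nonneg hlog.le, Real.norm_of_nonneg (by positivity)] at h1
  refine le_trans ?_ (Chebyshev.pi_ge' (by linarith))
  rw [le_div_iff₀ hlog]
  have h4 := Real.log_two_gt_d9
  have h5 : 2 * x ^ (1 - d) * Real.log x ≤ 2 * x ^ (1 - d) * (1 / 8 * x ^ d) := by gcongr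
  have h6 : x ^ (1 - d) * x ^ d = x := by
    rw [← Real.rpow_add hx0, sub_add_cancel, Real.rpow_one]
  nlinarith

/-- The primes up to X^{b-2d} are too few to matter against X^{b-d}. -/
theorem eventually_le_card_primes {b d : ℝ} (hb : 0 < b) (hd : 0 < d) :
    ∀ᶠ X : ℝ in Filter.atTop, X ^ (b - d) ≤
      ((Finset.Icc 1 ⌊X ^ b⌋₊).filter fun p : ℕ => p.Prime ∧ X ^ (b - 2 * d) < p).card := by
  filter_upwards [(tendsto_rpow_atTop hb).eventually (eventually_le_primeCounting (div_pos hd hb)),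
    Filter.eventually_ge_atTop 1] with X h1 hX
  have hX0 : 0 < X := by linarith
  have h2 : (X ^ b) ^ (1 - d / b) = X ^ (b - d) := by
    rw [← Real.rpow_mul hX0.le, mul_sub, mul_one, mul_div_cancel₀ _ hb.ne']
  rw [h2] at h1
  set S := (Finset.Icc 1 ⌊X ^ b⌋₊).filter fun p : ℕ => p.Prime ∧ X ^ (b - 2 * d) < p with hS
  have h3 : Nat.primeCounting ⌊X ^ b⌋₊ ≤ S.card + ⌊X ^ (b - 2 * d)⌋₊ := by
    rw [← Nat.primesLE_card_eq_primeCounting]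
    have h4 : Nat.primesLE ⌊X ^ b⌋₊ ⊆ S ∪ Finset.Icc 1 ⌊X ^ (b - 2 * d)⌋₊ := by
      intro p hp
      obtain ⟨hp1, hp2⟩ := Nat.mem_primesLE.1 hp
      rw [Finset.mem_union, hS, Finset.mem_filter, Finset.mem_Icc, Finset.mem_Icc]
      by_cases h5 : X ^ (b - 2 * d) < p
      · exact Or.inl ⟨⟨hp2.one_lt.le, hp1⟩, hp2, h5⟩
      · exact Or.inr ⟨hp2.one_lt.le, Nat.le_floor (not_lt.1 h5)⟩
    refine (Finset.card_le_card h4).trans ((Finset.card_union_le _ _).trans ?_)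
    rw [Nat.card_Icc, Nat.add_sub_cancel]
  have h5 : (⌊X ^ (b - 2 * d)⌋₊ : ℝ) ≤ X ^ (b - d) :=
    (Nat.floor_le (by positivity)).trans (Real.rpow_le_rpow_of_exponent_le hX (by linarith))
  have h6 : (Nat.primeCounting ⌊X ^ b⌋₊ : ℝ) ≤ S.card + ⌊X ^ (b - 2 * d)⌋₊ := by exact_mod_cast h3
  linarith

end UltraWeak

end

noncomputable section
namespace UltraWeak
open Polynomial

/-! ### Sizes in boxes -/

section

variable {n m : ℕ} {ε K X s t : ℝ}

theorem two_mul_sum_Ico {n : ℕ} (hn : 1 ≤ n) :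
    2 * (∑ i ∈ Finset.Ico 2 (n + 1), i) + 2 = n * (n + 1) := by
  induction n, hn using Nat.le_induction with
  | base => simp
  | succ n hn ih =>
    rw [Finset.sum_Ico_succ_top (by omega)]
    linear_combination ih

/-- With H = s t^n the definition of X becomes X m² = (sH)^{n-1}, which governs the size estimates.
-/
theorem mul_sq_eq (hn : 1 ≤ n) (hm : 0 < m)
    (hX : X = s ^ (2 * n - 2) * t ^ (n * (n - 1)) / (m : ℝ) ^ 2) :
    X * (m : ℝ) ^ 2 = s ^ (n - 1) * (s * t ^ n) ^ (n - 1) := by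
  have hm' : (m : ℝ) ≠ 0 := by exact_mod_cast hm.ne'
  obtain ⟨k, rfl⟩ : ∃ k, n = k + 1 := ⟨n - 1, by omega⟩
  rw [hX, div_mul_cancel₀ _ (pow_ne_zero _ hm'), Nat.add_sub_cancel, mul_pow, ← pow_mul,
    show 2 * (k + 1) - 2 = k + k by omega, pow_add]
  ring

theorem rpow_mul_div_eq (hn : 2 ≤ n) (hs : 0 < s) (ht : 0 < t) (hm : 0 < m)
    (hX : X = s ^ (2 * n - 2) * t ^ (n * (n - 1)) / (m : ℝ) ^ 2) :
    X ^ (1 / 2 + 1 / (n : ℝ)) * s ^ (2 / (n : ℝ)) / (m : ℝ) ^ (1 - 2 / (n : ℝ)) =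
      s ^ (n + 1) * t ^ (∑ i ∈ Finset.Ico 2 (n + 1), i) / (m : ℝ) ^ 2 := by
  have hm' : (0 : ℝ) < m := by exact_mod_cast hm
  have hn0 : (n : ℝ) ≠ 0 := by exact_mod_cast (by omega : n ≠ 0)
  have h1 : ((2 * n - 2 : ℕ) : ℝ) = 2 * n - 2 := by
    rw [Nat.cast_sub (by omega)]
    push_cast
    ring
  have h2 : ((n * (n - 1) : ℕ) : ℝ) = n * (n - 1) := by
    rw [Nat.cast_mul, Nat.cast_sub (by omega), Nat.cast_one]
  have h3 : ((∑ i ∈ Finset.Ico 2 (n + 1), i : ℕ) : ℝ) = n * (n + 1) / 2 - 1 := by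
    have := two_mul_sum_Ico (n := n) (by omega)
    have h4 : (2 : ℝ) * ((∑ i ∈ Finset.Ico 2 (n + 1), i : ℕ) : ℝ) + 2 = n * (n + 1) := by
      exact_mod_cast this
    linarith
  have h4 : ((n + 1 : ℕ) : ℝ) = n + 1 := by push_cast; ring
  have e1 : (2 * (n : ℝ) - 2) * (1 / 2 + 1 / n) + 2 / n = n + 1 := by field_simp; ring
  have e2 : (n : ℝ) * (n - 1) * (1 / 2 + 1 / n) = n * (n + 1) / 2 - 1 := by field_simp; ring
  have e3 : (2 : ℝ) * (1 / 2 + 1 / n) + (1 - 2 / n) = 2 := by field_simp; ring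
  rw [hX, ← Real.rpow_natCast s, ← Real.rpow_natCast t, ← Real.rpow_natCast s,
    ← Real.rpow_natCast t, ← Real.rpow_natCast (m : ℝ), h1, h2, h3, h4, Nat.cast_ofNat,
    Real.div_rpow (by positivity) (by positivity), Real.mul_rpow (by positivity) (by positivity),
    ← Real.rpow_mul hs.le, ← Real.rpow_mul ht.le, ← Real.rpow_mul hm'.le, div_mul_eq_mul_div,
    div_div, ← Real.rpow_add hm', mul_right_comm, ← Real.rpow_add hs, e1, e2, e3]

theorem le_pow_of_le_rpow (hs : 0 < s) (hm : 0 < m) (hX0 : 0 < X)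
    (hX : X = s ^ (2 * n - 2) * t ^ (n * (n - 1)) / (m : ℝ) ^ 2) {α : ℝ}
    (h : K * (s ^ (2 * n - 2) * (m : ℝ) ^ α) ≤ X ^ (1 - ε)) :
    K * X ^ ε * (m : ℝ) ^ (α + 2) ≤ t ^ (n * (n - 1)) := by
  have hm' : (0 : ℝ) < m := by exact_mod_cast hm
  have h1 : X ^ (1 - ε) * X ^ ε = X := by
    rw [← Real.rpow_add hX0, sub_add_cancel, Real.rpow_one]
  have h2 : K * (s ^ (2 * n - 2) * (m : ℝ) ^ α) * X ^ ε ≤ X :=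
    (mul_le_mul_of_nonneg_right h (Real.rpow_nonneg hX0.le _)).trans_eq h1
  rw [hX, le_div_iff₀ (by positivity), ← hX] at h2
  rw [Real.rpow_add hm', Real.rpow_two]
  refine le_of_mul_le_mul_left ?_ (pow_pos hs (2 * n - 2))
  linarith

/-- The bound s ≥ K H^ε with sH large makes s large. The second hypothesis says (H/m²)^{n-1} ≥ K
X^ε, so h = √(H/m²) is at least a power of X and H is at most a fixed power of h. The remaining
hypotheses bound t below, the last one also against m. -/
theorem exists_sizes (hn : 5 ≤ n) (hε : 0 < ε) (hK : 0 < K) :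
    ∃ ρ : ℕ, ∀ Y : ℝ, 1 ≤ Y → ∃ X₀ : ℝ, ∀ (X s t : ℝ) (m : ℕ), X₀ ≤ X → 0 < s → 0 < t → 0 < m →
      X = s ^ (2 * n - 2) * t ^ (n * (n - 1)) / (m : ℝ) ^ 2 →
      K * (s * t ^ n) ^ ε ≤ s →
      K * (s ^ (n - 1) * (m : ℝ) ^ (2 * n - 4)) ≤ X ^ (1 - ε) →
      Y ≤ s ∧ (∃ h, Y ≤ h ∧ s * t ^ n ≤ h ^ ρ ∧ (m : ℝ) ^ 2 * h ^ 2 ≤ s * t ^ n) ∧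
      (K * (s ^ (2 * n - 2) * (m : ℝ) ^ ((n : ℝ) - 4 - 1 / ((n : ℝ) - 2))) ≤ X ^ (1 - ε) → Y ≤ t) ∧
      (K * (s ^ (2 * n - 2) * (m : ℝ) ^ ((n : ℝ) - 1 + 2 / ((n : ℝ) - 2))) ≤ X ^ (1 - ε) →
        Y ≤ t ∧ Y * m ≤ t ^ (n - 2)) := by
  obtain ⟨ρ, hρ⟩ := exists_nat_ge (2 / ε)
  have hρ1 : 1 ≤ ρ * (ε / 2) := by
    rw [div_le_iff₀ hε] at hρ
    linarith
  refine ⟨2 * (n - 1) * ρ, fun Y hY => ?_⟩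
  have hY0 : 0 < Y := by linarith
  have hn5 : (5 : ℝ) ≤ n := by exact_mod_cast hn
  -- Chosen so that (n - 2) e = n(n - 1); this turns the last hypothesis into a lower bound for
  -- t^{n-2}/m.
  set e : ℝ := n - 1 + 2 / (n - 2) + 2 with he
  have he0 : 0 < e := by
    have : 0 < 2 / ((n : ℝ) - 2) := div_pos two_pos (by linarith)
    linarith
  set B : ℝ := Y ^ (2 * (n - 1)) + Y ^ (n * (n - 1)) + Y ^ e with hB
  have hev : ∀ᶠ X : ℝ in Filter.atTop, B ≤ K * X ^ ε ∧ 1 ≤ K * X ^ (ε / 2) ∧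
      (Y * (Y / K) ^ (1 / ε)) ^ (n - 1) < X ∧ 1 ≤ X := by
    refine ((tendsto_rpow_atTop hε).const_mul_atTop hK |>.eventually_ge_atTop B).and
      (((tendsto_rpow_atTop (half_pos hε)).const_mul_atTop hK |>.eventually_ge_atTop 1).and
      ((Filter.eventually_gt_atTop _).and (Filter.eventually_ge_atTop 1)))
  obtain ⟨X₀, hX₀⟩ := Filter.eventually_atTop.1 hev
  refine ⟨X₀, fun X s t m hXX hs ht hm hX h1 h2 => ?_⟩
  obtain ⟨hB1, hB2, hB3, hX1⟩ := hX₀ X hXX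
  have hX0 : 0 < X := by linarith
  have hm' : (1 : ℝ) ≤ m := by exact_mod_cast hm
  have hm0 : (0 : ℝ) < m := by linarith
  have hXm := mul_sq_eq (by omega) hm hX
  set H : ℝ := s * t ^ n with hH
  have hH0 : 0 < H := by positivity
  have hb1 : 0 < Y ^ (2 * (n - 1)) := by positivity
  have hb2 : 0 < Y ^ (n * (n - 1)) := by positivity
  have hb3 : 0 < Y ^ e := by positivity
  have hm2 : (1 : ℝ) ≤ (m : ℝ) ^ 2 := one_le_pow₀ hm'
  have hXle : X ≤ (s * H) ^ (n - 1) := by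
    rw [mul_pow, ← hXm]
    exact le_mul_of_one_le_right hX0.le hm2
  -- If s were below Y then H, and with it X, would be bounded.
  have hsY : Y ≤ s := by
    by_contra! hlt
    have h3 : H ≤ (Y / K) ^ (1 / ε) := by
      have h4 : H ^ ε ≤ Y / K := by
        rw [le_div_iff₀ hK]
        linarith
      have h5 : (H ^ ε) ^ (1 / ε) = H := by
        rw [← Real.rpow_mul hH0.le, mul_one_div_cancel hε.ne', Real.rpow_one]
      rw [← h5]
      exact Real.rpow_le_rpow (by positivity) h4 (by positivity)
    have h4 : (s * H) ^ (n - 1) ≤ (Y * (Y / K) ^ (1 / ε)) ^ (n - 1) := by gcongr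
    linarith
  have hs1 : 1 ≤ s := hY.trans hsY
  have hratio : K * X ^ ε ≤ (H / (m : ℝ) ^ 2) ^ (n - 1) := by
    have h3 : X ^ (1 - ε) * X ^ ε = X := by
      rw [← Real.rpow_add hX0, sub_add_cancel, Real.rpow_one]
    have h4 : K * (s ^ (n - 1) * (m : ℝ) ^ (2 * n - 4)) * X ^ ε ≤ X :=
      (mul_le_mul_of_nonneg_right h2 (Real.rpow_nonneg hX0.le _)).trans_eq h3
    have h5 : K * (s ^ (n - 1) * (m : ℝ) ^ (2 * n - 4)) * X ^ ε * (m : ℝ) ^ 2 ≤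
        s ^ (n - 1) * H ^ (n - 1) := by
      rw [← hXm]
      gcongr
    have h6 : ((m : ℝ) ^ 2) ^ (n - 1) = (m : ℝ) ^ (2 * n - 4) * (m : ℝ) ^ 2 := by
      rw [← pow_mul, ← pow_add]
      congr 1
      omega
    rw [div_pow, le_div_iff₀ (by positivity), h6]
    refine le_of_mul_le_mul_left ?_ (pow_pos hs (n - 1))
    linarith
  set h : ℝ := √(H / (m : ℝ) ^ 2) with hh
  have hh2 : h ^ 2 = H / (m : ℝ) ^ 2 := Real.sq_sqrt (by positivity)
  have hh0 : 0 ≤ h := Real.sqrt_nonneg _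
  rw [← hh2, ← pow_mul] at hratio
  have hYh : Y ≤ h := by
    refine le_of_pow_le_pow_left₀ (n := 2 * (n - 1)) (by omega) hh0 ?_
    linarith
  have hmh : (m : ℝ) ^ 2 * h ^ 2 = H := by
    rw [hh2]
    field_simp
  have hHX : H ≤ X := by
    have h3 : X * (m : ℝ) ^ 2 ≥ H * (m : ℝ) ^ 2 := by
      rw [hXm]
      have h4 : (m : ℝ) ^ 2 ≤ H := by
        rw [← hmh]
        exact le_mul_of_one_le_right (by positivity) (one_le_pow₀ (hY.trans hYh))
      have h5 : 1 ≤ H := hm2.trans h4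
      have h6 : 1 ≤ s ^ (n - 1) := one_le_pow₀ hs1
      have h7 : H ^ 2 ≤ H ^ (n - 1) := pow_le_pow_right₀ h5 (by omega)
      have h8 : H * (m : ℝ) ^ 2 ≤ H ^ 2 := by
        rw [pow_two H]
        gcongr
      calc H * (m : ℝ) ^ 2 ≤ 1 * H ^ (n - 1) := by linarith
        _ ≤ _ := by gcongr
    exact le_of_mul_le_mul_right h3 (by positivity)
  have ht1 : ∀ α : ℝ, 0 ≤ α + 2 →
      K * (s ^ (2 * n - 2) * (m : ℝ) ^ α) ≤ X ^ (1 - ε) → Y ≤ t := by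
    intro α hα hle
    have h3 := le_pow_of_le_rpow hs hm hX0 hX hle
    have h4 : 1 ≤ (m : ℝ) ^ (α + 2) := Real.one_le_rpow hm' hα
    have h5 : 0 < K * X ^ ε := by positivity
    refine le_of_pow_le_pow_left₀ (n := n * (n - 1)) ?_ ht.le ?_
    · exact Nat.mul_ne_zero (by omega) (by omega)
    · refine le_trans ?_ ((le_mul_of_one_le_right h5.le h4).trans h3)
      linarith
  refine ⟨hsY, ⟨h, hYh, ?_, hmh.le⟩, ht1 _ ?_, fun hle => ⟨ht1 _ he0.le hle, ?_⟩⟩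
  · refine hHX.trans ?_
    have h3 : X ^ (ε / 2) ≤ h ^ (2 * (n - 1)) := by
      refine le_trans ?_ hratio
      have h4 : X ^ ε = X ^ (ε / 2) * X ^ (ε / 2) := by
        rw [← Real.rpow_add hX0, add_halves]
      have h5 : 0 < X ^ (ε / 2) := by positivity
      calc X ^ (ε / 2) ≤ K * X ^ (ε / 2) * X ^ (ε / 2) := le_mul_of_one_le_left h5.le hB2
        _ = K * X ^ ε := by rw [h4, mul_assoc]
    calc X = X ^ (1 : ℝ) := (Real.rpow_one X).symm
      _ ≤ X ^ (ρ * (ε / 2)) := Real.rpow_le_rpow_of_exponent_le hX1 hρ1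
      _ = (X ^ (ε / 2)) ^ ρ := by
        rw [mul_comm, Real.rpow_mul hX0.le, Real.rpow_natCast]
      _ ≤ (h ^ (2 * (n - 1))) ^ ρ := by gcongr
      _ = _ := (pow_mul _ _ _).symm
  · have : 1 / ((n : ℝ) - 2) ≤ 1 := by
      rw [div_le_one (by linarith)]
      linarith
    linarith
  · have h3 := le_pow_of_le_rpow hs hm hX0 hX hle
    rw [← he] at h3
    have h4 : t ^ (n * (n - 1)) = (t ^ (n - 2)) ^ e := by
      rw [← Real.rpow_natCast, ← Real.rpow_natCast, ← Real.rpow_mul ht.le]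
      congr 1
      rw [Nat.cast_mul, Nat.cast_sub (by omega), Nat.cast_sub (by omega), he]
      have : (n : ℝ) - 2 ≠ 0 := by linarith
      push_cast
      field_simp
      ring
    rw [h4] at h3
    have h5 : (Y * m) ^ e ≤ (t ^ (n - 2)) ^ e := by
      rw [Real.mul_rpow hY0.le hm0.le]
      refine le_trans ?_ h3
      gcongr
      linarith
    exact (Real.rpow_le_rpow_iff (by positivity) (by positivity) he0).1 h5

end

theorem middleBound_mem {n : ℕ} (hn : 1 ≤ n) : 0 < middleBound n ∧ middleBound n ≤ 1 := by
  unfold middleBound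
  have h1 : (1 : ℝ) ≤ n := by exact_mod_cast hn
  have h2 : (1 : ℝ) ≤ 4 ^ n := one_le_pow₀ (by norm_num)
  refine ⟨by positivity, ?_⟩
  rw [div_le_one (by positivity)]
  nlinarith

/-- The family with q = 1 gives the ultra-weak counts, and the family with q the product of the
large primes dividing m gives the strict count; q ≤ m ≤ t^{n-2} is exactly what the last hypothesis
provides. -/
theorem boxes_lower_bound {n : ℕ} (hn : 5 ≤ n) :
    ∃ c : ℝ, 0 < c ∧ ∃ C : ℝ, 0 < C ∧
      ∀ ε : ℝ, 0 < ε → ∀ K : ℝ, 0 < K → ∃ X₀ : ℝ,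
      ∀ (X s t : ℝ) (m : ℕ), X₀ ≤ X → 0 < s → 0 < t → Squarefree m →
        X = s ^ (2 * n - 2) * t ^ (n * (n - 1)) / (m : ℝ) ^ 2 →
        K * (s * t ^ n) ^ ε ≤ s →
        K * (s ^ (n - 1) * (m : ℝ) ^ (2 * n - 4)) ≤ X ^ (1 - ε) →
        (K * (s ^ (2 * n - 2) * (m : ℝ) ^ ((n : ℝ) - 4 - 1 / ((n : ℝ) - 2))) ≤ X ^ (1 - ε) →
          ENNReal.ofReal (c * (X ^ (1 / 2 + 1 / (n : ℝ)) * s ^ (2 / (n : ℝ)) /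
              (m : ℝ) ^ (1 - 2 / (n : ℝ)))) ≤
            count (boxPairs UltraWeaklyDivisible n s t m)) ∧
        (K * (s ^ (2 * n - 2) * (m : ℝ) ^ ((n : ℝ) - 1 + 2 / ((n : ℝ) - 2))) ≤ X ^ (1 - ε) →
          ENNReal.ofReal (c * (X ^ (1 / 2 + 1 / (n : ℝ)) * s ^ (2 / (n : ℝ)) /
              (m : ℝ) ^ (1 - 2 / (n : ℝ)))) ≤
            count (boxClasses UltraWeaklyDivisible n s t m ∩ discLE n (C * X)) ∧
          ENNReal.ofReal (c * ((Nat.totient m : ℝ) / m) ^ n *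
              (X ^ (1 / 2 + 1 / (n : ℝ)) * s ^ (2 / (n : ℝ)) /
              (m : ℝ) ^ (1 - 2 / (n : ℝ)))) ≤
            count (boxClasses StrictlyUltraWeaklyDivisible n s t m ∩ discLE n (C * X))) := by
  obtain ⟨hκ, hκ1⟩ := middleBound_mem (n := n) (by omega)
  obtain ⟨N, rfl⟩ : ∃ N, n = N + 2 := ⟨n - 2, by omega⟩
  obtain ⟨c, hc, M, hM, hfam⟩ := exists_family (N := N) (by omega) hκ hκ1
  refine ⟨c, hc, 4 ^ ((N + 2) * (N + 2 - 1)), by positivity, fun ε hε K hK => ?_⟩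
  obtain ⟨ρ, hρ⟩ := exists_sizes hn hε hK
  obtain ⟨Y₀, hY₀⟩ := hfam ρ
  set Y : ℝ := max Y₀ ((N + 2 : ℕ) * 4 ^ (N + 2 + 2)) with hY
  have hY1 : 1 ≤ Y := by
    refine le_trans ?_ (le_max_right _ _)
    exact one_le_mul_of_one_le_of_one_le (by exact_mod_cast (by omega : 1 ≤ N + 2))
      (one_le_pow₀ (by norm_num))
  obtain ⟨X₀, hX₀⟩ := hρ Y hY1
  refine ⟨X₀, fun X s t m hXX hs ht hm hX h1 h2 => ?_⟩
  have hm0 : 0 < m := Nat.pos_of_ne_zero hm.ne_zero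
  obtain ⟨hsY, ⟨h, hYh, hhρ, hmh⟩, h3, h4⟩ := hX₀ X s t m hXX hs ht hm0 hX h1 h2
  rw [rpow_mul_div_eq (by omega) hs ht hm0 hX]
  have hG : ∀ q : ℕ, 1 ≤ t → q ∣ m → (∀ p ∈ q.primeFactors, M < p) → (q : ℝ) ≤ t ^ N →
      ∃ G : Finset (ℤ[X] × ℤ), c * (∏ p ∈ q.primeFactors, (1 - (N : ℝ) / p)) *
          (s ^ (N + 3) * t ^ (∑ i ∈ Finset.Ico 2 (N + 3), i) / (m : ℝ) ^ 2) ≤ G.card ∧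
        ∀ z ∈ G, IsGood (N + 2) M m q (middleBound (N + 2)) s t z.1 z.2 := fun q ht1 hqm hq hqt =>
    hY₀ s t h m q ((le_max_left _ _).trans hsY) ((le_max_left _ _).trans hYh) ht1 hhρ hmh hm hqm hq
      hqt
  have hone : ∀ (ht1 : 1 ≤ t), ∃ G : Finset (ℤ[X] × ℤ),
      c * (s ^ (N + 3) * t ^ (∑ i ∈ Finset.Ico 2 (N + 3), i) / (m : ℝ) ^ 2) ≤ G.card ∧
        ∀ z ∈ G, IsGood (N + 2) M m 1 (middleBound (N + 2)) s t z.1 z.2 := by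
    intro ht1
    obtain ⟨G, hG1, hG2⟩ := hG 1 ht1 (one_dvd _) (by simp) (by simpa using one_le_pow₀ ht1)
    rw [Nat.primeFactors_one, Finset.prod_empty, mul_one] at hG1
    exact ⟨G, hG1, hG2⟩
  refine ⟨fun h5 => ?_, fun h5 => ?_⟩
  · obtain ⟨G, hG1, hG2⟩ := hone (hY1.trans (h3 h5))
    exact ofReal_le_count (fun z hz => (hG2 z hz).mem_boxPairs (by omega) hκ1 ht
      (hG2 z hz).ultraWeaklyDivisible) hG1
  · obtain ⟨hYt, hYm⟩ := h4 h5
    have ht1 := hY1.trans hYt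
    have hle : ((N + 2 : ℕ) : ℝ) * 4 ^ (N + 2 + 2) ≤ t := (le_max_right _ _).trans hYt
    have hlem : ((N + 2 : ℕ) : ℝ) * 4 ^ (N + 2 + 2) * m ≤ t ^ (N + 2 - 2) :=
      (mul_le_mul_of_nonneg_right (le_max_right _ _) (Nat.cast_nonneg _)).trans hYm
    rw [hX]
    constructor
    · obtain ⟨G, hG1, hG2⟩ := hone ht1
      exact ofReal_le_count_boxClasses (fun z hz => ⟨(hG2 z hz).isTame hn hle hlem,
        (hG2 z hz).mem_boxPairs (by omega) hκ1 ht (hG2 z hz).ultraWeaklyDivisible⟩) hG1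
    · obtain ⟨G, hG1, hG2⟩ := hG (largePart M m) ht1 (largePart_dvd M m)
        (fun p hp => by
          rw [primeFactors_largePart] at hp
          exact (Finset.mem_filter.1 hp).2)
        (by
          refine le_trans ?_ (le_trans (le_mul_of_one_le_left (Nat.cast_nonneg m) hY1) hYm)
          exact_mod_cast Nat.le_of_dvd hm0 (largePart_dvd M m))
      refine ofReal_le_count_boxClasses (fun z hz => ⟨(hG2 z hz).isTame hn hle hlem,
        (hG2 z hz).mem_boxPairs (by omega) hκ1 ht
          ((hG2 z hz).strictlyUltraWeaklyDivisible fun p hp hpm hMp => ?_)⟩) (le_trans ?_ hG1)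
      · refine Nat.dvd_of_mem_primeFactors ?_
        rw [primeFactors_largePart]
        exact Finset.mem_filter.2 ⟨Nat.mem_primeFactors.2 ⟨hp, hpm, hm0.ne'⟩, hMp⟩
      · have h6 := totient_div_pow_le (n := N + 2) (by omega) hM hm0
        push_cast at h6
        simp only [add_sub_cancel_right] at h6
        gcongr

end UltraWeak

end

noncomputable section
namespace UltraWeak
open Polynomial

/-! ### Summing over weak divisors -/

/-- The exponents of `m`, `t`, `s` and `h` as powers of `X`. -/
theorem exists_exponents {x ε μ : ℝ} (hx : 5 ≤ x) (hμ : μ = (x - 2) / (3 * x ^ 2 - 13 * x + 12))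
    (hε : 0 < ε) (hεμ : ε < μ) :
    ∃ d η τ σ θ : ℝ, 0 < d ∧ 0 < μ - ε - 2 * d ∧ 0 < η ∧ (x - 2) * τ = μ - ε + η ∧ 0 < τ ∧
      (2 * x - 2) * σ + x * (x - 1) * τ = 1 + 2 * (μ - ε - 2 * d) ∧ 0 < σ ∧ 0 < θ ∧
      0 < σ + x * τ - 2 * (μ - ε) - 2 * θ ∧
      1 / 2 + 1 / (x - 4 / 3) - ε ≤
        (x + 1) * σ + (x * (x + 1) / 2 - 1) * τ - 2 * (μ - ε) + (μ - ε - d) := by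
  have hD : 0 < 3 * x ^ 2 - 13 * x + 12 := by nlinarith
  have hx2 : 0 < x - 2 := by linarith
  have hx1 : 0 < 2 * x - 2 := by linarith
  have hx3 : 0 < 3 * x - 4 := by linarith
  have hμD : μ * (3 * x ^ 2 - 13 * x + 12) = x - 2 := by rw [hμ, div_mul_cancel₀ _ hD.ne']
  have hμ0 : 0 < μ := hε.trans hεμ
  -- Here d measures the width of the range of m. In the limit ε, d → 0 the constraints t^{n-2} ≥ m
  -- and s t^n ≥ m² become tight at the same time, and this singles out the exponent μ; the slack in
  -- ε pays for d, η and θ.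
  obtain ⟨d, hd0, hd1, hd2⟩ : ∃ d : ℝ, 0 < d ∧ 20 * d ≤ ε ∧ 4 * d ≤ μ - ε := by
    refine ⟨min (ε / 20) ((μ - ε) / 4), lt_min (by linarith) (by linarith), ?_, ?_⟩
    · linarith [min_le_left (ε / 20) ((μ - ε) / 4)]
    · linarith [min_le_right (ε / 20) ((μ - ε) / 4)]
  obtain ⟨τ, hτ⟩ : ∃ τ : ℝ, (x - 2) * τ = μ - ε + ε / 10 :=
    ⟨(μ - ε + ε / 10) / (x - 2), mul_div_cancel₀ _ hx2.ne'⟩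
  obtain ⟨σ, hσ⟩ : ∃ σ : ℝ, (2 * x - 2) * σ = 1 + 2 * (μ - ε - 2 * d) - x * (x - 1) * τ :=
    ⟨_, mul_div_cancel₀ _ hx1.ne'⟩
  obtain ⟨θ, hθ⟩ : ∃ θ : ℝ, (2 * x - 2) * θ = ε := ⟨_, mul_div_cancel₀ _ hx1.ne'⟩
  refine ⟨d, ε / 10, τ, σ, θ, hd0, by linarith, by linarith, hτ, ?_, by linarith, ?_, ?_, ?_, ?_⟩
  · exact pos_of_mul_pos_right (by rw [hτ]; linarith) hx2.le
  · refine pos_of_mul_pos_right (a := (x - 2) * (2 * x - 2)) ?_ (by positivity)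
    have h1 : (x - 2) * (2 * x - 2) * σ = μ * (2 * (x - 1) * (x - 4)) +
        (ε * (x ^ 2 - 3 * x + 4 - x * (x - 1) / 10) - 4 * d * (x - 2)) := by
      linear_combination (x - 2) * hσ - x * (x - 1) * hτ - hμD
    rw [h1]
    have h2 : 0 < μ * (2 * (x - 1) * (x - 4)) :=
      mul_pos hμ0 (mul_pos (mul_pos two_pos (by linarith)) (by linarith))
    have h3 : 4 * d * (x - 2) ≤ ε / 5 * (x - 2) := mul_le_mul_of_nonneg_right (by linarith) hx2.le
    have h4 : 0 ≤ ε * (x ^ 2 - 3 * x + 4 - x * (x - 1) / 10 - (x - 2) / 5) :=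
      mul_nonneg hε.le (by nlinarith)
    linarith
  · exact pos_of_mul_pos_right (by rw [hθ]; exact hε) hx1.le
  · refine pos_of_mul_pos_right (a := (x - 2) * (2 * x - 2)) ?_ (by positivity)
    have h1 : (x - 2) * (2 * x - 2) * (σ + x * τ - 2 * (μ - ε) - 2 * θ) =
        ε * (3 * x ^ 2 - 13 * x + 12 + x * (x - 1) / 10 - 2 * (x - 2)) - 4 * d * (x - 2) := by
      linear_combination (x - 2) * hσ + x * (x - 1) * hτ - hμD - 2 * (x - 2) * hθ
    rw [h1]
    have h3 : 4 * d * (x - 2) ≤ ε / 5 * (x - 2) := mul_le_mul_of_nonneg_right (by linarith) hx2.le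
    have h4 : 0 < ε * (3 * x ^ 2 - 13 * x + 12 + x * (x - 1) / 10 - 2 * (x - 2) - (x - 2) / 5) :=
      mul_pos hε (by nlinarith)
    linarith
  · obtain ⟨ν, hν⟩ : ∃ ν : ℝ, (3 * x - 4) * ν = 1 := ⟨_, mul_div_cancel₀ _ hx3.ne'⟩
    have hν' : 1 / (x - 4 / 3) = 3 * ν := by
      rw [div_eq_iff (by linarith)]
      linear_combination -hν
    -- Here 3x² - 13x + 12 = (3x - 4)(x - 3), which explains the shift by 4/3 in the final exponent.
    have hμν : μ * (x - 3) = ν * (x - 2) := by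
      linear_combination ν * hμD - μ * (x - 3) * hν
    rw [hν']
    refine sub_nonneg.1 (nonneg_of_mul_nonneg_right (a := (x - 2) * (2 * x - 2)) ?_ (by positivity))
    have h1 : (x - 2) * (2 * x - 2) * ((x + 1) * σ + (x * (x + 1) / 2 - 1) * τ - 2 * (μ - ε) +
        (μ - ε - d) - (1 / 2 + 3 * ν - ε)) =
        ε * ((2 * x - 2) * (x - 2) - (2 * x - 6) - (2 * x - 2) / 10) -
          d * (4 * (x + 1) * (x - 2) + (2 * x - 2) * (x - 2)) := by
      linear_combination (x - 2) * (x + 1) * hσ - (2 * x - 2) * hτ + 2 * hμν - 2 * (x - 2) * hν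
    rw [h1]
    have h3 : d * (4 * (x + 1) * (x - 2) + (2 * x - 2) * (x - 2)) ≤
        ε / 20 * (4 * (x + 1) * (x - 2) + (2 * x - 2) * (x - 2)) :=
      mul_le_mul_of_nonneg_right (by linarith) (by nlinarith)
    have h4 : 0 ≤ ε * ((2 * x - 2) * (x - 2) - (2 * x - 6) - (2 * x - 2) / 10 -
        (4 * (x + 1) * (x - 2) + (2 * x - 2) * (x - 2)) / 20) := mul_nonneg hε.le (by nlinarith)
    linarith

-- Only primes m in (X^{b-2d}, X^b] are used, with b = μ - ε and a single choice of s and t for all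
-- of them. There are at least X^{b-d} such m, and for a large prime the Euler factor is at least
-- 1/2, so no averaging of φ(m)/m is needed.
set_option maxHeartbeats 1000000 in
theorem strict_classes_lower_bound {n : ℕ} (hn : 5 ≤ n) {ε : ℝ} (hε : 0 < ε)
    (hε' : ε < ((n : ℝ) - 2) / (3 * (n : ℝ) ^ 2 - 13 * n + 12)) :
    ∃ c : ℝ, 0 < c ∧ ∃ X₀ : ℝ, ∀ X : ℝ, X₀ ≤ X →
      ENNReal.ofReal (c * X ^ (1 / 2 + 1 / ((n : ℝ) - 4 / 3) - ε)) ≤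
        count (⋃ m ∈ mRange n ε X, wdClasses StrictlyUltraWeaklyDivisible n X m) := by
  obtain ⟨hκ, hκ1⟩ := middleBound_mem (n := n) (by omega)
  have hn5 : (5 : ℝ) ≤ n := by exact_mod_cast hn
  obtain ⟨d, η, τ, σ, θ, hd, hbd, hη, hτη, hτ, hσ, hσ0, hθ, hgap, hE⟩ :=
    exists_exponents hn5 rfl hε hε'
  set μ : ℝ := ((n : ℝ) - 2) / (3 * (n : ℝ) ^ 2 - 13 * n + 12) with hμ
  set b : ℝ := μ - ε with hb
  have hb0 : 0 < b := by linarith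
  set g : ℝ := σ + n * τ - 2 * b - 2 * θ with hg
  obtain ⟨N, hN⟩ : ∃ N, n = N + 2 := ⟨n - 2, by omega⟩
  have hNr : (n : ℝ) - 2 = N := by rw [hN]; push_cast; ring
  obtain ⟨c, hc, M, hM, hfam⟩ := exists_family (N := N) (by omega) hκ hκ1
  obtain ⟨ρ, hρ⟩ := exists_nat_ge ((σ + n * τ) / θ)
  rw [div_le_iff₀ hθ] at hρ
  obtain ⟨Y₀, hY₀⟩ := hfam ρ
  rw [← hN] at hM hY₀
  set T : ℝ := n * 4 ^ (n + 2) with hT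
  have hT1 : 1 ≤ T := one_le_mul_of_one_le_of_one_le (by linarith) (one_le_pow₀ (by norm_num))
  have hbig : ∀ {a : ℝ}, 0 < a → ∀ K : ℝ, ∀ᶠ X : ℝ in Filter.atTop, K ≤ X ^ a := fun ha K =>
    (tendsto_rpow_atTop ha).eventually_ge_atTop K
  have hev := (eventually_le_card_primes hb0 hd).and ((Filter.eventually_ge_atTop 1).and
    ((hbig hσ0 (2 ^ n * Y₀)).and ((hbig hθ Y₀).and ((hbig hτ T).and ((hbig hη T).and
    ((hbig hgap (2 ^ n)).and (hbig hbd M)))))))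
  obtain ⟨X₀, hX₀⟩ := Filter.eventually_atTop.1 hev
  refine ⟨c / 2 / 2 ^ (n * (n + 1)), by positivity, X₀, fun X hX => ?_⟩
  obtain ⟨hcard, hX1, hXσ, hXθ, hXτ, hXη, hXg, hXM⟩ := hX₀ X hX
  set S := (Finset.Icc 1 ⌊X ^ b⌋₊).filter fun p : ℕ => p.Prime ∧ X ^ (b - 2 * d) < p with hS
  have hX0 : 0 < X := by linarith
  -- The divisor 2^n compensates the constant 4^{n(n-1)} in the discriminant bound, since
  -- (2^n)^{2n-2} = 4^{n(n-1)}.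
  set s : ℝ := X ^ σ / 2 ^ n with hs
  set t : ℝ := X ^ τ with ht
  have hs0 : 0 < s := by positivity
  have ht0 : 0 < t := by positivity
  have htpow : ∀ k : ℕ, t ^ k = X ^ (k * τ) := fun k => by
    rw [ht, ← Real.rpow_natCast, ← Real.rpow_mul hX0.le, mul_comm]
  have hspow : ∀ k : ℕ, s ^ k = X ^ (k * σ) / 2 ^ (n * k) := fun k => by
    rw [hs, div_pow, ← Real.rpow_natCast, ← Real.rpow_mul hX0.le, mul_comm, pow_mul]
  have hH : s * t ^ n = X ^ (σ + n * τ) / 2 ^ n := by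
    rw [htpow, hs, div_mul_eq_mul_div, ← Real.rpow_add hX0]
  have h2n : (1 : ℝ) ≤ 2 ^ n := one_le_pow₀ (by norm_num)
  have htN : t ^ N = X ^ (b + η) := by rw [htpow, ← hNr, hτη]
  have hSb : ∀ m ∈ S, (m : ℝ) ≤ X ^ b := fun m hm =>
    (Nat.le_floor_iff (by positivity)).1 (Finset.mem_Icc.1 (Finset.mem_filter.1 hm).1).2
  have hSp : ∀ m ∈ S, m.Prime ∧ X ^ (b - 2 * d) < m := fun m hm => (Finset.mem_filter.1 hm).2
  have hSM : ∀ m ∈ S, M < m := fun m hm => by exact_mod_cast hXM.trans_lt (hSp m hm).2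
  have hTm : ∀ m ∈ S, T * m ≤ t ^ N := fun m hm => by
    rw [htN, add_comm, Real.rpow_add hX0]
    exact mul_le_mul hXη (hSb m hm) (Nat.cast_nonneg _) (by positivity)
  set e : ℕ := ∑ i ∈ Finset.Ico 2 (n + 1), i with he
  have her : (e : ℝ) = n * (n + 1) / 2 - 1 := by
    have h1 := two_mul_sum_Ico (n := n) (by omega)
    have h2 : (2 : ℝ) * e + 2 = n * (n + 1) := by exact_mod_cast h1
    linarith
  have hG : ∀ m ∈ S, ∃ G : Finset (ℤ[X] × ℤ),
      c / 2 * (s ^ (n + 1) * t ^ e / X ^ (2 * b)) ≤ G.card ∧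
        ∀ z ∈ G, IsGood n M m m (middleBound n) s t z.1 z.2 := by
    intro m hm
    have hmp := (hSp m hm).1
    have hm0 : (0 : ℝ) < m := by exact_mod_cast hmp.pos
    obtain ⟨G, hG1, hG2⟩ := hY₀ s t (X ^ θ) m m (by rw [hs, le_div_iff₀ (by positivity)]; linarith)
      hXθ (hT1.trans hXτ)
      (by
        rw [hH, ← Real.rpow_natCast (X ^ θ) ρ, ← Real.rpow_mul hX0.le]
        refine (div_le_self (by positivity) h2n).trans
          (Real.rpow_le_rpow_of_exponent_le hX1 ?_)
        linarith)
      (by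
        rw [hH, le_div_iff₀ (by positivity)]
        have h1 : X ^ (σ + n * τ) = X ^ b * X ^ b * (X ^ θ) ^ 2 * X ^ g := by
          rw [pow_two, ← Real.rpow_add hX0, ← Real.rpow_add hX0, ← Real.rpow_add hX0,
            ← Real.rpow_add hX0]
          congr 1
          rw [hg]
          ring
        rw [h1, pow_two (m : ℝ)]
        have := hSb m hm
        gcongr)
      hmp.squarefree dvd_rfl
      (by rw [hmp.primeFactors]; simpa using hSM m hm)
      ((le_mul_of_one_le_left hm0.le hT1).trans (hTm m hm))
    refine ⟨G, le_trans ?_ hG1, hG2⟩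
    rw [hmp.primeFactors, Finset.prod_singleton, show N + 3 = n + 1 by omega]
    have h1 : (1 : ℝ) / 2 ≤ 1 - N / m := by
      have h2 : 2 * N ≤ m := by nlinarith [hSM m hm]
      have h3 : (2 : ℝ) * N ≤ m := by exact_mod_cast h2
      have h4 : (N : ℝ) / m ≤ 1 / 2 := by rw [div_le_iff₀ hm0]; linarith
      linarith
    have h2 : (m : ℝ) ^ 2 ≤ X ^ (2 * b) := by
      rw [two_mul, Real.rpow_add hX0, pow_two]
      have := hSb m hm
      gcongr
    rw [div_eq_mul_one_div c]
    gcongr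
  choose! G hG1 hG2 using hG
  have hmain := ofReal_le_count_wdClasses (n := n) (P := StrictlyUltraWeaklyDivisible) (s := s) (t := t)
    (S := S) (T := mRange n ε X) (X := X) (c := c / 2 * (s ^ (n + 1) * t ^ e / X ^ (2 * b))) (G := G)
    (by
      intro m hm
      obtain ⟨h1, h2⟩ := Finset.mem_filter.1 hm
      unfold mRange
      exact Finset.mem_filter.2 ⟨h1, h2.1.squarefree⟩)
    (by
      intro m hm
      have hm0 : (0 : ℝ) < m := by exact_mod_cast (hSp m hm).1.pos
      -- By the choice of σ, s^{2n-2} t^{n(n-1)} is a constant times X · X^{2(b-2d)}, and the lower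
      -- bound on m makes the quotient by m² at most a constant times X.
      have h1 : (2 * n - 2 : ℕ) * σ + (n * (n - 1) : ℕ) * τ = 1 + ((b - 2 * d) + (b - 2 * d)) := by
        rw [← two_mul, ← hσ, Nat.cast_sub (by omega), Nat.cast_mul n, Nat.cast_sub (by omega)]
        push_cast
        ring
      have h2 : (2 : ℝ) ^ (n * (2 * n - 2)) = 4 ^ (n * (n - 1)) := by
        rw [show n * (2 * n - 2) = 2 * (n * (n - 1)) by
          rw [← Nat.mul_sub_one 2 n]; ring, pow_mul]
        norm_num
      rw [hspow, htpow, h2, div_mul_eq_mul_div, ← Real.rpow_add hX0, h1, ← mul_div_assoc,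
        mul_div_cancel₀ _ (by positivity), div_le_iff₀ (by positivity), Real.rpow_add hX0,
        Real.rpow_one, Real.rpow_add hX0, ← pow_two]
      have := (hSp m hm).2.le
      gcongr)
    (fun m hm z hz => ⟨(hG2 m hm z hz).isTame hn hXτ (by
        rw [show n - 2 = N by omega]
        exact hTm m hm), (hG2 m hm z hz).strictlyUltraWeaklyDivisible fun _ _ h _ => h⟩)
    hG1
  refine le_trans (ENNReal.ofReal_le_ofReal ?_) hmain
  have h1 : s ^ (n + 1) * t ^ e / X ^ (2 * b) =
      X ^ ((n + 1) * σ + e * τ - 2 * b) / 2 ^ (n * (n + 1)) := by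
    rw [hspow, htpow, Real.rpow_sub hX0, Real.rpow_add hX0]
    push_cast
    ring
  calc c / 2 / 2 ^ (n * (n + 1)) * X ^ (1 / 2 + 1 / ((n : ℝ) - 4 / 3) - ε)
      ≤ c / 2 / 2 ^ (n * (n + 1)) * X ^ ((n + 1) * σ + e * τ - 2 * b + (b - d)) := by
        rw [her]
        exact mul_le_mul_of_nonneg_left (Real.rpow_le_rpow_of_exponent_le hX1 hE) (by positivity)
    _ = X ^ (b - d) * (c / 2 * (s ^ (n + 1) * t ^ e / X ^ (2 * b))) := by
        rw [h1, Real.rpow_add hX0]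
        ring
    _ ≤ _ := by gcongr

end UltraWeak

end

/-! ### Conclusion -/

theorem mainTheorem12 (n : ℕ) (hn : 5 ≤ n) :
    (∃ c : ℝ, 0 < c ∧ ∃ C : ℝ, 0 < C ∧
      ∀ ε : ℝ, 0 < ε → ∀ K : ℝ, 0 < K → ∃ X₀ : ℝ,
      ∀ (X s t : ℝ) (m : ℕ), X₀ ≤ X → 0 < s → 0 < t → Squarefree m →
        X = s ^ (2 * n - 2) * t ^ (n * (n - 1)) / (m : ℝ) ^ 2 →
        K * (s * t ^ n) ^ ε ≤ s →
        K * (s ^ (n - 1) * (m : ℝ) ^ (2 * n - 4)) ≤ X ^ (1 - ε) →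
        (K * (s ^ (2 * n - 2) * (m : ℝ) ^ ((n : ℝ) - 4 - 1 / ((n : ℝ) - 2))) ≤ X ^ (1 - ε) →
          ENNReal.ofReal (c * (X ^ (1 / 2 + 1 / (n : ℝ)) * s ^ (2 / (n : ℝ)) /
              (m : ℝ) ^ (1 - 2 / (n : ℝ)))) ≤
            UltraWeak.count (UltraWeak.boxPairs UltraWeak.UltraWeaklyDivisible n s t m)) ∧
        (K * (s ^ (2 * n - 2) * (m : ℝ) ^ ((n : ℝ) - 1 + 2 / ((n : ℝ) - 2))) ≤ X ^ (1 - ε) →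
          ENNReal.ofReal (c * (X ^ (1 / 2 + 1 / (n : ℝ)) * s ^ (2 / (n : ℝ)) /
              (m : ℝ) ^ (1 - 2 / (n : ℝ)))) ≤
            UltraWeak.count (UltraWeak.boxClasses UltraWeak.UltraWeaklyDivisible n s t m ∩
              UltraWeak.discLE n (C * X)) ∧
          ENNReal.ofReal (c * ((Nat.totient m : ℝ) / m) ^ n *
              (X ^ (1 / 2 + 1 / (n : ℝ)) * s ^ (2 / (n : ℝ)) /
              (m : ℝ) ^ (1 - 2 / (n : ℝ)))) ≤
            UltraWeak.count (UltraWeak.boxClasses UltraWeak.StrictlyUltraWeaklyDivisible n s t m ∩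
              UltraWeak.discLE n (C * X)))) ∧
    (∀ ε : ℝ, 0 < ε → ε < ((n : ℝ) - 2) / (3 * (n : ℝ) ^ 2 - 13 * n + 12) →
      ∃ c : ℝ, 0 < c ∧ ∃ X₀ : ℝ, ∀ X : ℝ, X₀ ≤ X →
        ENNReal.ofReal (c * X ^ (1 / 2 + 1 / ((n : ℝ) - 4 / 3) - ε)) ≤
          ∑ m ∈ UltraWeak.mRange n ε X,
            UltraWeak.count (UltraWeak.wdClasses UltraWeak.UltraWeaklyDivisible n X m) ∧
        ENNReal.ofReal (c * X ^ (1 / 2 + 1 / ((n : ℝ) - 4 / 3) - ε)) ≤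
          UltraWeak.count (⋃ m ∈ UltraWeak.mRange n ε X,
            UltraWeak.wdClasses UltraWeak.StrictlyUltraWeaklyDivisible n X m)) := by
  refine ⟨UltraWeak.boxes_lower_bound hn, fun ε hε hε' => ?_⟩
  obtain ⟨c, hc, X₀, hX₀⟩ := UltraWeak.strict_classes_lower_bound hn hε hε'
  refine ⟨c, hc, X₀, fun X hX => ⟨(hX₀ X hX).trans ?_, hX₀ X hX⟩⟩
  -- The sum over m dominates the union, and strict rings are among the ultra-weak ones, so the
  -- strict bound implies the first estimate.
  refine (UltraWeak.count_biUnion_le _ _).trans (Finset.sum_le_sum fun m _ => ?_)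
  refine UltraWeak.count_mono ?_
  rintro q ⟨⟨f, l, h1, h2, h3⟩, h4⟩
  exact ⟨⟨f, l, h1, h2.1, h3⟩, h4⟩
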